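/- Let $X$ be a complex manifold, $(D_j)_{j\in J}$ a locally finite family of smooth hypersurfaces of $X$ whose union $D$ is a divisor with normal crossings, $X^*=X\setminus D$, $\varpi:\widetilde X\to X$ the real oriented blow-up of $X$ along the family $(D_j)_{j\in J}$ (the fibre product over $X$ of the real blow-ups along the $D_j$), $\partial\widetilde X=\varpi^{-1}(D)$ and $\tilde\jmath:X^*\hookrightarrow\widetilde X$ the inclusion. Stratify $\partial\widetilde X$ by $Y_I=\varpi^{-1}(D_I^\circ)$, $\emptyset\neq I\subset J$, where $D_I^\circ=\bigcap_{i\in I}D_i\setminus\bigcup_{j\notin I}D_j$. Let $\mathcal I$ be the sheaf on $\partial\widetilde X$ whose stalk at $y$ is the group of germs at $y$ of functions on $X^*$ that become meromorphic with poles along $D$ after a ramification around the components of $D$ through $\varpi(y)$, modulo germs that are bounded near $y$; it is ordered by $\varphi\leq_y\psi$ if and only if $e^{\varphi-\psi}$ has moderate growth along $D$ near $y$, and $\varphi<_y\psi$ means $\varphi\leq_y\psi$ and $\varphi\ne\psi$. A *stratified $\mathcal I$-covering* is a subset $\widetilde\Sigma$ of the étale space of $\mathcal I$ such that every $y\in\partial\widetilde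 X$ has a neighbourhood $U$ with sections $\varphi_1,\dots,\varphi_r\in\Gamma(U,\mathcal I)$ for which $\widetilde\Sigma|_U=\bigcup_i\varphi_i(U)$, the germs $\varphi_{1,z},\dots,\varphi_{r,z}$ being pairwise distinct whenever $z\in U$ lies in the stratum of $y$. It is *good* if, for every $y$ and all $\varphi\neq\psi$ in $\widetilde\Sigma_y$, the difference $\varphi-\psi$ is purely monomial: after ramification, in coordinates adapted to $D$, it is the class of $t^{-m}u(t)$ with $u$ holomorphic, $u(0)\neq0$, $m\ne0$ a multi-index of nonnegative integers supported on the coordinates defining $D$. Let $\Bbbk$ be a field. A *pre-Stokes-filtered local system* is a local system $\mathcal L$ of finite-dimensional $\Bbbk$-vector spaces on $\partial\widetilde X$ with a subsheaf $\mathcal L_\leq$ of its pull-back to the étale space of $\mathcal I$ such that $\mathcal L_{\leq\varphi}\subset\mathcal L_{\leq\psi}$ for all germs $\varphi\leq_y\psi$. Put $\mathcal L_{<\varphi}=\sum_{\psi<_y\varphi}\mathcal L_{\leq\psi}$ and $\mathrm{gr}_\varphi\mathcal L=\mathcal L_{\leq\varphi}/\mathcal L_{<\varphi}$ for a germ $\varphi$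 at $y$, and let $\widetilde\Sigma(\mathcal L)$ be the set of germs $\varphi$ with $\mathrm{gr}_\varphi\mathcal L\neq0$. It is a *Stokes-filtered local system* if (1) on each stratum it is locally graded: locally on the stratum there is a subsheaf $\mathcal G$ of the pull-back of $\mathcal L$ to the étale space with $\mathcal L_y=\bigoplus_{\psi\in\mathcal I_y}\mathcal G_\psi$ and $\mathcal L_{\leq\varphi}=\bigoplus_{\psi\leq_y\varphi}\mathcal G_\psi$; (2) $\widetilde\Sigma(\mathcal L)$ is a stratified $\mathcal I$-covering; (3) for every $y$, if $\varphi_i$ are sections near $y$ whose germs at $y$ are the distinct elements of $\widetilde\Sigma(\mathcal L)_y$, then for $z$ near $y$ every element of $\widetilde\Sigma(\mathcal L)_z$ is some $\varphi_{i,z}$ and $\mathrm{rk}\,\mathrm{gr}_\chi\mathcal L_z=\sum_{i:\varphi_{i,z}=\chi}\mathrm{rk}\,\mathrm{gr}_{\varphi_i}\mathcal L_y$ for all $\chi\in\mathcal I_z$. It is *good* if $\widetilde\Sigma(\mathcal L)$ is good. Morphisms are the morphisms of local systems compatible with the filtrations. Let $\widetilde\Sigma$ be a good stratified $\mathcal I$-covering.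 (a) Let $(\mathcal L,\mathcal L_\bullet)$, $(\mathcal L',\mathcal L'_\bullet)$ be Stokes-filtered local systems with $\widetilde\Sigma(\mathcal L),\widetilde\Sigma(\mathcal L')\subset\widetilde\Sigma$, and let $\lambda:(\mathcal L,\mathcal L_\bullet)\to(\mathcal L',\mathcal L'_\bullet)$ be a morphism. Then every point of $\partial\widetilde X$ has a neighbourhood on which there are sections $\varphi_1,\dots,\varphi_r$ of $\mathcal I$, with distinct germs at the given point, and decompositions into local subsystems $\mathcal L=\bigoplus_i G_i$, $\mathcal L'=\bigoplus_i G'_i$ with $\mathcal L_{\leq\psi}=\bigoplus_{\varphi_i\leq_z\psi}G_{i,z}$, $\mathcal L'_{\leq\psi}=\bigoplus_{\varphi_i\leq_z\psi}G'_{i,z}$ for all points $z$ of it and all $\psi\in\mathcal I_z$, such that $\lambda(G_i)\subset G'_i$ for all $i$. In particular $\lambda$ is strict, that is, $\lambda(\mathcal L_{\leq\varphi})=\mathcal L'_{\leq\varphi}\cap\lambda(\mathcal L)$ for all germs $\varphi$. Moreover $\ker\lambda$, $\operatorname{im}\lambda$ and $\operatorname{coker}\lambda$, with the naturally induced filtrations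 (the two natural ones on $\operatorname{im}\lambda$ coincide), are good Stokes-filtered local systems, and $$\widetilde\Sigma(\ker\lambda)\subset\widetilde\Sigma(\mathcal L),\quad \widetilde\Sigma(\operatorname{coker}\lambda)\subset\widetilde\Sigma(\mathcal L'),\quad \widetilde\Sigma(\operatorname{im}\lambda)\subset\widetilde\Sigma(\mathcal L)\cap\widetilde\Sigma(\mathcal L').$$ (b) The category of Stokes-filtered local systems with $\widetilde\Sigma(\mathcal L)\subset\widetilde\Sigma$ is abelian. -/

import Mathlib

open Set Filter Topology CategoryTheory
open scoped Manifold ContDiff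

universe u v w t

noncomputable section

namespace Stokes

/-! ### Normal crossing divisors -/

section Geometry

variable (n : ℕ) {X : Type u} [TopologicalSpace X] [ChartedSpace (Fin n → ℂ) X] {J : Type t}

/-- A holomorphic coordinate system centred at `x` in which the members of the family `D` passing
through `x` are pairwise distinct coordinate hyperplanes, the other members being avoided. -/
structure AdaptedChart (D : J → Set X) (x : X) where
  /-- the coordinate system -/
  chart : OpenPartialHomeomorph X (Fin n → ℂ)
  chart_mem : chart ∈ IsManifold.maximalAtlas 𝓘(ℂ, Fin n → ℂ) ω X
  mem_source : x ∈ chart.source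
  map_base : chart x = 0
  /-- the index of the coordinate defining `D j` -/
  idx : {j : J // x ∈ D j} ↪ Fin n
  mem_iff : ∀ j : {j : J // x ∈ D j}, ∀ z ∈ chart.source, z ∈ D j.1 ↔ chart z (idx j) = 0
  notMem : ∀ j : J, x ∉ D j → ∀ z ∈ chart.source, z ∉ D j

/-- `D` is a (locally finite) family of smooth hypersurfaces whose union is a divisor with normal
crossings. -/
def IsNormalCrossing (D : J → Set X) : Prop :=
  ∀ x : X, Nonempty (AdaptedChart n D x)

/-- `f` is a reduced holomorphic equation of the smooth hypersurface `H` on the open set `U`. -/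
structure IsLocalEquation (H U : Set X) (f : X → ℂ) : Prop where
  isOpen : IsOpen U
  holomorphic : ContMDiffOn 𝓘(ℂ, Fin n → ℂ) 𝓘(ℂ, ℂ) ω f U
  mem_iff : ∀ z ∈ U, z ∈ H ↔ f z = 0
  deriv_ne : ∀ z ∈ U, z ∈ H → mfderiv 𝓘(ℂ, Fin n → ℂ) 𝓘(ℂ, ℂ) f z ≠ 0

/-- The reduced equations of `H` defined near `x`. -/
abbrev EquationAt (H : Set X) (x : X) : Type u :=
  {f : X → ℂ // ∃ U : Set X, x ∈ U ∧ IsLocalEquation n H U f}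

/-! ### The real blow-up along the family `D` -/

/-- The real oriented blow-up of `X` along the family `D`, i.e. the fibre product over `X` of the
real blow-ups along the `D j`. A point over `x` is given, for every `j`, by a point of the fibre at
`x` of the circle bundle of the line bundle of `D j`, that is, by a phase `θ(f)` for each local
equation `f` of `D j` at `x` such that `θ(u g) = (u(x)/|u(x)|) θ(g)`; for `x ∉ D j` it has to be
the phase `f(x)/|f(x)|`. -/
@[ext]
structure RealBlowup (D : J → Set X) where
  /-- the projection to `X` -/
  pt : X
  /-- the phase with respect to a local equation -/
  phase : ∀ j : J, EquationAt n (D j) pt → Circle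
  phase_of_ne : ∀ (j : J) (f : EquationAt n (D j) pt),
    f.1 pt = (‖f.1 pt‖ : ℂ) * (phase j f : ℂ)
  phase_mul : ∀ (j : J) (f g : EquationAt n (D j) pt) (a : X → ℂ), ContinuousAt a pt →
    (∀ᶠ z in 𝓝 pt, f.1 z = a z * g.1 z) →
      (‖a pt‖ : ℂ) * (phase j f : ℂ) = a pt * (phase j g : ℂ)

/-- The coarsest topology for which the projection to `X` and the phases of all local equations
(defined over open subsets of `X`) are continuous. -/
instance (D : J → Set X) : TopologicalSpace (RealBlowup n D) :=
  TopologicalSpace.generateFrom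
    ({S | ∃ V : Set X, IsOpen V ∧ S = {p | p.pt ∈ V}} ∪
     {S | ∃ (j : J) (U : Set X) (f : X → ℂ) (hf : IsLocalEquation n (D j) U f) (W : Set Circle),
        IsOpen W ∧ S = {p | ∃ hp : p.pt ∈ U, p.phase j ⟨f, U, hp, hf⟩ ∈ W}})

/-- The open part `X ∖ D` of the real blow-up. -/
def RealBlowup.interior (D : J → Set X) : Set (RealBlowup n D) := {p | ∀ j, p.pt ∉ D j}

/-- The boundary of the real blow-up, i.e. the inverse image of `D`. -/
abbrev Boundary (D : J → Set X) : Type (max u t) := {p : RealBlowup n D // ∃ j, p.pt ∈ D j}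

variable {n}
variable {D : J → Set X}

/-- The stratum of a boundary point: the set of the `j` such that `D j` contains its projection. -/
def stratum (y : Boundary n D) : Set J := {j | y.1.pt ∈ D j}

/-- The filter on `X` of the traces on `X ∖ D` of the neighbourhoods of a boundary point. -/
def nearFilter (y : Boundary n D) : Filter X :=
  map RealBlowup.pt (𝓝[RealBlowup.interior n D] y.1)

/-! ### The sheaf of ordered abelian groups of exponential factors -/

/-- `s` is a continuous branch, near the boundary point `y`, of the ramified coordinates
obtained by taking `d`-th roots of the coordinates defining the divisor: `s` is a local
section of the ramified covering of order `d` along each component of the divisor. -/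
def IsBranch (y : Boundary n D) (c : AdaptedChart n D y.1.pt) (d : ℕ) (s : X → Fin n → ℂ) : Prop :=
  ∃ V ∈ nearFilter y, ContinuousOn s V ∧ ∀ z ∈ V, ∀ i,
    (i ∈ range c.idx → s z i ^ d = c.chart z i) ∧ (i ∉ range c.idx → s z i = c.chart z i)

/-- Near `y`, `f` is equal to `s^{-m} g(s)`, where `s` is a branch of the `d`-th
roots of the coordinates, `g` is holomorphic near the origin, and the pole is along the divisor. -/
def HasRamifiedForm (y : Boundary n D) (f : X → ℂ) (m : Fin n → ℕ) (g : (Fin n → ℂ) → ℂ) : Prop :=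
  ∃ (c : AdaptedChart n D y.1.pt) (d : ℕ) (s : X → Fin n → ℂ),
    1 ≤ d ∧ IsBranch y c d s ∧ (∀ i, i ∉ range c.idx → m i = 0) ∧ AnalyticAt ℂ g 0 ∧
    ∀ᶠ z in nearFilter y, f z * ∏ i, s z i ^ m i = g (s z)

/-- `f` defines, near `y`, a multivalued (ramified) meromorphic function with poles along `D`. -/
def IsMultivaluedMero (y : Boundary n D) (f : X → ℂ) : Prop :=
  ∃ m g, HasRamifiedForm y f m g

/-- The functions which are bounded near the boundary point `y`. -/
def boundedNear (y : Boundary n D) : AddSubgroup (X → ℂ) where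
  carrier := {f | f =O[nearFilter y] (fun _ => (1 : ℂ))}
  add_mem' := fun ha hb => Asymptotics.IsBigO.add ha hb
  zero_mem' := Asymptotics.isBigO_zero _ _
  neg_mem' := fun ha => Asymptotics.IsBigO.neg_left ha

/-- Germs at `y` of functions on `X ∖ D`, modulo germs of bounded functions. -/
abbrev GermModBounded (y : Boundary n D) : Type u := (X → ℂ) ⧸ boundedNear y

/-- The class at `y` of a function, modulo the functions which are bounded near `y`. -/
def germ (y : Boundary n D) (f : X → ℂ) : GermModBounded y := QuotientAddGroup.mk f

/-- The stalk at `y` of the sheaf of exponential factors: classes of multivalued meromorphic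
functions modulo bounded ones. -/
def expStalk (y : Boundary n D) : Set (GermModBounded y) :=
  germ y '' {f | IsMultivaluedMero y f}

/-- The order on the stalk: `a ≤ b` iff `exp (a - b)` has moderate growth along `D` near `y`. -/
def leAt (y : Boundary n D) (a b : expStalk y) : Prop :=
  ∃ f : X → ℂ, germ y f = a.1 - b.1 ∧
    ∃ (c : AdaptedChart n D y.1.pt) (N : Fin n → ℕ) (C : ℝ), (∀ i, i ∉ range c.idx → N i = 0) ∧
      ∀ᶠ z in nearFilter y, ‖Complex.exp (f z)‖ * ∏ i, ‖c.chart z i‖ ^ N i ≤ C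

/-- The strict order. -/
def ltAt (y : Boundary n D) (a b : expStalk y) : Prop := leAt y a b ∧ a ≠ b

/-- Families of elements of the stalks which are, near `y`, sections of the sheaf of exponential
factors, i.e. which are locally defined by one and the same function. -/
def IsSectionNear (y : Boundary n D) (φ : ∀ z : Boundary n D, expStalk z) : Prop :=
  ∃ f : X → ℂ, ∀ᶠ z in 𝓝 y, (φ z).1 = germ z f

/-- A germ is purely monomial and nonzero if it is the class of `s^{-m} g(s)` with `m ≠ 0`
and `g(0) ≠ 0`, in suitable (ramified) coordinates. -/
def IsPurelyMonomial (y : Boundary n D) (a : GermModBounded y) : Prop :=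
  ∃ (f : X → ℂ) (m : Fin n → ℕ) (g : (Fin n → ℂ) → ℂ),
    germ y f = a ∧ HasRamifiedForm y f m g ∧ m ≠ 0 ∧ g 0 ≠ 0

/-- A stratified covering contained in the étale space of the sheaf of exponential factors, given
by its fibres: near each point `y` it is the union of the images of finitely many sections, whose
germs are pairwise distinct along the stratum of `y`. -/
def IsStratifiedCovering (S : ∀ y : Boundary n D, Set (expStalk y)) : Prop :=
  ∀ y, ∃ (r : ℕ) (φ : Fin r → ∀ z : Boundary n D, expStalk z), (∀ i, IsSectionNear y (φ i)) ∧
    ∀ᶠ z in 𝓝 y, S z = range (fun i => φ i z) ∧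
      (stratum z = stratum y → Function.Injective (fun i => φ i z))

/-- Goodness: the difference of two distinct elements in the same fibre is purely monomial. -/
def IsGoodCovering (S : ∀ y : Boundary n D, Set (expStalk y)) : Prop :=
  ∀ y, ∀ a ∈ S y, ∀ b ∈ S y, a ≠ b → IsPurelyMonomial y (a.1 - b.1)

end Geometry

/-! ### Local systems -/

/-- A local system of finite dimensional `k`-vector spaces on `Y` (a locally constant sheaf),
presented by its stalks and by the families of elements of the stalks that are sections of the
sheaf near a given point: `sec y` is the space of the families which are sections on some
neighbourhood of `y`. -/
structure LocalSystem (k : Type v) [Field k] (Y : Type u) [TopologicalSpace Y] where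
  /-- the stalks -/
  stalk : Y → Type w
  [acg : ∀ y, AddCommGroup (stalk y)]
  [mod : ∀ y, Module k (stalk y)]
  /-- the families which are sections near `y` -/
  sec : ∀ _ : Y, Submodule k (∀ z, stalk z)
  sec_open : ∀ y, ∀ s ∈ sec y, ∀ᶠ z in 𝓝 y, s ∈ sec z
  sec_congr : ∀ y, ∀ s ∈ sec y, ∀ t, (∀ᶠ z in 𝓝 y, s z = t z) → t ∈ sec y
  sec_zero : ∀ y, ∀ s ∈ sec y, s y = 0 → ∀ᶠ z in 𝓝 y, s z = 0
  exists_frame : ∀ y, ∃ (r : ℕ) (b : Fin r → ∀ z, stalk z), (∀ i, b i ∈ sec y) ∧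
    ∀ᶠ z in 𝓝 y, LinearIndependent k (fun i => b i z) ∧
      Submodule.span k (range fun i => b i z) = ⊤

attribute [instance] LocalSystem.acg LocalSystem.mod

section Filtrations

variable (n : ℕ) {X : Type u} [TopologicalSpace X] [ChartedSpace (Fin n → ℂ) X] {J : Type t}

/-- A pre-Stokes-filtered local system on the boundary of the real blow-up: a local system with a
subsheaf of its pull-back to the étale space of the sheaf of exponential factors, given by
its stalks `filt y a` (for a germ `a` at `y`), which is increasing with respect to the order. -/
structure PreStokes (k : Type v) [Field k] (D : J → Set X)
    extends LocalSystem.{max u t, v, w} k (Boundary n D) where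
  /-- the stalk at the germ `a` of the filtration -/
  filt : ∀ y : Boundary n D, expStalk y → Submodule k (stalk y)
  filt_mono : ∀ y a b, leAt y a b → filt y a ≤ filt y b
  filt_open : ∀ y a, ∀ x ∈ filt y a, ∃ φ : ∀ z : Boundary n D, expStalk z,
    IsSectionNear y φ ∧ φ y = a ∧
      ∃ s ∈ sec y, s y = x ∧ ∀ᶠ z in 𝓝 y, s z ∈ filt z (φ z)

variable {n} {k : Type v} [Field k] {D : J → Set X}

namespace PreStokes

/-- The morphisms: families of linear maps on the stalks which send sections to sections
(i.e. morphisms of sheaves), and which are compatible with the filtrations. -/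
def homs (L L' : PreStokes.{u, v, w, t} n k D) :
    AddSubgroup (∀ y, L.stalk y →ₗ[k] L'.stalk y) where
  carrier := {f | (∀ y, ∀ s ∈ L.sec y, (fun z => f z (s z)) ∈ L'.sec y) ∧
    ∀ y a, ∀ x ∈ L.filt y a, f y x ∈ L'.filt y a}
  add_mem' := fun ha hb => ⟨fun y s hs => (L'.sec y).add_mem (ha.1 y s hs) (hb.1 y s hs),
    fun y a x hx => (L'.filt y a).add_mem (ha.2 y a x hx) (hb.2 y a x hx)⟩
  zero_mem' := ⟨fun y _ _ => (L'.sec y).zero_mem, fun y a _ _ => (L'.filt y a).zero_mem⟩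
  neg_mem' := fun ha => ⟨fun y s hs => (L'.sec y).neg_mem (ha.1 y s hs),
    fun y a x hx => (L'.filt y a).neg_mem (ha.2 y a x hx)⟩

instance : Category (PreStokes.{u, v, w, t} n k D) where
  Hom L L' := homs L L'
  id L := ⟨fun _ => LinearMap.id, fun _ _ hs => hs, fun _ _ _ hx => hx⟩
  comp f g := ⟨fun y => (g.1 y).comp (f.1 y), fun y s hs => g.2.1 y _ (f.2.1 y s hs),
    fun y a x hx => g.2.2 y a _ (f.2.2 y a x hx)⟩

/-- The linear map on the stalks induced by a morphism. -/
def app {L L' : PreStokes.{u, v, w, t} n k D} (f : L ⟶ L') (y : Boundary n D) :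
    L.stalk y →ₗ[k] L'.stalk y := f.1 y

instance : Preadditive (PreStokes.{u, v, w, t} n k D) where
  homGroup L L' := inferInstanceAs (AddCommGroup (homs L L'))
  add_comp := fun _ _ _ f f' g => Subtype.ext (funext fun y =>
    LinearMap.comp_add (f.1 y) (f'.1 y) (g.1 y))
  comp_add := fun _ _ _ f g g' => Subtype.ext (funext fun y =>
    LinearMap.add_comp (f.1 y) (g'.1 y) (g.1 y))

variable (L : PreStokes.{u, v, w, t} n k D)

/-- The stalk of the sum of the smaller steps of the filtration. -/
def filtLT (y : Boundary n D) (a : expStalk y) : Submodule k (L.stalk y) :=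
  ⨆ (b : expStalk y) (_ : ltAt y b a), L.filt y b

/-- The rank of the stalk at `a` of the graded sheaf. -/
def grRank (y : Boundary n D) (a : expStalk y) : ℕ :=
  Module.finrank k (L.filt y a ⧸ (L.filtLT y a).submoduleOf (L.filt y a))

/-- The fibre at `y` of the support of the graded sheaf (the exponential factors at `y`). -/
def factors (y : Boundary n D) : Set (expStalk y) := {a | ¬ L.filt y a ≤ L.filtLT y a}

/-- `G` is a gradation, along the stratum of `y` and near `y`, of the filtration: it is a subsheaf
over this stratum of the pull-back of the local system to the étale space of the sheaf of
exponential factors, the local system is the direct sum of the `G z a`, and the filtration is the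
associated one. -/
def IsGradedOnStratum (y : Boundary n D)
    (G : ∀ z : Boundary n D, expStalk z → Submodule k (L.stalk z)) : Prop :=
  ∀ᶠ z in 𝓝 y, stratum z = stratum y →
    (∀ a, ∀ x ∈ G z a, ∃ φ : ∀ t : Boundary n D, expStalk t, IsSectionNear z φ ∧ φ z = a ∧
      ∃ s ∈ L.sec z, s z = x ∧ ∀ᶠ t in 𝓝 z, stratum t = stratum y → s t ∈ G t (φ t)) ∧
    iSupIndep (G z) ∧ (⨆ a, G z a) = ⊤ ∧
    ∀ a, L.filt z a = ⨆ (b : expStalk z) (_ : leAt z b a), G z b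

/-- Stokes-filtered local systems: the filtration is locally graded on each
stratum, the union of the supports of the graded sheaves is a stratified covering, and, when one
moves from a point `y` to a point of another stratum near `y`, the ranks of the graded sheaf at
the germs which become equal add up. -/
structure IsStokes : Prop where
  graded : ∀ y, ∃ G, L.IsGradedOnStratum y G
  covering : IsStratifiedCovering L.factors
  rank : ∀ y, ∃ (r : ℕ) (φ : Fin r → ∀ z : Boundary n D, expStalk z),
    (∀ i, IsSectionNear y (φ i)) ∧
    (Function.Injective fun i => φ i y) ∧ (range fun i => φ i y) = L.factors y ∧
    ∀ᶠ z in 𝓝 y, L.factors z = range (fun i => φ i z) ∧ ∀ a : expStalk z,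
      L.grRank z a = ∑ᶠ (i : Fin r) (_ : φ i z = a), L.grRank y (φ i y)

/-- Good Stokes-filtered local systems. -/
def IsGoodStokes : Prop := L.IsStokes ∧ IsGoodCovering L.factors

/-- `G` is a gradation of the filtration on a whole neighbourhood of `y`, indexed by the finite
family of sections `φ` with pairwise distinct germs at `y`: near `y` the `G i` are local
subsystems, the local system is their direct sum, and the filtration is the associated one. -/
def IsGradationNear (y : Boundary n D) {r : ℕ} (φ : Fin r → ∀ z : Boundary n D, expStalk z)
    (G : Fin r → ∀ z : Boundary n D, Submodule k (L.stalk z)) : Prop :=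
  (∀ i, IsSectionNear y (φ i)) ∧ (Function.Injective fun i => φ i y) ∧
  (∀ i, ∃ (q : ℕ) (b : Fin q → ∀ z, L.stalk z), (∀ j, b j ∈ L.sec y) ∧
    ∀ᶠ z in 𝓝 y, LinearIndependent k (fun j => b j z) ∧
      Submodule.span k (range fun j => b j z) = G i z) ∧
  ∀ᶠ z in 𝓝 y, iSupIndep (fun i => G i z) ∧ (⨆ i, G i z) = ⊤ ∧
    ∀ a, L.filt z a = ⨆ (i : Fin r) (_ : leAt z (φ i z) a), G i z

variable {L} {L' : PreStokes.{u, v, w, t} n k D}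

/-- Near every point there are gradations of the source and of the target with respect to which
the morphism is diagonal. -/
def IsLocallyDiagonal (f : L ⟶ L') : Prop :=
  ∀ y, ∃ (r : ℕ) (φ : Fin r → ∀ z : Boundary n D, expStalk z)
    (G : Fin r → ∀ z : Boundary n D, Submodule k (L.stalk z))
    (G' : Fin r → ∀ z : Boundary n D, Submodule k (L'.stalk z)),
    L.IsGradationNear y φ G ∧ L'.IsGradationNear y φ G' ∧
    ∀ᶠ z in 𝓝 y, ∀ i, (G i z).map (app f z) ≤ G' i z

/-- Strict morphisms. -/
def IsStrict (f : L ⟶ L') : Prop :=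
  ∀ y a, (L.filt y a).map (app f y) = L'.filt y a ⊓ LinearMap.range (app f y)

/-- `i : K ⟶ L` identifies `K` with the kernel of the morphism of local systems `f`, with the
filtration induced by that of `L`. -/
def IsKernelOf {K : PreStokes.{u, v, w, t} n k D} (i : K ⟶ L) (f : L ⟶ L') : Prop :=
  ∀ y, Function.Injective (app i y) ∧ LinearMap.range (app i y) = LinearMap.ker (app f y) ∧
    ∀ a, K.filt y a = (L.filt y a).comap (app i y)

/-- `p : L' ⟶ C` identifies `C` with the cokernel of the morphism of local systems `f`, with the
filtration induced by that of `L'`. -/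
def IsCokernelOf {C : PreStokes.{u, v, w, t} n k D} (p : L' ⟶ C) (f : L ⟶ L') : Prop :=
  ∀ y, Function.Surjective (app p y) ∧ LinearMap.ker (app p y) = LinearMap.range (app f y) ∧
    ∀ a, C.filt y a = (L'.filt y a).map (app p y)

/-- `f = p ≫ i` identifies `M` with the image of the morphism of local systems `f`; its filtration
is both the one induced by that of the target and the image of that of the source. -/
def IsImageOf {M : PreStokes.{u, v, w, t} n k D} (p : L ⟶ M) (i : M ⟶ L') (f : L ⟶ L') : Prop :=
  p ≫ i = f ∧ ∀ y, Function.Surjective (app p y) ∧ Function.Injective (app i y) ∧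
    ∀ a, M.filt y a = (L'.filt y a).comap (app i y) ∧ M.filt y a = (L.filt y a).map (app p y)

end PreStokes

/-- The full subcategory of the Stokes-filtered local systems whose exponential factors are
contained in `S`. -/
def stokesIn (k : Type v) [Field k] (S : ∀ y : Boundary n D, Set (expStalk y)) :
    ObjectProperty (PreStokes.{u, v, w, t} n k D) :=
  fun L => L.IsStokes ∧ ∀ y, L.factors y ⊆ S y

end Filtrations

end Stokes

end

/-!
The point is to find, near every boundary point, gradations of the source and of the target of a
morphism with respect to which the morphism is diagonal (`exists_diagonal_model`). Strictness, the
structure of kernels, images and cokernels, and the abelian category all follow from this.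

*The order along a circle of directions.* Rotating simultaneously all phases of a boundary point `y`
gives a circle `rot y θ` of boundary points over the same point of the manifold, all in the stratum
of `y`. Pulled back to the universal covering `ℝ` of this circle, the covering `S` is trivial
(`IsStratifiedCovering.exists_labels`): its points are the values of finitely many sections `A i`.
Because `S` is good, a difference `A i - A j` has a leading term of some level `ℓ > 0`
(`HasRamifiedForm.exists_hasLead`), whose direction rotates by `-ℓ θ`. Hence `A i ≤ A j` in the
direction `θ` if and only if a cosine `cos (angle - ℓ θ)` is negative, and the levels satisfy the
ultrametric inequality; the structure `ExpData` records this (`exists_expData`). The order is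
antisymmetric on all germs (`leAt_antisymm`): a function with a ramified pole whose real part has at
most logarithmic growth is bounded, since the leading coefficient of the pole could be rotated to
have a nonzero real part (`exists_norm_le_of_abs_re_le`).

*Linear algebra.* Sections of the local system over `ℝ` form a vector space isomorphic to each
stalk, with a filtration depending on `θ` (`IsStokes.locGraded_lineFilt`). The theorem
`exists_diagonal_gradation` diagonalises a morphism between such objects by induction on the number
of factors. Group the factors into classes according to the largest level `M` (`IsTopClasses`). For
the coarse filtration by the classes there is only one level. Over an interval of length `π / M` any
two classes exchange their order exactly once, the filtrations at the two ends, taken in generic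
directions, are opposite, and their intersections split the filtration in between
(`LocGraded.isGradation_inf`). This splitting is canonical, hence respected by morphisms. The graded
pieces of the coarse filtration form local systems on `ℝ`, which are constant
(`IsLocSubq.exists_model`); they are filtered by the factors of one class, a smaller number, and the
induction hypothesis applies to them.

*Local models.* This gives diagonal gradations of the stalks (`exists_diagonal_stalk`). A gradation
of the stalk at `y` extends to a neighbourhood by parallel transport: the transported pieces stay in
the steps of the filtration because these are open conditions, and the dimensions agree because the
ranks of the graded pieces add up (`IsStokes.isModel`). Conversely, a filtration with local models
is Stokes-filtered (`isStokes_of_isModel`).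

*Consequences.* For a diagonal morphism, kernel and image are homogeneous, so they and the cokernel
inherit local models (`IsModel.comap`, `IsModel.map`) with no new exponential factors, and the
morphism is strict. Strict monomorphisms are kernels and strict epimorphisms are cokernels, so the
category is abelian (`abelianStokesIn`). That the zero local system is an object requires a section
of the sheaf of exponential factors through every germ (`IsMultivaluedMero.eventually`).
-/

noncomputable section

namespace Stokes

/-! ### Gradations of vector spaces filtered by a finite ordered set -/

section Gradation

variable {k : Type*} [Field k] {V : Type*} [AddCommGroup V] [Module k V] {ι : Type*}

/-- The subspaces `G i` decompose the space as a direct sum. -/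
structure IsDecomp (G : ι → Submodule k V) : Prop where
  indep : iSupIndep G
  iSup_eq_top : (⨆ i, G i) = ⊤

namespace IsDecomp

variable {G : ι → Submodule k V} (h : IsDecomp G)

open Classical in
/-- The component of index `i` with respect to a decomposition, as an endomorphism. -/
def proj (i : ι) : V →ₗ[k] V :=
  (G i).subtype ∘ₗ DirectSum.component k ι (fun i => G i) i ∘ₗ
    (LinearEquiv.ofBijective (DirectSum.coeLinearMap G)
      (DirectSum.isInternal_submodule_of_iSupIndep_of_iSup_eq_top h.indep h.iSup_eq_top)).symm

include h

lemma proj_mem (i : ι) (x : V) : h.proj i x ∈ G i := by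
  simp [proj]

lemma proj_self {i : ι} {x : V} (hx : x ∈ G i) : h.proj i x = x := by
  classical
  have := DirectSum.IsInternal.ofBijective_coeLinearMap_of_mem
    (DirectSum.isInternal_submodule_of_iSupIndep_of_iSup_eq_top h.indep h.iSup_eq_top) hx
  simp only [proj, LinearMap.comp_apply, LinearEquiv.coe_coe, Submodule.subtype_apply]
  exact congrArg Subtype.val this

lemma proj_of_ne {i j : ι} (hij : i ≠ j) {x : V} (hx : x ∈ G j) : h.proj i x = 0 := by
  classical
  have := DirectSum.IsInternal.ofBijective_coeLinearMap_of_mem_ne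
    (DirectSum.isInternal_submodule_of_iSupIndep_of_iSup_eq_top h.indep h.iSup_eq_top) hij.symm hx
  simp only [proj, LinearMap.comp_apply, LinearEquiv.coe_coe, Submodule.subtype_apply]
  exact congrArg Subtype.val this

lemma mem_biSup_iff {A : ι → Prop} {x : V} :
    x ∈ (⨆ (j) (_ : A j), G j) ↔ ∀ i, ¬ A i → h.proj i x = 0 := by
  classical
  constructor
  · intro hx i hi
    have : (⨆ (j) (_ : A j), G j) ≤ LinearMap.ker (h.proj i) := by
      refine iSup₂_le fun j hj y hy => ?_
      exact h.proj_of_ne (fun e : i = j => hi (e ▸ hj)) hy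
    exact this hx
  · intro hx
    set e := (LinearEquiv.ofBijective (DirectSum.coeLinearMap G)
      (DirectSum.isInternal_submodule_of_iSupIndep_of_iSup_eq_top h.indep h.iSup_eq_top)).symm
    have hs : x = ∑ i ∈ (e x).support, ((e x) i : V) := by
      conv_lhs => rw [← e.symm_apply_apply x]
      conv_lhs => rw [← DirectSum.sum_support_of (e x)]
      rw [map_sum]
      refine Finset.sum_congr rfl fun i _ => ?_
      exact DirectSum.coeLinearMap_of G i _
    rw [hs]
    refine Submodule.sum_mem _ fun i _ => ?_
    by_cases hi : A i
    · exact Submodule.mem_iSup_of_mem i (Submodule.mem_iSup_of_mem hi ((e x) i).2)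
    · have : ((e x) i : V) = 0 := hx i hi
      rw [this]; exact Submodule.zero_mem _

lemma eq_zero {x : V} (hx : ∀ i, h.proj i x = 0) : x = 0 := by
  have : x ∈ (⨆ (j) (_ : False), G j) := h.mem_biSup_iff.2 fun i _ => hx i
  simpa using this

lemma sum_proj [Fintype ι] (x : V) : ∑ i, h.proj i x = x := by
  rw [← sub_eq_zero]
  refine h.eq_zero fun j => ?_
  rw [map_sub, map_sum, Finset.sum_eq_single j, h.proj_self (h.proj_mem j x), sub_self]
  · intro i _ hi
    exact h.proj_of_ne hi.symm (h.proj_mem i x)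
  · simp

lemma disjoint_biSup {A B : ι → Prop} (hAB : ∀ i, A i → ¬ B i) :
    Disjoint (⨆ (j) (_ : A j), G j) (⨆ (j) (_ : B j), G j) := by
  rw [Submodule.disjoint_def]
  intro x hx hx'
  rw [h.mem_biSup_iff] at hx hx'
  refine h.eq_zero fun i => ?_
  by_cases hi : A i
  · exact hx' i (hAB i hi)
  · exact hx i hi

omit h in
lemma finrank_biSup [FiniteDimensional k V] (hG : iSupIndep G) (s : Finset ι) :
    Module.finrank k (⨆ i ∈ s, G i : Submodule k V) = ∑ i ∈ s, Module.finrank k (G i) := by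
  classical
  induction s using Finset.induction_on with
  | empty => simp
  | insert a s ha ih =>
    have hd : Disjoint (G a) (⨆ i ∈ s, G i) :=
      iSupIndep.disjoint_biSup hG (y := (s : Set ι)) (by simpa using ha)
    rw [Finset.sum_insert ha, ← ih, Finset.iSup_insert]
    have := Submodule.finrank_sup_add_finrank_inf_eq (G a) (⨆ i ∈ s, G i)
    rw [hd.eq_bot, finrank_bot, add_zero] at this
    exact this

end IsDecomp

lemma iSupIndep_of_sum_eq_zero [Fintype ι] {G : ι → Submodule k V}
    (h : ∀ x : ι → V, (∀ i, x i ∈ G i) → ∑ i, x i = 0 → ∀ i, x i = 0) : iSupIndep G := by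
  classical
  rw [iSupIndep_iff_finsetSum_eq_zero_imp_eq_zero]
  intro s x hx hs i hi
  have := h (fun i => if i ∈ s then x i else 0) (fun i => by
    by_cases hi : i ∈ s
    · simpa [hi] using hx i hi
    · simp [hi]) (by simpa using hs) i
  simpa [hi] using this

/-- `G` is a gradation of the filtration `F` indexed by a set ordered by `le`. -/
structure IsGradation (le : ι → ι → Prop) (F G : ι → Submodule k V) : Prop extends IsDecomp G where
  filt : ∀ i, F i = ⨆ (j) (_ : le j i), G j

/-- A partial order relation, as hypothesis on a relation depending on parameters. -/
structure IsPO (le : ι → ι → Prop) : Prop where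
  refl : ∀ i, le i i
  trans : ∀ i j l, le i j → le j l → le i l
  antisymm : ∀ i j, le i j → le j i → i = j

/-- The sum of the strictly smaller steps of a filtration. -/
def below (le : ι → ι → Prop) (F : ι → Submodule k V) (i : ι) : Submodule k V :=
  ⨆ (j) (_ : le j i ∧ j ≠ i), F j

namespace IsGradation

variable {le : ι → ι → Prop} {F G : ι → Submodule k V}

lemma le_filt (h : IsGradation le F G) (hle : IsPO le) (i : ι) : G i ≤ F i := by
  rw [h.filt]
  exact le_iSup₂_of_le i (hle.refl i) le_rfl

/-- The sum of the steps of a filtration over a lower set of indices. -/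
lemma biSup_filt (h : IsGradation le F G) (hle : IsPO le) {A : ι → Prop}
    (hA : ∀ i j, le i j → A j → A i) : (⨆ (j) (_ : A j), F j) = ⨆ (j) (_ : A j), G j := by
  apply le_antisymm
  · refine iSup₂_le fun j hj => ?_
    rw [h.filt]
    exact iSup₂_le fun i hi => le_iSup₂_of_le i (hA i j hi hj) le_rfl
  · exact iSup₂_mono fun j hj => h.le_filt hle j

lemma below_eq (h : IsGradation le F G) (hle : IsPO le) (i : ι) :
    below le F i = ⨆ (j) (_ : le j i ∧ j ≠ i), G j := by
  refine h.biSup_filt hle fun a b hab hb => ⟨hle.trans _ _ _ hab hb.1, ?_⟩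
  rintro rfl
  exact hb.2 (hle.antisymm _ _ hb.1 hab)

lemma sup_below (h : IsGradation le F G) (hle : IsPO le) (i : ι) : G i ⊔ below le F i = F i := by
  rw [h.below_eq hle, h.filt i]
  apply le_antisymm
  · exact sup_le (le_iSup₂_of_le i (hle.refl i) le_rfl) (biSup_mono fun j hj => hj.1)
  · refine iSup₂_le fun j hj => ?_
    by_cases hji : j = i
    · subst hji; exact le_sup_left
    · exact le_sup_of_le_right (le_iSup₂_of_le j ⟨hj, hji⟩ le_rfl)

lemma disjoint_below (h : IsGradation le F G) (hle : IsPO le) (i : ι) :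
    Disjoint (G i) (below le F i) := by
  rw [h.below_eq hle]
  exact iSupIndep.disjoint_biSup h.indep (y := {j | le j i ∧ j ≠ i}) (by simp)

lemma finrank_filt [FiniteDimensional k V] (h : IsGradation le F G) (hle : IsPO le) (i : ι) :
    Module.finrank k (F i) = Module.finrank k (G i) + Module.finrank k (below le F i) := by
  have := Submodule.finrank_sup_add_finrank_inf_eq (G i) (below le F i)
  rw [(h.disjoint_below hle i).eq_bot, finrank_bot, add_zero, h.sup_below hle] at this
  exact this

lemma finrank_eq [FiniteDimensional k V] {G' : ι → Submodule k V} (h : IsGradation le F G)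
    (h' : IsGradation le F G') (hle : IsPO le) (i : ι) :
    Module.finrank k (G i) = Module.finrank k (G' i) := by
  have h1 := h.finrank_filt hle i
  have h2 := h'.finrank_filt hle i
  omega

/-- Lifts of the graded pieces of a gradable filtration form a gradation. -/
lemma of_isCompl [Fintype ι] {G₀ : ι → Submodule k V} (h : IsGradation le F G₀) (hle : IsPO le)
    (hsup : ∀ i, F i = G i ⊔ below le F i) (hdisj : ∀ i, Disjoint (G i) (below le F i)) :
    IsGradation le F G := by
  classical
  have hF : ∀ i, F i ≤ ⨆ (j) (_ : le j i), G j := by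
    have wf : WellFounded fun i j => le i j ∧ i ≠ j := by
      have : IsTrans ι fun i j => le i j ∧ i ≠ j := ⟨fun a b c hab hbc =>
        ⟨hle.trans _ _ _ hab.1 hbc.1, fun e => hab.2 (hle.antisymm _ _ hab.1 (e ▸ hbc.1))⟩⟩
      have : Std.Irrefl fun i j : ι => le i j ∧ i ≠ j := ⟨fun a ha => ha.2 rfl⟩
      exact Finite.wellFounded_of_trans_of_irrefl _
    intro i
    induction i using wf.induction with
    | _ i ih =>
      rw [hsup]
      refine sup_le (le_iSup₂_of_le i (hle.refl i) le_rfl) (iSup₂_le fun j hj => ?_)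
      refine (ih j hj).trans (iSup₂_le fun l hl => ?_)
      exact le_iSup₂_of_le l (hle.trans _ _ _ hl hj.1) le_rfl
  have hG : ∀ i, G i ≤ F i := fun i => by rw [hsup]; exact le_sup_left
  have hF' : ∀ i, F i = ⨆ (j) (_ : le j i), G j := by
    refine fun i => le_antisymm (hF i) (iSup₂_le fun j hj => (hG j).trans ?_)
    rw [h.filt, h.filt]
    exact biSup_mono fun l hl => hle.trans _ _ _ hl hj
  refine ⟨⟨?_, ?_⟩, hF'⟩
  · refine iSupIndep_of_sum_eq_zero fun x hx hs => ?_
    by_contra! hne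
    obtain ⟨a, ha⟩ := hne
    -- an index maximal among those of the nonzero terms
    obtain ⟨i, hi, hmax⟩ : ∃ i, x i ≠ 0 ∧ ∀ j, x j ≠ 0 → le i j → j = i := by
      have wf : WellFounded fun i j => le j i ∧ i ≠ j := by
        have : IsTrans ι fun i j => le j i ∧ i ≠ j := ⟨fun a b c hab hbc =>
          ⟨hle.trans _ _ _ hbc.1 hab.1, fun e => hab.2 (hle.antisymm _ _ (e ▸ hbc.1) hab.1)⟩⟩
        have : Std.Irrefl fun i j : ι => le j i ∧ i ≠ j := ⟨fun a ha => ha.2 rfl⟩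
        exact Finite.wellFounded_of_trans_of_irrefl _
      obtain ⟨i, hi, hm⟩ := wf.has_min {i | x i ≠ 0} ⟨a, ha⟩
      exact ⟨i, hi, fun j hj hij => by by_contra hne; exact hm j hj ⟨hij, hne⟩⟩
    have hpi : h.proj i (x i) = 0 := by
      have h0 := congrArg (h.proj i) hs
      rw [map_sum, map_zero, Finset.sum_eq_single i] at h0
      · exact h0
      · intro j _ hji
        by_contra hne
        have hxj : x j ≠ 0 := fun e => hne (by rw [e, map_zero])
        have hxF : x j ∈ F j := hG j (hx j)
        rw [h.filt, h.mem_biSup_iff] at hxF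
        exact hji (hmax j hxj (by by_contra hn; exact hne (hxF i hn)))
      · simp
    have hb : x i ∈ below le F i := by
      have hxF : x i ∈ F i := hG i (hx i)
      rw [h.filt, h.mem_biSup_iff] at hxF
      rw [h.below_eq hle, h.mem_biSup_iff]
      intro j hj
      by_cases hji : j = i
      · rw [hji]; exact hpi
      · exact hxF j fun hn => hj ⟨hn, hji⟩
    exact hi ((Submodule.disjoint_def.1 (hdisj i)) _ (hx i) hb)
  · rw [eq_top_iff, ← h.iSup_eq_top]
    refine iSup_le fun i => (h.le_filt hle i).trans ?_
    rw [hF' i]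
    exact iSup₂_le_iSup _ _

end IsGradation

end Gradation

/-! ### Locally constant families over the real line -/

/-- `sec z` is the set of the families which are sections near `z` of a locally constant sheaf over
the real line, with stalks `A z`. -/
structure IsLocConst {E : ℝ → Type*} (A : ∀ z, Set (E z)) (sec : ℝ → Set (∀ z, E z)) : Prop where
  congr : ∀ z, ∀ s ∈ sec z, ∀ t, (∀ᶠ z' in 𝓝 z, s z' = t z') → t ∈ sec z
  mem : ∀ z, ∀ s ∈ sec z, s z ∈ A z
  eq_iff : ∀ z, ∀ s ∈ sec z, ∀ t ∈ sec z, ∀ᶠ z' in 𝓝 z, (s z' = t z' ↔ s z = t z)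
  cover : ∀ z, ∃ ε > 0, ∀ z' ∈ Metric.ball z ε, ∀ e ∈ A z', ∃ s : ∀ z, E z, s z' = e ∧
    ∀ z'' ∈ Metric.ball z ε, s ∈ sec z''

namespace IsLocConst

variable {E : ℝ → Type*} {A : ∀ z, Set (E z)} {sec : ℝ → Set (∀ z, E z)} (h : IsLocConst A sec)
include h

lemma eq_iff_of_isPreconnected {I : Set ℝ} (hI : _root_.IsPreconnected I) {s t : ∀ z, E z}
    (hs : ∀ z ∈ I, s ∈ sec z) (ht : ∀ z ∈ I, t ∈ sec z) {x y : ℝ} (hx : x ∈ I) (hy : y ∈ I) :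
    s x = t x ↔ s y = t y := by
  refine hI.induction₂ (fun x y => s x = t x ↔ s y = t y) ?_ ?_ ?_ hx hy
  · intro z hz
    exact ((h.eq_iff z s (hs z hz) t (ht z hz)).mono fun _ h => h.symm).filter_mono
      nhdsWithin_le_nhds
  · intro x y z _ _ _ h1 h2; exact h1.trans h2
  · intro x y _ _ h1; exact h1.symm

lemma glue {a b y : ℝ} {s s' : ∀ z, E z} (hs : ∀ z ∈ Icc a y, s ∈ sec z)
    (hs' : ∀ z ∈ Icc y b, s' ∈ sec z) (hy : s y = s' y) (hay : a ≤ y) (hyb : y ≤ b) :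
    ∀ z ∈ Icc a b, (fun w => if w ≤ y then s w else s' w) ∈ sec z := by
  intro z hz
  rcases lt_trichotomy z y with hzy | rfl | hzy
  · refine h.congr z s (hs z ⟨hz.1, hzy.le⟩) _ ?_
    filter_upwards [Iio_mem_nhds hzy] with w hw
    rw [if_pos (le_of_lt hw)]
  · refine h.congr z s (hs z ⟨hay, le_rfl⟩) _ ?_
    filter_upwards [h.eq_iff z s (hs z ⟨hay, le_rfl⟩) s' (hs' z ⟨le_rfl, hyb⟩)] with w hw
    split_ifs
    · rfl
    · exact hw.2 hy
  · refine h.congr z s' (hs' z ⟨hzy.le, hz.2⟩) _ ?_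
    filter_upwards [Ioi_mem_nhds hzy] with w hw
    rw [if_neg (not_le_of_gt hw)]

lemma exists_section_uIcc (x y : ℝ) :
    ∀ e ∈ A x, ∃ s : ∀ z, E z, s x = e ∧ ∀ z ∈ uIcc x y, s ∈ sec z := by
  refine isPreconnected_univ.induction₂'
    (fun x y => ∀ e ∈ A x, ∃ s : ∀ z, E z, s x = e ∧ ∀ z ∈ uIcc x y, s ∈ sec z)
    ?_ ?_ (mem_univ x) (mem_univ y)
  · intro x _
    obtain ⟨ε, hε, hc⟩ := h.cover x
    rw [nhdsWithin_univ]
    filter_upwards [Metric.ball_mem_nhds x hε] with y hy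
    have hsub : uIcc x y ⊆ Metric.ball x ε := by
      rw [Real.ball_eq_Ioo] at hy ⊢
      exact ordConnected_Ioo.uIcc_subset ⟨by linarith, by linarith⟩ hy
    refine ⟨fun e he => ?_, fun e he => ?_⟩
    · obtain ⟨s, hs, hs'⟩ := hc x (Metric.mem_ball_self hε) e he
      exact ⟨s, hs, fun z hz => hs' z (hsub hz)⟩
    · obtain ⟨s, hs, hs'⟩ := hc y hy e he
      exact ⟨s, hs, fun z hz => hs' z (hsub (uIcc_comm x y ▸ hz))⟩
  · intro x y z _ _ _ hxy hyz e he
    obtain ⟨s, hs, hs'⟩ := hxy e he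
    obtain ⟨r, hr, hr'⟩ := hyz (s y) (h.mem y s (hs' y right_mem_uIcc))
    -- the point that lies between the other two decides how the two sections are combined
    have h1 : z ∈ uIcc x y ∨ x ∈ uIcc y z ∨ (x ≤ y ∧ y ≤ z) ∨ (z ≤ y ∧ y ≤ x) := by
      simp only [mem_uIcc]
      rcases le_total x y with h1 | h1 <;> rcases le_total y z with h2 | h2 <;>
        rcases le_total x z with h3 | h3 <;> tauto
    rcases h1 with h1 | h1 | ⟨h1, h2⟩ | ⟨h1, h2⟩
    · exact ⟨s, hs, fun w hw => hs' w (uIcc_subset_uIcc left_mem_uIcc h1 hw)⟩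
    · refine ⟨r, ?_, fun w hw => hr' w (uIcc_subset_uIcc h1 right_mem_uIcc hw)⟩
      rw [← hs]
      refine ((h.eq_iff_of_isPreconnected (isPreconnected_uIcc (a := x) (b := y)) hs' (fun w hw => hr' w ?_)
        left_mem_uIcc right_mem_uIcc).2 hr.symm).symm
      exact uIcc_subset_uIcc h1 left_mem_uIcc hw
    · rw [uIcc_of_le h1] at hs'
      rw [uIcc_of_le h2] at hr'
      refine ⟨_, ?_, uIcc_of_le (h1.trans h2) ▸ h.glue hs' hr' hr.symm h1 h2⟩
      simp [h1, hs]
    · rw [uIcc_of_ge h2] at hs'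
      rw [uIcc_of_ge h1] at hr'
      refine ⟨_, ?_, uIcc_of_ge (h1.trans h2) ▸ h.glue hr' hs' hr h1 h2⟩
      rcases h2.eq_or_lt with rfl | h2
      · simp [hr, hs]
      · simp [not_le_of_gt h2, hs]

/-- A locally constant family over the real line is constant. -/
lemma exists_section (x : ℝ) {e : E x} (he : e ∈ A x) :
    ∃ s : ∀ z, E z, s x = e ∧ ∀ z, s ∈ sec z := by
  choose S hS hS' using fun y => h.exists_section_uIcc x y e he
  -- the sections over the intervals from `x` agree where they are both defined
  have key : ∀ y y', y ∈ uIcc x y' → S y y = S y' y := by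
    intro y y' hy
    refine (h.eq_iff_of_isPreconnected isPreconnected_uIcc (hS' y) (fun w hw => hS' y' w ?_)
      left_mem_uIcc right_mem_uIcc).1 ((hS y).trans (hS y').symm)
    exact uIcc_subset_uIcc left_mem_uIcc hy hw
  refine ⟨fun y => S y y, hS x, fun z => ?_⟩
  rcases lt_trichotomy x z with hz | rfl | hz
  · refine h.congr z (S (z + 1)) (hS' _ z (mem_uIcc.2 (Or.inl ⟨hz.le, by linarith⟩))) _ ?_
    filter_upwards [Ioo_mem_nhds hz (show z < z + 1 by linarith)] with w hw
    exact (key w (z + 1) (mem_uIcc.2 (Or.inl ⟨hw.1.le, hw.2.le⟩))).symm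
  · obtain ⟨ε, hε, hc⟩ := h.cover x
    obtain ⟨s, hs, hs'⟩ := hc x (Metric.mem_ball_self hε) e he
    refine h.congr x s (hs' x (Metric.mem_ball_self hε)) _ ?_
    filter_upwards [Metric.ball_mem_nhds x hε] with y hy
    have hsub : uIcc x y ⊆ Metric.ball x ε := by
      rw [Real.ball_eq_Ioo] at hy ⊢
      exact ordConnected_Ioo.uIcc_subset ⟨by linarith, by linarith⟩ hy
    exact (h.eq_iff_of_isPreconnected isPreconnected_uIcc (fun w hw => hs' w (hsub hw)) (hS' y)
      left_mem_uIcc right_mem_uIcc).1 (hs.trans (hS y).symm)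
  · refine h.congr z (S (z - 1)) (hS' _ z (mem_uIcc.2 (Or.inr ⟨by linarith, hz.le⟩))) _ ?_
    filter_upwards [Ioo_mem_nhds (show z - 1 < z by linarith) hz] with w hw
    exact (key w (z - 1) (mem_uIcc.2 (Or.inr ⟨hw.1.le, hw.2.le⟩))).symm

end IsLocConst

/-! ### Filtrations over the real line: one level -/

/-- A relation between the points of a segment which is transitive and holds locally holds
globally. -/
lemma rel_of_local {P : ℝ → ℝ → Prop} {a b : ℝ}
    (loc : ∀ t ∈ Icc a b, ∃ ε > 0, ∀ s ∈ Icc a b, ∀ s' ∈ Icc a b, |s - t| < ε → |s' - t| < ε →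
      s < s' → P s s')
    (trans : ∀ s ∈ Icc a b, ∀ s' ∈ Icc a b, ∀ s'' ∈ Icc a b, s < s' → s' < s'' →
      P s s' → P s' s'' → P s s'') :
    ∀ s ∈ Icc a b, ∀ s' ∈ Icc a b, s < s' → P s s' := by
  intro s hs s' hs' hss'
  set S : Set ℝ := {u | u ∈ Icc s b ∧ ∀ v, s < v → v ≤ u → P s v} with hSdef
  have hsS : s ∈ S := ⟨⟨le_rfl, hs.2⟩, fun v h1 h2 => absurd h2 (not_le_of_gt h1)⟩
  have hbdd : BddAbove S := ⟨b, fun u hu => hu.1.2⟩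
  set c := sSup S with hc
  have hsc : s ≤ c := le_csSup hbdd hsS
  have hcb : c ≤ b := csSup_le ⟨s, hsS⟩ fun u hu => hu.1.2
  obtain ⟨ε, hε, hloc⟩ := loc c ⟨hs.1.trans hsc, hcb⟩
  obtain ⟨v, hvS, hv⟩ := exists_lt_of_lt_csSup ⟨s, hsS⟩ (show c - ε < sSup S by linarith)
  have hvc : v ≤ c := le_csSup hbdd hvS
  have hw : ∀ w, s < w → w ≤ b → w < c + ε → P s w := by
    intro w hsw hwb hwc
    by_cases hwv : w ≤ v
    · exact hvS.2 w hsw hwv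
    push Not at hwv
    have hvI : v ∈ Icc a b := ⟨hs.1.trans hvS.1.1, hvS.1.2⟩
    have hwI : w ∈ Icc a b := ⟨hs.1.trans hsw.le, hwb⟩
    have hvw : P v w := hloc v hvI w hwI (abs_lt.2 ⟨by linarith, by linarith⟩)
      (abs_lt.2 ⟨by linarith, by linarith⟩) hwv
    rcases hvS.1.1.eq_or_lt with rfl | hsv
    · exact hvw
    · exact trans s hs v hvI w hwI hsv hwv (hvS.2 v hsv le_rfl) hvw
  have hmem : min b (c + ε / 2) ∈ S := by
    refine ⟨⟨le_min hs.2 (by linarith), min_le_left _ _⟩, fun w h1 h2 => hw w h1 ?_ ?_⟩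
    · exact h2.trans (min_le_left _ _)
    · exact (h2.trans (min_le_right _ _)).trans_lt (by linarith)
  have hbc : b ≤ c := by
    have := le_csSup hbdd hmem
    rcases min_le_iff.1 this with h | h
    · exact h
    · linarith
  exact hw s' hss' hs'.2 (by linarith [hs'.2])

/-- The leading terms of the differences of the members of a finite family of exponential factors
along a circle of directions: the real part of the difference of the factors `i` and `j` behaves
like `cos (angle i j - level i j * θ) / r ^ level i j` near the origin. -/
structure ExpData (ι : Type) where
  /-- the order of the pole of the difference of two factors -/
  level : ι → ι → ℝ
  /-- the argument of the leading coefficient of the difference of two factors -/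
  angle : ι → ι → ℝ
  level_pos : ∀ i j, i ≠ j → 0 < level i j
  level_symm : ∀ i j, level i j = level j i
  cos_anti : ∀ i j, i ≠ j → ∀ θ,
    Real.cos (angle j i - level j i * θ) = - Real.cos (angle i j - level i j * θ)
  ultra : ∀ i j l, i ≠ j → j ≠ l → i ≠ l → level i l ≤ max (level i j) (level j l)
  cos_eq : ∀ i j l, i ≠ j → j ≠ l → i ≠ l → level i j < level j l → ∀ θ,
    Real.cos (angle i l - level i l * θ) = Real.cos (angle j l - level j l * θ)
  trans : ∀ θ i j l, i ≠ j → j ≠ l → Real.cos (angle i j - level i j * θ) < 0 →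
    Real.cos (angle j l - level j l * θ) < 0 → i ≠ l ∧ Real.cos (angle i l - level i l * θ) < 0

namespace ExpData

variable {ι : Type} (D : ExpData ι)

/-- The strict order of the factors in the direction `θ`. -/
def lt (θ : ℝ) (i j : ι) : Prop := i ≠ j ∧ Real.cos (D.angle i j - D.level i j * θ) < 0

/-- The order of the factors in the direction `θ`. -/
def le (θ : ℝ) (i j : ι) : Prop := i = j ∨ D.lt θ i j

lemma not_lt_of_lt {θ : ℝ} {i j : ι} (h : D.lt θ i j) : ¬ D.lt θ j i := by
  intro h'
  have := D.cos_anti i j h.1 θ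
  have h1 := h.2
  have h2 := h'.2
  linarith

lemma lt_trans {θ : ℝ} {i j l : ι} (h : D.lt θ i j) (h' : D.lt θ j l) : D.lt θ i l :=
  D.trans θ i j l h.1 h'.1 h.2 h'.2

lemma isPO (θ : ℝ) : IsPO (D.le θ) where
  refl i := Or.inl rfl
  trans i j l h h' := by
    rcases h with rfl | h
    · exact h'
    rcases h' with rfl | h'
    · exact Or.inr h
    exact Or.inr (D.lt_trans h h')
  antisymm i j h h' := by
    rcases h with rfl | h
    · rfl
    rcases h' with h' | h'
    · exact h'.symm
    exact absurd h' (D.not_lt_of_lt h)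

lemma le_and_ne_iff {θ : ℝ} {i j : ι} : D.le θ i j ∧ i ≠ j ↔ D.lt θ i j :=
  ⟨fun h => h.1.resolve_left h.2, fun h => ⟨Or.inr h, h.1⟩⟩

/-- The restriction of the data to a family of indices. -/
def comap {κ : Type} (e : κ ↪ ι) : ExpData κ where
  level i j := D.level (e i) (e j)
  angle i j := D.angle (e i) (e j)
  level_pos i j h := D.level_pos _ _ (e.injective.ne h)
  level_symm i j := D.level_symm _ _
  cos_anti i j h := D.cos_anti _ _ (e.injective.ne h)
  ultra i j l h h' h'' := D.ultra _ _ _ (e.injective.ne h) (e.injective.ne h') (e.injective.ne h'')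
  cos_eq i j l h h' h'' :=
    D.cos_eq _ _ _ (e.injective.ne h) (e.injective.ne h') (e.injective.ne h'')
  trans θ i j l h h' h1 h2 := by
    have := D.trans θ _ _ _ (e.injective.ne h) (e.injective.ne h') h1 h2
    exact ⟨fun h => this.1 (congrArg e h), this.2⟩

lemma comap_lt {κ : Type} (e : κ ↪ ι) {θ : ℝ} {i j : κ} :
    (D.comap e).lt θ i j ↔ D.lt θ (e i) (e j) :=
  and_congr e.injective.ne_iff.symm Iff.rfl

lemma comap_le {κ : Type} (e : κ ↪ ι) {θ : ℝ} {i j : κ} :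
    (D.comap e).le θ i j ↔ D.le θ (e i) (e j) :=
  or_congr e.injective.eq_iff.symm (D.comap_lt e)

end ExpData

/-- On a segment of length half a period, a sinusoid which starts negative changes its sign only
once. -/
lemma cos_pos_of_cross {α M a s s' : ℝ} (hM : 0 < M) (h0 : Real.cos (α - M * a) < 0)
    (has : a ≤ s) (hss' : s < s') (hs' : s' ≤ a + Real.pi / M) (hs : 0 ≤ Real.cos (α - M * s)) :
    0 < Real.cos (α - M * s') := by
  set x := M * a - α with hx
  have hpi := Real.pi_pos
  -- translate the argument by a period into `[0, 2π)`
  obtain ⟨n, hn, -⟩ := existsUnique_sub_zsmul_mem_Ico Real.two_pi_pos x 0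
  have hn' : x - n * (2 * Real.pi) ∈ Ico 0 (2 * Real.pi) := by simpa using hn
  have hc : ∀ r, Real.cos (α - M * r) = Real.cos (M * r - α - n * (2 * Real.pi)) := by
    intro r
    rw [Real.cos_sub_int_mul_two_pi, ← Real.cos_neg]; ring_nf
  rw [hc] at h0 hs ⊢
  set y := M * a - α - n * (2 * Real.pi)
  set y' := M * s - α - n * (2 * Real.pi)
  set y'' := M * s' - α - n * (2 * Real.pi)
  have h1 : y ≤ y' := by
    have := mul_le_mul_of_nonneg_left has hM.le
    simp only [y, y']; linarith
  have h2 : y' < y'' := by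
    have := mul_lt_mul_of_pos_left hss' hM
    simp only [y', y'']; linarith
  have h3 : y'' ≤ y + Real.pi := by
    have := mul_le_mul_of_nonneg_left hs' hM.le
    rw [mul_add, mul_div_cancel₀ _ hM.ne'] at this
    simp only [y, y'']; linarith
  have hy1 : Real.pi / 2 < y := by
    by_contra! hle
    have := Real.cos_nonneg_of_neg_pi_div_two_le_of_le (x := y)
      (by have := hn'.1; simp only [y]; linarith) hle
    linarith
  have hy2 : y < 3 * Real.pi / 2 := by
    by_contra! hle
    have h4 := Real.cos_nonneg_of_neg_pi_div_two_le_of_le (x := y - 2 * Real.pi)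
      (by linarith) (by have := hn'.2; simp only [y]; linarith)
    rw [Real.cos_sub_two_pi] at h4
    linarith
  have hy' : 3 * Real.pi / 2 ≤ y' := by
    by_contra! hlt
    have := Real.cos_neg_of_pi_div_two_lt_of_lt (x := y') (by linarith) (by linarith)
    linarith
  have := Real.cos_pos_of_mem_Ioo (x := y'' - 2 * Real.pi) ⟨by linarith, by linarith⟩
  rwa [Real.cos_sub_two_pi] at this

/-- Every interval contains a direction in which any two of the factors are comparable. -/
lemma exists_generic {ι : Type} [Finite ι] (D : ExpData ι) {a b : ℝ} (hab : a < b) :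
    ∃ θ ∈ Ioo a b, ∀ i j, i ≠ j → Real.cos (D.angle i j - D.level i j * θ) ≠ 0 := by
  have hc : (⋃ p : {p : ι × ι // p.1 ≠ p.2},
      {θ : ℝ | Real.cos (D.angle p.1.1 p.1.2 - D.level p.1.1 p.1.2 * θ) = 0}).Countable := by
    refine countable_iUnion fun p => ?_
    have hl := (D.level_pos _ _ p.2).ne'
    refine (countable_range fun n : ℤ =>
      (D.angle p.1.1 p.1.2 - (2 * n + 1) * Real.pi / 2) / D.level p.1.1 p.1.2).mono ?_
    intro θ hθ
    obtain ⟨n, hn⟩ := Real.cos_eq_zero_iff.1 hθ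
    refine ⟨n, ?_⟩
    simp only
    rw [← hn]
    field_simp
    ring
  have hne : ¬ Ioo a b ⊆ (⋃ p : {p : ι × ι // p.1 ≠ p.2},
      {θ : ℝ | Real.cos (D.angle p.1.1 p.1.2 - D.level p.1.1 p.1.2 * θ) = 0}) := fun hsub =>
    (Cardinal.Real.Ioo_countable_iff.not.2 (not_le_of_gt hab)) (hc.mono hsub)
  obtain ⟨θ, hθ, hθ'⟩ := not_subset.1 hne
  refine ⟨θ, hθ, fun i j hij h0 => hθ' ?_⟩
  exact mem_iUnion.2 ⟨⟨(i, j), hij⟩, h0⟩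

section Filtration

variable {k : Type v} [Field k] {V : Type w} [AddCommGroup V] [Module k V] {ι : Type}

/-- Filtrations depending on a direction which are locally induced by one and the same
gradation. -/
def LocGraded (D : ExpData ι) (F : ℝ → ι → Submodule k V) : Prop :=
  ∀ t, ∃ G, ∀ᶠ θ in 𝓝 t, IsGradation (D.le θ) (F θ) G

/-- The index `a` is maximal among those of the nonzero components of `x`. -/
def IsLead (le : ι → ι → Prop) (F : ι → Submodule k V) (x : V) (a : ι) : Prop :=
  x ∈ (⨆ (j) (_ : ¬ (le a j ∧ a ≠ j)), F j) ∧ x ∉ (⨆ (j) (_ : ¬ le a j), F j)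

/-- Leading indices are read off the components with respect to any gradation; `IsLead` itself only
involves the filtration. -/
lemma isLead_iff {le : ι → ι → Prop} {F G : ι → Submodule k V} (h : IsGradation le F G)
    (hle : IsPO le) {x : V} {a : ι} :
    IsLead le F x a ↔ h.proj a x ≠ 0 ∧ ∀ j, le a j → a ≠ j → h.proj j x = 0 := by
  have h1 : ∀ i j, le i j → ¬ (le a j ∧ a ≠ j) → ¬ (le a i ∧ a ≠ i) := by
    intro i j hij hj hi
    refine hj ⟨hle.trans _ _ _ hi.1 hij, ?_⟩
    rintro rfl
    exact hi.2 (hle.antisymm _ _ hi.1 hij)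
  have h2 : ∀ i j, le i j → ¬ le a j → ¬ le a i := fun i j hij hj hi =>
    hj (hle.trans _ _ _ hi hij)
  rw [IsLead, h.biSup_filt hle h1, h.biSup_filt hle h2, h.mem_biSup_iff, h.mem_biSup_iff]
  constructor
  · rintro ⟨h3, h4⟩
    have h5 : ∀ j, le a j → a ≠ j → h.proj j x = 0 := fun j hj hne => h3 j (by tauto)
    refine ⟨fun h0 => h4 fun i hi => ?_, h5⟩
    push Not at hi
    by_cases hai : a = i
    · rw [← hai]; exact h0
    · exact h5 i hi hai
  · rintro ⟨h3, h4⟩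
    refine ⟨fun i hi => ?_, fun h5 => h3 (h5 a (by simpa using hle.refl a))⟩
    push Not at hi
    exact h4 i hi.1 hi.2

lemma exists_isLead_ge [Finite ι] {le : ι → ι → Prop} {F G : ι → Submodule k V}
    (h : IsGradation le F G) (hle : IsPO le) {x : V} {j : ι} (hx : h.proj j x ≠ 0) :
    ∃ a, le j a ∧ IsLead le F x a := by
  have wf : WellFounded fun i j => le j i ∧ i ≠ j := by
    have : IsTrans ι fun i j => le j i ∧ i ≠ j := ⟨fun a b c hab hbc =>
      ⟨hle.trans _ _ _ hbc.1 hab.1, fun e => hab.2 (hle.antisymm _ _ (e ▸ hbc.1) hab.1)⟩⟩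
    have : Std.Irrefl fun i j : ι => le j i ∧ i ≠ j := ⟨fun a ha => ha.2 rfl⟩
    exact Finite.wellFounded_of_trans_of_irrefl _
  obtain ⟨i, hi, hm⟩ := wf.has_min {i | h.proj i x ≠ 0 ∧ le j i} ⟨j, hx, hle.refl j⟩
  refine ⟨i, hi.2, (isLead_iff h hle).2 ⟨hi.1, fun l hl hne => ?_⟩⟩
  by_contra h0
  exact hm l ⟨h0, hle.trans _ _ _ hi.2 hl⟩ ⟨hl, hne.symm⟩

lemma exists_isLead [Finite ι] {le : ι → ι → Prop} {F G : ι → Submodule k V}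
    (h : IsGradation le F G) (hle : IsPO le) {x : V} (hx : x ≠ 0) : ∃ a, IsLead le F x a := by
  have hne : ∃ i, h.proj i x ≠ 0 := by
    by_contra! hall
    exact hx (h.eq_zero hall)
  obtain ⟨i, hi⟩ := hne
  obtain ⟨a, -, ha⟩ := exists_isLead_ge h hle hi
  exact ⟨a, ha⟩

/-- With one level, when the direction increases by at most half a period, the leading index of a
vector can only decrease for the initial order: of two indices, it is the one which was smaller that
overtakes the other. -/
lemma isLead_antitone [Finite ι] {D : ExpData ι} {M : ℝ} (hM : 0 < M)
    (hD : ∀ i j, i ≠ j → D.level i j = M) {F : ℝ → ι → Submodule k V} (hF : LocGraded D F)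
    {a : ℝ} (ha : ∀ i j, i ≠ j → Real.cos (D.angle i j - D.level i j * a) ≠ 0) :
    ∀ s ∈ Icc a (a + Real.pi / M), ∀ s' ∈ Icc a (a + Real.pi / M), s < s' →
      ∀ x p q, IsLead (D.le s) (F s) x p → IsLead (D.le s') (F s') x q → D.le a q p := by
  refine rel_of_local ?_ ?_
  -- near `t` the gradation is fixed: if `p` were smaller than `q` in the direction `a`, it would
  -- not be so any more at `s`, and `p` would be larger than `q` at `s'`, where `q` is leading
  · intro t ht
    obtain ⟨G, hG⟩ := hF t
    obtain ⟨ε, hε, hG⟩ := Metric.eventually_nhds_iff.1 hG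
    refine ⟨ε, hε, fun s hs s' hs' hst hst' hss' x p q hp hq => ?_⟩
    have hGs := hG hst
    have hGs' := hG hst'
    rw [isLead_iff hGs (D.isPO s)] at hp
    rw [isLead_iff hGs' (D.isPO s')] at hq
    by_contra hqp
    have hne : p ≠ q := fun e => hqp (Or.inl e.symm)
    have hap : Real.cos (D.angle p q - M * a) < 0 := by
      have h1 := ha q p hne.symm
      have h2 := D.cos_anti q p hne.symm a
      have h3 : ¬ Real.cos (D.angle q p - D.level q p * a) < 0 := fun h =>
        hqp (Or.inr ⟨hne.symm, h⟩)
      rw [← hD p q hne]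
      have : 0 < Real.cos (D.angle q p - D.level q p * a) := lt_of_le_of_ne (not_lt.1 h3) h1.symm
      linarith
    have hsp : 0 ≤ Real.cos (D.angle p q - M * s) := by
      by_contra! hlt
      rw [← hD p q hne] at hlt
      exact hq.1 (hp.2 q (Or.inr ⟨hne, hlt⟩) hne)
    have hsp' := cos_pos_of_cross hM hap hs.1 hss' hs'.2 hsp
    rw [← hD p q hne] at hsp'
    have h4 := D.cos_anti p q hne s'
    exact hp.1 (hq.2 p (Or.inr ⟨hne.symm, by linarith⟩) hne.symm)
  · intro s hs s' hs' s'' hs'' _ _ h1 h2 x p q hp hq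
    obtain ⟨G, hG⟩ := hF s'
    have hG' := hG.self_of_nhds
    have hx : x ≠ 0 := by
      rintro rfl
      exact hp.2 (Submodule.zero_mem _)
    obtain ⟨r, hr⟩ := exists_isLead hG' (D.isPO s') hx
    exact (D.isPO a).trans _ _ _ (h2 x r q hr hq) (h1 x p r hp hr)

lemma LocGraded.finrank_const [FiniteDimensional k V] {D : ExpData ι}
    {F : ℝ → ι → Submodule k V} (hF : LocGraded D F) {s t : ℝ} {G G' : ι → Submodule k V}
    (hG : IsGradation (D.le s) (F s) G) (hG' : IsGradation (D.le t) (F t) G') (i : ι) :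
    Module.finrank k (G i) = Module.finrank k (G' i) := by
  choose Γ hΓ using hF
  have key : Module.finrank k (Γ s i) = Module.finrank k (Γ t i) := by
    refine isPreconnected_univ.induction₂
      (fun s t => Module.finrank k (Γ s i) = Module.finrank k (Γ t i)) ?_
      (fun _ _ _ _ _ _ h h' => h.trans h') (fun _ _ _ _ h => h.symm) (mem_univ s) (mem_univ t)
    intro x _
    rw [nhdsWithin_univ]
    filter_upwards [hΓ x] with y hy
    exact hy.finrank_eq (hΓ y).self_of_nhds (D.isPO y) i
  rw [hG.finrank_eq (hΓ s).self_of_nhds (D.isPO s), key,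
    hG'.finrank_eq (hΓ t).self_of_nhds (D.isPO t)]

lemma IsGradation.finrank_eq_sum [Fintype ι] [FiniteDimensional k V] {le : ι → ι → Prop}
    {F G : ι → Submodule k V} (h : IsGradation le F G) (i : ι) [DecidablePred fun j => le j i] :
    Module.finrank k (F i) = ∑ j with le j i, Module.finrank k (G j) := by
  have : (⨆ (j) (_ : le j i), G j) = ⨆ j ∈ Finset.univ.filter fun j => le j i, G j := by simp
  rw [h.filt, this, IsDecomp.finrank_biSup h.indep]

lemma IsDecomp.finrank_eq_sum [Fintype ι] [FiniteDimensional k V] {G : ι → Submodule k V}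
    (h : IsDecomp G) : Module.finrank k V = ∑ j, Module.finrank k (G j) := by
  have : (⨆ j ∈ (Finset.univ : Finset ι), G j) = ⊤ := by simp [h.iSup_eq_top]
  rw [← IsDecomp.finrank_biSup h.indep, this, finrank_top]

/-- With one level, the filtrations in two opposite generic directions are opposite, and they
determine a splitting of the filtrations in the directions between them. -/
lemma LocGraded.isGradation_inf [Fintype ι] [FiniteDimensional k V] {D : ExpData ι} {M : ℝ}
    (hM : 0 < M) (hD : ∀ i j, i ≠ j → D.level i j = M) {F : ℝ → ι → Submodule k V}
    (hF : LocGraded D F) {a θ : ℝ}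
    (ha : ∀ i j, i ≠ j → Real.cos (D.angle i j - D.level i j * a) ≠ 0)
    (hθ : θ ∈ Ioo a (a + Real.pi / M)) :
    IsGradation (D.le θ) (F θ) fun i => F a i ⊓ F (a + Real.pi / M) i := by
  classical
  set b := a + Real.pi / M with hb
  obtain ⟨G, hG⟩ := hF θ
  obtain ⟨Ga, hGa⟩ := hF a
  obtain ⟨Gb, hGb⟩ := hF b
  have hG := hG.self_of_nhds
  have hGa := hGa.self_of_nhds
  have hGb := hGb.self_of_nhds
  have hab : a < b := hθ.1.trans hθ.2
  -- the order in the direction `b` is opposite to the one in the direction `a`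
  have hop : ∀ i j, D.le b i j ↔ D.le a j i := by
    intro i j
    by_cases hij : i = j
    · simp [ExpData.le, hij]
    have h1 : Real.cos (D.angle i j - D.level i j * b)
        = - Real.cos (D.angle i j - D.level i j * a) := by
      rw [hD i j hij, hb, mul_add, mul_div_cancel₀ _ hM.ne', ← sub_sub, Real.cos_sub_pi]
    have h2 := D.cos_anti i j hij a
    have h3 : D.le b i j ↔ Real.cos (D.angle i j - D.level i j * b) < 0 := by
      simp [ExpData.le, ExpData.lt, hij]
    have h4 : D.le a j i ↔ Real.cos (D.angle j i - D.level j i * a) < 0 := by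
      simp [ExpData.le, ExpData.lt, Ne.symm hij]
    rw [h3, h4, h1, h2]
  have htot : ∀ i j, D.le a i j ∨ D.le a j i := by
    intro i j
    by_cases hij : i = j
    · exact Or.inl (Or.inl hij)
    rcases lt_or_gt_of_ne (ha i j hij) with h | h
    · exact Or.inl (Or.inr ⟨hij, h⟩)
    · exact Or.inr (Or.inr ⟨Ne.symm hij, by rw [D.cos_anti i j hij]; linarith⟩)
  have hIa : a ∈ Icc a b := ⟨le_rfl, hab.le⟩
  have hIb : b ∈ Icc a b := ⟨hab.le, le_rfl⟩
  have hIθ : θ ∈ Icc a b := ⟨hθ.1.le, hθ.2.le⟩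
  -- a vector of the intersection has no leading index other than `i` in the direction `θ`
  have hlead : ∀ i, ∀ x ∈ F a i ⊓ F b i, ∀ c, IsLead (D.le θ) (F θ) x c → c = i := by
    rintro i x ⟨hxa, hxb⟩ c hc
    have hx : x ≠ 0 := by
      rintro rfl
      exact hc.2 (Submodule.zero_mem _)
    obtain ⟨p, hp⟩ := exists_isLead hGa (D.isPO a) hx
    obtain ⟨q, hq⟩ := exists_isLead hGb (D.isPO b) hx
    have h1 := isLead_antitone hM hD hF ha a hIa θ hIθ hθ.1 x p c hp hc
    have h2 := isLead_antitone hM hD hF ha θ hIθ b hIb hθ.2 x c q hc hq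
    have hpi : D.le a p i := by
      rw [isLead_iff hGa (D.isPO a)] at hp
      rw [SetLike.mem_coe, hGa.filt, hGa.mem_biSup_iff] at hxa
      by_contra h
      exact hp.1 (hxa p h)
    have hqi : D.le a i q := by
      rw [isLead_iff hGb (D.isPO b)] at hq
      rw [SetLike.mem_coe, hGb.filt, hGb.mem_biSup_iff] at hxb
      rw [← hop]
      by_contra h
      exact hq.1 (hxb q h)
    exact (D.isPO a).antisymm _ _ ((D.isPO a).trans _ _ _ h1 hpi)
      ((D.isPO a).trans _ _ _ hqi h2)
  have hle : ∀ i, F a i ⊓ F b i ≤ F θ i := by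
    intro i x hx
    rw [hG.filt, hG.mem_biSup_iff]
    intro j hj
    by_contra h0
    obtain ⟨c, hjc, hc⟩ := exists_isLead_ge hG (D.isPO θ) h0
    exact hj (hlead i x hx c hc ▸ hjc)
  have hdisj : ∀ i, Disjoint (F a i ⊓ F b i) (below (D.le θ) (F θ) i) := by
    intro i
    rw [Submodule.disjoint_def]
    intro x hx hx'
    by_contra h0
    obtain ⟨c, hc⟩ := exists_isLead hG (D.isPO θ) h0
    have hci := hlead i x hx c hc
    subst hci
    rw [hG.below_eq (D.isPO θ), hG.mem_biSup_iff] at hx'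
    exact ((isLead_iff hG (D.isPO θ)).1 hc).1 (hx' c (by simp))
  refine hG.of_isCompl (D.isPO θ) (fun i => ?_) hdisj
  -- the dimensions of the opposite filtrations add up
  have hdim : Module.finrank k (G i) ≤ Module.finrank k (F a i ⊓ F b i : Submodule k V) := by
    have h1 := Submodule.finrank_sup_add_finrank_inf_eq (F a i) (F b i)
    have h2 := Submodule.finrank_le (F a i ⊔ F b i)
    have h3 := hGa.finrank_eq_sum i
    have h4 := hGb.finrank_eq_sum i
    simp_rw [hF.finrank_const hGa hG] at h3
    simp_rw [hF.finrank_const hGb hG] at h4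
    have h5 := hG.toIsDecomp.finrank_eq_sum
    have h6 := Finset.sum_union_inter (s₁ := Finset.univ.filter fun j => D.le a j i)
      (s₂ := Finset.univ.filter fun j => D.le b j i) (f := fun j => Module.finrank k (G j))
    have h7 : (Finset.univ.filter fun j => D.le a j i) ∪ (Finset.univ.filter fun j => D.le b j i)
        = Finset.univ := by
      ext j
      simpa [hop] using htot j i
    have h8 : (Finset.univ.filter fun j => D.le a j i) ∩ (Finset.univ.filter fun j => D.le b j i)
        = {i} := by
      ext j
      simp only [Finset.mem_inter, Finset.mem_filter, Finset.mem_univ, true_and,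
        Finset.mem_singleton, hop]
      exact ⟨fun h => (D.isPO a).antisymm _ _ h.1 h.2, fun h => h ▸ ⟨Or.inl rfl, Or.inl rfl⟩⟩
    rw [h7, h8, Finset.sum_singleton] at h6
    omega
  symm
  refine Submodule.eq_of_le_of_finrank_le (sup_le (hle i) ?_) ?_
  · rw [hG.below_eq (D.isPO θ), hG.filt]
    exact biSup_mono fun j hj => hj.1
  · have h1 := Submodule.finrank_sup_add_finrank_inf_eq (F a i ⊓ F b i) (below (D.le θ) (F θ) i)
    rw [(hdisj i).eq_bot, finrank_bot, add_zero] at h1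
    rw [h1, hG.finrank_filt (D.isPO θ)]
    omega

end Filtration

/-! ### Filtrations over the real line: diagonalisation of morphisms -/

section Subquotient

variable {k : Type v} [Field k] {V : Type w} [AddCommGroup V] [Module k V]

/-- The global sections of the locally constant sheaf over the real line with stalks `U θ ⧸ N θ`. -/
def Subq (N U : ℝ → Submodule k V) : Submodule k (∀ θ, V ⧸ N θ) where
  carrier := {s | ∀ t, ∃ x, ∀ᶠ θ in 𝓝 t, x ∈ U θ ∧ (N θ).mkQ x = s θ}
  add_mem' := fun {a b} ha hb t => by
    obtain ⟨x, hx⟩ := ha t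
    obtain ⟨y, hy⟩ := hb t
    refine ⟨x + y, ?_⟩
    filter_upwards [hx, hy] with θ h1 h2
    exact ⟨(U θ).add_mem h1.1 h2.1, by rw [map_add, h1.2, h2.2]; rfl⟩
  zero_mem' := fun t => ⟨0, Eventually.of_forall fun θ => ⟨(U θ).zero_mem, map_zero _⟩⟩
  smul_mem' := fun c a ha t => by
    obtain ⟨x, hx⟩ := ha t
    refine ⟨c • x, ?_⟩
    filter_upwards [hx] with θ h1
    exact ⟨(U θ).smul_mem c h1.1, by rw [map_smul, h1.2]; rfl⟩

/-- The subquotients `U θ ⧸ N θ` form a locally constant family. -/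
structure IsLocSubq (N U : ℝ → Submodule k V) : Prop where
  compl : ∀ t, ∃ P : Submodule k V, ∀ᶠ θ in 𝓝 t, U θ = N θ ⊔ P ∧ Disjoint P (N θ)
  mem_iff : ∀ t x, (∀ᶠ θ in 𝓝 t, x ∈ U θ) → ∀ᶠ θ in 𝓝 t, (x ∈ N θ ↔ x ∈ N t)

variable {N U : ℝ → Submodule k V}

lemma IsLocSubq.isLocConst (h : IsLocSubq N U) :
    IsLocConst (fun θ => ((U θ).map (N θ).mkQ : Set (V ⧸ N θ)))
      (fun t => {s | ∃ x, ∀ᶠ θ in 𝓝 t, x ∈ U θ ∧ (N θ).mkQ x = s θ}) where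
  congr := by
    rintro t s ⟨x, hx⟩ s' hs
    refine ⟨x, ?_⟩
    filter_upwards [hx, hs] with θ h1 h2
    exact ⟨h1.1, h1.2.trans h2⟩
  mem := by
    rintro t s ⟨x, hx⟩
    exact ⟨x, hx.self_of_nhds.1, hx.self_of_nhds.2⟩
  eq_iff := by
    rintro t s ⟨x, hx⟩ s' ⟨x', hx'⟩
    have hsub : ∀ᶠ θ in 𝓝 t, x - x' ∈ U θ := by
      filter_upwards [hx, hx'] with θ h1 h2
      exact (U θ).sub_mem h1.1 h2.1
    have key : ∀ᶠ θ in 𝓝 t, (s θ = s' θ ↔ x - x' ∈ N θ) := by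
      filter_upwards [hx, hx'] with θ h1 h2
      rw [← h1.2, ← h2.2, Submodule.mkQ_apply, Submodule.mkQ_apply, Submodule.Quotient.eq]
    filter_upwards [key, h.mem_iff t _ hsub] with θ h1 h2
    rw [h1, h2, key.self_of_nhds]
  cover := by
    intro t
    obtain ⟨P, hP⟩ := h.compl t
    obtain ⟨ε, hε, hP⟩ := Metric.eventually_nhds_iff_ball.1 hP
    refine ⟨ε, hε, fun t' ht' e he => ?_⟩
    obtain ⟨x, hx, rfl⟩ := he
    rw [SetLike.mem_coe, (hP t' ht').1] at hx
    obtain ⟨y, hy, p, hp, rfl⟩ := Submodule.mem_sup.1 hx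
    refine ⟨fun θ => (N θ).mkQ p, ?_, fun t'' ht'' => ⟨p, ?_⟩⟩
    · rw [map_add, Submodule.mkQ_apply, Submodule.mkQ_apply,
        (Submodule.Quotient.mk_eq_zero _).2 hy, zero_add]
      rfl
    · filter_upwards [Metric.isOpen_ball.mem_nhds ht''] with θ hθ
      exact ⟨by rw [(hP θ hθ).1]; exact Submodule.mem_sup_right hp, rfl⟩

/-- A complement `P` of `N t` in `U t` is a model of the space of the global sections. -/
lemma IsLocSubq.exists_model (h : IsLocSubq N U) {t : ℝ} {P : Submodule k V}
    (hP : U t = N t ⊔ P) (hP' : Disjoint P (N t)) :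
    ∃ ψ : Subq N U →ₗ[k] V, Function.Injective ψ ∧ LinearMap.range ψ = P ∧
      (∀ s : Subq N U, (N t).mkQ (ψ s) = s.1 t) ∧
      ((∀ᶠ θ in 𝓝 t, U θ = N θ ⊔ P ∧ Disjoint P (N θ)) →
        ∀ᶠ θ in 𝓝 t, ∀ s : Subq N U, (N θ).mkQ (ψ s) = s.1 θ) := by
  have hc := h.isLocConst
  set α : P →ₗ[k] V ⧸ N t := (N t).mkQ ∘ₗ P.subtype with hα
  set β : Subq N U →ₗ[k] V ⧸ N t := LinearMap.proj t ∘ₗ (Subq N U).subtype with hβ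
  have hαi : Function.Injective α := by
    rw [← LinearMap.ker_eq_bot, LinearMap.ker_eq_bot']
    intro p hp
    have : (p : V) ∈ N t := (Submodule.Quotient.mk_eq_zero _).1 hp
    exact Subtype.ext ((Submodule.disjoint_def.1 hP') _ p.2 this)
  have hβi : Function.Injective β := by
    intro s s' hss'
    refine Subtype.ext (funext fun θ => ?_)
    exact (hc.eq_iff_of_isPreconnected isPreconnected_univ (fun z _ => s.2 z) (fun z _ => s'.2 z)
      (mem_univ t) (mem_univ θ)).1 hss'
  have hαr : LinearMap.range α = (U t).map (N t).mkQ := by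
    rw [hα, LinearMap.range_comp, Submodule.range_subtype, hP, Submodule.map_sup]
    rw [Submodule.mkQ_map_self, bot_sup_eq]
  have hβr : LinearMap.range β = (U t).map (N t).mkQ := by
    apply le_antisymm
    · rintro _ ⟨s, rfl⟩
      exact hc.mem t _ (s.2 t)
    · intro e he
      obtain ⟨s, hs, hs'⟩ := hc.exists_section t he
      exact ⟨⟨s, hs'⟩, hs⟩
  set Ψ : Subq N U ≃ₗ[k] P := (LinearEquiv.ofInjective β hβi).trans
    ((LinearEquiv.ofEq _ _ (hβr.trans hαr.symm)).trans (LinearEquiv.ofInjective α hαi).symm)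
  have hΨ : ∀ s, α (Ψ s) = β s := by
    intro s
    have : LinearEquiv.ofInjective α hαi (Ψ s)
        = LinearEquiv.ofEq _ _ (hβr.trans hαr.symm) (LinearEquiv.ofInjective β hβi s) := by
      simp [Ψ]
    exact congrArg Subtype.val this
  refine ⟨P.subtype ∘ₗ Ψ.toLinearMap, P.injective_subtype.comp Ψ.injective, ?_, hΨ, ?_⟩
  · rw [LinearMap.range_comp_of_range_eq_top _ Ψ.range, Submodule.range_subtype]
  · intro hev
    obtain ⟨ε, hε, hP⟩ := Metric.eventually_nhds_iff_ball.1 hev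
    filter_upwards [Metric.ball_mem_nhds t hε] with θ hθ s
    refine (hc.eq_iff_of_isPreconnected (convex_ball t ε).isPreconnected
      (s := fun θ => (N θ).mkQ ((Ψ s : P) : V)) (fun z hz => ⟨(Ψ s : P), ?_⟩)
      (fun z _ => s.2 z) (Metric.mem_ball_self hε) hθ).1 (hΨ s)
    filter_upwards [Metric.isOpen_ball.mem_nhds hz] with θ' hθ'
    exact ⟨by rw [(hP θ' hθ').1]; exact Submodule.mem_sup_right (Ψ s).2, rfl⟩

/-- The map induced on the global sections of the subquotients. -/
def Subq.map {V' : Type w} [AddCommGroup V'] [Module k V'] {N' U' : ℝ → Submodule k V'}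
    (f : V →ₗ[k] V') (hN : ∀ θ, N θ ≤ (N' θ).comap f) (hU : ∀ θ, U θ ≤ (U' θ).comap f) :
    Subq N U →ₗ[k] Subq N' U' where
  toFun s := ⟨fun θ => (N θ).mapQ (N' θ) f (hN θ) (s.1 θ), fun t => by
    obtain ⟨x, hx⟩ := s.2 t
    refine ⟨f x, ?_⟩
    filter_upwards [hx] with θ h1
    exact ⟨hU θ h1.1, by rw [← h1.2]; rfl⟩⟩
  map_add' s s' := Subtype.ext (funext fun θ => map_add _ _ _)
  map_smul' c s := Subtype.ext (funext fun θ => ((N θ).mapQ (N' θ) f (hN θ)).map_smul c (s.1 θ))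

end Subquotient

/-- A partition of the indices into classes, two factors being in the same class if and only if the
level of their difference is less than `M`, the largest level; `e` chooses representatives. -/
structure IsTopClasses {ι κ : Type} (D : ExpData ι) (M : ℝ) (q : ι → κ) (e : κ ↪ ι) : Prop where
  section_eq : ∀ c, q (e c) = c
  lt_iff : ∀ i j, i ≠ j → (q i = q j ↔ D.level i j < M)
  level_le : ∀ i j, i ≠ j → D.level i j ≤ M

section Classes

variable {k : Type v} [Field k] {V : Type w} [AddCommGroup V] [Module k V]
  {ι κ : Type} {D : ExpData ι} {M : ℝ} {q : ι → κ} {e : κ ↪ ι}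

namespace IsTopClasses

variable (h : IsTopClasses D M q e)
include h

lemma level_eq {i j : ι} (hij : q i ≠ q j) : D.level i j = M := by
  have hne : i ≠ j := fun e => hij (congrArg q e)
  exact le_antisymm (h.level_le i j hne) (not_lt.1 fun hlt => hij ((h.lt_iff i j hne).2 hlt))

lemma cos_congr_left {i i' j : ι} (hi : q i = q i') (hij : q i ≠ q j) (θ : ℝ) :
    Real.cos (D.angle i j - D.level i j * θ) = Real.cos (D.angle i' j - D.level i' j * θ) := by
  by_cases hii : i = i'
  · rw [hii]
  have hij' : q i' ≠ q j := hi ▸ hij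
  refine D.cos_eq i i' j hii (fun e => hij' (congrArg q e)) (fun e => hij (congrArg q e)) ?_ θ
  rw [h.level_eq hij']
  exact (h.lt_iff i i' hii).1 hi

lemma cos_congr {i i' j j' : ι} (hi : q i = q i') (hj : q j = q j') (hij : q i ≠ q j) (θ : ℝ) :
    Real.cos (D.angle i j - D.level i j * θ) = Real.cos (D.angle i' j' - D.level i' j' * θ) := by
  have hij' : q i' ≠ q j := hi ▸ hij
  have h1 : j ≠ i' := fun e => hij' (congrArg q e).symm
  have h2 : j' ≠ i' := fun e => hij' ((congrArg q e).symm.trans hj.symm)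
  have h3 := D.cos_anti j i' h1 θ
  have h4 := D.cos_anti j' i' h2 θ
  rw [h.cos_congr_left hi hij, h3, h4, h.cos_congr_left hj hij'.symm]

lemma lt_iff_of_ne {i j : ι} (hij : q i ≠ q j) (θ : ℝ) :
    D.lt θ i j ↔ (D.comap e).lt θ (q i) (q j) := by
  rw [D.comap_lt]
  have h1 := h.cos_congr (i' := e (q i)) (j' := e (q j)) (h.section_eq _).symm
    (h.section_eq _).symm hij θ
  have hne : i ≠ j := fun e => hij (congrArg q e)
  have hne' : e (q i) ≠ e (q j) := e.injective.ne hij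
  simp only [ExpData.lt, h1, hne, hne', ne_eq, not_false_eq_true, true_and]

lemma le_of_le {i j : ι} {θ : ℝ} (hij : D.le θ i j) : (D.comap e).le θ (q i) (q j) := by
  by_cases hq : q i = q j
  · exact Or.inl hq
  · rcases hij with rfl | hij
    · exact absurd rfl hq
    · exact Or.inr ((h.lt_iff_of_ne hq θ).1 hij)

end IsTopClasses

/-- The filtration by the classes of indices. -/
def coarse (D : ExpData ι) (q : ι → κ) (e : κ ↪ ι) (F : ℝ → ι → Submodule k V) (θ : ℝ) (c : κ) :
    Submodule k V := ⨆ (j) (_ : (D.comap e).le θ (q j) c), F θ j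

lemma IsTopClasses.isGradation_coarse (h : IsTopClasses D M q e) {F : ℝ → ι → Submodule k V}
    {G : ι → Submodule k V} {θ : ℝ} (hG : IsGradation (D.le θ) (F θ) G) :
    IsGradation ((D.comap e).le θ) (coarse D q e F θ) fun c => ⨆ (j) (_ : q j = c), G j := by
  refine ⟨⟨fun c => ?_, ?_⟩, fun c => ?_⟩
  · have : (⨆ (c') (_ : c' ≠ c), ⨆ (j) (_ : q j = c'), G j) = ⨆ (j) (_ : q j ≠ c), G j := by
      apply le_antisymm
      · exact iSup₂_le fun c' hc' => iSup₂_le fun j hj => le_iSup₂_of_le j (hj ▸ hc') le_rfl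
      · exact iSup₂_le fun j hj => le_iSup₂_of_le (q j) hj (le_iSup₂_of_le j rfl le_rfl)
    rw [this]
    exact hG.disjoint_biSup fun i hi hi' => hi' hi
  · rw [eq_top_iff, ← hG.iSup_eq_top]
    exact iSup_le fun j => le_iSup_of_le (q j) (le_iSup₂_of_le j rfl le_rfl)
  · rw [coarse, hG.biSup_filt (D.isPO θ)]
    · apply le_antisymm
      · exact iSup₂_le fun j hj => le_iSup₂_of_le (q j) hj (le_iSup₂_of_le j rfl le_rfl)
      · exact iSup₂_le fun c' hc' => iSup₂_le fun j hj => le_iSup₂_of_le j (hj ▸ hc') le_rfl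
    · intro i j hij hj
      exact ((D.comap e).isPO θ).trans _ _ _ (h.le_of_le hij) hj

/-- The part of the filtration by classes strictly below a class. -/
def coarseLT (D : ExpData ι) (q : ι → κ) (e : κ ↪ ι) (F : ℝ → ι → Submodule k V) (c : κ) (θ : ℝ) :
    Submodule k V := below ((D.comap e).le θ) (coarse D q e F θ) c

lemma IsTopClasses.coarseLT_eq (h : IsTopClasses D M q e) {F : ℝ → ι → Submodule k V}
    {G : ι → Submodule k V} {θ : ℝ} (hG : IsGradation (D.le θ) (F θ) G) (c : κ) :
    coarseLT D q e F c θ = ⨆ (j) (_ : (D.comap e).lt θ (q j) c), G j := by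
  rw [coarseLT, (h.isGradation_coarse hG).below_eq ((D.comap e).isPO θ)]
  simp only [ExpData.le_and_ne_iff]
  apply le_antisymm
  · exact iSup₂_le fun c' hc' => iSup₂_le fun j hj => le_iSup₂_of_le j (hj ▸ hc') le_rfl
  · exact iSup₂_le fun j hj => le_iSup₂_of_le (q j) hj (le_iSup₂_of_le j rfl le_rfl)

lemma IsTopClasses.coarse_eq (h : IsTopClasses D M q e) {F : ℝ → ι → Submodule k V}
    {G : ι → Submodule k V} {θ : ℝ} (hG : IsGradation (D.le θ) (F θ) G) (c : κ) :
    coarse D q e F θ c = ⨆ (j) (_ : (D.comap e).le θ (q j) c), G j :=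
  hG.biSup_filt (D.isPO θ) fun _ _ hij hj =>
    ((D.comap e).isPO θ).trans _ _ _ (h.le_of_le hij) hj

/-- The graded pieces of the filtration by classes form a local system over the real line, although
neither the steps of the filtration nor the steps strictly below them do. -/
lemma IsTopClasses.isLocSubq (h : IsTopClasses D M q e) {F : ℝ → ι → Submodule k V}
    (hF : LocGraded D F) (c : κ) :
    IsLocSubq (coarseLT D q e F c) (fun θ => coarse D q e F θ c) where
  compl t := by
    obtain ⟨G, hG⟩ := hF t
    refine ⟨⨆ (j) (_ : q j = c), G j, ?_⟩
    filter_upwards [hG] with θ hθ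
    have := h.isGradation_coarse hθ
    exact ⟨by rw [sup_comm]; exact (this.sup_below ((D.comap e).isPO θ) c).symm,
      this.disjoint_below ((D.comap e).isPO θ) c⟩
  mem_iff t x hx := by
    obtain ⟨G, hG⟩ := hF t
    have hG0 := hG.self_of_nhds
    have key : ∀ᶠ θ in 𝓝 t, (x ∈ coarseLT D q e F c θ ↔ ∀ j, q j = c → hG0.proj j x = 0) := by
      filter_upwards [hG, hx] with θ hθ hxθ
      rw [h.coarse_eq hθ, hG0.mem_biSup_iff] at hxθ
      rw [h.coarseLT_eq hθ, hG0.mem_biSup_iff]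
      constructor
      · intro h1 j hj
        exact h1 j (by rw [hj]; exact fun h => h.1 rfl)
      · intro h1 j hj
        by_cases hjc : q j = c
        · exact h1 j hjc
        · exact hxθ j fun h2 => hj (h2.resolve_left hjc)
    filter_upwards [key] with θ hθ
    rw [hθ, key.self_of_nhds]

/-- The filtration induced on the graded piece of a class. -/
def classFilt (D : ExpData ι) (q : ι → κ) (e : κ ↪ ι) (F : ℝ → ι → Submodule k V) (c : κ) (θ : ℝ)
    (i : {i // q i = c}) : Submodule k (Subq (coarseLT D q e F c) fun θ => coarse D q e F θ c) :=
  (((F θ i.1).map (coarseLT D q e F c θ).mkQ).comap (LinearMap.proj θ)).comap (Submodule.subtype _)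

lemma IsTopClasses.coarseLT_le (h : IsTopClasses D M q e) {F : ℝ → ι → Submodule k V}
    {G : ι → Submodule k V} {θ : ℝ} (hG : IsGradation (D.le θ) (F θ) G) (i : ι) :
    coarseLT D q e F (q i) θ ≤ below (D.le θ) (F θ) i := by
  rw [h.coarseLT_eq hG, hG.below_eq (D.isPO θ)]
  refine biSup_mono fun j hj => ?_
  rw [ExpData.le_and_ne_iff, h.lt_iff_of_ne hj.1]
  exact hj

lemma IsTopClasses.classFilt_eq (h : IsTopClasses D M q e) {F : ℝ → ι → Submodule k V}
    {G : ι → Submodule k V} {θ : ℝ} (hG : IsGradation (D.le θ) (F θ) G) {c : κ}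
    {ψ : Subq (coarseLT D q e F c) (fun θ => coarse D q e F θ c) →ₗ[k] V}
    (hψ : ∀ s, (coarseLT D q e F c θ).mkQ (ψ s) = s.1 θ) (i : {i // q i = c}) :
    classFilt D q e F c θ i = (F θ i.1).comap ψ := by
  obtain ⟨i, rfl⟩ := i
  have hle : coarseLT D q e F (q i) θ ≤ F θ i := by
    refine (h.coarseLT_le hG i).trans ?_
    rw [← hG.sup_below (D.isPO θ) i]
    exact le_sup_right
  ext s
  change s.1 θ ∈ (F θ i).map _ ↔ ψ s ∈ F θ i
  rw [← hψ]
  constructor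
  · rintro ⟨y, hy, hys⟩
    have : y - ψ s ∈ coarseLT D q e F (q i) θ := (Submodule.Quotient.eq _).1 hys
    have h2 := (F θ i).sub_mem hy (hle this)
    simpa using h2
  · intro hs
    exact ⟨_, hs, rfl⟩

lemma map_comap_eq_inf {W : Type*} [AddCommGroup W] [Module k W] (ψ : W →ₗ[k] V)
    (A : Submodule k V) : (A.comap ψ).map ψ = A ⊓ LinearMap.range ψ := by
  rw [Submodule.map_comap_eq, inf_comm]

/-- The filtration induced on the graded piece of a class is again locally graded, with respect to
the smaller family of factors; this is what makes the induction on the number of factors work. -/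
lemma IsTopClasses.locGraded_class [Fintype ι] (h : IsTopClasses D M q e)
    {F : ℝ → ι → Submodule k V} (hF : LocGraded D F) (c : κ) :
    LocGraded (D.comap (Function.Embedding.subtype fun i => q i = c)) (classFilt D q e F c) := by
  classical
  intro t
  obtain ⟨G, hG⟩ := hF t
  have hG0 := hG.self_of_nhds
  have hcompl : ∀ θ, IsGradation (D.le θ) (F θ) G → coarse D q e F θ c =
      coarseLT D q e F c θ ⊔ (⨆ (j) (_ : q j = c), G j) ∧
      Disjoint (⨆ (j) (_ : q j = c), G j) (coarseLT D q e F c θ) := fun θ hθ => by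
    have := h.isGradation_coarse hθ
    exact ⟨by rw [sup_comm]; exact (this.sup_below ((D.comap e).isPO θ) c).symm,
      this.disjoint_below ((D.comap e).isPO θ) c⟩
  obtain ⟨ψ, hinj, hr, -, hψ⟩ := (h.isLocSubq hF c).exists_model (hcompl t hG0).1 (hcompl t hG0).2
  have hψ := hψ (hG.mono fun θ hθ => hcompl θ hθ)
  refine ⟨fun i => (G i.1).comap ψ, ?_⟩
  have hmapG : ∀ i : {i // q i = c}, ((G i.1).comap ψ).map ψ = G i.1 := fun i => by
    rw [map_comap_eq_inf, hr]
    exact inf_eq_left.2 (le_iSup₂_of_le i.1 i.2 le_rfl)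
  filter_upwards [hG, hψ] with θ hθ hψθ
  refine ⟨⟨iSupIndep_of_sum_eq_zero fun x hx hs i => ?_, ?_⟩, fun i => ?_⟩
  · have h1 : ∑ j, ψ (x j) = 0 := by rw [← map_sum, hs, map_zero]
    have h2 := congrArg (hG0.proj i.1) h1
    rw [map_sum, map_zero, Finset.sum_eq_single i, hG0.proj_self (hx i)] at h2
    · exact hinj (h2.trans (map_zero ψ).symm)
    · intro j _ hji
      exact hG0.proj_of_ne (fun e => hji (Subtype.ext e.symm)) (hx j)
    · simp
  · apply Submodule.map_injective_of_injective hinj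
    rw [Submodule.map_iSup, Submodule.map_top, hr]
    simp_rw [hmapG]
    exact iSup_subtype
  · apply Submodule.map_injective_of_injective hinj
    rw [h.classFilt_eq hθ hψθ, map_comap_eq_inf, hr]
    simp only [Submodule.map_iSup, hmapG]
    apply le_antisymm
    · rintro x ⟨h1, h2⟩
      rw [SetLike.mem_coe, hθ.filt, hG0.mem_biSup_iff] at h1
      rw [SetLike.mem_coe, hG0.mem_biSup_iff] at h2
      have : x ∈ ⨆ (j) (_ : D.le θ j i.1 ∧ q j = c), G j := by
        rw [hG0.mem_biSup_iff]
        intro j hj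
        by_cases hjc : q j = c
        · exact h1 j fun h3 => hj ⟨h3, hjc⟩
        · exact h2 j hjc
      have hle : (⨆ (j) (_ : D.le θ j i.1 ∧ q j = c), G j) ≤
          ⨆ (j : {i // q i = c})
            (_ : (D.comap (Function.Embedding.subtype fun i => q i = c)).le θ j i), G j.1 :=
        iSup₂_le fun j hj =>
          le_iSup₂_of_le (⟨j, hj.2⟩ : {i // q i = c}) ((D.comap_le _).2 hj.1) le_rfl
      exact hle this
    · refine iSup₂_le fun j hj => le_inf ?_ (le_iSup₂_of_le j.1 j.2 le_rfl)
      rw [hθ.filt]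
      exact le_iSup₂_of_le j.1 ((D.comap_le _).1 hj) le_rfl

/-- The steps of the filtration and the sums of the smaller steps, in terms of a model of the graded
piece of a class. -/
lemma IsTopClasses.filt_eq_sup [Fintype ι] (h : IsTopClasses D M q e) {F : ℝ → ι → Submodule k V}
    {G : ι → Submodule k V} {θ : ℝ} (hG : IsGradation (D.le θ) (F θ) G) {c : κ}
    {ψ : Subq (coarseLT D q e F c) (fun θ => coarse D q e F θ c) →ₗ[k] V}
    (hψ : ∀ s, (coarseLT D q e F c θ).mkQ (ψ s) = s.1 θ)
    (hr : coarse D q e F θ c = coarseLT D q e F c θ ⊔ LinearMap.range ψ) (i : {i // q i = c}) :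
    F θ i.1 = coarseLT D q e F c θ ⊔ (classFilt D q e F c θ i).map ψ ∧
    below (D.le θ) (F θ) i.1 = coarseLT D q e F c θ ⊔
      (below ((D.comap (Function.Embedding.subtype fun i => q i = c)).le θ)
        (classFilt D q e F c θ) i).map ψ := by
  have hle : ∀ i : {i // q i = c}, coarseLT D q e F c θ ≤ below (D.le θ) (F θ) i.1 := by
    intro i
    have := h.coarseLT_le hG i.1
    rwa [i.2] at this
  have hle' : ∀ i : {i // q i = c}, coarseLT D q e F c θ ≤ F θ i.1 := fun i => by
    refine (hle i).trans ?_
    rw [← hG.sup_below (D.isPO θ) i.1]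
    exact le_sup_right
  have hmap : ∀ i : {i // q i = c}, (classFilt D q e F c θ i).map ψ ≤ F θ i.1 := fun i => by
    rw [h.classFilt_eq hG hψ]
    exact Submodule.map_comap_le _ _
  have key : ∀ i : {i // q i = c},
      F θ i.1 = coarseLT D q e F c θ ⊔ (classFilt D q e F c θ i).map ψ := by
    intro i
    refine le_antisymm (fun x hx => ?_) (sup_le (hle' i) (hmap i))
    have hxc : x ∈ coarse D q e F θ c := by
      have : F θ i.1 ≤ coarse D q e F θ c := le_iSup₂_of_le i.1 (Or.inl i.2) le_rfl
      exact this hx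
    rw [hr] at hxc
    obtain ⟨y, hy, _, ⟨s, rfl⟩, rfl⟩ := Submodule.mem_sup.1 hxc
    refine Submodule.add_mem_sup hy ⟨s, ?_, rfl⟩
    rw [h.classFilt_eq hG hψ, SetLike.mem_coe, Submodule.mem_comap]
    have := (F θ i.1).sub_mem hx (hle' i hy)
    simpa using this
  refine ⟨key i, le_antisymm ?_ (sup_le (hle i) ?_)⟩
  · refine iSup₂_le fun j hj => ?_
    by_cases hjc : q j = c
    · rw [key ⟨j, hjc⟩]
      refine sup_le_sup_left (Submodule.map_mono ?_) _
      exact le_iSup₂_of_le (⟨j, hjc⟩ : {i // q i = c})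
        ⟨(D.comap_le _).2 hj.1, fun e => hj.2 (congrArg Subtype.val e)⟩ le_rfl
    · refine le_sup_of_le_left ?_
      have hlt : D.lt θ j i.1 := ExpData.le_and_ne_iff D |>.1 hj
      have hji : q j ≠ q i.1 := fun h1 => hjc (h1.trans i.2)
      refine le_trans ?_ (le_iSup₂_of_le (q j) ⟨?_, hjc⟩ le_rfl)
      · exact le_iSup₂_of_le j (Or.inl rfl) le_rfl
      · have := (h.lt_iff_of_ne hji θ).1 hlt
        rw [i.2] at this
        exact Or.inr this
  · rw [below, Submodule.map_iSup]
    refine iSup_le fun j => ?_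
    rw [Submodule.map_iSup]
    refine iSup_le fun hj => (hmap j).trans ?_
    exact le_iSup₂_of_le j.1 ⟨(D.comap_le _).1 hj.1, fun e => hj.2 (Subtype.ext e)⟩ le_rfl

end Classes

/-- The classes exist because the levels satisfy the ultrametric inequality; each of them is proper
because the largest level is attained. -/
lemma exists_topClasses {ι : Type} [Fintype ι] [Nontrivial ι] (D : ExpData ι) :
    ∃ (M : ℝ) (κ : Type) (_ : Fintype κ) (q : ι → κ) (e : κ ↪ ι), 0 < M ∧
      IsTopClasses D M q e ∧ ∀ c, ∃ i, q i ≠ c := by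
  classical
  obtain ⟨i, j, hij⟩ := exists_pair_ne ι
  obtain ⟨⟨a, b⟩, hab, hmax⟩ := Finset.exists_max_image
    (Finset.univ.filter fun p : ι × ι => p.1 ≠ p.2) (fun p => D.level p.1 p.2)
    ⟨(i, j), by simpa using hij⟩
  simp only [Finset.mem_filter, Finset.mem_univ, true_and, Prod.forall] at hab hmax
  set M := D.level a b with hM
  let s : Setoid ι :=
    { r := fun i j => i = j ∨ D.level i j < M
      iseqv :=
        { refl := fun i => Or.inl rfl
          symm := fun {i j} h => by
            rcases h with h | h
            · exact Or.inl h.symm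
            · exact Or.inr (by rw [D.level_symm]; exact h)
          trans := fun {i j l} h h' => by
            by_cases hij : i = j
            · exact hij ▸ h'
            by_cases hjl : j = l
            · exact hjl ▸ h
            by_cases hil : i = l
            · exact Or.inl hil
            refine Or.inr ((D.ultra i j l hij hjl hil).trans_lt (max_lt ?_ ?_))
            · exact h.resolve_left hij
            · exact h'.resolve_left hjl } }
  have hq : ∀ i j, (Quotient.mk s i = Quotient.mk s j) ↔ (i = j ∨ D.level i j < M) :=
    fun i j => Quotient.eq
  refine ⟨M, Quotient s, inferInstance, Quotient.mk s, ⟨Quotient.out, Quotient.out_injective⟩,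
    D.level_pos a b hab, ⟨fun c => Quotient.out_eq c, fun i j hij => ?_, fun i j hij => ?_⟩, ?_⟩
  · rw [hq]
    simp [hij]
  · exact hmax i j hij
  · intro c
    by_contra! hall
    have : Quotient.mk s a = Quotient.mk s b := (hall a).trans (hall b).symm
    rcases (hq a b).1 this with h | h
    · exact hab h
    · exact lt_irrefl _ h

/-- A morphism between spaces with filtrations depending on a direction, which is compatible with
the filtrations in all directions, is diagonal for suitable gradations in a given direction.

The proof is by induction on the number of factors. The filtrations by the classes of the largest
level `M` have a canonical splitting in the directions of an interval of length `π / M`, and any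
morphism respects it. The pieces of the splitting represent the global sections of the graded pieces
of the classes, to which the induction hypothesis applies. -/
theorem exists_diagonal_gradation {k : Type v} [Field k] (n : ℕ) : ∀ {ι : Type} [Fintype ι]
    (D : ExpData ι), Fintype.card ι ≤ n → ∀ {V V' : Type w} [AddCommGroup V] [Module k V]
    [FiniteDimensional k V] [AddCommGroup V'] [Module k V'] [FiniteDimensional k V']
    {F : ℝ → ι → Submodule k V} {F' : ℝ → ι → Submodule k V'}, LocGraded D F → LocGraded D F' →
    ∀ f : V →ₗ[k] V', (∀ θ i, F θ i ≤ (F' θ i).comap f) → ∀ θ₀, ∃ G G',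
      IsGradation (D.le θ₀) (F θ₀) G ∧ IsGradation (D.le θ₀) (F' θ₀) G' ∧
      ∀ i, G i ≤ (G' i).comap f := by
  induction n with
  | zero =>
    intro ι _ D hn V V' _ _ _ _ _ _ F F' hF hF' f hf θ₀
    obtain ⟨G, hG⟩ := hF θ₀
    obtain ⟨G', hG'⟩ := hF' θ₀
    have : IsEmpty ι := Fintype.card_eq_zero_iff.1 (by omega)
    exact ⟨G, G', hG.self_of_nhds, hG'.self_of_nhds, fun i => isEmptyElim i⟩
  | succ n ih =>
    intro ι _ D hn V V' _ _ _ _ _ _ F F' hF hF' f hf θ₀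
    classical
    rcases subsingleton_or_nontrivial ι with hι | hι
    · obtain ⟨G, hG⟩ := hF θ₀
      obtain ⟨G', hG'⟩ := hF' θ₀
      refine ⟨G, G', hG.self_of_nhds, hG'.self_of_nhds, fun i => ?_⟩
      have : G' i = ⊤ := by
        rw [eq_top_iff, ← hG'.self_of_nhds.iSup_eq_top]
        exact iSup_le fun j => by rw [Subsingleton.elim j i]
      rw [this, Submodule.comap_top]
      exact le_top
    obtain ⟨M, κ, _, q, e, hM, hq, hqc⟩ := exists_topClasses D
    obtain ⟨a, ha, hgen⟩ := exists_generic (D.comap e)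
      (show θ₀ - Real.pi / M < θ₀ by have := div_pos Real.pi_pos hM; linarith)
    have hlev : ∀ c c', c ≠ c' → (D.comap e).level c c' = M := fun c c' hcc =>
      hq.level_eq (by rw [hq.section_eq, hq.section_eq]; exact hcc)
    -- the endpoints of the interval are generic, and it contains the given direction
    have hθ : θ₀ ∈ Ioo a (a + Real.pi / M) := ⟨ha.2, by linarith [ha.1]⟩
    -- the canonical splittings of the filtrations by the classes
    have hC : LocGraded (D.comap e) (coarse D q e F) := fun t => by
      obtain ⟨G, hG⟩ := hF t
      exact ⟨_, hG.mono fun θ hθ => hq.isGradation_coarse hθ⟩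
    have hC' : LocGraded (D.comap e) (coarse D q e F') := fun t => by
      obtain ⟨G, hG⟩ := hF' t
      exact ⟨_, hG.mono fun θ hθ => hq.isGradation_coarse hθ⟩
    have hH := hC.isGradation_inf hM hlev hgen hθ
    have hH' := hC'.isGradation_inf hM hlev hgen hθ
    have hfC : ∀ θ c, coarse D q e F θ c ≤ (coarse D q e F' θ c).comap f := fun θ c =>
      iSup₂_le fun j hj x hx => (le_iSup₂_of_le j hj le_rfl : F' θ j ≤ _) (hf θ j hx)
    have hfN : ∀ c θ, coarseLT D q e F c θ ≤ (coarseLT D q e F' c θ).comap f := fun c θ =>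
      iSup₂_le fun j hj x hx =>
        (le_iSup₂_of_le j hj le_rfl : coarse D q e F' θ j ≤ _) (hfC θ j hx)
    have hPO := (D.comap e).isPO θ₀
    -- the diagonalisation of the morphism induced on the graded piece of each class
    have hstep : ∀ c, ∃ (G : {i // q i = c} → Submodule k V) (G' : {i // q i = c} → Submodule k V'),
        (∀ i, F θ₀ i.1 = G i ⊔ below (D.le θ₀) (F θ₀) i.1 ∧
          Disjoint (G i) (below (D.le θ₀) (F θ₀) i.1)) ∧
        (∀ i, F' θ₀ i.1 = G' i ⊔ below (D.le θ₀) (F' θ₀) i.1 ∧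
          Disjoint (G' i) (below (D.le θ₀) (F' θ₀) i.1)) ∧
        ∀ i, G i ≤ (G' i).comap f := by
      intro c
      obtain ⟨ψ, hinj, hr, hψ, -⟩ := (hq.isLocSubq hF c).exists_model (t := θ₀)
        (by rw [sup_comm]; exact (hH.sup_below hPO c).symm) (hH.disjoint_below hPO c)
      obtain ⟨ψ', hinj', hr', hψ', -⟩ := (hq.isLocSubq hF' c).exists_model (t := θ₀)
        (by rw [sup_comm]; exact (hH'.sup_below hPO c).symm) (hH'.disjoint_below hPO c)
      obtain ⟨G₀, hG₀⟩ := hF θ₀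
      obtain ⟨G₀', hG₀'⟩ := hF' θ₀
      have hfin : FiniteDimensional k
          (Subq (coarseLT D q e F c) fun θ => coarse D q e F θ c) :=
        FiniteDimensional.of_injective ψ hinj
      have hfin' : FiniteDimensional k
          (Subq (coarseLT D q e F' c) fun θ => coarse D q e F' θ c) :=
        FiniteDimensional.of_injective ψ' hinj'
      set g := Subq.map f (hfN c) (fun θ => hfC θ c) with hg
      have hcard : Fintype.card {i // q i = c} ≤ n := by
        obtain ⟨i, hi⟩ := hqc c
        have := Fintype.card_subtype_lt (p := fun i => q i = c) hi
        omega
      obtain ⟨Γ, Γ', hΓ, hΓ', hgΓ⟩ := ih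
        (D.comap (Function.Embedding.subtype fun i => q i = c)) hcard
        (hq.locGraded_class hF c) (hq.locGraded_class hF' c) g (by
          rintro θ i s ⟨x, hx, hxs⟩
          exact ⟨f x, hf θ i.1 hx, congrArg ((coarseLT D q e F c θ).mapQ _ f (hfN c θ)) hxs⟩) θ₀
      -- the canonical splittings are respected by `f`, so `f` is the induced morphism on the pieces
      have hfψ : ∀ s, f (ψ s) = ψ' (g s) := by
        intro s
        have h1 : ψ s ∈ coarse D q e F a c ⊓ coarse D q e F (a + Real.pi / M) c := by
          rw [← hr]; exact ⟨s, rfl⟩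
        have h2 : ψ' (g s) ∈ coarse D q e F' a c ⊓ coarse D q e F' (a + Real.pi / M) c := by
          rw [← hr']; exact ⟨g s, rfl⟩
        have h3 : f (ψ s) - ψ' (g s) ∈ coarseLT D q e F' c θ₀ := by
          rw [← Submodule.Quotient.eq, ← Submodule.mkQ_apply, ← Submodule.mkQ_apply, hψ']
          exact congrArg ((coarseLT D q e F c θ₀).mapQ _ f (hfN c θ₀)) (hψ s)
        refine sub_eq_zero.1 ((Submodule.disjoint_def.1 (hH'.disjoint_below hPO c)) _ ?_ h3)
        exact Submodule.sub_mem _ ⟨hfC _ _ h1.1, hfC _ _ h1.2⟩ h2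
      -- gradations of the piece of a class yield complements of the steps strictly below
      have hlift : ∀ {V : Type w} [AddCommGroup V] [Module k V] [FiniteDimensional k V]
          {F : ℝ → ι → Submodule k V}
          {G₀ : ι → Submodule k V} (_ : IsGradation (D.le θ₀) (F θ₀) G₀)
          {ψ : Subq (coarseLT D q e F c) (fun θ => coarse D q e F θ c) →ₗ[k] V}
          (_ : Function.Injective ψ)
          (_ : coarse D q e F θ₀ c = coarseLT D q e F c θ₀ ⊔ LinearMap.range ψ)
          (_ : Disjoint (LinearMap.range ψ) (coarseLT D q e F c θ₀))
          (_ : ∀ s, (coarseLT D q e F c θ₀).mkQ (ψ s) = s.1 θ₀) {Γ}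
          (_ : IsGradation ((D.comap (Function.Embedding.subtype fun i => q i = c)).le θ₀)
            (classFilt D q e F c θ₀) Γ) (i : {i // q i = c}),
          F θ₀ i.1 = (Γ i).map ψ ⊔ below (D.le θ₀) (F θ₀) i.1 ∧
          Disjoint ((Γ i).map ψ) (below (D.le θ₀) (F θ₀) i.1) := by
        intro V _ _ _ F G₀ hG₀ ψ hinj hr hd hψ Γ hΓ i
        have hPO' := (D.comap (Function.Embedding.subtype fun i => q i = c)).isPO θ₀
        obtain ⟨h1, h2⟩ := hq.filt_eq_sup hG₀ hψ hr i
        constructor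
        · rw [h1, h2, ← hΓ.sup_below hPO' i, Submodule.map_sup]
          exact sup_left_comm _ _ _
        · rw [h2, Submodule.disjoint_def]
          rintro _ ⟨s, hs, rfl⟩ hx
          obtain ⟨y, hy, _, ⟨s', hs', rfl⟩, hys⟩ := Submodule.mem_sup.1 hx
          have h3 : y = 0 := by
            refine (Submodule.disjoint_def.1 hd) y ⟨s - s', ?_⟩ hy
            rw [map_sub, ← hys]
            abel
          rw [h3, zero_add] at hys
          rw [(Submodule.disjoint_def.1 (hΓ.disjoint_below hPO' i)) s hs (hinj hys ▸ hs'), map_zero]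
      refine ⟨fun i => (Γ i).map ψ, fun i => (Γ' i).map ψ', ?_, ?_, ?_⟩
      · refine hlift hG₀.self_of_nhds hinj ?_ ?_ hψ hΓ
        · rw [hr, sup_comm]
          exact (hH.sup_below hPO c).symm
        · rw [hr]
          exact hH.disjoint_below hPO c
      · refine hlift hG₀'.self_of_nhds hinj' ?_ ?_ hψ' hΓ'
        · rw [hr', sup_comm]
          exact (hH'.sup_below hPO c).symm
        · rw [hr']
          exact hH'.disjoint_below hPO c
      · rintro i _ ⟨s, hs, rfl⟩
        exact ⟨g s, hgΓ i hs, (hfψ s).symm⟩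
    choose G G' h1 h2 h3 using hstep
    obtain ⟨G₀, hG₀⟩ := hF θ₀
    obtain ⟨G₀', hG₀'⟩ := hF' θ₀
    refine ⟨fun i => G (q i) ⟨i, rfl⟩, fun i => G' (q i) ⟨i, rfl⟩, ?_, ?_, fun i => h3 _ _⟩
    · exact hG₀.self_of_nhds.of_isCompl (D.isPO θ₀) (fun i => (h1 (q i) ⟨i, rfl⟩).1)
        fun i => (h1 (q i) ⟨i, rfl⟩).2
    · exact hG₀'.self_of_nhds.of_isCompl (D.isPO θ₀) (fun i => (h2 (q i) ⟨i, rfl⟩).1)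
        fun i => (h2 (q i) ⟨i, rfl⟩).2

/-! ### Neighbourhoods of the boundary points of the real blow-up -/

section Charts

variable {n : ℕ} {X : Type u} [TopologicalSpace X] [ChartedSpace (Fin n → ℂ) X] {J : Type t}
  {D : J → Set X}

namespace AdaptedChart

variable {x : X} (c : AdaptedChart n D x)

lemma zero_mem_target : (0 : Fin n → ℂ) ∈ c.chart.target :=
  c.map_base ▸ c.chart.map_source c.mem_source

lemma symm_zero : c.chart.symm 0 = x := by
  rw [← c.map_base, c.chart.left_inv c.mem_source]

lemma tendsto_chart : Tendsto c.chart (𝓝 x) (𝓝 0) := by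
  have := c.chart.continuousAt c.mem_source
  rwa [ContinuousAt, c.map_base] at this

lemma tendsto_symm : Tendsto c.chart.symm (𝓝 0) (𝓝 x) := by
  have := c.chart.continuousAt_symm c.zero_mem_target
  rwa [ContinuousAt, c.symm_zero] at this

lemma source_mem : c.chart.source ∈ 𝓝 x := c.chart.open_source.mem_nhds c.mem_source

lemma target_mem : c.chart.target ∈ 𝓝 (0 : Fin n → ℂ) :=
  c.chart.open_target.mem_nhds c.zero_mem_target

lemma contMDiffOn_coord (i : Fin n) :
    ContMDiffOn 𝓘(ℂ, Fin n → ℂ) 𝓘(ℂ, ℂ) ω (fun z => c.chart z i) c.chart.source :=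
  ((ContinuousLinearMap.proj (R := ℂ) (φ := fun _ : Fin n => ℂ) i).contMDiff.comp_contMDiffOn
    (contMDiffOn_of_mem_maximalAtlas c.chart_mem) :)

lemma analyticAt_comp_symm {f : X → ℂ} (hf : ContMDiffAt 𝓘(ℂ, Fin n → ℂ) 𝓘(ℂ, ℂ) ω f x) :
    AnalyticAt ℂ (f ∘ c.chart.symm) 0 := by
  have h1 := contMDiffAt_symm_of_mem_maximalAtlas c.chart_mem c.zero_mem_target
  rw [← c.symm_zero] at hf
  exact (ContMDiffAt.comp (0 : Fin n → ℂ) hf h1).contDiffAt.analyticAt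

lemma mfderiv_coord_ne (i : Fin n) {z : X} (hz : z ∈ c.chart.source) :
    mfderiv 𝓘(ℂ, Fin n → ℂ) 𝓘(ℂ, ℂ) (fun z => c.chart z i) z ≠ 0 := by
  intro h0
  have hw := c.chart.map_source hz
  have hzw := c.chart.left_inv hz
  have h1 : MDifferentiableAt 𝓘(ℂ, Fin n → ℂ) 𝓘(ℂ, Fin n → ℂ) c.chart.symm (c.chart z) :=
    (contMDiffAt_symm_of_mem_maximalAtlas c.chart_mem hw).mdifferentiableAt (by simp)
  have h2 : MDifferentiableAt 𝓘(ℂ, Fin n → ℂ) 𝓘(ℂ, ℂ) (fun z => c.chart z i)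
      (c.chart.symm (c.chart z)) := by
    rw [hzw]
    exact ((c.contMDiffOn_coord i).contMDiffAt
      (c.chart.open_source.mem_nhds hz)).mdifferentiableAt (by simp)
  have h3 := mfderiv_comp (c.chart z) h2 h1
  rw [hzw, h0] at h3
  have h4 : ((fun z => c.chart z i) ∘ c.chart.symm) =ᶠ[𝓝 (c.chart z)]
      (ContinuousLinearMap.proj (R := ℂ) (φ := fun _ : Fin n => ℂ) i) := by
    filter_upwards [c.chart.open_target.mem_nhds hw] with w hw
    simp [c.chart.right_inv hw]
  rw [h4.mfderiv_eq, mfderiv_eq_fderiv, ContinuousLinearMap.fderiv] at h3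
  have h5 := congrArg (fun L : (Fin n → ℂ) →L[ℂ] ℂ => L (Pi.single i 1)) h3
  simp at h5
  exact one_ne_zero (α := ℂ) (h5.trans rfl)

/-- The coordinate functions defining the members of the family through the base point. -/
lemma isLocalEquation (j : {j : J // x ∈ D j}) :
    IsLocalEquation n (D j.1) c.chart.source (fun z => c.chart z (c.idx j)) where
  isOpen := c.chart.open_source
  holomorphic := c.contMDiffOn_coord _
  mem_iff := c.mem_iff j
  deriv_ne _ hz _ := c.mfderiv_coord_ne _ hz

/-- The coordinate function `c.idx j`, as a local equation of `D j`. -/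
def coordEq (j : {j : J // x ∈ D j}) : EquationAt n (D j.1) x :=
  ⟨fun z => c.chart z (c.idx j), c.chart.source, c.mem_source, c.isLocalEquation j⟩

/-- Two local equations differ by a factor which is continuous and does not vanish at the base
point. -/
lemma exists_ratio (j : {j : J // x ∈ D j}) (f : EquationAt n (D j.1) x) :
    ∃ a : X → ℂ, ContinuousAt a x ∧ a x ≠ 0 ∧ ∀ᶠ z in 𝓝 x, f.1 z = a z * c.chart z (c.idx j) := by
  classical
  obtain ⟨f, U, hxU, hf⟩ := f
  set i := c.idx j with hi
  have hfx := hf.holomorphic.contMDiffAt (hf.isOpen.mem_nhds hxU)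
  have han := c.analyticAt_comp_symm hfx
  set h := f ∘ c.chart.symm with hh
  have hstrict := han.hasStrictFDerivAt
  set h' := fderiv ℂ h 0 with hh'
  -- the equation vanishes on the coordinate hyperplane
  have hvan : ∀ᶠ w in 𝓝 (0 : Fin n → ℂ), w i = 0 → h w = 0 := by
    filter_upwards [c.target_mem, c.tendsto_symm (hf.isOpen.mem_nhds hxU)] with w hw hwU hwi
    refine (hf.mem_iff _ hwU).1 ((c.mem_iff j _ (c.chart.map_target hw)).2 ?_)
    rw [c.chart.right_inv hw]; exact hwi
  have hbase : c.chart x i = 0 := by rw [c.map_base]; rfl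
  refine ⟨fun z => if c.chart z i = 0 then h' (Pi.single i 1) else f z / c.chart z i, ?_, ?_, ?_⟩
  · rw [ContinuousAt, if_pos hbase, Metric.tendsto_nhds]
    intro ε hε
    have h1 := hstrict.isLittleO.def (half_pos hε)
    have hT : Tendsto (fun z => (c.chart z, Function.update (c.chart z) i 0)) (𝓝 x)
        (𝓝 ((0 : Fin n → ℂ), (0 : Fin n → ℂ))) := by
      rw [nhds_prod_eq]
      refine c.tendsto_chart.prodMk ?_
      have : Tendsto (fun w : Fin n → ℂ => Function.update w i 0) (𝓝 0)
          (𝓝 (Function.update (0 : Fin n → ℂ) i 0)) :=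
        (continuous_id.update i continuous_const).tendsto _
      rw [show Function.update (0 : Fin n → ℂ) i 0 = 0 from Function.update_eq_self i 0] at this
      exact this.comp c.tendsto_chart
    have hT2 : Tendsto (fun z => Function.update (c.chart z) i 0) (𝓝 x) (𝓝 (0 : Fin n → ℂ)) :=
      (continuous_snd.tendsto _).comp hT
    filter_upwards [hT.eventually h1, hT2.eventually hvan, c.source_mem] with z hz1 hz2 hz3
    by_cases hzi : c.chart z i = 0
    · rw [if_pos hzi, dist_self]; exact hε
    · rw [if_neg hzi]
      have hsub : c.chart z - Function.update (c.chart z) i 0 = Pi.single i (c.chart z i) := by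
        ext l
        by_cases hl : l = i
        · subst hl; simp
        · simp [hl]
      have hh0 : h (Function.update (c.chart z) i 0) = 0 := hz2 (by simp)
      have hhz : h (c.chart z) = f z := by rw [hh, Function.comp_apply, c.chart.left_inv hz3]
      have hsm : (Pi.single i (c.chart z i) : Fin n → ℂ)
          = c.chart z i • (Pi.single i (1 : ℂ) : Fin n → ℂ) := by
        rw [← Pi.single_smul, smul_eq_mul, mul_one]
      simp only [hsub, hh0, hhz, sub_zero] at hz1
      rw [hsm, map_smul, norm_smul, smul_eq_mul] at hz1
      have hn1 : ‖(Pi.single i (1 : ℂ) : Fin n → ℂ)‖ = 1 := by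
        rw [Pi.norm_single, norm_one]
      rw [hn1, mul_one] at hz1
      rw [dist_eq_norm]
      have hpos : 0 < ‖c.chart z i‖ := norm_pos_iff.2 hzi
      have : f z / c.chart z i - h' (Pi.single i 1)
          = (f z - c.chart z i * h' (Pi.single i 1)) / c.chart z i := by
        field_simp
      rw [this, norm_div, div_lt_iff₀ hpos]
      exact hz1.trans_lt (mul_lt_mul_of_pos_right (half_lt_self hε) hpos)
  · simp only [if_pos hbase]
    intro h0
    -- the derivative vanishes along the hyperplane, hence it would vanish
    have hk : ∀ l, l ≠ i → h' (Pi.single l 1) = 0 := by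
      intro l hl
      have hd : HasDerivAt (fun t : ℂ => h (t • (Pi.single l (1 : ℂ) : Fin n → ℂ)))
          (h' (Pi.single l 1)) 0 := by
        have h1 : HasDerivAt (fun t : ℂ => t • (Pi.single l (1 : ℂ) : Fin n → ℂ))
            (Pi.single l 1) 0 := by
          simpa using (hasDerivAt_id (0 : ℂ)).smul_const (Pi.single l (1 : ℂ) : Fin n → ℂ)
        have h2 : HasFDerivAt h h' ((0 : ℂ) • (Pi.single l (1 : ℂ) : Fin n → ℂ)) := by
          rw [zero_smul]; exact hstrict.hasFDerivAt
        exact h2.comp_hasDerivAt (0 : ℂ) h1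
      have hz : (fun t : ℂ => h (t • (Pi.single l (1 : ℂ) : Fin n → ℂ))) =ᶠ[𝓝 0] fun _ => 0 := by
        have hT : Tendsto (fun t : ℂ => t • (Pi.single l (1 : ℂ) : Fin n → ℂ)) (𝓝 0) (𝓝 0) := by
          have : Continuous (fun t : ℂ => t • (Pi.single l (1 : ℂ) : Fin n → ℂ)) := by fun_prop
          simpa using this.tendsto 0
        filter_upwards [hT.eventually hvan] with t ht
        exact ht (by simp [Ne.symm hl])
      exact hd.unique ((hasDerivAt_const (0 : ℂ) (0 : ℂ)).congr_of_eventuallyEq hz)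
    have hh'0 : h' = 0 := by
      ext v
      rw [pi_eq_sum_univ v, map_sum]
      refine Finset.sum_eq_zero fun l _ => ?_
      have : (fun j => if l = j then (1 : ℂ) else 0) = Pi.single l 1 := by
        ext j
        simp [Pi.single_apply, eq_comm]
      rw [this, map_smul]
      by_cases hl : l = i
      · rw [hl, h0, smul_zero]
      · rw [hk l hl, smul_zero]
    have hfz : f x = 0 := (hf.mem_iff x hxU).1 j.2
    refine hf.deriv_ne x hxU j.2 ?_
    have heq : f =ᶠ[𝓝 x] h ∘ c.chart := by
      filter_upwards [c.source_mem] with z hz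
      rw [hh, Function.comp_apply, Function.comp_apply, c.chart.left_inv hz]
    rw [heq.mfderiv_eq]
    have h1 : MDifferentiableAt 𝓘(ℂ, Fin n → ℂ) 𝓘(ℂ, Fin n → ℂ) c.chart x :=
      (contMDiffAt_of_mem_maximalAtlas c.chart_mem c.mem_source).mdifferentiableAt (by simp)
    have h2 : MDifferentiableAt 𝓘(ℂ, Fin n → ℂ) 𝓘(ℂ, ℂ) h (c.chart x) := by
      rw [c.map_base]
      exact han.differentiableAt.mdifferentiableAt
    rw [mfderiv_comp x h2 h1, c.map_base, mfderiv_eq_fderiv, ← hh', hh'0]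
    ext v
    rfl
  · filter_upwards [hf.isOpen.mem_nhds hxU, c.source_mem] with z hzU hzs
    by_cases hzi : c.chart z i = 0
    · rw [if_pos hzi, hzi, mul_zero]
      exact (hf.mem_iff z hzU).1 ((c.mem_iff j z hzs).2 hzi)
    · rw [if_neg hzi]
      field_simp

end AdaptedChart

end Charts

section Blowup

variable {n : ℕ} {X : Type u} [TopologicalSpace X] [ChartedSpace (Fin n → ℂ) X] {J : Type t}
  {D : J → Set X}

lemma isEmbedding_coe_circle : IsEmbedding (fun p : Circle => (p : ℂ)) :=
  IsEmbedding.subtypeVal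

lemma continuous_coe_circle : Continuous (fun p : Circle => (p : ℂ)) :=
  isEmbedding_coe_circle.continuous

/-- The point of the real blow-up over a point outside of the divisor. -/
def RealBlowup.interiorPoint (z : X) (hz : ∀ j, z ∉ D j) : RealBlowup n D where
  pt := z
  phase j f := ⟨f.1 z / ‖f.1 z‖, by
    obtain ⟨f, U, hzU, hf⟩ := f
    have h0 : f z ≠ 0 := fun h => hz j ((hf.mem_iff z hzU).2 h)
    refine mem_sphere_zero_iff_norm.2 ?_
    rw [norm_div, Complex.norm_real, norm_norm, div_self (norm_ne_zero_iff.2 h0)]⟩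
  phase_of_ne j f := by
    obtain ⟨f, U, hzU, hf⟩ := f
    have h0 : f z ≠ 0 := fun h => hz j ((hf.mem_iff z hzU).2 h)
    have : (‖f z‖ : ℂ) ≠ 0 := by simpa using h0
    simp only
    field_simp
  phase_mul j f g a _ hfg := by
    obtain ⟨f, U, hzU, hf⟩ := f
    obtain ⟨g, U', hzU', hg⟩ := g
    have h0 : g z ≠ 0 := fun h => hz j ((hg.mem_iff z hzU').2 h)
    have h1 : f z ≠ 0 := fun h => hz j ((hf.mem_iff z hzU).2 h)
    have h2 : f z = a z * g z := hfg.self_of_nhds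
    have h3 : (‖g z‖ : ℂ) ≠ 0 := by simpa using h0
    have h4 : (‖a z‖ : ℂ) ≠ 0 := by
      rw [h2] at h1
      simpa using (mul_ne_zero_iff.1 h1).1
    simp only [h2, norm_mul, Complex.ofReal_mul]
    field_simp

lemma RealBlowup.eventually_phase_mem (y : RealBlowup n D) {j : J} {U : Set X} {f : X → ℂ}
    (hf : IsLocalEquation n (D j) U f) (hy : y.pt ∈ U) {W : Set Circle} (hW : IsOpen W)
    (hyW : y.phase j ⟨f, U, hy, hf⟩ ∈ W) :
    ∀ᶠ p : RealBlowup n D in 𝓝 y, ∃ hp : p.pt ∈ U, p.phase j ⟨f, U, hp, hf⟩ ∈ W :=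
  IsOpen.mem_nhds (TopologicalSpace.isOpen_generateFrom_of_mem
    (Or.inr ⟨j, U, f, hf, W, hW, rfl⟩)) ⟨hy, hyW⟩

lemma RealBlowup.continuous_pt : Continuous (RealBlowup.pt : RealBlowup n D → X) :=
  continuous_def.2 fun V hV =>
    TopologicalSpace.isOpen_generateFrom_of_mem (Or.inl ⟨V, hV, rfl⟩)

/-- The phase at a boundary point of the coordinate `c.idx j`. -/
def coordPhase (y : Boundary n D) (c : AdaptedChart n D y.1.pt) (j : {j : J // y.1.pt ∈ D j}) : ℂ :=
  (y.1.phase j.1 (c.coordEq j) : ℂ)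

lemma norm_coordPhase (y : Boundary n D) (c : AdaptedChart n D y.1.pt)
    (j : {j : J // y.1.pt ∈ D j}) : ‖coordPhase y c j‖ = 1 := Circle.norm_coe _

/-- The traces on the complement of the divisor of the neighbourhoods of a boundary point, in terms
of a system of coordinates: the phases of the coordinates defining the divisor are prescribed. -/
lemma nearFilter_eq (y : Boundary n D) (c : AdaptedChart n D y.1.pt) :
    nearFilter y = 𝓝 y.1.pt ⊓ ⨅ j : {j : J // y.1.pt ∈ D j},
      comap (fun z => c.chart z (c.idx j) / ‖c.chart z (c.idx j)‖) (𝓝 (coordPhase y c j)) := by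
  classical
  apply le_antisymm
  · refine le_inf ?_ (le_iInf fun j => ?_)
    · exact (RealBlowup.continuous_pt.tendsto y.1).mono_left nhdsWithin_le_nhds
    · rw [nearFilter, ← tendsto_iff_comap, tendsto_map'_iff, tendsto_def]
      intro W hW
      obtain ⟨W', hW'W, hW', hyW'⟩ := mem_nhds_iff.1 hW
      have h1 := RealBlowup.eventually_phase_mem y.1 (c.isLocalEquation j) c.mem_source
        (W := (fun p : Circle => (p : ℂ)) ⁻¹' W') (hW'.preimage continuous_coe_circle) hyW'
      filter_upwards [nhdsWithin_le_nhds h1, self_mem_nhdsWithin] with p ⟨hp, hpW⟩ hpi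
      refine hW'W ?_
      have h2 := p.phase_of_ne j.1 ⟨_, _, hp, c.isLocalEquation j⟩
      simp only at h2
      have h3 : c.chart p.pt (c.idx j) ≠ 0 := fun h => hpi j.1 ((c.mem_iff j _ hp).2 h)
      have h4 : (‖c.chart p.pt (c.idx j)‖ : ℂ) ≠ 0 := by simpa using h3
      have h5 : c.chart p.pt (c.idx j) / ‖c.chart p.pt (c.idx j)‖
          = (p.phase j.1 ⟨_, _, hp, c.isLocalEquation j⟩ : ℂ) := by
        rw [div_eq_iff h4, mul_comm]; exact h2
      simp only [Function.comp_apply, h5]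
      exact hpW
  · set Φ := 𝓝 y.1.pt ⊓ ⨅ j : {j : J // y.1.pt ∈ D j},
      comap (fun z => c.chart z (c.idx j) / ‖c.chart z (c.idx j)‖) (𝓝 (coordPhase y c j)) with hΦ
    have hΦ1 : Φ ≤ 𝓝 y.1.pt := inf_le_left
    have hΦ2 : ∀ j : {j : J // y.1.pt ∈ D j},
        Tendsto (fun z => c.chart z (c.idx j) / ‖c.chart z (c.idx j)‖) Φ
          (𝓝 (coordPhase y c j)) := fun j =>
      tendsto_iff_comap.2 (inf_le_right.trans (iInf_le _ j))
    -- the divisor is avoided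
    have hfin : Finite {j : J // y.1.pt ∈ D j} := Finite.of_injective _ c.idx.injective
    have hint : ∀ᶠ z in Φ, ∀ j, z ∉ D j := by
      have h1 : ∀ᶠ z in Φ, ∀ j : {j : J // y.1.pt ∈ D j}, c.chart z (c.idx j) ≠ 0 := by
        rw [eventually_all]
        intro j
        have h2 : coordPhase y c j ≠ 0 := by
          rw [← norm_ne_zero_iff, norm_coordPhase]; exact one_ne_zero
        filter_upwards [(hΦ2 j).eventually_ne h2] with z hz h0
        rw [h0, zero_div] at hz
        exact hz rfl
      filter_upwards [h1, hΦ1 c.source_mem] with z hz hzs j hj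
      by_cases hyj : y.1.pt ∈ D j
      · exact hz ⟨j, hyj⟩ ((c.mem_iff ⟨j, hyj⟩ z hzs).1 hj)
      · exact c.notMem j hyj z hzs hj
    -- the points close to `y` lift to the real blow-up, and their lifts tend to `y`
    set lift : X → RealBlowup n D := fun z =>
      if hz : ∀ j, z ∉ D j then RealBlowup.interiorPoint z hz else y.1 with hlift
    have hlift' : ∀ᶠ z in Φ, ∃ hz : ∀ j, z ∉ D j, lift z = RealBlowup.interiorPoint z hz := by
      filter_upwards [hint] with z hz
      exact ⟨hz, by rw [hlift]; simp only [dif_pos hz]⟩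
    have hT : Tendsto lift Φ (𝓝 y.1) := by
      rw [TopologicalSpace.tendsto_nhds_generateFrom_iff]
      rintro S (⟨V, hV, rfl⟩ | ⟨j, U, f, hf, W, hW, rfl⟩) hyS
      · filter_upwards [hΦ1 (hV.mem_nhds hyS), hlift'] with z hz ⟨hz', hl⟩
        rw [mem_preimage, hl]
        exact hz
      · obtain ⟨hyU, hyW⟩ := hyS
        have hcont : ContinuousAt f y.1.pt :=
          (hf.holomorphic.contMDiffAt (hf.isOpen.mem_nhds hyU)).continuousAt
        have hlim : Tendsto (fun z => f z / ‖f z‖) Φ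
            (𝓝 (y.1.phase j ⟨f, U, hyU, hf⟩ : ℂ)) := by
          by_cases hyj : y.1.pt ∈ D j
          · obtain ⟨a, ha, ha0, hfa⟩ := c.exists_ratio ⟨j, hyj⟩ ⟨f, U, hyU, hf⟩
            have h1 := y.1.phase_mul j ⟨f, U, hyU, hf⟩ (c.coordEq ⟨j, hyj⟩) a ha hfa
            have h2 : Tendsto (fun z => a z / ‖a z‖) Φ (𝓝 (a y.1.pt / ‖a y.1.pt‖)) := by
              have h3 : ContinuousAt (fun z => a z / (‖a z‖ : ℂ)) y.1.pt := by
                refine ContinuousAt.div ha ?_ (by simpa using ha0)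
                exact Complex.continuous_ofReal.continuousAt.comp ha.norm
              exact h3.tendsto.mono_left hΦ1
            have h4 := h2.mul (hΦ2 ⟨j, hyj⟩)
            have h5 : a y.1.pt / ‖a y.1.pt‖ * coordPhase y c ⟨j, hyj⟩
                = (y.1.phase j ⟨f, U, hyU, hf⟩ : ℂ) := by
              have : (‖a y.1.pt‖ : ℂ) ≠ 0 := by simpa using ha0
              rw [div_mul_eq_mul_div, div_eq_iff this, mul_comm _ (‖a y.1.pt‖ : ℂ), h1]
              rfl
            rw [h5] at h4
            refine h4.congr' ?_
            filter_upwards [hΦ1 hfa] with z hz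
            rw [hz, norm_mul, Complex.ofReal_mul, div_mul_div_comm]
          · have h0 : f y.1.pt ≠ 0 := fun h => hyj ((hf.mem_iff _ hyU).2 h)
            have h1 := y.1.phase_of_ne j ⟨f, U, hyU, hf⟩
            have h2 : (‖f y.1.pt‖ : ℂ) ≠ 0 := by simpa using h0
            have h3 : (y.1.phase j ⟨f, U, hyU, hf⟩ : ℂ) = f y.1.pt / ‖f y.1.pt‖ := by
              rw [eq_div_iff h2, mul_comm]; exact h1.symm
            rw [h3]
            have h4 : ContinuousAt (fun z => f z / (‖f z‖ : ℂ)) y.1.pt := by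
              refine ContinuousAt.div hcont ?_ h2
              exact Complex.continuous_ofReal.continuousAt.comp hcont.norm
            exact h4.tendsto.mono_left hΦ1
        obtain ⟨W', hW', rfl⟩ := isEmbedding_coe_circle.isOpen_iff.1 hW
        filter_upwards [hΦ1 (hf.isOpen.mem_nhds hyU), hlift', hlim.eventually_mem
          (hW'.mem_nhds hyW)] with z hz ⟨hz', hl⟩ hzW
        rw [mem_preimage, hl]
        exact ⟨hz, hzW⟩
    intro S hS
    rw [nearFilter, mem_map, mem_nhdsWithin_iff_eventually] at hS
    filter_upwards [hT.eventually hS, hlift'] with z hz ⟨hz', hl⟩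
    rw [hl] at hz
    exact hz hz'

lemma tendsto_nearFilter (y : Boundary n D) : nearFilter y ≤ 𝓝 y.1.pt :=
  (RealBlowup.continuous_pt.tendsto y.1).mono_left nhdsWithin_le_nhds

lemma tendsto_coordPhase (y : Boundary n D) (c : AdaptedChart n D y.1.pt)
    (j : {j : J // y.1.pt ∈ D j}) :
    Tendsto (fun z => c.chart z (c.idx j) / ‖c.chart z (c.idx j)‖) (nearFilter y)
      (𝓝 (coordPhase y c j)) := by
  rw [nearFilter_eq y c]
  exact tendsto_iff_comap.2 (inf_le_right.trans (iInf_le _ j))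

lemma eventually_notMem (y : Boundary n D) : ∀ᶠ z in nearFilter y, ∀ j, z ∉ D j := by
  rw [nearFilter, eventually_map]
  exact self_mem_nhdsWithin

lemma eventually_coord_ne (y : Boundary n D) (c : AdaptedChart n D y.1.pt) :
    ∀ᶠ z in nearFilter y, ∀ j, c.chart z (c.idx j) ≠ 0 := by
  filter_upwards [eventually_notMem y, tendsto_nearFilter y c.source_mem] with z hz hzs j h0
  exact hz j.1 ((c.mem_iff j z hzs).2 h0)

lemma eventually_eventually_nearFilter {y : Boundary n D} {P : X → Prop}
    (h : ∀ᶠ z in nearFilter y, P z) : ∀ᶠ t in 𝓝 y, ∀ᶠ z in nearFilter t, P z := by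
  rw [nearFilter, eventually_map, eventually_nhdsWithin_iff] at h
  have h1 := (continuous_subtype_val.tendsto y).eventually (eventually_eventually_nhds.2 h)
  filter_upwards [h1] with t ht
  rw [nearFilter, eventually_map, eventually_nhdsWithin_iff]
  exact ht

/-- The rotation of a boundary point along the diagonal circle of the fibre of the real blow-up. -/
def rot (y : Boundary n D) (θ : ℝ) : Boundary n D := by
  classical
  exact ⟨{
    pt := y.1.pt
    phase := fun j f => if y.1.pt ∈ D j then Circle.exp θ * y.1.phase j f else y.1.phase j f
    phase_of_ne := fun j f => by
      split_ifs with h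
      · obtain ⟨f, U, hU, hf⟩ := f
        simp [(hf.mem_iff _ hU).1 h]
      · exact y.1.phase_of_ne j f
    phase_mul := fun j f g a ha hfg => by
      have := y.1.phase_mul j f g a ha hfg
      split_ifs with h
      · rw [Circle.coe_mul, Circle.coe_mul, mul_left_comm, this, mul_left_comm]
      · exact this }, y.2⟩

lemma rot_zero (y : Boundary n D) : rot y 0 = y := by
  refine Subtype.ext (RealBlowup.ext rfl (heq_of_eq ?_))
  funext j f
  simp [rot]

lemma stratum_rot (y : Boundary n D) (θ : ℝ) : stratum (rot y θ) = stratum y := rfl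

lemma coordPhase_rot (y : Boundary n D) (θ : ℝ) (c : AdaptedChart n D y.1.pt)
    (j : {j : J // y.1.pt ∈ D j}) :
    coordPhase (rot y θ) c j = Complex.exp (θ * Complex.I) * coordPhase y c j := by
  have hj : y.1.pt ∈ D j.1 := j.2
  simp only [coordPhase, rot, if_pos hj, Circle.coe_mul, Circle.coe_exp]

lemma continuous_rot (y : Boundary n D) : Continuous (rot y) := by
  classical
  have key : Continuous fun θ => (rot y θ).1 := by
    refine continuous_generateFrom_iff.2 ?_
    rintro S (⟨V, hV, rfl⟩ | ⟨j, U, f, hf, W, hW, rfl⟩)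
    · exact isOpen_const (p := y.1.pt ∈ V)
    · by_cases hU : y.1.pt ∈ U
      · have h1 : Continuous fun θ : ℝ => (if y.1.pt ∈ D j then
            Circle.exp θ * y.1.phase j ⟨f, U, hU, hf⟩ else y.1.phase j ⟨f, U, hU, hf⟩) := by
          split_ifs
          · exact Circle.exp.continuous.mul continuous_const
          · exact continuous_const
        convert hW.preimage h1 using 1
        ext θ
        exact ⟨fun ⟨_, h⟩ => h, fun h => ⟨hU, h⟩⟩
      · convert isOpen_empty using 1
        ext θ
        exact ⟨fun ⟨h, _⟩ => hU h, fun h => h.elim⟩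
  exact key.subtype_mk _

open Classical in
/-- The curve on which the coordinates defining the divisor are real positive multiples of their
phases at `y` and the other coordinates vanish. -/
def radialCurve (y : Boundary n D) (c : AdaptedChart n D y.1.pt) (τ : ℝ) : X :=
  c.chart.symm fun i => if h : ∃ j, c.idx j = i then τ * coordPhase y c h.choose else 0

open Classical in
lemma radialCurve_coord (y : Boundary n D) (c : AdaptedChart n D y.1.pt) :
    ∀ᶠ τ : ℝ in 𝓝 0, ∀ j, c.chart (radialCurve y c τ) (c.idx j) = τ * coordPhase y c j := by
  have hT : Tendsto (fun (τ : ℝ) (i : Fin n) =>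
      if h : ∃ j, c.idx j = i then τ * coordPhase y c h.choose else 0) (𝓝 0) (𝓝 0) := by
    rw [tendsto_pi_nhds]
    intro i
    by_cases h : ∃ j, c.idx j = i
    · simp only [dif_pos h]
      have : Continuous fun τ : ℝ => (τ : ℂ) * coordPhase y c h.choose := by fun_prop
      simpa using this.tendsto 0
    · simp only [dif_neg h]
      exact tendsto_const_nhds
  filter_upwards [hT c.target_mem] with τ hτ j
  rw [radialCurve, c.chart.right_inv hτ]
  have h : ∃ j', c.idx j' = c.idx j := ⟨j, rfl⟩
  have h' : h.choose = j := c.idx.injective h.choose_spec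
  exact (dif_pos h).trans (by rw [h'])

lemma tendsto_radialCurve (y : Boundary n D) (c : AdaptedChart n D y.1.pt) :
    Tendsto (radialCurve y c) (𝓝[>] 0) (nearFilter y) := by
  rw [nearFilter_eq y c]
  refine tendsto_inf.2 ⟨?_, tendsto_iInf.2 fun j => tendsto_comap_iff.2 ?_⟩
  · refine c.tendsto_symm.comp (tendsto_pi_nhds.2 fun i => ?_)
    by_cases h : ∃ j, c.idx j = i
    · simp only [dif_pos h]
      have : Continuous fun τ : ℝ => (τ : ℂ) * coordPhase y c h.choose := by fun_prop
      simpa using (this.tendsto 0).mono_left nhdsWithin_le_nhds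
    · simp only [dif_neg h]
      exact tendsto_const_nhds
  · refine tendsto_const_nhds.congr' ?_
    filter_upwards [nhdsWithin_le_nhds (radialCurve_coord y c), self_mem_nhdsWithin] with τ hτ hτ0
    have hτ0 : 0 < τ := hτ0
    rw [Function.comp_apply, hτ, norm_mul, norm_coordPhase, Complex.norm_real, Real.norm_eq_abs,
      abs_of_pos hτ0, mul_one]
    have : (τ : ℂ) ≠ 0 := by exact_mod_cast hτ0.ne'
    field_simp

lemma nearFilter_neBot (y : Boundary n D) (c : AdaptedChart n D y.1.pt) : (nearFilter y).NeBot :=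
  (tendsto_radialCurve y c).neBot

end Blowup

/-! ### Sectors and branches of the roots of the coordinates -/

section Sectors

open ComplexConjugate

variable {n : ℕ} {X : Type u} [TopologicalSpace X] [ChartedSpace (Fin n → ℂ) X] {J : Type t}
  {D : J → Set X}

/-- The small sectors, in a system of coordinates, around the directions defined by a boundary
point. -/
def sector (y : Boundary n D) (c : AdaptedChart n D y.1.pt) (δ ε : ℝ) : Set (Fin n → ℂ) :=
  {w | ‖w‖ < δ ∧ ∀ j, (1 - ε) * ‖w (c.idx j)‖ < (w (c.idx j) * conj (coordPhase y c j)).re}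

lemma convex_sector (y : Boundary n D) (c : AdaptedChart n D y.1.pt) (δ : ℝ) {ε : ℝ}
    (hε : ε ≤ 1) : Convex ℝ (sector y c δ ε) := by
  intro w hw w' hw' a b ha hb hab
  have hε' : 0 ≤ 1 - ε := sub_nonneg.2 hε
  refine ⟨?_, fun j => ?_⟩
  · have := convex_ball (0 : Fin n → ℂ) δ (x := w) (by simpa using hw.1)
      (y := w') (by simpa using hw'.1) ha hb hab
    simpa using this
  · have h1 := hw.2 j
    have h2 := hw'.2 j
    have h3 : ‖(a • w + b • w') (c.idx j)‖ ≤ a * ‖w (c.idx j)‖ + b * ‖w' (c.idx j)‖ := by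
      refine (norm_add_le _ _).trans (le_of_eq ?_)
      simp [abs_of_nonneg ha, abs_of_nonneg hb]
    have h4 : ((a • w + b • w') (c.idx j) * conj (coordPhase y c j)).re
        = a * (w (c.idx j) * conj (coordPhase y c j)).re
          + b * (w' (c.idx j) * conj (coordPhase y c j)).re := by
      simp [Complex.add_re, Complex.mul_re]; ring
    rw [h4]
    have h5 := mul_le_mul_of_nonneg_left h3 hε'
    rcases ha.eq_or_lt with rfl | ha
    · have : b = 1 := by linarith
      subst this
      nlinarith
    · nlinarith [mul_lt_mul_of_pos_left h1 ha, mul_le_mul_of_nonneg_left h2.le hb]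

lemma eventually_mem_sector (y : Boundary n D) (c : AdaptedChart n D y.1.pt) {δ ε : ℝ}
    (hδ : 0 < δ) (hε : 0 < ε) : ∀ᶠ z in nearFilter y, c.chart z ∈ sector y c δ ε := by
  have hfin : Finite {j : J // y.1.pt ∈ D j} := Finite.of_injective _ c.idx.injective
  have h1 : ∀ᶠ z in nearFilter y, ‖c.chart z‖ < δ := by
    have := (c.tendsto_chart.norm).mono_left (tendsto_nearFilter y)
    rw [norm_zero] at this
    exact this.eventually_lt_const hδ
  have h2 : ∀ᶠ z in nearFilter y, ∀ j, (1 - ε) <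
      (c.chart z (c.idx j) / ‖c.chart z (c.idx j)‖ * conj (coordPhase y c j)).re := by
    rw [eventually_all]
    intro j
    have := (Complex.continuous_re.tendsto _).comp
      ((tendsto_coordPhase y c j).mul_const (conj (coordPhase y c j)))
    rw [Complex.mul_conj, Complex.normSq_eq_norm_sq, norm_coordPhase] at this
    refine this.eventually_const_lt ?_
    simp [hε]
  filter_upwards [h1, h2, eventually_coord_ne y c] with z h1 h2 h3
  refine ⟨h1, fun j => ?_⟩
  have h4 : 0 < ‖c.chart z (c.idx j)‖ := norm_pos_iff.2 (h3 j)
  have h5 := h2 j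
  rw [div_mul_eq_mul_div, Complex.div_ofReal_re, lt_div_iff₀ h4] at h5
  exact h5

lemma exists_sector_subset (y : Boundary n D) (c : AdaptedChart n D y.1.pt) {V : Set X}
    (hV : V ∈ nearFilter y) : ∃ δ > 0, ∃ ε > 0, ε ≤ 1 ∧ sector y c δ ε ⊆ c.chart.target ∧
      c.chart.symm '' sector y c δ ε ⊆ V := by
  have hfin : Finite {j : J // y.1.pt ∈ D j} := Finite.of_injective _ c.idx.injective
  rw [nearFilter_eq y c, mem_inf_iff] at hV
  obtain ⟨A, hA, B, hB, rfl⟩ := hV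
  rw [mem_iInf_of_finite] at hB
  obtain ⟨T, hT, hB⟩ := hB
  have h1 : ∀ᶠ ε : ℝ in 𝓝[>] 0, ∀ j, ∀ z : X, ∀ w : ℂ, c.chart z (c.idx j) = w →
      (1 - ε) * ‖w‖ < (w * conj (coordPhase y c j)).re → z ∈ T j := by
    rw [eventually_all]
    intro j
    obtain ⟨W, hW, hWT⟩ := mem_comap.1 (hT j)
    obtain ⟨η, hη, hηW⟩ := Metric.mem_nhds_iff.1 hW
    have h2 : ∀ᶠ ε : ℝ in 𝓝[>] 0, 2 * ε < η ^ 2 := by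
      have : Tendsto (fun ε : ℝ => 2 * ε) (𝓝[>] 0) (𝓝 0) := by
        have h : Continuous fun ε : ℝ => 2 * ε := by fun_prop
        simpa using (h.tendsto 0).mono_left nhdsWithin_le_nhds
      exact this.eventually_lt_const (by positivity)
    have h3 : ∀ᶠ ε : ℝ in 𝓝[>] 0, ε < 1 :=
      nhdsWithin_le_nhds (eventually_lt_nhds (by norm_num))
    filter_upwards [h2, h3] with ε hε hε1 z w hzw hw
    refine hWT (hηW ?_)
    have hw0 : w ≠ 0 := by
      rintro rfl
      simp at hw
    have hwp : 0 < ‖w‖ := norm_pos_iff.2 hw0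
    simp only [hzw]
    rw [Metric.mem_ball, dist_eq_norm]
    set p := coordPhase y c j
    have hp : Complex.normSq p = 1 := by
      rw [Complex.normSq_eq_norm_sq, norm_coordPhase, one_pow]
    have hq : Complex.normSq (w / ‖w‖) = 1 := by
      rw [Complex.normSq_eq_norm_sq, norm_div, Complex.norm_real, norm_norm, div_self hwp.ne',
        one_pow]
    have h5 : ‖w / ‖w‖ - p‖ ^ 2 = 2 - 2 * (w / ‖w‖ * conj p).re := by
      rw [← Complex.normSq_eq_norm_sq, Complex.normSq_sub, hp, hq]; ring
    have h6 : (1 - ε) < (w / ‖w‖ * conj p).re := by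
      rw [div_mul_eq_mul_div, Complex.div_ofReal_re, lt_div_iff₀ hwp]
      exact hw
    exact lt_of_pow_lt_pow_left₀ 2 hη.le (by rw [h5]; linarith)
  obtain ⟨ε, hε, hε0, hε1⟩ := (h1.and ((eventually_mem_nhdsWithin
    (a := (0 : ℝ)) (s := Ioi 0)).and
    (nhdsWithin_le_nhds (eventually_le_nhds (zero_lt_one' ℝ))))).exists
  obtain ⟨δ, hδ, hδ'⟩ := Metric.mem_nhds_iff.1 (inter_mem c.target_mem (c.tendsto_symm hA))
  have hsub : ∀ w ∈ sector y c δ ε, w ∈ Metric.ball (0 : Fin n → ℂ) δ := fun w hw => by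
    simpa using hw.1
  refine ⟨δ, hδ, ε, hε0, hε1, fun w hw => (hδ' (hsub w hw)).1, ?_⟩
  rintro _ ⟨w, hw, rfl⟩
  refine ⟨(hδ' (hsub w hw)).2, ?_⟩
  rw [hB]
  refine mem_iInter.2 fun j => hε j _ _ rfl ?_
  rw [c.chart.right_inv (hδ' (hsub w hw)).1]
  exact hw.2 j

lemma exists_preconnected_subset (y : Boundary n D) (c : AdaptedChart n D y.1.pt) {V : Set X}
    (hV : V ∈ nearFilter y) : ∃ W ⊆ V, W ∈ nearFilter y ∧ _root_.IsPreconnected W := by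
  obtain ⟨δ, hδ, ε, hε, hε1, hT, hsub⟩ := exists_sector_subset y c hV
  refine ⟨_, hsub, ?_, (convex_sector y c δ hε1).isPreconnected.image _
    (c.chart.continuousOn_symm.mono hT)⟩
  filter_upwards [eventually_mem_sector y c hδ hε, tendsto_nearFilter y c.source_mem] with z hz hzs
  exact ⟨c.chart z, hz, c.chart.left_inv hzs⟩

/-- Two continuous functions near a boundary point with the same `d`-th power differ by a
root of unity. -/
lemma eventually_eq_const_mul (y : Boundary n D) (c : AdaptedChart n D y.1.pt) {d : ℕ}
    (hd : 1 ≤ d) {V : Set X} (hV : V ∈ nearFilter y) {s q : X → ℂ} (hs : ContinuousOn s V)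
    (hq : ContinuousOn q V) (hq0 : ∀ z ∈ V, q z ≠ 0) (h : ∀ z ∈ V, s z ^ d = q z ^ d) :
    ∃ ζ : ℂ, ζ ^ d = 1 ∧ ∀ᶠ z in nearFilter y, s z = ζ * q z := by
  obtain ⟨W, hWV, hW, hWc⟩ := exists_preconnected_subset y c hV
  have hne := nearFilter_neBot y c
  obtain ⟨z₀, hz₀⟩ := Filter.nonempty_of_mem hW
  have hfin : {ζ : ℂ | ζ ^ d = 1}.Finite := by
    have h1 : (Polynomial.X ^ d - Polynomial.C (1 : ℂ)) ≠ 0 :=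
      Polynomial.X_pow_sub_C_ne_zero (by omega) 1
    refine (Polynomial.finite_setOfPred_isRoot h1).subset fun ζ hζ => ?_
    simp only [mem_ofPred_eq, Polynomial.IsRoot.def, Polynomial.eval_sub, Polynomial.eval_pow,
      Polynomial.eval_X, Polynomial.eval_C]
    rw [show ζ ^ d = 1 from hζ, sub_self]
  have hmaps : MapsTo (fun z => s z / q z) W {ζ : ℂ | ζ ^ d = 1} := fun z hz => by
    have := hq0 z (hWV hz)
    simp only [mem_ofPred_eq, div_pow, h z (hWV hz)]
    exact div_self (pow_ne_zero _ this)
  have hcont : ContinuousOn (fun z => s z / q z) W :=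
    (hs.mono hWV).div (hq.mono hWV) fun z hz => hq0 z (hWV hz)
  refine ⟨s z₀ / q z₀, hmaps hz₀, ?_⟩
  filter_upwards [hW] with z hz
  have h1 := hWc.constant_of_mapsTo hfin.isDiscrete hcont hmaps hz₀ hz
  rw [show s z₀ / q z₀ = s z / q z from h1, div_mul_cancel₀ _ (hq0 z (hWV hz))]

/-- The explicit form of the `d`-th roots of a coordinate defining the divisor. -/
lemma eventually_eq_root (y : Boundary n D) (c : AdaptedChart n D y.1.pt)
    (j : {j : J // y.1.pt ∈ D j}) {d : ℕ} (hd : 1 ≤ d) {V : Set X} (hV : V ∈ nearFilter y)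
    {s : X → ℂ} (hs : ContinuousOn s V) (h : ∀ z ∈ V, s z ^ d = c.chart z (c.idx j)) :
    ∃ ζ : ℂ, ζ ^ d = coordPhase y c j ∧ ∀ᶠ z in nearFilter y,
      c.chart z (c.idx j) / coordPhase y c j ∈ Complex.slitPlane ∧
      s z = ζ * Complex.exp (Complex.log (c.chart z (c.idx j) / coordPhase y c j) / d) := by
  have hp0 : coordPhase y c j ≠ 0 := by
    rw [← norm_ne_zero_iff, norm_coordPhase]; exact one_ne_zero
  have hd0 : (d : ℂ) ≠ 0 := by exact_mod_cast (by omega : d ≠ 0)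
  obtain ⟨r, hr⟩ := IsAlgClosed.exists_pow_nat_eq (coordPhase y c j) (n := d) (by omega)
  set W : Set X := {z | z ∈ c.chart.source ∧ c.chart z ∈ sector y c 1 1} with hW
  have hWm : W ∈ nearFilter y :=
    inter_mem (tendsto_nearFilter y c.source_mem)
      (eventually_mem_sector y c one_pos one_pos)
  have hslit : ∀ z ∈ W, c.chart z (c.idx j) / coordPhase y c j ∈ Complex.slitPlane := by
    intro z hz
    have h1 := hz.2.2 j
    rw [sub_self, zero_mul] at h1
    refine Or.inl ?_
    have : c.chart z (c.idx j) / coordPhase y c j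
        = c.chart z (c.idx j) * conj (coordPhase y c j) := by
      rw [div_eq_iff hp0, mul_assoc, mul_comm (conj _), Complex.mul_conj,
        Complex.normSq_eq_norm_sq, norm_coordPhase]
      simp
    rw [this]
    exact h1
  have hcc : ContinuousOn (fun z => c.chart z (c.idx j)) W :=
    ((continuous_apply _).comp_continuousOn c.chart.continuousOn).mono fun z hz => hz.1
  obtain ⟨ζ, hζ, hev⟩ := eventually_eq_const_mul y c hd (inter_mem hV hWm) (s := s)
    (q := fun z => r * Complex.exp (Complex.log (c.chart z (c.idx j) / coordPhase y c j) / d))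
    (hs.mono inter_subset_left) (by
      refine continuousOn_const.mul (Complex.continuous_exp.comp_continuousOn
        (ContinuousOn.div_const ?_ _))
      exact ContinuousOn.clog ((hcc.mono inter_subset_right).div_const _)
        fun z hz => hslit z hz.2)
    (fun z hz => mul_ne_zero (by rintro rfl; exact hp0 (by rw [← hr, zero_pow (by omega)]))
      (Complex.exp_ne_zero _))
    (fun z hz => by
      rw [h z hz.1, mul_pow, hr, ← Complex.exp_nat_mul, mul_div_cancel₀ _ hd0,
        Complex.exp_log (Complex.slitPlane_ne_zero (hslit z hz.2)), mul_div_cancel₀ _ hp0])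
  refine ⟨ζ * r, by rw [mul_pow, hζ, hr, one_mul], ?_⟩
  filter_upwards [hev, hWm] with z hz hzW
  exact ⟨hslit z hzW, by rw [hz, mul_assoc]⟩

end Sectors

/-! ### The order on the stalks of the sheaf of exponential factors -/

section Order

open Asymptotics

variable {n : ℕ} {X : Type u} [TopologicalSpace X] [ChartedSpace (Fin n → ℂ) X] {J : Type t}
  {D : J → Set X}

/-- The members of the family passing through a given point are finite in number. -/
abbrev AdaptedChart.fintypeIdx {x : X} (c : AdaptedChart n D x) : Fintype {j : J // x ∈ D j} :=
  have : Finite {j : J // x ∈ D j} := Finite.of_injective _ c.idx.injective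
  Fintype.ofFinite _

/-- The logarithmic weight `1 + ∑ j, |log |c_j||` of the coordinates defining the divisor. -/
def logWeight {x : X} (c : AdaptedChart n D x) (z : X) : ℝ :=
  letI := c.fintypeIdx
  1 + ∑ j, |Real.log ‖c.chart z (c.idx j)‖|

lemma one_le_logWeight {x : X} (c : AdaptedChart n D x) (z : X) : 1 ≤ logWeight c z := by
  let := c.fintypeIdx
  have : 0 ≤ ∑ j, |Real.log ‖c.chart z (c.idx j)‖| := Finset.sum_nonneg fun _ _ => abs_nonneg _
  simp only [logWeight]
  linarith

lemma abs_log_le_logWeight {x : X} (c : AdaptedChart n D x) (z : X) (j : {j : J // x ∈ D j}) :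
    |Real.log ‖c.chart z (c.idx j)‖| ≤ logWeight c z := by
  let := c.fintypeIdx
  have := Finset.single_le_sum (f := fun j => |Real.log ‖c.chart z (c.idx j)‖|)
    (fun _ _ => abs_nonneg _) (Finset.mem_univ j)
  simp only [logWeight]
  linarith

/-- A product over all coordinates which only involves the coordinates defining the divisor. -/
lemma AdaptedChart.prod_eq {x : X} (c : AdaptedChart n D x) {M : Type*} [CommMonoid M]
    (F : Fin n → M) (hF : ∀ i, i ∉ range c.idx → F i = 1) :
    letI := c.fintypeIdx
    ∏ i, F i = ∏ j, F (c.idx j) := by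
  let := c.fintypeIdx
  exact (Fintype.prod_of_injective c.idx c.idx.injective _ F hF fun _ => rfl).symm

lemma AdaptedChart.coord_isTheta {x : X} (c c' : AdaptedChart n D x) (j : {j : J // x ∈ D j}) :
    (fun z => c.chart z (c.idx j)) =Θ[𝓝 x] (fun z => c'.chart z (c'.idx j)) := by
  obtain ⟨a, ha, ha0, hfa⟩ := c'.exists_ratio j (c.coordEq j)
  have h1 : a =Θ[𝓝 x] fun _ => (1 : ℂ) := by
    refine isTheta_of_div_tendsto_nhds_ne_zero (c := (a x)⁻¹) ?_ (inv_ne_zero ha0)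
    simpa using ha.tendsto.inv₀ ha0
  have h2 := h1.mul (isTheta_refl (fun z => c'.chart z (c'.idx j)) (𝓝 x))
  simp only [one_mul] at h2
  exact EventuallyEq.trans_isTheta hfa h2

lemma exists_logWeight_le (y : Boundary n D) (c c' : AdaptedChart n D y.1.pt) :
    ∃ K, ∀ᶠ z in nearFilter y, logWeight c' z ≤ K * logWeight c z := by
  let := c.fintypeIdx
  have h : ∀ j, ∃ B, ∀ᶠ z in nearFilter y,
      |Real.log ‖c'.chart z (c'.idx j)‖| ≤ |Real.log ‖c.chart z (c.idx j)‖| + B := by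
    intro j
    have hθ := (c.coord_isTheta c' j).mono (tendsto_nearFilter y)
    obtain ⟨A, hA, h1⟩ := hθ.1.exists_pos
    obtain ⟨B, hB, h2⟩ := hθ.2.exists_pos
    refine ⟨|Real.log A| + |Real.log B|, ?_⟩
    filter_upwards [h1.bound, h2.bound, eventually_coord_ne y c, eventually_coord_ne y c'] with
      z h1 h2 h3 h4
    have h3 := norm_pos_iff.2 (h3 j)
    have h4 := norm_pos_iff.2 (h4 j)
    have h5 := Real.log_le_log h3 h1
    have h6 := Real.log_le_log h4 h2
    rw [Real.log_mul hA.ne' h4.ne'] at h5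
    rw [Real.log_mul hB.ne' h3.ne'] at h6
    have := neg_abs_le (Real.log ‖c.chart z (c.idx j)‖)
    have := le_abs_self (Real.log ‖c.chart z (c.idx j)‖)
    have := le_abs_self (Real.log A)
    have := le_abs_self (Real.log B)
    have := abs_nonneg (Real.log A)
    have := abs_nonneg (Real.log B)
    rw [abs_le]
    constructor <;> linarith
  choose B hB using h
  refine ⟨1 + ∑ j, |B j|, ?_⟩
  filter_upwards [eventually_all.2 hB] with z hz
  have h1 : logWeight c' z ≤ logWeight c z + ∑ j, |B j| := by
    have : logWeight c' z = 1 + ∑ j, |Real.log ‖c'.chart z (c'.idx j)‖| := rfl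
    have h2 : logWeight c z = 1 + ∑ j, |Real.log ‖c.chart z (c.idx j)‖| := rfl
    rw [this, h2, add_assoc, ← Finset.sum_add_distrib]
    gcongr with j
    exact (hz j).trans (by gcongr; exact le_abs_self _)
  have h2 := one_le_logWeight c z
  have h3 : 0 ≤ ∑ j, |B j| := Finset.sum_nonneg fun _ _ => abs_nonneg _
  nlinarith

lemma germ_eq_germ_iff {y : Boundary n D} {f g : X → ℂ} :
    germ y f = germ y g ↔ f - g ∈ boundedNear y := by
  rw [germ, germ, QuotientAddGroup.eq, ← neg_mem_iff]
  simp [sub_eq_add_neg, add_comm]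

lemma germ_sub (y : Boundary n D) (f g : X → ℂ) : germ y (f - g) = germ y f - germ y g := rfl

lemma exists_germ_eq {y : Boundary n D} (a : GermModBounded y) : ∃ f, germ y f = a :=
  QuotientAddGroup.mk_surjective a

/-- The elements of `boundedNear y`, with an explicit bound. -/
lemma mem_boundedNear_iff {y : Boundary n D} {f : X → ℂ} :
    f ∈ boundedNear y ↔ ∃ C : ℝ, ∀ᶠ z in nearFilter y, ‖f z‖ ≤ C := by
  refine (isBigO_iff (f := f) (g := fun _ => (1 : ℂ))).trans ?_
  simp

lemma eventually_mem_boundedNear {y : Boundary n D} {f : X → ℂ} (hf : f ∈ boundedNear y) :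
    ∀ᶠ t in 𝓝 y, f ∈ boundedNear t := by
  obtain ⟨C, hC⟩ := mem_boundedNear_iff.1 hf
  filter_upwards [eventually_eventually_nearFilter hC] with t ht
  exact mem_boundedNear_iff.2 ⟨C, ht⟩

lemma eventually_germ_eq {y : Boundary n D} {f g : X → ℂ} (h : germ y f = germ y g) :
    ∀ᶠ t in 𝓝 y, germ t f = germ t g :=
  (eventually_mem_boundedNear (germ_eq_germ_iff.1 h)).mono fun _ ht => germ_eq_germ_iff.2 ht

/-- The order in terms of the real part of a representative, in any system of coordinates. -/
lemma leAt_iff {y : Boundary n D} (c : AdaptedChart n D y.1.pt) {a b : expStalk y} {f : X → ℂ}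
    (hf : germ y f = a.1 - b.1) :
    leAt y a b ↔ ∃ K, ∀ᶠ z in nearFilter y, (f z).re ≤ K * logWeight c z := by
  constructor
  · rintro ⟨f', hf', c', N, C, hN, hC⟩
    let := c.fintypeIdx
    obtain ⟨B, hB⟩ := mem_boundedNear_iff.1 (germ_eq_germ_iff.1 (hf.trans hf'.symm))
    obtain ⟨K, hK⟩ := exists_logWeight_le y c c'
    refine ⟨|B| + (|Real.log (|C|)| + ∑ i, (N i : ℝ)) * K, ?_⟩
    filter_upwards [hB, hK, hC, eventually_coord_ne y c'] with z hB hK hC hc0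
    rw [c'.prod_eq (fun i => ‖c'.chart z i‖ ^ N i) (fun i hi => by simp only [hN i hi, pow_zero]),
      Complex.norm_exp] at hC
    have hpos : ∀ j, 0 < ‖c'.chart z (c'.idx j)‖ := fun j => norm_pos_iff.2 (hc0 j)
    have hprod : 0 < ∏ j, ‖c'.chart z (c'.idx j)‖ ^ N (c'.idx j) :=
      Finset.prod_pos fun j _ => pow_pos (hpos j) _
    have h1 := Real.log_le_log (mul_pos (Real.exp_pos _) hprod) (hC.trans (le_abs_self C))
    rw [Real.log_mul (Real.exp_pos _).ne' hprod.ne', Real.log_exp,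
      Real.log_prod fun j _ => (pow_pos (hpos j) _).ne'] at h1
    have h2 : -∑ j, Real.log (‖c'.chart z (c'.idx j)‖ ^ N (c'.idx j))
        ≤ (∑ i, (N i : ℝ)) * logWeight c' z := by
      rw [← Finset.sum_neg_distrib]
      have h3 : ∑ i, (N i : ℝ) = ∑ j, (N (c'.idx j) : ℝ) :=
        (Fintype.sum_of_injective c'.idx c'.idx.injective _ (fun i => (N i : ℝ))
          (fun i hi => by simp only [hN i hi, Nat.cast_zero]) fun _ => rfl).symm
      rw [h3, Finset.sum_mul]
      refine Finset.sum_le_sum fun j _ => ?_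
      rw [Real.log_pow, ← mul_neg]
      gcongr
      exact (neg_le_abs _).trans (abs_log_le_logWeight c' z j)
    have h4 : (f z).re ≤ (f' z).re + |B| := by
      have := (Complex.abs_re_le_norm (f z - f' z)).trans (hB.trans (le_abs_self B))
      rw [Complex.sub_re] at this
      have := le_abs_self ((f z).re - (f' z).re)
      linarith
    have h5 : (f' z).re ≤ (|Real.log (|C|)| + ∑ i, (N i : ℝ)) * logWeight c' z := by
      have := one_le_logWeight c' z
      have := le_abs_self (Real.log (|C|))
      have := abs_nonneg (Real.log (|C|))
      nlinarith
    have h6 : 0 ≤ |Real.log (|C|)| + ∑ i, (N i : ℝ) := by positivity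
    have h7 := mul_le_mul_of_nonneg_left hK h6
    have h8 := one_le_logWeight c z
    nlinarith [abs_nonneg B]
  · rintro ⟨K, hK⟩
    classical
    let := c.fintypeIdx
    obtain ⟨N, hN⟩ := exists_nat_ge K
    refine ⟨f, hf, c, fun i => if i ∈ range c.idx then N else 0, Real.exp N, fun i hi => if_neg hi,
      ?_⟩
    have hsmall : ∀ᶠ z in nearFilter y, ∀ j, ‖c.chart z (c.idx j)‖ < 1 := by
      rw [eventually_all]
      intro j
      have := (((continuous_apply (c.idx j)).tendsto _).comp
        (c.tendsto_chart.mono_left (tendsto_nearFilter y))).norm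
      simp only [Pi.zero_apply, norm_zero] at this
      exact this.eventually_lt_const one_pos
    filter_upwards [hK, hsmall, eventually_coord_ne y c] with z hK hs hc0
    have hpos : ∀ j, 0 < ‖c.chart z (c.idx j)‖ := fun j => norm_pos_iff.2 (hc0 j)
    rw [c.prod_eq (fun i => ‖c.chart z i‖ ^ (if i ∈ range c.idx then N else 0))
      (fun i hi => by simp only [if_neg hi, pow_zero]), Complex.norm_exp]
    simp only [mem_range_self, if_true]
    rw [Finset.prod_pow]
    have h1 : ∏ j, ‖c.chart z (c.idx j)‖ = Real.exp (-∑ j, |Real.log ‖c.chart z (c.idx j)‖|) := by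
      rw [← Finset.sum_neg_distrib, Real.exp_sum]
      refine Finset.prod_congr rfl fun j _ => ?_
      rw [abs_of_nonpos (Real.log_nonpos (hpos j).le (hs j).le), neg_neg, Real.exp_log (hpos j)]
    rw [h1, ← Real.exp_nat_mul, ← Real.exp_add, Real.exp_le_exp]
    have h2 : logWeight c z = 1 + ∑ j, |Real.log ‖c.chart z (c.idx j)‖| := rfl
    have h3 := mul_le_mul_of_nonneg_right hN (zero_le_one.trans (one_le_logWeight c z))
    rw [h2] at h3 hK
    linarith

lemma leAt_refl {y : Boundary n D} (c : AdaptedChart n D y.1.pt) (a : expStalk y) :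
    leAt y a a := by
  rw [leAt_iff c (f := 0) (by rw [sub_self]; rfl)]
  exact ⟨0, by simp⟩

lemma leAt_trans {y : Boundary n D} (c : AdaptedChart n D y.1.pt) {a b e : expStalk y}
    (h1 : leAt y a b) (h2 : leAt y b e) : leAt y a e := by
  obtain ⟨f, hf⟩ := exists_germ_eq (a.1 - b.1)
  obtain ⟨g, hg⟩ := exists_germ_eq (b.1 - e.1)
  obtain ⟨K, hK⟩ := (leAt_iff c hf).1 h1
  obtain ⟨K', hK'⟩ := (leAt_iff c hg).1 h2
  rw [leAt_iff c (f := f + g) (by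
    rw [show germ y (f + g) = germ y f + germ y g from rfl, hf, hg, sub_add_sub_cancel])]
  refine ⟨K + K', ?_⟩
  filter_upwards [hK, hK'] with z h1 h2
  rw [Pi.add_apply, Complex.add_re, add_mul]
  exact add_le_add h1 h2

end Order

/-! ### The leading term of a purely monomial germ -/

section Lead

open Asymptotics

lemma tendsto_dir_add {α : Type*} {l : Filter α} {f g : α → ℂ} {κ : ℂ} (hκ : ‖κ‖ = 1)
    (hg : Tendsto (fun x => g x / ‖g x‖) l (𝓝 κ)) (hf : f =o[l] g) :
    Tendsto (fun x => (f x + g x) / ‖f x + g x‖) l (𝓝 κ) := by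
  have h1 : Tendsto (fun x => f x / (‖g x‖ : ℂ)) l (𝓝 0) := by
    refine IsLittleO.tendsto_div_nhds_zero (hf.trans_isTheta ?_)
    exact IsTheta.of_norm_eventuallyEq_norm (Eventually.of_forall fun x => by simp)
  have h2 : Tendsto (fun x => (f x + g x) / (‖g x‖ : ℂ)) l (𝓝 κ) := by
    have := h1.add hg
    rw [zero_add] at this
    exact this.congr fun x => (add_div _ _ _).symm
  have h3 := h2.div ((Complex.continuous_ofReal.tendsto _).comp h2.norm)
    (by rw [hκ]; simp)
  rw [hκ, Complex.ofReal_one, div_one] at h3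
  refine h3.congr' ?_
  have hκ0 : κ ≠ 0 := by rw [← norm_ne_zero_iff, hκ]; exact one_ne_zero
  filter_upwards [hg.eventually_ne hκ0] with x hx
  have h4 : (‖g x‖ : ℂ) ≠ 0 := by
    intro h
    rw [h, div_zero] at hx
    exact hx rfl
  simp only [Pi.div_apply, Function.comp_apply, norm_div, Complex.norm_real, norm_norm,
    Complex.ofReal_div]
  rw [div_div_div_cancel_right₀ h4]

lemma rpow_neg_isLittleO {a b : ℝ} (hab : a < b) :
    (fun τ : ℝ => τ ^ (-a)) =o[𝓝[>] 0] fun τ : ℝ => τ ^ (-b) := by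
  rw [isLittleO_iff_tendsto']
  · have h1 : Tendsto (fun τ : ℝ => τ ^ (b - a)) (𝓝[>] 0) (𝓝 0) := by
      have := (Real.continuousAt_rpow_const 0 (b - a) (Or.inr (sub_pos.2 hab).le)).tendsto
      rw [Real.zero_rpow (sub_pos.2 hab).ne'] at this
      exact this.mono_left nhdsWithin_le_nhds
    refine h1.congr' ?_
    filter_upwards [self_mem_nhdsWithin] with τ (hτ : 0 < τ)
    rw [← Real.rpow_sub hτ]
    congr 1
    ring
  · filter_upwards [self_mem_nhdsWithin] with τ (hτ : 0 < τ) h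
    exact absurd h (Real.rpow_pos_of_pos hτ _).ne'

lemma le_of_rpow_neg_isBigO {a b : ℝ}
    (h : (fun τ : ℝ => τ ^ (-a)) =O[𝓝[>] 0] fun τ : ℝ => τ ^ (-b)) : a ≤ b := by
  by_contra! hab
  have h1 := (rpow_neg_isLittleO hab).trans_isBigO h
  have h2 := (isLittleO_irrefl (f'' := fun τ : ℝ => τ ^ (-b)) (l := 𝓝[>] 0) ?_) h1
  · exact h2
  · refine Eventually.frequently ?_
    filter_upwards [self_mem_nhdsWithin] with τ (hτ : 0 < τ)
    exact (Real.rpow_pos_of_pos hτ _).ne'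

lemma tendsto_rpow_neg_atTop {a : ℝ} (ha : 0 < a) :
    Tendsto (fun τ : ℝ => τ ^ (-a)) (𝓝[>] 0) atTop := by
  have h1 := (tendsto_rpow_atTop ha).comp (tendsto_inv_nhdsGT_zero (𝕜 := ℝ))
  refine h1.congr' ?_
  filter_upwards [self_mem_nhdsWithin] with τ (hτ : 0 < τ)
  rw [Function.comp_apply, Real.rpow_neg hτ.le, Real.inv_rpow hτ.le]

variable {n : ℕ} {X : Type u} [TopologicalSpace X] [ChartedSpace (Fin n → ℂ) X] {J : Type t}
  {D : J → Set X}

/-- Near `y`, the function `f` tends to infinity in the direction `κ`, and it grows like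
`τ ^ (-ℓ)` along the radial curves. -/
structure HasLead (y : Boundary n D) (f : X → ℂ) (ℓ : ℝ) (κ : ℂ) : Prop where
  pos : 0 < ℓ
  norm_eq : ‖κ‖ = 1
  tendsto_dir : Tendsto (fun z => f z / ‖f z‖) (nearFilter y) (𝓝 κ)
  tendsto_norm : Tendsto (fun z => ‖f z‖) (nearFilter y) atTop
  growth : ∀ c : AdaptedChart n D y.1.pt,
    (fun τ : ℝ => f (radialCurve y c τ)) =Θ[𝓝[>] 0] fun τ : ℝ => τ ^ (-ℓ)

namespace HasLead

variable {y : Boundary n D} {f f' g : X → ℂ} {ℓ ℓ' : ℝ} {κ κ' : ℂ}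

lemma congr (h : HasLead y f ℓ κ) (hf : germ y f' = germ y f) : HasLead y f' ℓ κ := by
  have hb := germ_eq_germ_iff.1 hf
  have h1 : (f' - f) =o[nearFilter y] f := by
    refine IsBigO.trans_isLittleO (g := fun _ => (1 : ℂ)) hb ?_
    rw [isLittleO_const_left]
    exact Or.inr h.tendsto_norm
  have hsum : ∀ z, (f' - f) z + f z = f' z := fun z => sub_add_cancel _ _
  have h2 : f' =Θ[nearFilter y] f := by
    have := h1.right_isTheta_add'.symm
    refine (EventuallyEq.isTheta (Eventually.of_forall fun z => ?_)).trans this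
    simp
  refine ⟨h.pos, h.norm_eq, ?_, ?_, fun c => ?_⟩
  · refine (tendsto_dir_add h.norm_eq h.tendsto_dir h1).congr fun z => ?_
    rw [hsum]
  · exact h2.tendsto_norm_atTop_iff.2 h.tendsto_norm
  · refine IsTheta.trans ?_ (h.growth c)
    have hT := tendsto_radialCurve y c
    exact ⟨h2.1.comp_tendsto hT, h2.2.comp_tendsto hT⟩

lemma neg (h : HasLead y f ℓ κ) : HasLead y (-f) ℓ (-κ) := by
  refine ⟨h.pos, by rw [norm_neg, h.norm_eq], ?_, ?_, fun c => ?_⟩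
  · refine h.tendsto_dir.neg.congr fun z => ?_
    rw [Pi.neg_apply, norm_neg, neg_div]
  · simpa using h.tendsto_norm
  · have := h.growth c
    exact ⟨this.1.neg_left, this.2.trans (isBigO_refl _ _).neg_right⟩

lemma unique (c : AdaptedChart n D y.1.pt) (h : HasLead y f ℓ κ) (h' : HasLead y f ℓ' κ') :
    ℓ = ℓ' ∧ κ = κ' := by
  have := nearFilter_neBot y c
  refine ⟨?_, tendsto_nhds_unique h.tendsto_dir h'.tendsto_dir⟩
  have h1 := (h.growth c).symm.trans (h'.growth c)
  exact le_antisymm (le_of_rpow_neg_isBigO h1.1) (le_of_rpow_neg_isBigO h1.2)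

lemma tendsto_dir_radialCurve (h : HasLead y f ℓ κ) (c : AdaptedChart n D y.1.pt) :
    Tendsto (fun τ => f (radialCurve y c τ) / ‖f (radialCurve y c τ)‖) (𝓝[>] 0) (𝓝 κ) :=
  h.tendsto_dir.comp (tendsto_radialCurve y c)

/-- The levels of the leading terms satisfy the ultrametric inequality. -/
lemma level_le_max {ℓ₁ ℓ₂ : ℝ} {κ₁ κ₂ : ℂ} (c : AdaptedChart n D y.1.pt) (h₁ : HasLead y f ℓ₁ κ₁)
    (h₂ : HasLead y g ℓ₂ κ₂) (h : HasLead y (f + g) ℓ κ) : ℓ ≤ max ℓ₁ ℓ₂ := by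
  have hle : ∀ {a b : ℝ}, a ≤ b →
      (fun τ : ℝ => τ ^ (-a)) =O[𝓝[>] 0] fun τ : ℝ => τ ^ (-b) := fun {a b} hab => by
    rcases hab.eq_or_lt with rfl | hab
    · exact isBigO_refl _ _
    · exact (rpow_neg_isLittleO hab).isBigO
  refine le_of_rpow_neg_isBigO ((h.growth c).2.trans ?_)
  exact ((h₁.growth c).1.trans (hle (le_max_left _ _))).add
    ((h₂.growth c).1.trans (hle (le_max_right _ _)))

/-- In a sum the leading term of the larger level dominates. -/
lemma dir_eq_of_lt {ℓ₁ ℓ₂ : ℝ} {κ₁ κ₂ : ℂ} (c : AdaptedChart n D y.1.pt) (h₁ : HasLead y f ℓ₁ κ₁)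
    (h₂ : HasLead y g ℓ₂ κ₂) (h : HasLead y (f + g) ℓ κ) (hlt : ℓ₁ < ℓ₂) : κ = κ₂ := by
  refine tendsto_nhds_unique (h.tendsto_dir_radialCurve c)
    (tendsto_dir_add h₂.norm_eq (h₂.tendsto_dir_radialCurve c) ?_)
  exact ((h₁.growth c).1.trans_isLittleO (rpow_neg_isLittleO hlt)).trans_isTheta
    (h₂.growth c).symm

lemma eventually_re_neg (h : HasLead y f ℓ κ) (hκ : κ.re < 0) :
    ∀ᶠ z in nearFilter y, (f z).re ≤ 0 := by
  have h1 := (Complex.continuous_re.tendsto _).comp h.tendsto_dir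
  filter_upwards [h1.eventually_lt_const hκ] with z hz
  by_contra! h0
  rw [Function.comp_apply, Complex.div_ofReal_re] at hz
  exact absurd (div_nonneg h0.le (norm_nonneg (f z))) (not_le.2 hz)

/-- If the real part of `f` has at most logarithmic growth from above, then the direction of `f`
has nonpositive real part. -/
lemma re_nonpos (h : HasLead y f ℓ κ) (c : AdaptedChart n D y.1.pt) {K : ℝ}
    (hK : ∀ᶠ z in nearFilter y, (f z).re ≤ K * logWeight c z) : κ.re ≤ 0 := by
  by_contra! hκ
  let := c.fintypeIdx
  obtain ⟨N, hN⟩ : ∃ N : ℝ, N = (Fintype.card {j : J // y.1.pt ∈ D j} : ℕ) := ⟨_, rfl⟩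
  have hT := tendsto_radialCurve y c
  have h1 : ∀ᶠ τ : ℝ in 𝓝[>] 0, logWeight c (radialCurve y c τ) = 1 + N * |Real.log τ| := by
    filter_upwards [nhdsWithin_le_nhds (radialCurve_coord y c), self_mem_nhdsWithin]
      with τ hτ (hτ0 : 0 < τ)
    have : logWeight c (radialCurve y c τ)
      = 1 + ∑ j, |Real.log ‖c.chart (radialCurve y c τ) (c.idx j)‖| := rfl
    rw [this]
    simp only [hτ, norm_mul, norm_coordPhase, mul_one, Complex.norm_real, Real.norm_eq_abs,
      Real.log_abs, Finset.sum_const, Finset.card_univ, nsmul_eq_mul, hN]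
  have h2 : (fun τ : ℝ => K * logWeight c (radialCurve y c τ)) =o[𝓝[>] 0]
      fun τ : ℝ => τ ^ (-ℓ) := by
    refine IsLittleO.const_mul_left ?_ K
    refine IsLittleO.congr' (f₁ := fun τ => 1 + N * |Real.log τ|) ?_
      (h1.mono fun _ h => h.symm) EventuallyEq.rfl
    refine IsLittleO.add ?_ (IsLittleO.const_mul_left ?_ N)
    · rw [isLittleO_const_left]
      refine Or.inr (tendsto_norm_atTop_atTop.comp (tendsto_rpow_neg_atTop h.pos))
    · exact (isLittleO_log_rpow_nhdsGT_zero (by linarith [h.pos])).abs_left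
  have h3 := (h2.trans_isTheta (h.growth c).symm).def (half_pos hκ)
  have h4 := ((Complex.continuous_re.tendsto _).comp
    (h.tendsto_dir_radialCurve c)).eventually_const_lt (half_lt_self hκ)
  obtain ⟨τ, h3, h4, h5, h6⟩ := (h3.and (h4.and ((hT.eventually hK).and
    (hT.eventually (h.tendsto_norm.eventually_gt_atTop 0))))).exists
  rw [Function.comp_apply, Complex.div_ofReal_re, lt_div_iff₀ h6] at h4
  have := (le_abs_self _).trans h3
  linarith

end HasLead

/-- Ramified coordinates, even perturbed by phases, tend to zero at the base point. -/
lemma tendsto_zero_of_norm_pow {x : X} (c : AdaptedChart n D x) {d : ℕ} (hd : 1 ≤ d)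
    {s : X → Fin n → ℂ} {l : Filter X} (hl : l ≤ 𝓝 x) (hs : ∀ᶠ z in l, ∀ i,
      (i ∈ range c.idx → ‖s z i‖ ^ d = ‖c.chart z i‖) ∧
        (i ∉ range c.idx → ‖s z i‖ = ‖c.chart z i‖)) :
    Tendsto s l (𝓝 0) := by
  rw [tendsto_pi_nhds]
  intro i
  have h1 : Tendsto (fun z => c.chart z i) l (𝓝 0) :=
    ((continuous_apply i).tendsto _).comp (c.tendsto_chart.mono_left hl)
  rw [Pi.zero_apply, tendsto_zero_iff_norm_tendsto_zero] at *
  by_cases hi : i ∈ range c.idx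
  · have hd0 : (0 : ℝ) < (d : ℝ)⁻¹ := by positivity
    have h2 := (Real.continuousAt_rpow_const 0 (d : ℝ)⁻¹ (Or.inr hd0.le)).tendsto
    rw [Real.zero_rpow hd0.ne'] at h2
    refine (h2.comp h1).congr' ?_
    filter_upwards [hs] with z hz
    rw [Function.comp_apply, ← (hz i).1 hi,
      Real.pow_rpow_inv_natCast (norm_nonneg _) (by omega)]
  · refine h1.congr' ?_
    filter_upwards [hs] with z hz
    exact ((hz i).2 hi).symm

/-- The ramified coordinates tend to zero. -/
lemma tendsto_branch {x : X} (c : AdaptedChart n D x) {d : ℕ} (hd : 1 ≤ d) {s : X → Fin n → ℂ}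
    {l : Filter X} (hl : l ≤ 𝓝 x) (hs : ∀ᶠ z in l, ∀ i,
      (i ∈ range c.idx → s z i ^ d = c.chart z i) ∧ (i ∉ range c.idx → s z i = c.chart z i)) :
    Tendsto s l (𝓝 0) := by
  refine tendsto_zero_of_norm_pow c hd hl (hs.mono fun z hz i => ⟨fun hi => ?_, fun hi => ?_⟩)
  · rw [← (hz i).1 hi, norm_pow]
  · rw [(hz i).2 hi]

lemma eventually_rot {y : Boundary n D} {P : Boundary n D → Prop} (h : ∀ᶠ t in 𝓝 y, P t) :
    ∀ᶠ θ : ℝ in 𝓝 0, P (rot y θ) := by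
  have := (continuous_rot y).tendsto 0
  rw [rot_zero] at this
  exact this.eventually h

lemma rot_add (y : Boundary n D) (θ θ' : ℝ) : rot (rot y θ) θ' = rot y (θ + θ') := by
  refine Subtype.ext (RealBlowup.ext rfl (heq_of_eq ?_))
  funext j f
  by_cases h : y.1.pt ∈ D j
  · simp [rot, h, Circle.exp_add, mul_left_comm, mul_comm]
  · simp [rot, h]

/-- The direction of a root of a coordinate, at the boundary points close to `y`. -/
lemma tendsto_dir_root (y : Boundary n D) (c : AdaptedChart n D y.1.pt)
    (j : {j : J // y.1.pt ∈ D j}) {d : ℕ} {s : X → ℂ} {ζ : ℂ} (hζ : ‖ζ‖ = 1) {θ : ℝ}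
    (hθ : |θ| < Real.pi)
    (h : ∀ᶠ z in nearFilter (rot y θ), s z =
      ζ * Complex.exp (Complex.log (c.chart z (c.idx j) / coordPhase y c j) / d)) :
    Tendsto (fun z => s z / ‖s z‖) (nearFilter (rot y θ))
      (𝓝 (ζ * Complex.exp (Complex.I * (θ / d)))) := by
  have hp0 : coordPhase y c j ≠ 0 := by
    rw [← norm_ne_zero_iff, norm_coordPhase]; exact one_ne_zero
  have hθ' := abs_lt.1 hθ
  have harg : Complex.arg (Complex.exp (θ * Complex.I)) = θ := by
    rw [Complex.exp_mul_I, Complex.arg_cos_add_sin_mul_I ⟨hθ'.1, hθ'.2.le⟩]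
  have h1 : Tendsto (fun z => c.chart z (c.idx j) / ‖c.chart z (c.idx j)‖ / coordPhase y c j)
      (nearFilter (rot y θ)) (𝓝 (Complex.exp (θ * Complex.I))) := by
    have := (tendsto_coordPhase (rot y θ) c j).div_const (coordPhase y c j)
    rwa [coordPhase_rot, mul_div_assoc, div_self hp0, mul_one] at this
  have h2 : Tendsto (fun z => Complex.arg (c.chart z (c.idx j) / coordPhase y c j))
      (nearFilter (rot y θ)) (𝓝 θ) := by
    have h3 : ContinuousAt Complex.arg (Complex.exp (θ * Complex.I)) := by
      refine Complex.continuousAt_arg (Complex.mem_slitPlane_iff_arg.2 ⟨?_, Complex.exp_ne_zero _⟩)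
      rw [harg]
      exact hθ'.2.ne
    have h4 := h3.tendsto.comp h1
    rw [harg] at h4
    refine h4.congr' ?_
    filter_upwards [eventually_coord_ne (rot y θ) c] with z hz
    have h5 : 0 < ‖c.chart z (c.idx j)‖⁻¹ := inv_pos.2 (norm_pos_iff.2 (hz j))
    rw [Function.comp_apply, ← Complex.arg_real_mul (c.chart z (c.idx j) / coordPhase y c j) h5]
    congr 1
    push_cast
    ring
  have h6 : Tendsto (fun z => ζ * Complex.exp (Complex.I *
      ((Complex.arg (c.chart z (c.idx j) / coordPhase y c j) : ℝ) / d)))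
      (nearFilter (rot y θ)) (𝓝 (ζ * Complex.exp (Complex.I * (θ / d)))) := by
    have h7 : Continuous fun a : ℝ => ζ * Complex.exp (Complex.I * ((a : ℂ) / d)) := by fun_prop
    exact (h7.tendsto θ).comp h2
  refine h6.congr' ?_
  filter_upwards [h] with z hz
  rw [hz, norm_mul, hζ, one_mul, Complex.norm_exp, mul_div_assoc, Complex.ofReal_exp,
    ← Complex.exp_sub]
  congr 2
  have h8 : (Complex.log (c.chart z (c.idx j) / coordPhase y c j) / (d : ℂ)).re
      = (Complex.log (c.chart z (c.idx j) / coordPhase y c j)).re / d := by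
    rw [← Complex.ofReal_natCast, Complex.div_ofReal_re]
  rw [h8, ← Complex.log_im, Complex.ofReal_div, Complex.ofReal_natCast, ← sub_div, mul_div_assoc']
  congr 1
  conv_rhs => rw [← Complex.re_add_im (Complex.log (c.chart z (c.idx j) / coordPhase y c j))]
  simp [mul_comm]

/-- A purely monomial germ has a leading term, which rotates with the boundary point. The level is
the total order of the pole divided by the ramification, and the direction of the germ is that of
`g 0` divided by that of the monomial. -/
lemma HasRamifiedForm.exists_hasLead {y : Boundary n D} {f : X → ℂ} {m : Fin n → ℕ}
    {g : (Fin n → ℂ) → ℂ} (h : HasRamifiedForm y f m g) (hm : m ≠ 0) (hg0 : g 0 ≠ 0) :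
    ∃ (ℓ : ℝ) (κ : ℂ), ∀ᶠ θ : ℝ in 𝓝 0,
      HasLead (rot y θ) f ℓ (κ * Complex.exp (-(Complex.I * (ℓ * θ)))) := by
  obtain ⟨c, d, s, hd, ⟨V, hV, hs, hbr⟩, hm0, hg, hev⟩ := h
  let := c.fintypeIdx
  have hd0 : (d : ℝ) ≠ 0 := by exact_mod_cast (by omega : d ≠ 0)
  have hdC : (d : ℂ) ≠ 0 := by exact_mod_cast (by omega : d ≠ 0)
  have hroot := fun j => eventually_eq_root y c j hd hV (s := fun z => s z (c.idx j))
    ((continuous_apply (c.idx j)).comp_continuousOn hs)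
    (fun z hz => (hbr z hz (c.idx j)).1 ⟨j, rfl⟩)
  choose ζ hζ hroot using hroot
  have hζ1 : ∀ j, ‖ζ j‖ = 1 := fun j => by
    have := congrArg norm (hζ j)
    rw [norm_pow, norm_coordPhase] at this
    exact (pow_eq_one_iff_of_nonneg (norm_nonneg _) (by omega)).1 this
  obtain ⟨i₀, hi₀⟩ : ∃ i, m i ≠ 0 := by
    by_contra! h
    exact hm (funext h)
  obtain ⟨j₀, rfl⟩ : i₀ ∈ range c.idx := by
    by_contra h
    exact hi₀ (hm0 i₀ h)
  set ℓ : ℝ := (∑ j, (m (c.idx j) : ℝ)) / d with hℓ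
  have hℓ0 : 0 < ℓ := by
    refine div_pos ?_ (by positivity)
    refine Finset.sum_pos' (fun j _ => by positivity) ⟨j₀, Finset.mem_univ _, ?_⟩
    exact_mod_cast Nat.pos_of_ne_zero hi₀
  set κ : ℂ := g 0 / ‖g 0‖ * (∏ j, ζ j ^ m (c.idx j))⁻¹ with hκ
  have hprod : ∀ z, ∏ i, s z i ^ m i = ∏ j, s z (c.idx j) ^ m (c.idx j) := fun z =>
    c.prod_eq (fun i => s z i ^ m i) fun i hi => by rw [hm0 i hi, pow_zero]
  refine ⟨ℓ, κ, ?_⟩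
  have hall := (hev.and (eventually_all.2 hroot)).and (Filter.mem_of_superset hV hbr)
  filter_upwards [eventually_rot (eventually_eventually_nearFilter hall),
    Metric.ball_mem_nhds (0 : ℝ) Real.pi_pos] with θ hθ hθπ
  have hθπ : |θ| < Real.pi := by simpa using hθπ
  set x := rot y θ with hx
  have hs0 : Tendsto s (nearFilter x) (𝓝 0) :=
    tendsto_branch c hd (tendsto_nearFilter x) (hθ.mono fun z hz => hz.2)
  have hgs : Tendsto (fun z => g (s z)) (nearFilter x) (𝓝 (g 0)) :=
    hg.continuousAt.tendsto.comp hs0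
  have hg0' : (‖g 0‖ : ℂ) ≠ 0 := by simpa using hg0
  -- the denominator of the germ and its direction
  set P : X → ℂ := fun z => ∏ i, s z i ^ m i with hP
  have hPdir : Tendsto (fun z => P z / ‖P z‖) (nearFilter x)
      (𝓝 (∏ j, (ζ j * Complex.exp (Complex.I * (θ / d))) ^ m (c.idx j))) := by
    have h1 : Tendsto (fun z => ∏ j, (s z (c.idx j) / ‖s z (c.idx j)‖) ^ m (c.idx j))
        (nearFilter x) (𝓝 (∏ j, (ζ j * Complex.exp (Complex.I * (θ / d))) ^ m (c.idx j))) := by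
      refine tendsto_finsetProd _ fun j _ => Tendsto.pow ?_ _
      exact tendsto_dir_root y c j (hζ1 j) hθπ (hθ.mono fun z hz => (hz.1.2 j).2)
    refine h1.congr fun z => ?_
    simp only [hP, hprod, norm_prod, Complex.ofReal_prod, div_pow, norm_pow, Complex.ofReal_pow,
      Finset.prod_div_distrib]
  have hP0 : ∀ᶠ z in nearFilter x, P z ≠ 0 := by
    filter_upwards [hθ, eventually_coord_ne x c] with z hz hc
    simp only [hP, hprod]
    refine Finset.prod_ne_zero_iff.2 fun j _ => pow_ne_zero _ fun h0 => hc j ?_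
    exact ((hz.2 (c.idx j)).1 ⟨j, rfl⟩).symm.trans (by rw [h0, zero_pow (by omega)])
  have hf : ∀ᶠ z in nearFilter x, f z = g (s z) * (P z)⁻¹ := by
    filter_upwards [hθ, hP0] with z hz h0
    rw [← hz.1.1, mul_assoc, mul_inv_cancel₀ h0, mul_one]
  have hPlim : Tendsto P (nearFilter x) (𝓝 0) := by
    have h1 : Continuous fun w : Fin n → ℂ => ∏ i, w i ^ m i := by fun_prop
    have h2 := (h1.tendsto 0).comp hs0
    rw [show ∏ i, (0 : Fin n → ℂ) i ^ m i = 0 from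
      Finset.prod_eq_zero (Finset.mem_univ (c.idx j₀)) (by
        rw [Pi.zero_apply, zero_pow hi₀])] at h2
    exact h2
  have hlim : κ * Complex.exp (-(Complex.I * (ℓ * θ)))
      = g 0 / ‖g 0‖ * (∏ j, (ζ j * Complex.exp (Complex.I * (θ / d))) ^ m (c.idx j))⁻¹ := by
    simp only [hκ, mul_pow, Finset.prod_mul_distrib, mul_inv, mul_assoc]
    congr 2
    rw [Complex.exp_neg]
    congr 1
    simp only [← Complex.exp_nat_mul]
    rw [← Complex.exp_sum, ← Finset.sum_mul, hℓ]
    congr 1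
    push_cast
    field_simp
  have hdir : Tendsto (fun z => f z / ‖f z‖) (nearFilter x)
      (𝓝 (κ * Complex.exp (-(Complex.I * (ℓ * θ))))) := by
    rw [hlim]
    have h1 : Tendsto (fun z => g (s z) / ‖g (s z)‖) (nearFilter x) (𝓝 (g 0 / ‖g 0‖)) :=
      hgs.div ((Complex.continuous_ofReal.tendsto _).comp hgs.norm) hg0'
    have h2 := h1.mul (hPdir.inv₀ (Finset.prod_ne_zero_iff.2 fun j _ => pow_ne_zero _
      (mul_ne_zero (by rw [← norm_ne_zero_iff, hζ1]; exact one_ne_zero) (Complex.exp_ne_zero _))))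
    refine h2.congr' ?_
    filter_upwards [hf] with z hz
    rw [hz, norm_mul, norm_inv, inv_div]
    push_cast
    rw [mul_div_mul_comm, inv_div_inv]
  refine ⟨hℓ0, ?_, hdir, ?_, fun c' => ?_⟩
  · rw [norm_mul, hκ, norm_mul, norm_inv, norm_prod, norm_div, Complex.norm_real, norm_norm,
      div_self (norm_ne_zero_iff.2 hg0)]
    simp only [norm_pow, hζ1, one_pow, Finset.prod_const_one, inv_one, mul_one, one_mul]
    rw [Complex.norm_exp]
    simp
  · have h1 : Tendsto (fun z => ‖P z‖) (nearFilter x) (𝓝[>] 0) := by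
      refine tendsto_nhdsWithin_iff.2 ⟨by simpa using hPlim.norm, ?_⟩
      filter_upwards [hP0] with z hz
      exact norm_pos_iff.2 hz
    refine ((hgs.norm).pos_mul_atTop (norm_pos_iff.2 hg0)
      (tendsto_inv_nhdsGT_zero.comp h1)).congr' ?_
    filter_upwards [hf] with z hz
    rw [hz, norm_mul, norm_inv]
    rfl
  · have hT := tendsto_radialCurve x c'
    have h1 : (fun τ => g (s (radialCurve x c' τ))) =Θ[𝓝[>] 0] fun _ : ℝ => (1 : ℝ) := by
      have h2 := (hgs.comp hT).norm
      have h3 : (fun τ => ‖g (s (radialCurve x c' τ))‖) =Θ[𝓝[>] 0] fun _ : ℝ => (1 : ℝ) := by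
        refine isTheta_of_div_tendsto_nhds_ne_zero (c := ‖g 0‖⁻¹) ?_
          (inv_ne_zero (norm_ne_zero_iff.2 hg0))
        have h4 := h2.inv₀ (norm_ne_zero_iff.2 hg0)
        refine h4.congr fun τ => ?_
        simp
      exact h3.of_norm_left
    have h5 : ∀ j, (fun τ => s (radialCurve x c' τ) (c.idx j)) =Θ[𝓝[>] 0]
        fun τ : ℝ => τ ^ (d : ℝ)⁻¹ := by
      intro j
      have h6 : (fun τ => ‖c.chart (radialCurve x c' τ) (c.idx j)‖) =Θ[𝓝[>] 0]
          fun τ : ℝ => τ := by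
        have h7 := (c.coord_isTheta c' j).mono (tendsto_nearFilter x)
        have h8 : (fun τ => c.chart (radialCurve x c' τ) (c.idx j)) =Θ[𝓝[>] 0]
            fun τ => c'.chart (radialCurve x c' τ) (c'.idx j) :=
          ⟨h7.1.comp_tendsto hT, h7.2.comp_tendsto hT⟩
        refine (h8.trans (IsTheta.of_norm_eventuallyEq_norm ?_)).norm_left
        filter_upwards [nhdsWithin_le_nhds (radialCurve_coord x c')] with τ hτ
        have h9 : ∀ j' : {j : J // x.1.pt ∈ D j},
            ‖c'.chart (radialCurve x c' τ) (c'.idx j')‖ = ‖τ‖ := fun j' => by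
          rw [hτ, norm_mul, norm_coordPhase, mul_one, Complex.norm_real]
        exact h9 j
      have h9 := IsTheta.rpow (r := (d : ℝ)⁻¹) (Eventually.of_forall fun τ => norm_nonneg _)
        (eventually_mem_nhdsWithin.mono fun τ (hτ : 0 < τ) => hτ.le) h6
      refine IsTheta.trans (IsTheta.of_norm_eventuallyEq ?_) h9
      filter_upwards [hT.eventually hθ] with τ hτ
      rw [← (hτ.2 (c.idx j)).1 ⟨j, rfl⟩, norm_pow,
        Real.pow_rpow_inv_natCast (norm_nonneg _) (by omega)]
    have h10 : (fun τ => P (radialCurve x c' τ)) =Θ[𝓝[>] 0] fun τ : ℝ => τ ^ ℓ := by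
      have h11 := IsTheta.finsetProd (s := Finset.univ)
        (f := fun j τ => s (radialCurve x c' τ) (c.idx j) ^ m (c.idx j))
        (g := fun j (τ : ℝ) => (τ ^ (d : ℝ)⁻¹) ^ m (c.idx j)) (l := 𝓝[>] 0)
        fun j _ => (h5 j).pow _
      refine (EventuallyEq.isTheta (Eventually.of_forall fun τ => ?_)).trans
        (h11.trans (EventuallyEq.isTheta ?_))
      · simp only [hP, hprod]
      · filter_upwards [self_mem_nhdsWithin] with τ (hτ : 0 < τ)
        rw [Finset.prod_congr rfl fun j _ => (Real.rpow_mul_natCast hτ.le _ _).symm,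
          ← Real.rpow_sum_of_pos hτ, ← Finset.mul_sum, hℓ, div_eq_inv_mul]
    refine EventuallyEq.trans_isTheta (hT.eventually hf) ?_
    refine (h1.mul h10.inv).trans (EventuallyEq.isTheta ?_)
    filter_upwards [self_mem_nhdsWithin] with τ (hτ : 0 < τ)
    rw [one_mul, Real.rpow_neg hτ.le]

end Lead

/-! ### Division by a coordinate and poles with logarithmically bounded real part -/

section Division

open scoped NNReal ENNReal

variable {n : ℕ}

/-- The projection to a coordinate hyperplane. -/
def killCoord (i : Fin n) : (Fin n → ℂ) →L[ℂ] (Fin n → ℂ) :=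
  ContinuousLinearMap.pi fun l =>
    if l = i then 0 else ContinuousLinearMap.proj (R := ℂ) (φ := fun _ : Fin n => ℂ) l

lemma killCoord_apply (i : Fin n) (w : Fin n → ℂ) : killCoord i w = Function.update w i 0 := by
  ext l
  by_cases h : l = i
  · subst h; simp [killCoord]
  · simp [killCoord, h]

lemma norm_killCoord_apply_le (i : Fin n) (w : Fin n → ℂ) : ‖killCoord i w‖ ≤ ‖w‖ := by
  rw [pi_norm_le_iff_of_nonneg (norm_nonneg _)]
  intro l
  rw [killCoord_apply]
  by_cases h : l = i
  · subst h; simp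
  · rw [Function.update_of_ne h]; exact norm_le_pi_norm w l

lemma sub_killCoord (i : Fin n) (w : Fin n → ℂ) :
    w - killCoord i w = w i • (Pi.single i 1 : Fin n → ℂ) := by
  ext l
  rw [killCoord_apply]
  by_cases h : l = i
  · subst h; simp
  · simp [h]

/-- The terms of the power series of the quotient of `h - h ∘ killCoord i` by the `i`-th
coordinate, where `p` is the power series of `h`. -/
def divSeries (p : FormalMultilinearSeries ℂ (Fin n → ℂ) ℂ) (i : Fin n) :
    FormalMultilinearSeries ℂ (Fin n → ℂ) ℂ := fun k =>
  ∑ j : Fin (k + 1), ((p (k + 1)).curryMid j (Pi.single i 1)).compContinuousLinearMap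
    fun l => if j.succAbove l < j then killCoord i else ContinuousLinearMap.id ℂ _

lemma norm_divSeries_le (p : FormalMultilinearSeries ℂ (Fin n → ℂ) ℂ) (i : Fin n) (k : ℕ) :
    ‖divSeries p i k‖ ≤ (k + 1) * ‖p (k + 1)‖ := by
  refine (norm_sum_le _ _).trans ?_
  have h : ∀ j : Fin (k + 1), ‖((p (k + 1)).curryMid j (Pi.single i 1)).compContinuousLinearMap
      fun l => if j.succAbove l < j then killCoord i else ContinuousLinearMap.id ℂ _‖
      ≤ ‖p (k + 1)‖ := by
    intro j
    refine (ContinuousMultilinearMap.norm_compContinuousLinearMap_le _ _).trans ?_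
    have h1 : ‖(p (k + 1)).curryMid j (Pi.single i 1)‖ ≤ ‖p (k + 1)‖ := by
      refine (ContinuousLinearMap.le_opNorm _ _).trans ?_
      rw [ContinuousMultilinearMap.norm_curryMid, Pi.norm_single, norm_one, mul_one]
    refine (mul_le_of_le_one_right (norm_nonneg _) ?_).trans h1
    refine Finset.prod_le_one (fun _ _ => norm_nonneg _) fun l _ => ?_
    split_ifs
    · exact ContinuousLinearMap.opNorm_le_bound _ zero_le_one fun w => by
        rw [one_mul]; exact norm_killCoord_apply_le i w
    · exact ContinuousLinearMap.norm_id_le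
  refine (Finset.sum_le_sum fun j _ => h j).trans (le_of_eq ?_)
  simp

lemma divSeries_apply (p : FormalMultilinearSeries ℂ (Fin n → ℂ) ℂ) (i : Fin n) (k : ℕ)
    (w : Fin n → ℂ) : w i * divSeries p i k (fun _ => w)
      = p (k + 1) (fun _ => w) - p (k + 1) (fun _ => killCoord i w) := by
  -- the vectors which interpolate between `w, …, w` and its projection
  set z : ℕ → Fin (k + 1) → (Fin n → ℂ) := fun j l => if (l : ℕ) < j then killCoord i w else w
    with hz
  have h1 : ∀ j : Fin (k + 1), w i * ((p (k + 1)).curryMid j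
      (Pi.single i 1)).compContinuousLinearMap
      (fun l => if j.succAbove l < j then killCoord i else ContinuousLinearMap.id ℂ _) (fun _ => w)
      = p (k + 1) (z j) - p (k + 1) (z (j + 1)) := by
    intro j
    have h2 : z j = Function.update (z j) j w := by
      rw [eq_comm, Function.update_eq_self_iff]
      simp [hz]
    have h3 : z (j + 1) = Function.update (z j) j (killCoord i w) := by
      ext1 l
      by_cases hl : l = j
      · subst hl; simp [hz]
      · rw [Function.update_of_ne hl]
        have : (l : ℕ) ≠ j := fun h => hl (Fin.ext h)
        simp only [hz]
        congr 1
        exact propext ⟨fun h => by omega, fun h => by omega⟩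
    rw [h3]
    conv_rhs => rw [h2]
    rw [Function.update_idem, ← ContinuousMultilinearMap.map_update_sub, sub_killCoord,
      ContinuousMultilinearMap.map_update_smul, smul_eq_mul,
      ContinuousMultilinearMap.compContinuousLinearMap_apply,
      ContinuousMultilinearMap.curryMid_apply]
    congr 2
    ext1 l
    refine Fin.succAboveCases j ?_ (fun l => ?_) l
    · simp
    · rw [Fin.insertNth_apply_succAbove, Function.update_of_ne (Fin.succAbove_ne j l)]
      simp only [hz, ← Fin.lt_def]
      split_ifs <;> rfl
  rw [divSeries, sum_apply, Finset.mul_sum,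
    Finset.sum_congr rfl fun j _ => h1 j,
    Fin.sum_univ_eq_sum_range (fun j => p (k + 1) (z j) - p (k + 1) (z (j + 1))) (k + 1),
    Finset.sum_range_sub']
  congr 2
  ext1 l
  simp only [hz, if_pos l.2]

/-- An analytic function which vanishes on a coordinate hyperplane is divisible by the
coordinate. -/
lemma exists_eq_coord_mul {h : (Fin n → ℂ) → ℂ} (hh : AnalyticAt ℂ h 0) (i : Fin n)
    (h0 : ∀ᶠ w in 𝓝 (0 : Fin n → ℂ), w i = 0 → h w = 0) :
    ∃ q, AnalyticAt ℂ q 0 ∧ ∀ᶠ w in 𝓝 (0 : Fin n → ℂ), h w = w i * q w := by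
  obtain ⟨p, hp⟩ := hh
  obtain ⟨r, hr0, hr⟩ := ENNReal.lt_iff_exists_nnreal_btwn.1 hp.radius_pos
  have hr0' : 0 < r := by exact_mod_cast hr0
  obtain ⟨C, hC, hpC⟩ := p.norm_mul_pow_le_of_lt_radius hr
  have hrad : 0 < (divSeries p i).radius := by
    refine lt_of_lt_of_le ?_ ((divSeries p i).le_radius_of_bound (C / r) (r := r / 2) fun k => ?_)
    · simpa using hr0'.ne'
    · have h1 := hpC (k + 1)
      have h2 := norm_divSeries_le p i k
      have hrr : (0 : ℝ) < r := hr0'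
      have h3 : ((k : ℝ) + 1) ≤ 2 ^ k := by exact_mod_cast Nat.lt_two_pow_self
      calc ‖divSeries p i k‖ * ((r / 2 : ℝ≥0) : ℝ) ^ k
          ≤ (2 ^ k * ‖p (k + 1)‖) * ((r : ℝ) / 2) ^ k := by
            push_cast
            gcongr
            exact h2.trans (by gcongr)
        _ = (‖p (k + 1)‖ * (r : ℝ) ^ (k + 1)) / r := by
            rw [div_pow]; field_simp; ring
        _ ≤ C / r := by gcongr
  refine ⟨(divSeries p i).sum, ((divSeries p i).hasFPowerSeriesOnBall hrad).analyticAt, ?_⟩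
  have hsum := hp.eventually_hasSum
  have hT : Tendsto (killCoord i) (𝓝 0) (𝓝 0) := by
    have := (killCoord i).continuous.tendsto 0
    rwa [map_zero] at this
  filter_upwards [hsum, hT.eventually hsum, hT.eventually h0,
    Metric.eball_mem_nhds (0 : Fin n → ℂ) hrad] with w h1 h2 h3 h4
  rw [zero_add] at h1 h2
  have h5 : h (killCoord i w) = 0 := h3 (by rw [killCoord_apply]; simp)
  have h6 := h1.sub h2
  rw [h5, sub_zero] at h6
  have h7 := (hasSum_nat_add_iff' 1).2 h6
  have h8 : p 0 (fun _ => w) = p 0 (fun _ => killCoord i w) := by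
    congr 1
    exact Subsingleton.elim _ _
  simp only [Finset.range_one, Finset.sum_singleton, h8, sub_self, sub_zero] at h7
  have h9 := ((divSeries p i).hasSum h4).mul_left (w i)
  simp only [divSeries_apply] at h9
  exact h7.unique h9

/-- A function `F = G / σ ^ M`, where `G` is analytic, whose real part has at most
logarithmic growth on a region of products of sectors, is bounded there. If `M i ≠ 0`, then the
coefficient of the largest pole along `σ i = 0` has real part zero on all rays; since rotating the
coordinate `σ i` changes its argument, it vanishes. So `G` is divisible by the `i`-th coordinate,
and an induction on the order of the pole applies. -/
lemma exists_norm_le_of_abs_re_le {I : Set (Fin n)} {Q : Set (Fin n → ℂ)} (hQ : IsOpen Q)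
    (hQ0 : (0 : Fin n → ℂ) ∈ closure Q)
    (hQs : ∀ σ ∈ Q, ∀ i ∈ I, σ i ≠ 0 ∧ ∀ τ ∈ Ioc (0 : ℝ) 1, Function.update σ i (τ * σ i) ∈ Q)
    {F : (Fin n → ℂ) → ℂ} {K : ℝ}
    (hF : ∀ᶠ σ in 𝓝[Q] 0, |(F σ).re| ≤ K * (1 + ∑ i, |Real.log ‖σ i‖|)) (N : ℕ) :
    ∀ (M : Fin n → ℕ) (G : (Fin n → ℂ) → ℂ), ∑ i, M i = N → (∀ i, i ∉ I → M i = 0) →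
      AnalyticAt ℂ G 0 → (∀ᶠ σ in 𝓝[Q] 0, F σ * ∏ i, σ i ^ M i = G σ) →
      ∃ C : ℝ, ∀ᶠ σ in 𝓝[Q] 0, ‖F σ‖ ≤ C := by
  induction N with
  | zero =>
    intro M G hM _ hG hFG
    have hM0 : ∀ i, M i = 0 := fun i => by
      have := Finset.single_le_sum (f := M) (fun _ _ => Nat.zero_le _) (Finset.mem_univ i)
      omega
    refine ⟨‖G 0‖ + 1, ?_⟩
    filter_upwards [hFG, nhdsWithin_le_nhds (hG.continuousAt.norm.tendsto.eventually_le_const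
      (lt_add_one _))] with σ h1 h2
    simp only [hM0, pow_zero, Finset.prod_const_one, mul_one] at h1
    rw [h1]; exact h2
  | succ N ih =>
    intro M G hM hMI hG hFG
    obtain ⟨i, hi⟩ : ∃ i, M i ≠ 0 := by
      by_contra! h
      simp [h] at hM
    have hiI : i ∈ I := by
      by_contra h
      exact hi (hMI i h)
    obtain ⟨R, hR, hball⟩ := Metric.eventually_nhds_iff_ball.1
      ((eventually_nhdsWithin_iff.1 (hF.and hFG)).and hG.eventually_analyticAt)
    have hupd : ∀ (σ : Fin n → ℂ) (a : ℂ), ‖a‖ ≤ ‖σ i‖ → σ ∈ Metric.ball (0 : Fin n → ℂ) R →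
        Function.update σ i a ∈ Metric.ball (0 : Fin n → ℂ) R := by
      intro σ a ha hσ
      rw [mem_ball_zero_iff] at hσ ⊢
      refine lt_of_le_of_lt ?_ hσ
      rw [pi_norm_le_iff_of_nonneg (norm_nonneg _)]
      intro l
      by_cases h : l = i
      · subst h; rw [Function.update_self]; exact ha.trans (norm_le_pi_norm σ l)
      · rw [Function.update_of_ne h]; exact norm_le_pi_norm σ l
    -- on the rays the real part of the leading coefficient has to vanish
    have hray : ∀ σ ∈ Q ∩ Metric.ball 0 R,
        (G (killCoord i σ) / ∏ l, σ l ^ M l).re = 0 := by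
      intro σ hσ
      set B := ∏ l, σ l ^ M l with hB
      have hB0 : B ≠ 0 := by
        refine Finset.prod_ne_zero_iff.2 fun l _ => ?_
        by_cases hl : l ∈ I
        · exact pow_ne_zero _ (hQs σ hσ.1 l hl).1
        · rw [hMI l hl, pow_zero]; exact one_ne_zero
      have hmem : ∀ τ ∈ Ioc (0 : ℝ) 1,
          Function.update σ i (τ * σ i) ∈ Q ∩ Metric.ball 0 R := fun τ hτ =>
        ⟨(hQs σ hσ.1 i hiI).2 τ hτ, hupd σ _ (by
          rw [norm_mul, Complex.norm_real, Real.norm_eq_abs, abs_of_pos hτ.1]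
          exact mul_le_of_le_one_left (norm_nonneg _) hτ.2) hσ.2⟩
      have hev : ∀ᶠ τ : ℝ in 𝓝[>] 0, τ ∈ Ioc (0 : ℝ) 1 := Ioc_mem_nhdsGT one_pos
      have hval : ∀ τ ∈ Ioc (0 : ℝ) 1, F (Function.update σ i (τ * σ i)) * (τ : ℂ) ^ M i
          = G (Function.update σ i (τ * σ i)) / B := by
        intro τ hτ
        have h1 := ((hball _ (hmem τ hτ).2).1 (hmem τ hτ).1).2
        have h2 : ∏ l, Function.update σ i (τ * σ i) l ^ M l = (τ : ℂ) ^ M i * B := by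
          rw [hB, ← Finset.mul_prod_erase _ _ (Finset.mem_univ i),
            ← Finset.mul_prod_erase _ (fun l => σ l ^ M l) (Finset.mem_univ i),
            Function.update_self, mul_pow, mul_assoc]
          congr 2
          refine Finset.prod_congr rfl fun l hl => ?_
          rw [Function.update_of_ne (Finset.ne_of_mem_erase hl)]
        rw [eq_div_iff hB0, mul_assoc, ← h2, h1]
      have hlim1 : Tendsto (fun τ : ℝ => (F (Function.update σ i (τ * σ i))
          * (τ : ℂ) ^ M i).re) (𝓝[>] 0) (𝓝 (G (killCoord i σ) / B).re) := by
        have hk : killCoord i σ ∈ Metric.ball (0 : Fin n → ℂ) R := by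
          rw [killCoord_apply]; exact hupd σ 0 (by simp) hσ.2
        have h1 : ContinuousAt G (killCoord i σ) := (hball _ hk).2.continuousAt
        have h2 : Tendsto (fun τ : ℝ => Function.update σ i (τ * σ i)) (𝓝[>] 0)
            (𝓝 (killCoord i σ)) := by
          have h3 : Continuous fun τ : ℝ => Function.update σ i (τ * σ i) :=
            continuous_const.update i (by fun_prop)
          have h4 := h3.tendsto 0
          rw [Complex.ofReal_zero, zero_mul, ← killCoord_apply] at h4
          exact h4.mono_left nhdsWithin_le_nhds
        refine ((Complex.continuous_re.tendsto _).comp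
          ((h1.tendsto.comp h2).div_const B)).congr' ?_
        filter_upwards [hev] with τ hτ
        simp only [Function.comp_apply, hval τ hτ]
      have hlim2 : Tendsto (fun τ : ℝ => (F (Function.update σ i (τ * σ i))
          * (τ : ℂ) ^ M i).re) (𝓝[>] 0) (𝓝 0) := by
        set A := ∑ l, |Real.log ‖σ l‖|
        have h5 : Tendsto (fun τ : ℝ => K * (1 + A) * τ ^ M i + K * |Real.log τ * τ ^ M i|)
            (𝓝[>] 0) (𝓝 0) := by
          have h6 : Tendsto (fun τ : ℝ => τ ^ M i) (𝓝[>] 0) (𝓝 0) := by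
            have : Continuous fun τ : ℝ => τ ^ M i := by fun_prop
            have := this.tendsto 0
            rw [zero_pow hi] at this
            exact this.mono_left nhdsWithin_le_nhds
          have h7 : Tendsto (fun τ : ℝ => Real.log τ * τ ^ M i) (𝓝[>] 0) (𝓝 0) := by
            have := tendsto_log_mul_rpow_nhdsGT_zero (r := (M i : ℝ))
              (by exact_mod_cast Nat.pos_of_ne_zero hi)
            simpa only [Real.rpow_natCast] using this
          have h8 := (h6.const_mul (K * (1 + A))).add (h7.abs.const_mul K)
          simpa using h8
        refine squeeze_zero_norm' ?_ h5
        filter_upwards [hev] with τ hτ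
        have h9 := ((hball _ (hmem τ hτ).2).1 (hmem τ hτ).1).1
        have h10 : ∑ l, |Real.log ‖Function.update σ i (τ * σ i) l‖| ≤ A + |Real.log τ| := by
          rw [← Finset.add_sum_erase _ _ (Finset.mem_univ i), Function.update_self, norm_mul,
            Complex.norm_real, Real.norm_eq_abs, Real.log_mul (abs_pos.2 hτ.1.ne').ne'
              (norm_ne_zero_iff.2 (hQs σ hσ.1 i hiI).1), Real.log_abs,
            show A = ∑ l, |Real.log ‖σ l‖| from rfl,
            ← Finset.add_sum_erase _ (fun l => |Real.log ‖σ l‖|) (Finset.mem_univ i)]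
          have h11 : ∑ l ∈ Finset.univ.erase i, |Real.log ‖Function.update σ i (τ * σ i) l‖|
              = ∑ l ∈ Finset.univ.erase i, |Real.log ‖σ l‖| :=
            Finset.sum_congr rfl fun l hl => by
              rw [Function.update_of_ne (Finset.ne_of_mem_erase hl)]
          rw [h11]
          linarith [abs_add_le (Real.log τ) (Real.log ‖σ i‖)]
        have hK : 0 ≤ K := by
          by_contra! hK
          have h12 : 0 ≤ ∑ l, |Real.log ‖Function.update σ i (τ * σ i) l‖| :=
            Finset.sum_nonneg fun _ _ => abs_nonneg _
          nlinarith [abs_nonneg (F (Function.update σ i (τ * σ i))).re]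
        have hτp : 0 < τ ^ M i := pow_pos hτ.1 _
        rw [← Complex.ofReal_pow, Complex.re_mul_ofReal, Real.norm_eq_abs, abs_mul,
          abs_of_pos hτp, abs_mul, abs_of_pos hτp, ← mul_assoc, ← add_mul]
        refine mul_le_mul_of_nonneg_right (h9.trans ?_) hτp.le
        nlinarith
      exact tendsto_nhds_unique hlim1 hlim2
    -- hence the leading coefficient itself vanishes
    have hQR : IsOpen (Q ∩ Metric.ball 0 R) := hQ.inter Metric.isOpen_ball
    have hzero : ∀ σ ∈ Q ∩ Metric.ball 0 R, G (killCoord i σ) = 0 := by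
      intro σ hσ
      set B := ∏ l, σ l ^ M l with hB
      have hB0 : B ≠ 0 := by
        refine Finset.prod_ne_zero_iff.2 fun l _ => ?_
        by_cases hl : l ∈ I
        · exact pow_ne_zero _ (hQs σ hσ.1 l hl).1
        · rw [hMI l hl, pow_zero]; exact one_ne_zero
      have hcont : Tendsto (fun φ : ℝ => Function.update σ i (Complex.exp (φ * Complex.I) * σ i))
          (𝓝[>] 0) (𝓝 σ) := by
        have h3 : Continuous fun φ : ℝ =>
            Function.update σ i (Complex.exp (φ * Complex.I) * σ i) :=
          continuous_const.update i (by fun_prop)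
        have h4 := h3.tendsto 0
        rw [Complex.ofReal_zero, zero_mul, Complex.exp_zero, one_mul,
          Function.update_eq_self] at h4
        exact h4.mono_left nhdsWithin_le_nhds
      have hsin : ∀ᶠ φ : ℝ in 𝓝[>] 0, φ ∈ Ioo (0 : ℝ) (Real.pi / M i) := by
        refine Ioo_mem_nhdsGT (div_pos Real.pi_pos ?_)
        exact_mod_cast Nat.pos_of_ne_zero hi
      -- rotate the coordinate `σ i` by a small angle `φ` for which `sin (M i * φ) ≠ 0`
      obtain ⟨φ, hφ1, hφ2⟩ := ((hcont.eventually (hQR.mem_nhds hσ)).and hsin).exists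
      have h1 := hray _ hσ
      have h2 := hray _ hφ1
      have h3 : killCoord i (Function.update σ i (Complex.exp (φ * Complex.I) * σ i))
          = killCoord i σ := by
        rw [killCoord_apply, killCoord_apply, Function.update_idem]
      have h4 : ∏ l, Function.update σ i (Complex.exp (φ * Complex.I) * σ i) l ^ M l
          = Complex.exp (φ * Complex.I) ^ M i * B := by
        rw [hB, ← Finset.mul_prod_erase _ _ (Finset.mem_univ i),
          ← Finset.mul_prod_erase _ (fun l => σ l ^ M l) (Finset.mem_univ i),
          Function.update_self, mul_pow, mul_assoc]
        congr 2
        refine Finset.prod_congr rfl fun l hl => ?_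
        rw [Function.update_of_ne (Finset.ne_of_mem_erase hl)]
      rw [h3, h4, ← Complex.exp_nat_mul, mul_comm (Complex.exp _) B, ← div_div, div_eq_mul_inv,
        ← Complex.exp_neg] at h2
      set α := G (killCoord i σ) / B with hα
      have h5 : (-(↑(M i) * ((φ : ℂ) * Complex.I))) = ((-(M i * φ) : ℝ) : ℂ) * Complex.I := by
        push_cast; ring
      rw [h5, Complex.mul_re, Complex.exp_ofReal_mul_I_re, Complex.exp_ofReal_mul_I_im, h1,
        zero_mul, zero_sub, Real.sin_neg, mul_neg, neg_neg] at h2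
      have hMpos : (0 : ℝ) < M i := by exact_mod_cast Nat.pos_of_ne_zero hi
      have h6 : 0 < Real.sin (M i * φ) := by
        refine Real.sin_pos_of_pos_of_lt_pi (mul_pos hMpos hφ2.1) ?_
        rw [mul_comm, ← lt_div_iff₀ hMpos]
        exact hφ2.2
      have h7 : α = 0 := Complex.ext h1 ((mul_eq_zero.1 h2).resolve_right h6.ne')
      rw [hα, div_eq_zero_iff] at h7
      exact h7.resolve_right hB0
    -- by the identity theorem, `G` vanishes on the hyperplane and is divisible by the coordinate
    have hanal : AnalyticOnNhd ℂ (fun σ => G (killCoord i σ)) (Metric.ball 0 R) := by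
      intro σ hσ
      have hk : killCoord i σ ∈ Metric.ball (0 : Fin n → ℂ) R := by
        rw [killCoord_apply]; exact hupd σ 0 (by simp) hσ
      exact (hball _ hk).2.comp (f := killCoord i) ((killCoord i).analyticAt σ)
    obtain ⟨σ₀, hσ₀⟩ : (Q ∩ Metric.ball 0 R).Nonempty := by
      rw [inter_comm]
      exact mem_closure_iff.1 hQ0 _ Metric.isOpen_ball (Metric.mem_ball_self hR)
    have hident := hanal.eqOn_zero_of_preconnected_of_eventuallyEq_zero
      (convex_ball (0 : Fin n → ℂ) R).isPreconnected hσ₀.2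
      (by filter_upwards [hQR.mem_nhds hσ₀] with σ hσ using hzero σ hσ)
    obtain ⟨q, hq, hGq⟩ := exists_eq_coord_mul hG i (by
      filter_upwards [Metric.ball_mem_nhds (0 : Fin n → ℂ) hR] with σ hσ hσi
      have := hident hσ
      simp only [killCoord_apply, Pi.zero_apply] at this
      rwa [Function.update_eq_self_iff.2 hσi.symm] at this)
    classical
    refine ih (Function.update M i (M i - 1)) q ?_ (fun l hl => ?_) hq ?_
    · have h1 := Finset.add_sum_erase Finset.univ M (Finset.mem_univ i)
      have h2 := Finset.add_sum_erase Finset.univ (Function.update M i (M i - 1))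
        (Finset.mem_univ i)
      have h3 : ∑ l ∈ Finset.univ.erase i, Function.update M i (M i - 1) l
          = ∑ l ∈ Finset.univ.erase i, M l := Finset.sum_congr rfl fun l hl => by
        rw [Function.update_of_ne (Finset.ne_of_mem_erase hl)]
      rw [Function.update_self] at h2
      omega
    · by_cases h : l = i
      · exact absurd hiI (h ▸ hl)
      · rw [Function.update_of_ne h]; exact hMI l hl
    · filter_upwards [hFG, nhdsWithin_le_nhds hGq, self_mem_nhdsWithin] with σ h1 h2 h3
      have h4 : ∏ l, σ l ^ M l = σ i * ∏ l, σ l ^ Function.update M i (M i - 1) l := by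
        rw [← Finset.mul_prod_erase _ _ (Finset.mem_univ i),
          ← Finset.mul_prod_erase _ (fun l => σ l ^ Function.update M i (M i - 1) l)
            (Finset.mem_univ i), Function.update_self, ← mul_assoc, ← pow_succ',
          Nat.sub_add_cancel (Nat.pos_of_ne_zero hi)]
        congr 1
        refine Finset.prod_congr rfl fun l hl => ?_
        rw [Function.update_of_ne (Finset.ne_of_mem_erase hl)]
      rw [h4, h2] at h1
      refine mul_left_cancel₀ (hQs σ h3 i hiI).1 ?_
      rw [← h1]; ring

end Division

/-! ### Ramified coordinates and the antisymmetry of the order -/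

section Ramified

open Asymptotics ComplexConjugate

variable {n : ℕ} {X : Type u} [TopologicalSpace X] [ChartedSpace (Fin n → ℂ) X] {J : Type t}
  {D : J → Set X}

variable (y : Boundary n D) (c : AdaptedChart n D y.1.pt) (d : ℕ)

lemma coordPhase_ne_zero (j : {j : J // y.1.pt ∈ D j}) : coordPhase y c j ≠ 0 := by
  rw [← norm_ne_zero_iff, norm_coordPhase]; exact one_ne_zero

/-- The principal `d`-th roots, near `y`, of the coordinates defining the divisor, normalised by
their phases, together with the other coordinates. -/
def rootCoord (z : X) : Fin n → ℂ :=
  Function.extend c.idx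
    (fun j => Complex.exp (Complex.log (c.chart z (c.idx j) / coordPhase y c j) / d)) (c.chart z)

/-- The coordinates in terms of their normalised `d`-th roots. -/
def powCoord (σ : Fin n → ℂ) : Fin n → ℂ :=
  Function.extend c.idx (fun j => coordPhase y c j * σ (c.idx j) ^ d) σ

lemma rootCoord_idx (z : X) (j : {j : J // y.1.pt ∈ D j}) : rootCoord y c d z (c.idx j) =
    Complex.exp (Complex.log (c.chart z (c.idx j) / coordPhase y c j) / d) :=
  c.idx.injective.extend_apply _ _ _

lemma rootCoord_of_notMem (z : X) {i : Fin n} (hi : i ∉ range c.idx) :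
    rootCoord y c d z i = c.chart z i := Function.extend_apply' _ _ _ hi

lemma powCoord_idx (σ : Fin n → ℂ) (j : {j : J // y.1.pt ∈ D j}) :
    powCoord y c d σ (c.idx j) = coordPhase y c j * σ (c.idx j) ^ d :=
  c.idx.injective.extend_apply _ _ _

lemma powCoord_of_notMem (σ : Fin n → ℂ) {i : Fin n} (hi : i ∉ range c.idx) :
    powCoord y c d σ i = σ i := Function.extend_apply' _ _ _ hi

variable {d}

lemma coordPhase_mul_rootCoord_pow (hd : 1 ≤ d) {z : X} {j : {j : J // y.1.pt ∈ D j}}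
    (hz : c.chart z (c.idx j) ≠ 0) :
    coordPhase y c j * rootCoord y c d z (c.idx j) ^ d = c.chart z (c.idx j) := by
  have hd0 : (d : ℂ) ≠ 0 := by exact_mod_cast (by omega : d ≠ 0)
  have hp0 := coordPhase_ne_zero y c j
  rw [rootCoord_idx, ← Complex.exp_nat_mul, mul_div_cancel₀ _ hd0,
    Complex.exp_log (div_ne_zero hz hp0), mul_div_cancel₀ _ hp0]

lemma powCoord_rootCoord (hd : 1 ≤ d) {z : X} (hz : ∀ j, c.chart z (c.idx j) ≠ 0) :
    powCoord y c d (rootCoord y c d z) = c.chart z := by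
  ext i
  by_cases hi : i ∈ range c.idx
  · obtain ⟨j, rfl⟩ := hi
    rw [powCoord_idx, coordPhase_mul_rootCoord_pow y c hd (hz j)]
  · rw [powCoord_of_notMem y c d _ hi, rootCoord_of_notMem y c d _ hi]

lemma tendsto_rootCoord (hd : 1 ≤ d) : Tendsto (rootCoord y c d) (nearFilter y) (𝓝 0) := by
  refine tendsto_zero_of_norm_pow c hd (tendsto_nearFilter y) ?_
  filter_upwards [eventually_coord_ne y c] with z hz i
  refine ⟨?_, fun hi => by rw [rootCoord_of_notMem y c d _ hi]⟩
  rintro ⟨j, rfl⟩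
  have := congrArg norm (coordPhase_mul_rootCoord_pow y c hd (hz j))
  rwa [norm_mul, norm_coordPhase, one_mul, norm_pow] at this

lemma analyticAt_extend {E : Type*} [NormedAddCommGroup E] [NormedSpace ℂ E]
    {x : X} (c : AdaptedChart n D x) {a : E → {j : J // x ∈ D j} → ℂ} {b : E → Fin n → ℂ} {e : E}
    (ha : ∀ j, AnalyticAt ℂ (fun e => a e j) e)
    (hb : ∀ i, i ∉ range c.idx → AnalyticAt ℂ (fun e => b e i) e) :
    AnalyticAt ℂ (fun e => Function.extend c.idx (a e) (b e)) e := by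
  refine AnalyticAt.pi fun i => ?_
  by_cases hi : i ∈ range c.idx
  · obtain ⟨j, rfl⟩ := hi
    simpa only [c.idx.injective.extend_apply] using ha j
  · simpa only [Function.extend_apply' _ _ _ (show ¬ ∃ j, c.idx j = i from hi)] using hb i hi

lemma analyticAt_coord (i : Fin n) (σ : Fin n → ℂ) :
    AnalyticAt ℂ (fun σ : Fin n → ℂ => σ i) σ :=
  (ContinuousLinearMap.proj (R := ℂ) (φ := fun _ : Fin n => ℂ) i).analyticAt σ

lemma analyticAt_powCoord (σ : Fin n → ℂ) : AnalyticAt ℂ (powCoord y c d) σ :=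
  analyticAt_extend c (fun _ => analyticAt_const.mul ((analyticAt_coord _ _).pow _))
    fun _ _ => analyticAt_coord _ _

lemma powCoord_zero (hd : 1 ≤ d) : powCoord y c d 0 = 0 := by
  ext i
  by_cases hi : i ∈ range c.idx
  · obtain ⟨j, rfl⟩ := hi
    rw [powCoord_idx, Pi.zero_apply, zero_pow (by omega), mul_zero]
  · rw [powCoord_of_notMem y c d _ hi]

/-- A region of products of sectors on which the normalised `d`-th roots of the coordinates are
coordinates of points in a prescribed neighbourhood of `y`. -/
lemma exists_root_region (hd : 1 ≤ d) {V : Set X} (hV : V ∈ nearFilter y) :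
    ∃ Q : Set (Fin n → ℂ), IsOpen Q ∧ (0 : Fin n → ℂ) ∈ closure Q ∧
      (∀ σ ∈ Q, ∀ i ∈ range c.idx, σ i ≠ 0 ∧
        ∀ τ ∈ Ioc (0 : ℝ) 1, Function.update σ i (τ * σ i) ∈ Q) ∧
      Tendsto (rootCoord y c d) (nearFilter y) (𝓝[Q] 0) ∧
      ∀ᶠ σ in 𝓝[Q] 0, c.chart.symm (powCoord y c d σ) ∈ V ∧
        c.chart (c.chart.symm (powCoord y c d σ)) = powCoord y c d σ ∧
        rootCoord y c d (c.chart.symm (powCoord y c d σ)) = σ := by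
  let := c.fintypeIdx
  have hd0 : (0 : ℝ) < d := by exact_mod_cast hd
  have hdC : (d : ℂ) ≠ 0 := by exact_mod_cast (by omega : d ≠ 0)
  obtain ⟨δ, hδ, ε, hε, hε1, hT, hsub⟩ := exists_sector_subset y c hV
  -- the opening of the sectors
  obtain ⟨η, hη1, hη2, hη0⟩ : ∃ η : ℝ, d * η < Real.pi ∧ 1 - ε < Real.cos (d * η) ∧ 0 < η := by
    have h1 : Tendsto (fun η : ℝ => d * η) (𝓝[>] 0) (𝓝 0) := by
      have : Continuous fun η : ℝ => d * η := by fun_prop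
      simpa using (this.tendsto 0).mono_left nhdsWithin_le_nhds
    have h2 := (Real.continuous_cos.tendsto _).comp h1
    rw [Real.cos_zero] at h2
    exact ((h1.eventually_lt_const Real.pi_pos).and
      ((h2.eventually_const_lt (by linarith)).and eventually_mem_nhdsWithin)).exists
  have hηπ : η < Real.pi := by
    have h1 : (1 : ℝ) ≤ d := by exact_mod_cast hd
    nlinarith
  set κ := Real.cos η with hκ
  have hκ1 : κ < 1 := by
    rw [hκ, ← Real.cos_zero]
    exact Real.cos_lt_cos_of_nonneg_of_le_pi le_rfl hηπ.le hη0
  set Q : Set (Fin n → ℂ) := {σ | ∀ j, κ * ‖σ (c.idx j)‖ < (σ (c.idx j)).re} with hQ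
  have hQne : ∀ σ ∈ Q, ∀ j, σ (c.idx j) ≠ 0 := by
    intro σ hσ j h0
    have := hσ j
    simp [h0] at this
  refine ⟨Q, ?_, ?_, ?_, ?_, ?_⟩
  · have : Q = ⋂ j, {σ | κ * ‖σ (c.idx j)‖ < (σ (c.idx j)).re} := by
      ext σ; simp [hQ]
    rw [this]
    exact isOpen_iInter_of_finite fun j => isOpen_lt (by fun_prop) (by fun_prop)
  · have h1 : Tendsto (fun (τ : ℝ) (_ : Fin n) => (τ : ℂ)) (𝓝[>] 0) (𝓝 0) := by
      have : Continuous fun (τ : ℝ) (_ : Fin n) => (τ : ℂ) := by fun_prop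
      have h2 := (this.tendsto 0).mono_left (nhdsWithin_le_nhds (s := Ioi 0))
      rwa [Complex.ofReal_zero] at h2
    refine mem_closure_of_tendsto h1 ?_
    filter_upwards [self_mem_nhdsWithin] with τ (hτ : 0 < τ) j
    simp only [Complex.norm_real, Real.norm_eq_abs, abs_of_pos hτ, Complex.ofReal_re]
    nlinarith
  · rintro σ hσ _ ⟨j, rfl⟩
    refine ⟨hQne σ hσ j, fun τ hτ j' => ?_⟩
    by_cases h : j' = j
    · subst h
      rw [Function.update_self, norm_mul, Complex.norm_real, Real.norm_eq_abs, abs_of_pos hτ.1,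
        Complex.re_ofReal_mul, mul_left_comm]
      exact mul_lt_mul_of_pos_left (hσ j') hτ.1
    · rw [Function.update_of_ne (fun h' => h (c.idx.injective h'))]
      exact hσ j'
  · refine tendsto_nhdsWithin_iff.2 ⟨tendsto_rootCoord y c hd, eventually_all.2 fun j => ?_⟩
    have h1 := tendsto_dir_root y c j (d := d) (s := fun z => rootCoord y c d z (c.idx j))
      (ζ := 1) norm_one (θ := 0) (by simpa using Real.pi_pos)
      (Eventually.of_forall fun z => by rw [one_mul]; exact rootCoord_idx y c d z j)
    rw [rot_zero] at h1
    have h2 := (Complex.continuous_re.tendsto _).comp h1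
    simp only [Complex.ofReal_zero, zero_div, mul_zero, Complex.exp_zero, mul_one,
      Complex.one_re] at h2
    filter_upwards [h2.eventually_const_lt hκ1] with z hz
    rw [Function.comp_apply, Complex.div_ofReal_re] at hz
    have h3 : 0 < ‖rootCoord y c d z (c.idx j)‖ := by
      rw [rootCoord_idx]; exact norm_pos_iff.2 (Complex.exp_ne_zero _)
    rwa [lt_div_iff₀ h3] at hz
  · have h1 : Tendsto (fun σ => ‖powCoord y c d σ‖) (𝓝[Q] 0) (𝓝 0) := by
      have := (analyticAt_powCoord y c (d := d) 0).continuousAt.norm.tendsto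
      rw [powCoord_zero y c hd, norm_zero] at this
      exact this.mono_left nhdsWithin_le_nhds
    filter_upwards [self_mem_nhdsWithin, h1.eventually_lt_const hδ] with σ hσ hσδ
    have harg : ∀ j, |Complex.arg (σ (c.idx j))| < η := by
      intro j
      have h2 := hQne σ hσ j
      have h3 : κ < Real.cos |Complex.arg (σ (c.idx j))| := by
        rw [Real.cos_abs, Complex.cos_arg h2, lt_div_iff₀ (norm_pos_iff.2 h2)]
        exact hσ j
      exact (Real.strictAntiOn_cos.lt_iff_gt ⟨hη0.le, hηπ.le⟩
        ⟨abs_nonneg _, Complex.abs_arg_le_pi _⟩).1 h3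
    have hdarg : ∀ j, |d * Complex.arg (σ (c.idx j))| ≤ d * η := fun j => by
      rw [abs_mul, abs_of_pos hd0]
      exact mul_le_mul_of_nonneg_left (harg j).le hd0.le
    have hlogim : ∀ j, ((d : ℂ) * Complex.log (σ (c.idx j))).im
        = d * Complex.arg (σ (c.idx j)) := fun j => by
      rw [← Complex.ofReal_natCast, Complex.im_ofReal_mul, Complex.log_im]
    have hexp : ∀ j, Complex.exp ((d : ℂ) * Complex.log (σ (c.idx j))) = σ (c.idx j) ^ d :=
      fun j => by rw [Complex.exp_nat_mul, Complex.exp_log (hQne σ hσ j)]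
    -- the `d`-th powers of the elements of `Q` lie in the sector around `y`
    have hsec : powCoord y c d σ ∈ sector y c δ ε := by
      refine ⟨hσδ, fun j => ?_⟩
      have hp : coordPhase y c j * conj (coordPhase y c j) = 1 := by
        rw [Complex.mul_conj, Complex.normSq_eq_norm_sq, norm_coordPhase]; simp
      rw [powCoord_idx, norm_mul, norm_coordPhase, one_mul, mul_right_comm, hp, one_mul,
        norm_pow, ← hexp, Complex.exp_re, hlogim]
      have h2 : Real.exp ((d : ℂ) * Complex.log (σ (c.idx j))).re = ‖σ (c.idx j)‖ ^ d := by
        rw [← Complex.norm_exp, hexp, norm_pow]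
      rw [h2, mul_comm]
      refine mul_lt_mul_of_pos_left (hη2.trans_le ?_) (pow_pos (norm_pos_iff.2 (hQne σ hσ j)) _)
      rw [← Real.cos_abs (d * Complex.arg (σ (c.idx j)))]
      exact Real.cos_le_cos_of_nonneg_of_le_pi (abs_nonneg _) hη1.le (hdarg j)
    have hinv := c.chart.right_inv (hT hsec)
    refine ⟨hsub ⟨_, hsec, rfl⟩, hinv, ?_⟩
    ext i
    by_cases hi : i ∈ range c.idx
    · obtain ⟨j, rfl⟩ := hi
      rw [rootCoord_idx, hinv, powCoord_idx, mul_div_cancel_left₀ _ (coordPhase_ne_zero y c j),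
        ← hexp, Complex.log_exp, mul_div_cancel_left₀ _ hdC, Complex.exp_log (hQne σ hσ j)]
      · rw [hlogim]; linarith [(abs_le.1 (hdarg j)).1]
      · rw [hlogim]; linarith [(abs_le.1 (hdarg j)).2]
    · rw [rootCoord_of_notMem y c d _ hi, hinv, powCoord_of_notMem y c d _ hi]

end Ramified

section NormalForm

open Asymptotics

variable {n : ℕ} {X : Type u} [TopologicalSpace X] [ChartedSpace (Fin n → ℂ) X] {J : Type t}
  {D : J → Set X}

/-- In a second system of coordinates a coordinate defining the divisor is, up to a factor
which is analytic and does not vanish, the corresponding coordinate of the first system. -/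
lemma AdaptedChart.exists_analytic_ratio {y : Boundary n D} (c c₂ : AdaptedChart n D y.1.pt)
    (j : {j : J // y.1.pt ∈ D j}) :
    ∃ r : (Fin n → ℂ) → ℂ, AnalyticAt ℂ r 0 ∧ r 0 ≠ 0 ∧
      ∀ᶠ z in 𝓝 y.1.pt, c₂.chart z (c₂.idx j) = c.chart z (c.idx j) * r (c.chart z) := by
  have hφ : AnalyticAt ℂ ((fun z => c₂.chart z (c₂.idx j)) ∘ c.chart.symm) 0 :=
    c.analyticAt_comp_symm ((c₂.contMDiffOn_coord _).contMDiffAt c₂.source_mem)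
  obtain ⟨r, hr, hev⟩ := exists_eq_coord_mul hφ (c.idx j) (by
    filter_upwards [c.target_mem, c.tendsto_symm c₂.source_mem] with w hw hw2 hw0
    refine (c₂.mem_iff j _ hw2).1 ((c.mem_iff j _ (c.chart.map_target hw)).2 ?_)
    rwa [c.chart.right_inv hw])
  have hev' : ∀ᶠ z in 𝓝 y.1.pt,
      c₂.chart z (c₂.idx j) = c.chart z (c.idx j) * r (c.chart z) := by
    filter_upwards [c.tendsto_chart.eventually hev, c.source_mem] with z hz hzs
    rwa [Function.comp_apply, c.chart.left_inv hzs] at hz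
  refine ⟨r, hr, fun h0 => ?_, hev'⟩
  have hne := nearFilter_neBot y c
  have h1 : (fun z => c₂.chart z (c₂.idx j)) =o[nearFilter y] fun z => c.chart z (c.idx j) := by
    have h2 : (fun z => r (c.chart z)) =o[nearFilter y] fun _ => (1 : ℂ) := by
      rw [isLittleO_one_iff, ← h0]
      exact hr.continuousAt.tendsto.comp (c.tendsto_chart.mono_left (tendsto_nearFilter y))
    have h3 := (isBigO_refl (fun z => c.chart z (c.idx j)) (nearFilter y)).mul_isLittleO h2
    simp only [mul_one] at h3
    exact h3.congr' (Eventually.mono (tendsto_nearFilter y hev') fun z hz => hz.symm)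
      EventuallyEq.rfl
  have h4 := ((c.coord_isTheta c₂ j).mono (tendsto_nearFilter y)).1.trans_isLittleO h1
  refine isLittleO_irrefl ?_ h4
  exact Eventually.frequently ((eventually_coord_ne y c).mono fun z hz => hz j)

/-- A multivalued meromorphic function can be written in terms of the normalised roots, of
sufficiently divisible order, of the coordinates of any prescribed system. -/
lemma HasRamifiedForm.exists_normal_form {y : Boundary n D} {f : X → ℂ} {m : Fin n → ℕ}
    {g : (Fin n → ℂ) → ℂ} (h : HasRamifiedForm y f m g) (c : AdaptedChart n D y.1.pt) :
    ∃ d : ℕ, 1 ≤ d ∧ ∀ e : ℕ, 1 ≤ e → ∃ (M : Fin n → ℕ) (G : (Fin n → ℂ) → ℂ),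
      (∀ i, i ∉ range c.idx → M i = 0) ∧ AnalyticAt ℂ G 0 ∧ ∀ᶠ z in nearFilter y,
        f z * ∏ i, rootCoord y c (d * e) z i ^ M i = G (rootCoord y c (d * e) z) := by
  obtain ⟨c₂, d, s, hd, ⟨V, hV, hs, hbr⟩, hm0, hg, hev⟩ := h
  let := c.fintypeIdx
  have hdC : (d : ℂ) ≠ 0 := by exact_mod_cast (by omega : d ≠ 0)
  refine ⟨d, hd, fun e he => ?_⟩
  have hde : 1 ≤ d * e := Nat.mul_pos hd he
  choose r hr hr0 hratio using c.exists_analytic_ratio c₂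
  have hρ : ∀ j, ∃ ρ : ℂ, ρ ^ d = r j 0 * coordPhase y c j := fun j =>
    IsAlgClosed.exists_pow_nat_eq _ (by omega)
  choose ρ hρ using hρ
  have hρ0 : ∀ j, ρ j ≠ 0 := fun j h0 => by
    have := hρ j
    rw [h0, zero_pow (by omega)] at this
    exact mul_ne_zero (hr0 j) (coordPhase_ne_zero y c j) this.symm
  -- the `d`-th root of the ratio of the two coordinates
  set R : {j : J // y.1.pt ∈ D j} → (Fin n → ℂ) → ℂ := fun j w =>
    ρ j * Complex.exp (Complex.log (r j w / r j 0) / d) with hR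
  have hRan : ∀ j, AnalyticAt ℂ (R j) 0 := fun j => by
    refine analyticAt_const.mul (AnalyticAt.cexp' ?_)
    refine AnalyticAt.div ?_ analyticAt_const hdC
    refine AnalyticAt.clog ((hr j).div analyticAt_const (hr0 j)) ?_
    rw [div_self (hr0 j)]
    exact Complex.one_mem_slitPlane
  have hRne : ∀ j w, R j w ≠ 0 := fun j w => mul_ne_zero (hρ0 j) (Complex.exp_ne_zero _)
  have hRpow : ∀ j w, r j w ≠ 0 → R j w ^ d = r j w * coordPhase y c j := fun j w hw => by
    rw [hR, mul_pow, hρ, ← Complex.exp_nat_mul, mul_div_cancel₀ _ hdC,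
      Complex.exp_log (div_ne_zero hw (hr0 j))]
    field_simp [hr0 j]
  -- two roots of the same coordinate differ by a constant root of unity
  have hroot : ∀ j, ∃ ζ : ℂ, ζ ^ d = 1 ∧ ∀ᶠ z in nearFilter y, s z (c₂.idx j)
      = ζ * (rootCoord y c (d * e) z (c.idx j) ^ e * R j (c.chart z)) := by
    intro j
    have hW : ∀ᶠ z in nearFilter y, z ∈ V ∧ z ∈ c.chart.source ∧ AnalyticAt ℂ (R j) (c.chart z) ∧
        r j (c.chart z) ≠ 0 ∧ c.chart z (c.idx j) / coordPhase y c j ∈ Complex.slitPlane ∧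
        c.chart z (c.idx j) ≠ 0 ∧
        c₂.chart z (c₂.idx j) = c.chart z (c.idx j) * r j (c.chart z) := by
      have hT := c.tendsto_chart.mono_left (tendsto_nearFilter y)
      filter_upwards [hV, tendsto_nearFilter y c.source_mem,
        hT.eventually (hRan j).eventually_analyticAt,
        hT.eventually ((hr j).continuousAt.eventually_ne (hr0 j)),
        eventually_mem_sector y c one_pos one_pos, eventually_coord_ne y c,
        tendsto_nearFilter y (hratio j)] with z h1 h2 h3 h4 h5 h6 h7
      refine ⟨h1, h2, h3, h4, Or.inl ?_, h6 j, h7⟩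
      have h8 := h5.2 j
      rw [sub_self, zero_mul] at h8
      have hp := coordPhase_ne_zero y c j
      have h9 : c.chart z (c.idx j) / coordPhase y c j
          = c.chart z (c.idx j) * (starRingEnd ℂ) (coordPhase y c j) := by
        rw [div_eq_iff hp, mul_assoc, mul_comm ((starRingEnd ℂ) _), Complex.mul_conj,
          Complex.normSq_eq_norm_sq, norm_coordPhase]
        simp
      rw [h9]; exact h8
    refine eventually_eq_const_mul y c hd hW (s := fun z => s z (c₂.idx j))
      (q := fun z => rootCoord y c (d * e) z (c.idx j) ^ e * R j (c.chart z))
      ((continuous_apply (c₂.idx j)).comp_continuousOn (hs.mono fun z hz => hz.1)) ?_ ?_ ?_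
    · intro z hz
      refine ContinuousAt.continuousWithinAt (ContinuousAt.mul ?_ ?_)
      · simp only [rootCoord_idx]
        have h1 : ContinuousAt (fun z => c.chart z (c.idx j)) z :=
          (continuous_apply (c.idx j)).continuousAt.comp (c.chart.continuousAt hz.2.1)
        exact (Complex.continuous_exp.continuousAt.comp
          (((h1.div_const _).clog hz.2.2.2.2.1).div_const _)).pow _
      · exact hz.2.2.1.continuousAt.comp (c.chart.continuousAt hz.2.1)
    · intro z _
      refine mul_ne_zero (pow_ne_zero _ ?_) (hRne _ _)
      rw [rootCoord_idx]; exact Complex.exp_ne_zero _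
    · intro z hz
      have h1 := coordPhase_mul_rootCoord_pow y c hde hz.2.2.2.2.2.1
      have h2 := (hbr z hz.1 (c₂.idx j)).1 ⟨j, rfl⟩
      rw [h2, hz.2.2.2.2.2.2, mul_pow, ← pow_mul, mul_comm e d, hRpow j _ hz.2.2.2.1, ← h1]
      ring
  choose ζ hζ hroot using hroot
  have hζ0 : ∀ j, ζ j ≠ 0 := fun j h0 => by
    have := hζ j
    rw [h0, zero_pow (by omega)] at this
    exact zero_ne_one this
  -- the branch `s` in terms of the normalised roots
  set S : (Fin n → ℂ) → Fin n → ℂ := fun σ => Function.extend c₂.idx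
    (fun j => ζ j * (σ (c.idx j) ^ e * R j (powCoord y c (d * e) σ)))
    (fun i => c₂.chart (c.chart.symm (powCoord y c (d * e) σ)) i) with hS
  have hψ := analyticAt_powCoord y c (d := d * e) 0
  have hψ0 := powCoord_zero y c hde
  have hSan : AnalyticAt ℂ S 0 := by
    refine analyticAt_extend c₂ (fun j => analyticAt_const.mul
      (((analyticAt_coord _ _).pow _).mul ((hRan j).comp_of_eq hψ hψ0))) fun i _ => ?_
    have h1 : AnalyticAt ℂ ((fun z => c₂.chart z i) ∘ c.chart.symm) 0 :=
      c.analyticAt_comp_symm ((c₂.contMDiffOn_coord _).contMDiffAt c₂.source_mem)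
    exact h1.comp_of_eq hψ hψ0
  have hS0 : S 0 = 0 := by
    ext i
    by_cases hi : i ∈ range c₂.idx
    · obtain ⟨j, rfl⟩ := hi
      simp only [hS]
      rw [c₂.idx.injective.extend_apply, Pi.zero_apply, zero_pow (by omega), zero_mul, mul_zero,
        Pi.zero_apply]
    · simp only [hS]
      rw [Function.extend_apply' _ _ _ hi, hψ0, c.symm_zero, c₂.map_base]
  set M : Fin n → ℕ := Function.extend c.idx (fun j => e * m (c₂.idx j)) 0 with hM
  refine ⟨M, fun σ => g (S σ) *
    (∏ j, (ζ j * R j (powCoord y c (d * e) σ)) ^ m (c₂.idx j))⁻¹, ?_, ?_, ?_⟩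
  · intro i hi
    exact Function.extend_apply' _ _ _ hi
  · refine AnalyticAt.mul ((by rwa [hS0] : AnalyticAt ℂ g (S 0)).comp hSan) (AnalyticAt.inv ?_ ?_)
    · exact Finset.analyticAt_fun_prod _ fun j _ =>
        (analyticAt_const.mul ((hRan j).comp_of_eq hψ hψ0)).pow _
    · exact Finset.prod_ne_zero_iff.2 fun j _ => pow_ne_zero _ (mul_ne_zero (hζ0 j) (hRne _ _))
  · filter_upwards [hev, eventually_all.2 hroot, eventually_coord_ne y c, hV,
      tendsto_nearFilter y c.source_mem] with z h1 h2 h3 h4 h5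
    have hψz := powCoord_rootCoord y c hde h3
    have hSz : S (rootCoord y c (d * e) z) = s z := by
      ext i
      by_cases hi : i ∈ range c₂.idx
      · obtain ⟨j, rfl⟩ := hi
        simp only [hS]
        rw [c₂.idx.injective.extend_apply, hψz, h2 j]
      · simp only [hS]
        rw [Function.extend_apply' _ _ _ hi, hψz, c.chart.left_inv h5, (hbr z h4 i).2 hi]
    rw [hSz, ← h1, hψz]
    have h6 : ∏ i, s z i ^ m i = ∏ j, s z (c₂.idx j) ^ m (c₂.idx j) :=
      (Fintype.prod_of_injective c₂.idx c₂.idx.injective _ (fun i => s z i ^ m i)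
        (fun i hi => by simp only [hm0 i hi, pow_zero]) fun _ => rfl).symm
    have h7 : ∏ i, rootCoord y c (d * e) z i ^ M i
        = ∏ j, (rootCoord y c (d * e) z (c.idx j) ^ e) ^ m (c₂.idx j) := by
      rw [c.prod_eq (fun i => rootCoord y c (d * e) z i ^ M i) fun i hi => by
        rw [hM, Function.extend_apply' _ _ _ hi, Pi.zero_apply, pow_zero]]
      refine Finset.prod_congr rfl fun j _ => ?_
      rw [hM, c.idx.injective.extend_apply, pow_mul]
    have h8 : ∏ j, (ζ j * R j (c.chart z)) ^ m (c₂.idx j) ≠ 0 :=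
      Finset.prod_ne_zero_iff.2 fun j _ => pow_ne_zero _ (mul_ne_zero (hζ0 j) (hRne _ _))
    rw [h6, h7, eq_mul_inv_iff_mul_eq₀ h8, mul_assoc, ← Finset.prod_mul_distrib]
    congr 1
    refine Finset.prod_congr rfl fun j _ => ?_
    rw [h2 j, ← mul_pow]
    congr 1
    ring

/-- The order on the stalks is antisymmetric: the difference of two multivalued meromorphic
functions is bounded as soon as its real part has at most logarithmic growth. -/
lemma leAt_antisymm {y : Boundary n D} (c : AdaptedChart n D y.1.pt) {a b : expStalk y}
    (h1 : leAt y a b) (h2 : leAt y b a) : a = b := by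
  obtain ⟨f₁, ⟨m₁, g₁, hf₁⟩, ha⟩ := a.2
  obtain ⟨f₂, ⟨m₂, g₂, hf₂⟩, hb⟩ := b.2
  let := c.fintypeIdx
  obtain ⟨d₁, hd₁, H₁⟩ := hf₁.exists_normal_form c
  obtain ⟨d₂, hd₂, H₂⟩ := hf₂.exists_normal_form c
  obtain ⟨M₁, G₁, hM₁, hG₁, hfG₁⟩ := H₁ d₂ hd₂
  obtain ⟨M₂, G₂, hM₂, hG₂, hfG₂⟩ := H₂ d₁ hd₁
  rw [mul_comm d₂ d₁] at hfG₂
  set d := d₁ * d₂ with hd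
  have hd1 : 1 ≤ d := Nat.mul_pos hd₁ hd₂
  have hdR : (1 : ℝ) ≤ d := by exact_mod_cast hd1
  obtain ⟨K₁, hK₁⟩ := (leAt_iff c (f := f₁ - f₂) (by rw [germ_sub, ha, hb])).1 h1
  obtain ⟨K₂, hK₂⟩ := (leAt_iff c (f := f₂ - f₁) (by rw [germ_sub, ha, hb])).1 h2
  have hV : ∀ᶠ z in nearFilter y, ((f₁ z - f₂ z).re ≤ K₁ * logWeight c z ∧
      (f₂ z - f₁ z).re ≤ K₂ * logWeight c z) ∧
      f₁ z * ∏ i, rootCoord y c d z i ^ M₁ i = G₁ (rootCoord y c d z) ∧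
      f₂ z * ∏ i, rootCoord y c d z i ^ M₂ i = G₂ (rootCoord y c d z) :=
    (hK₁.and hK₂).and (hfG₁.and hfG₂)
  obtain ⟨Q, hQ, hQ0, hQs, hTQ, hQev⟩ := exists_root_region y c hd1 hV
  -- the difference of the two functions in terms of the normalised roots
  set F : (Fin n → ℂ) → ℂ := fun σ =>
    f₁ (c.chart.symm (powCoord y c d σ)) - f₂ (c.chart.symm (powCoord y c d σ)) with hF
  have hmono : ∀ M : Fin n → ℕ, AnalyticAt ℂ (fun σ : Fin n → ℂ => ∏ i, σ i ^ M i) 0 := fun M =>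
    Finset.analyticAt_fun_prod _ fun i _ => (analyticAt_coord i 0).pow _
  obtain ⟨C, hC⟩ := exists_norm_le_of_abs_re_le hQ hQ0 hQs (F := F) (K := (|K₁| + |K₂|) * d) (by
      filter_upwards [hQev, self_mem_nhdsWithin] with σ hσ hσQ
      obtain ⟨hσV, hσc, hσr⟩ := hσ
      have hw : logWeight c (c.chart.symm (powCoord y c d σ))
          ≤ d * (1 + ∑ i, |Real.log ‖σ i‖|) := by
        have h3 : logWeight c (c.chart.symm (powCoord y c d σ))
            = 1 + ∑ j, d * |Real.log ‖σ (c.idx j)‖| := by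
          have h4 : ∀ j, |Real.log ‖c.chart (c.chart.symm (powCoord y c d σ)) (c.idx j)‖|
              = d * |Real.log ‖σ (c.idx j)‖| := fun j => by
            rw [hσc, powCoord_idx, norm_mul, norm_coordPhase, one_mul, norm_pow, Real.log_pow,
              abs_mul, Nat.abs_cast]
          rw [← Finset.sum_congr rfl fun j _ => h4 j]
          rfl
        have h5 : ∑ j, |Real.log ‖σ (c.idx j)‖| ≤ ∑ i, |Real.log ‖σ i‖| := by
          rw [← Finset.sum_map Finset.univ c.idx (fun i => |Real.log ‖σ i‖|)]
          exact Finset.sum_le_sum_of_subset_of_nonneg (Finset.subset_univ _)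
            fun _ _ _ => abs_nonneg _
        rw [h3, ← Finset.mul_sum, mul_add, mul_one]
        gcongr
      have h6 : (0 : ℝ) ≤ d * (1 + ∑ i, |Real.log ‖σ i‖|) := by positivity
      have h7 := zero_le_one.trans (one_le_logWeight c (c.chart.symm (powCoord y c d σ)))
      have h8 := hσV.1.1
      have h9 := hσV.1.2
      rw [Complex.sub_re] at h8 h9
      have h10 := mul_le_mul_of_nonneg_right (le_abs_self K₁) h7
      have h11 := mul_le_mul_of_nonneg_right (le_abs_self K₂) h7
      have h12 := mul_le_mul_of_nonneg_left hw (abs_nonneg K₁)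
      have h13 := mul_le_mul_of_nonneg_left hw (abs_nonneg K₂)
      have h14 := mul_nonneg (abs_nonneg K₁) h6
      have h15 := mul_nonneg (abs_nonneg K₂) h6
      rw [mul_assoc, add_mul]
      simp only [hF]
      rw [Complex.sub_re, abs_le]
      constructor <;> linarith)
    _ (M₁ + M₂) (fun σ => (∏ i, σ i ^ M₂ i) * G₁ σ - (∏ i, σ i ^ M₁ i) * G₂ σ) rfl
    (fun i hi => by rw [Pi.add_apply, hM₁ i hi, hM₂ i hi])
    (((hmono M₂).mul hG₁).sub ((hmono M₁).mul hG₂)) (by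
      filter_upwards [hQev] with σ hσ
      obtain ⟨⟨-, h3, h4⟩, hσc, hσr⟩ := hσ
      rw [hσr] at h3 h4
      simp only [Pi.add_apply, pow_add, Finset.prod_mul_distrib, ← h3, ← h4, hF]
      ring)
  refine Subtype.ext ?_
  rw [← ha, ← hb, germ_eq_germ_iff, mem_boundedNear_iff]
  refine ⟨C, ?_⟩
  filter_upwards [hTQ.eventually hC, eventually_coord_ne y c,
    tendsto_nearFilter y c.source_mem] with z h3 h4 h5
  simp only [hF] at h3
  rwa [powCoord_rootCoord y c hd1 h4, c.chart.left_inv h5] at h3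

end NormalForm

/-! ### Exponential factors at neighbouring points -/

section Recentre

open Asymptotics

variable {n : ℕ} {X : Type u} [TopologicalSpace X] [ChartedSpace (Fin n → ℂ) X] {J : Type t}
  {D : J → Set X}

lemma AdaptedChart.mem_of_mem {x x' : X} (c : AdaptedChart n D x) (hx' : x' ∈ c.chart.source)
    {j : J} (hj : x' ∈ D j) : x ∈ D j := by
  by_contra h
  exact c.notMem j h x' hx' hj

lemma AdaptedChart.isOpen_recentre {x : X} (c : AdaptedChart n D x) (x' : X) :
    IsOpen (c.chart.source ∩ c.chart ⁻¹' {w | ∀ j, x' ∉ D j.1 → w (c.idx j) ≠ 0}) := by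
  let := c.fintypeIdx
  refine c.chart.isOpen_inter_preimage ?_
  have : {w : Fin n → ℂ | ∀ j, x' ∉ D j.1 → w (c.idx j) ≠ 0}
      = ⋂ j, {w | x' ∉ D j.1 → w (c.idx j) ≠ 0} := by
    ext; simp
  rw [this]
  refine isOpen_iInter_of_finite fun j => ?_
  by_cases h : x' ∈ D j.1
  · simp [h]
  · simpa [h] using isOpen_ne_fun (continuous_apply (c.idx j)) continuous_const

/-- The coordinate system centred at a neighbouring point which is obtained by translation, on the
complement of the members of the family that do not contain this point. -/
def AdaptedChart.recentre [IsManifold 𝓘(ℂ, Fin n → ℂ) ω X] {x x' : X} (c : AdaptedChart n D x)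
    (hx' : x' ∈ c.chart.source) : AdaptedChart n D x' where
  chart := (c.chart.restrOpen _ (c.isOpen_recentre x')).transHomeomorph
    (Homeomorph.addRight (-c.chart x'))
  chart_mem := by
    refine OpenPartialHomeomorph.mem_maximalAtlas_of_contMDiffOn _ ?_ ?_
    · have h1 : ContMDiff 𝓘(ℂ, Fin n → ℂ) 𝓘(ℂ, Fin n → ℂ) ω
          (fun w : Fin n → ℂ => w + -c.chart x') := (contDiff_id.add contDiff_const).contMDiff
      refine h1.comp_contMDiffOn ((contMDiffOn_of_mem_maximalAtlas c.chart_mem).mono ?_)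
      intro z hz
      exact hz.1
    · have h1 : ContMDiff 𝓘(ℂ, Fin n → ℂ) 𝓘(ℂ, Fin n → ℂ) ω
          (fun w : Fin n → ℂ => w + - -c.chart x') := (contDiff_id.add contDiff_const).contMDiff
      refine (contMDiffOn_symm_of_mem_maximalAtlas c.chart_mem).comp h1.contMDiffOn ?_
      intro w hw
      exact hw.1
  mem_source := ⟨hx', hx', fun j hj h0 => hj ((c.mem_iff j x' hx').2 h0)⟩
  map_base := by
    show c.chart x' + -c.chart x' = 0
    rw [add_neg_cancel]
  idx := ⟨fun j => c.idx ⟨j.1, c.mem_of_mem hx' j.2⟩, fun j j' h => by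
    have := c.idx.injective h
    rw [Subtype.mk.injEq] at this
    exact Subtype.ext this⟩
  mem_iff := fun j z hz => by
    have h0 : c.chart x' (c.idx ⟨j.1, c.mem_of_mem hx' j.2⟩) = 0 :=
      (c.mem_iff ⟨j.1, c.mem_of_mem hx' j.2⟩ x' hx').1 j.2
    show z ∈ D j.1 ↔ (c.chart z + -c.chart x') (c.idx ⟨j.1, c.mem_of_mem hx' j.2⟩) = 0
    rw [Pi.add_apply, Pi.neg_apply, h0, neg_zero, add_zero]
    exact c.mem_iff ⟨j.1, c.mem_of_mem hx' j.2⟩ z hz.1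
  notMem := fun j hj z hz hzj => by
    by_cases h : x ∈ D j
    · exact hz.2.2 ⟨j, h⟩ hj ((c.mem_iff ⟨j, h⟩ z hz.1).1 hzj)
    · exact c.notMem j h z hz.1 hzj

lemma AdaptedChart.recentre_apply [IsManifold 𝓘(ℂ, Fin n → ℂ) ω X] {x x' : X}
    (c : AdaptedChart n D x) (hx' : x' ∈ c.chart.source) (z : X) (i : Fin n) :
    (c.recentre hx').chart z i = c.chart z i - c.chart x' i := by
  show (c.chart z + -c.chart x') i = _
  rw [Pi.add_apply, Pi.neg_apply, sub_eq_add_neg]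

lemma AdaptedChart.mem_range_recentre_idx [IsManifold 𝓘(ℂ, Fin n → ℂ) ω X] {x x' : X}
    (c : AdaptedChart n D x) (hx' : x' ∈ c.chart.source) {i : Fin n} :
    i ∈ range (c.recentre hx').idx ↔ ∃ j, c.idx j = i ∧ x' ∈ D j.1 := by
  constructor
  · rintro ⟨j, rfl⟩
    exact ⟨⟨j.1, c.mem_of_mem hx' j.2⟩, rfl, j.2⟩
  · rintro ⟨j, rfl, hj⟩
    exact ⟨⟨j.1, hj⟩, rfl⟩

/-- A multivalued meromorphic function near `y` is multivalued meromorphic near the boundary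
points close to `y`: the coordinates which no longer vanish contribute analytic factors. -/
lemma IsMultivaluedMero.eventually [IsManifold 𝓘(ℂ, Fin n → ℂ) ω X] {y : Boundary n D}
    {f : X → ℂ} (hf : IsMultivaluedMero y f) : ∀ᶠ t in 𝓝 y, IsMultivaluedMero t f := by
  classical
  obtain ⟨m, g, c, d, s, hd, ⟨V, hV, hs, hbr⟩, hm0, hg, hev⟩ := hf
  let := c.fintypeIdx
  have hdC : (d : ℂ) ≠ 0 := by exact_mod_cast (by omega : d ≠ 0)
  have hroot := fun j => eventually_eq_root y c j hd hV (s := fun z => s z (c.idx j))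
    ((continuous_apply (c.idx j)).comp_continuousOn hs)
    (fun z hz => (hbr z hz (c.idx j)).1 ⟨j, rfl⟩)
  choose ζ hζ hroot using hroot
  have hζ1 : ∀ j, ‖ζ j‖ = 1 := fun j => by
    have := congrArg norm (hζ j)
    rw [norm_pow, norm_coordPhase] at this
    exact (pow_eq_one_iff_of_nonneg (norm_nonneg _) (by omega)).1 this
  have hζ0 : ∀ j, ζ j ≠ 0 := fun j => by rw [← norm_ne_zero_iff, hζ1]; exact one_ne_zero
  -- the values of the ramified coordinates at the points close to `y`
  set T : X → Fin n → ℂ := fun x' => Function.extend c.idx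
    (fun j => if c.chart x' (c.idx j) = 0 then 0 else
      ζ j * Complex.exp (Complex.log (c.chart x' (c.idx j) / coordPhase y c j) / d))
    (c.chart x') with hT
  have hTlim : Tendsto T (𝓝 y.1.pt) (𝓝 0) := by
    refine tendsto_zero_of_norm_pow c hd le_rfl (Eventually.of_forall fun z i => ⟨?_, fun hi => ?_⟩)
    · rintro ⟨j, rfl⟩
      simp only [hT, c.idx.injective.extend_apply]
      split_ifs with h0
      · rw [h0, norm_zero, zero_pow (by omega)]
      · rw [← norm_pow, mul_pow, hζ, ← Complex.exp_nat_mul, mul_div_cancel₀ _ hdC,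
          Complex.exp_log (div_ne_zero h0 (coordPhase_ne_zero y c j)),
          mul_div_cancel₀ _ (coordPhase_ne_zero y c j)]
    · simp only [hT]
      rw [Function.extend_apply' _ _ _ hi]
  have hpt : Tendsto (fun t : Boundary n D => t.1.pt) (𝓝 y) (𝓝 y.1.pt) :=
    (RealBlowup.continuous_pt.comp continuous_subtype_val).tendsto y
  have hphase : ∀ᶠ t in 𝓝 y, ∀ j, c.chart t.1.pt (c.idx j) ≠ 0 →
      c.chart t.1.pt (c.idx j) / coordPhase y c j ∈ Complex.slitPlane := by
    rw [eventually_all]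
    intro j
    have hW : IsOpen {q : Circle | (q : ℂ) / coordPhase y c j ∈ Complex.slitPlane} :=
      Complex.isOpen_slitPlane.preimage (continuous_coe_circle.div_const _)
    have h1 := RealBlowup.eventually_phase_mem y.1 (c.isLocalEquation j) c.mem_source hW (by
      show coordPhase y c j / coordPhase y c j ∈ Complex.slitPlane
      rw [div_self (coordPhase_ne_zero y c j)]
      exact Complex.one_mem_slitPlane)
    filter_upwards [(continuous_subtype_val.tendsto y).eventually h1] with t ⟨ht, htW⟩ h0
    have h2 := t.1.phase_of_ne j.1 ⟨_, _, ht, c.isLocalEquation j⟩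
    simp only at h2
    rw [h2, mul_div_assoc]
    refine Complex.mem_slitPlane_iff_arg.2 ⟨?_, mul_ne_zero (by simpa using h0)
      (Complex.slitPlane_ne_zero htW)⟩
    rw [Complex.arg_real_mul _ (norm_pos_iff.2 h0)]
    exact Complex.slitPlane_arg_ne_pi htW
  filter_upwards [hpt c.source_mem, hphase,
    hpt (hTlim.eventually hg.eventually_analyticAt),
    eventually_eventually_nearFilter hV, eventually_eventually_nearFilter hev,
    eventually_eventually_nearFilter (eventually_all.2 hroot)]
    with t ht htph htg htV htev htroot
  -- the coordinates vanishing at `t` keep their roots as ramified coordinates, the others are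
  -- translated; `Ψ` recovers the old ramified coordinates from the new ones
  set c' := c.recentre ht with hc'
  have hidx : ∀ {i}, i ∈ range c'.idx ↔ ∃ j, c.idx j = i ∧ t.1.pt ∈ D j.1 :=
    c.mem_range_recentre_idx ht
  have hidx' : ∀ {j}, c.idx j ∈ range c'.idx ↔ c.chart t.1.pt (c.idx j) = 0 := by
    intro j
    rw [hidx, ← c.mem_iff j _ ht]
    refine ⟨?_, fun h => ⟨j, rfl, h⟩⟩
    rintro ⟨j', hj', h⟩
    rwa [← c.idx.injective hj']
  set s' : X → Fin n → ℂ := fun z i =>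
    if i ∈ range c'.idx then s z i else c.chart z i - c.chart t.1.pt i with hs'
  set Ψ : (Fin n → ℂ) → Fin n → ℂ := fun σ => Function.extend c.idx
    (fun j => if c.chart t.1.pt (c.idx j) = 0 then σ (c.idx j) else
      ζ j * Complex.exp (Complex.log
        ((σ (c.idx j) + c.chart t.1.pt (c.idx j)) / coordPhase y c j) / d))
    (fun i => σ i + c.chart t.1.pt i) with hΨ
  have hΨ0 : Ψ 0 = T t.1.pt := by
    simp only [hΨ, hT, Pi.zero_apply, zero_add]
  have hΨan : AnalyticAt ℂ Ψ 0 := by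
    refine analyticAt_extend c (fun j => ?_) fun i _ => (analyticAt_coord i 0).add analyticAt_const
    by_cases h0 : c.chart t.1.pt (c.idx j) = 0
    · simp only [if_pos h0]
      exact analyticAt_coord _ _
    · simp only [if_neg h0]
      refine analyticAt_const.mul (AnalyticAt.cexp' (AnalyticAt.div ?_ analyticAt_const hdC))
      refine AnalyticAt.clog (((analyticAt_coord _ _).add analyticAt_const).div analyticAt_const
        (coordPhase_ne_zero y c j)) ?_
      simpa using htph j h0
  have hΨs : ∀ᶠ z in nearFilter t, Ψ (s' z) = s z := by
    filter_upwards [htV, htroot] with z hzV hz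
    ext i
    by_cases hi : i ∈ range c.idx
    · obtain ⟨j, rfl⟩ := hi
      simp only [hΨ, c.idx.injective.extend_apply]
      split_ifs with h0
      · rw [hs']; simp only [if_pos (hidx'.2 h0)]
      · rw [(hz j).2, hs']
        simp only [if_neg (fun h => h0 (hidx'.1 h)), sub_add_cancel]
    · simp only [hΨ]
      have h1 : i ∉ range c'.idx := fun h => by
        obtain ⟨j, rfl, _⟩ := hidx.1 h
        exact hi ⟨j, rfl⟩
      rw [Function.extend_apply' _ _ _ hi, (hbr z hzV i).2 hi, hs']
      simp only [if_neg h1, sub_add_cancel]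
  have hne : ∀ σ i, i ∉ range c'.idx → Ψ σ i ^ m i ≠ 0 := by
    intro σ i hi
    by_cases hi' : i ∈ range c.idx
    · obtain ⟨j, rfl⟩ := hi'
      refine pow_ne_zero _ ?_
      simp only [hΨ, c.idx.injective.extend_apply]
      rw [if_neg (fun h => hi (hidx'.2 h))]
      exact mul_ne_zero (hζ0 j) (Complex.exp_ne_zero _)
    · rw [hm0 i hi', pow_zero]; exact one_ne_zero
  -- the factors of the denominator which do not vanish at `t` are moved to the numerator
  refine ⟨fun i => if i ∈ range c'.idx then m i else 0,
    fun σ => g (Ψ σ) * (∏ i with i ∉ range c'.idx, Ψ σ i ^ m i)⁻¹,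
    c', d, s', hd, ⟨V ∩ c.chart.source, inter_mem htV (tendsto_nearFilter t
      (c.chart.open_source.mem_nhds ht)), ?_, ?_⟩, fun i hi => if_neg hi, ?_, ?_⟩
  · refine continuousOn_pi.2 fun i => ?_
    by_cases hi : i ∈ range c'.idx
    · simp only [hs', if_pos hi]
      exact (continuous_apply i).comp_continuousOn (hs.mono inter_subset_left)
    · simp only [hs', if_neg hi]
      exact (((continuous_apply i).comp_continuousOn c.chart.continuousOn).mono
        inter_subset_right).sub continuousOn_const
  · intro z hz i
    refine ⟨fun hi => ?_, fun hi => ?_⟩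
    · obtain ⟨j, rfl, hj⟩ := hidx.1 hi
      simp only [hs', if_pos hi]
      rw [(hbr z hz.1 _).1 ⟨j, rfl⟩, c.recentre_apply ht, (c.mem_iff j _ ht).1 hj, sub_zero]
    · simp only [hs', if_neg hi]
      rw [c.recentre_apply ht]
  · refine AnalyticAt.mul (AnalyticAt.comp (by rwa [hΨ0]) hΨan) (AnalyticAt.inv ?_ ?_)
    · exact Finset.analyticAt_fun_prod _ fun i _ => ((analyticAt_pi_iff.1 hΨan) i).pow _
    · exact Finset.prod_ne_zero_iff.2 fun i hi => hne _ i (Finset.mem_filter.1 hi).2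
  · filter_upwards [htev, hΨs] with z h1 h2
    rw [h2, ← h1]
    have h3 : ∏ i with i ∉ range c'.idx, s z i ^ m i ≠ 0 :=
      Finset.prod_ne_zero_iff.2 fun i hi => by
        rw [← h2]; exact hne _ i (Finset.mem_filter.1 hi).2
    rw [eq_mul_inv_iff_mul_eq₀ h3, mul_assoc,
      ← Finset.prod_filter_mul_prod_filter_not Finset.univ (fun i => i ∈ range c'.idx)
        (fun i => s z i ^ m i)]
    congr 2
    rw [Finset.prod_filter]
    refine Finset.prod_congr rfl fun i _ => ?_
    by_cases hi : i ∈ range c'.idx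
    · simp only [hs', if_pos hi]
    · simp only [if_neg hi, pow_zero]

end Recentre

/-! ### Good families of exponential factors along the circles of directions -/

section Circle

variable {n : ℕ} {X : Type u} [TopologicalSpace X] [ChartedSpace (Fin n → ℂ) X] {J : Type t}
  {D : J → Set X}

lemma eventually_rot_add {y : Boundary n D} {θ₀ : ℝ} {P : Boundary n D → Prop}
    (h : ∀ᶠ t in 𝓝 (rot y θ₀), P t) : ∀ᶠ θ in 𝓝 θ₀, P (rot y θ) :=
  ((continuous_rot y).tendsto θ₀).eventually h

/-- The germ `a` has a representative with leading term `(ℓ, κ)`; by `HasLead.congr` this is then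
true of all its representatives. -/
def GermHasLead (y : Boundary n D) (a : GermModBounded y) (ℓ : ℝ) (κ : ℂ) : Prop :=
  ∃ f, germ y f = a ∧ HasLead y f ℓ κ

lemma GermHasLead.hasLead {y : Boundary n D} {a : GermModBounded y} {ℓ : ℝ} {κ : ℂ}
    (h : GermHasLead y a ℓ κ) {f : X → ℂ} (hf : germ y f = a) : HasLead y f ℓ κ := by
  obtain ⟨g, hg, hl⟩ := h
  exact hl.congr (hf.trans hg.symm)

/-- The leading term, along a whole circle of directions, of a section whose germs are purely
monomial. -/
lemma exists_germHasLead (y : Boundary n D) (c : AdaptedChart n D y.1.pt)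
    (a : ∀ θ : ℝ, GermModBounded (rot y θ))
    (ha : ∀ θ₀, ∃ f, ∀ᶠ θ in 𝓝 θ₀, germ (rot y θ) f = a θ)
    (hm : ∀ θ, IsPurelyMonomial (rot y θ) (a θ)) :
    ∃ (ℓ : ℝ) (κ : ℂ), ∀ θ : ℝ,
      GermHasLead (rot y θ) (a θ) ℓ (κ * Complex.exp (-(Complex.I * (ℓ * θ)))) := by
  have hloc : ∀ θ₀ : ℝ, ∃ (ℓ : ℝ) (κ : ℂ), ∀ᶠ θ : ℝ in 𝓝 θ₀,
      GermHasLead (rot y θ) (a θ) ℓ (κ * Complex.exp (-(Complex.I * (ℓ * θ)))) := by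
    intro θ₀
    obtain ⟨f, m, g, hf, hform, hm0, hg0⟩ := hm θ₀
    obtain ⟨f', hf'⟩ := ha θ₀
    obtain ⟨ℓ, κ, hlead⟩ := hform.exists_hasLead hm0 hg0
    have hfa : ∀ᶠ θ in 𝓝 θ₀, germ (rot y θ) f = a θ := by
      filter_upwards [hf', eventually_rot_add
        (eventually_germ_eq (hf.trans hf'.self_of_nhds.symm))] with θ h1 h2
      exact h2.trans h1
    have hT : Tendsto (fun θ : ℝ => θ - θ₀) (𝓝 θ₀) (𝓝 0) := by
      have : Continuous fun θ : ℝ => θ - θ₀ := by fun_prop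
      simpa using this.tendsto θ₀
    refine ⟨ℓ, κ * Complex.exp (Complex.I * (ℓ * θ₀)), ?_⟩
    filter_upwards [hfa, hT.eventually hlead] with θ h1 h2
    refine ⟨f, h1, ?_⟩
    rw [rot_add, add_sub_cancel] at h2
    rw [mul_assoc, ← Complex.exp_add]
    convert h2 using 3
    push_cast
    ring
  choose L k hLk using hloc
  have key : ∀ {θ : ℝ} {ℓ ℓ' : ℝ} {κ κ' : ℂ},
      GermHasLead (rot y θ) (a θ) ℓ (κ * Complex.exp (-(Complex.I * (ℓ * θ)))) →
      GermHasLead (rot y θ) (a θ) ℓ' (κ' * Complex.exp (-(Complex.I * (ℓ' * θ)))) →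
      (ℓ, κ) = (ℓ', κ') := by
    intro θ ℓ ℓ' κ κ' h h'
    obtain ⟨f, hf, hl⟩ := h
    obtain ⟨h1, h2⟩ := HasLead.unique (y := rot y θ) c hl (h'.hasLead hf)
    subst h1
    exact Prod.ext rfl (mul_right_cancel₀ (Complex.exp_ne_zero _) h2)
  have hconst : IsLocallyConstant fun θ => (L θ, k θ) := by
    rw [IsLocallyConstant.iff_eventually_eq]
    intro θ₀
    filter_upwards [hLk θ₀] with θ hθ
    exact key (hLk θ).self_of_nhds hθ
  refine ⟨L 0, k 0, fun θ => ?_⟩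
  have h1 := hconst.apply_eq_of_isPreconnected isPreconnected_univ (mem_univ θ) (mem_univ 0)
  have h2 := (hLk θ).self_of_nhds
  rw [Prod.mk.injEq] at h1
  rwa [h1.1, h1.2] at h2

lemma re_mul_exp_eq_cos {κ : ℂ} (hκ : ‖κ‖ = 1) (ℓ θ : ℝ) :
    (κ * Complex.exp (-(Complex.I * (ℓ * θ)))).re = Real.cos (Complex.arg κ - ℓ * θ) := by
  have h1 : κ = Complex.exp (Complex.arg κ * Complex.I) := by
    conv_lhs => rw [← Complex.norm_mul_exp_arg_mul_I κ, hκ]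
    simp
  conv_lhs => rw [h1]
  rw [← Complex.exp_add, show (Complex.arg κ : ℂ) * Complex.I + -(Complex.I * (ℓ * θ))
    = ((Complex.arg κ - ℓ * θ : ℝ) : ℂ) * Complex.I by push_cast; ring,
    Complex.exp_ofReal_mul_I_re]

/-- A good family of exponential factors which is defined along the whole circle of directions is
described by the leading terms of its differences. -/
lemma exists_expData {ι : Type} (y : Boundary n D) (c : AdaptedChart n D y.1.pt)
    (A : ι → ∀ θ : ℝ, expStalk (rot y θ))
    (hsec : ∀ i θ₀, ∃ f, ∀ᶠ θ in 𝓝 θ₀, (A i θ).1 = germ (rot y θ) f)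
    (hne : ∀ i j, i ≠ j → ∀ θ, A i θ ≠ A j θ)
    (hgood : ∀ i j, i ≠ j → ∀ θ, IsPurelyMonomial (rot y θ) ((A i θ).1 - (A j θ).1)) :
    ∃ E : ExpData ι, ∀ θ i j, E.le θ i j ↔ leAt (rot y θ) (A i θ) (A j θ) := by
  classical
  have hlead : ∀ i j, ∃ (ℓ : ℝ) (κ : ℂ), i ≠ j → ∀ θ : ℝ,
      GermHasLead (rot y θ) ((A i θ).1 - (A j θ).1) ℓ
        (κ * Complex.exp (-(Complex.I * (ℓ * θ)))) := by
    intro i j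
    by_cases hij : i = j
    · exact ⟨0, 0, fun h => absurd hij h⟩
    · obtain ⟨ℓ, κ, h⟩ := exists_germHasLead y c (fun θ => (A i θ).1 - (A j θ).1) (fun θ₀ => by
        obtain ⟨f, hf⟩ := hsec i θ₀
        obtain ⟨g, hg⟩ := hsec j θ₀
        refine ⟨f - g, ?_⟩
        filter_upwards [hf, hg] with θ h1 h2
        rw [germ_sub, h1, h2]) (hgood i j hij)
      exact ⟨ℓ, κ, fun _ => h⟩
  choose L κ hL using hlead
  have hpos : ∀ i j, i ≠ j → 0 < L i j := fun i j h => by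
    obtain ⟨f, -, hf⟩ := hL i j h 0
    exact hf.pos
  have hκ : ∀ i j, i ≠ j → ‖κ i j‖ = 1 := fun i j h => by
    obtain ⟨f, -, hf⟩ := hL i j h 0
    simpa using hf.norm_eq
  have hcos : ∀ i j, i ≠ j → ∀ θ : ℝ, (κ i j * Complex.exp (-(Complex.I * (L i j * θ)))).re
      = Real.cos (Complex.arg (κ i j) - L i j * θ) := fun i j h θ =>
    re_mul_exp_eq_cos (hκ i j h) _ _
  have hsymm : ∀ i j, i ≠ j → ∀ θ : ℝ, L i j = L j i ∧
      κ j i * Complex.exp (-(Complex.I * (L j i * θ)))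
        = -(κ i j * Complex.exp (-(Complex.I * (L i j * θ)))) := by
    intro i j h θ
    obtain ⟨f, hf, hl⟩ := hL i j h θ
    have h1 : germ (rot y θ) (-f) = (A j θ).1 - (A i θ).1 := by
      rw [← neg_sub, ← hf]; rfl
    obtain ⟨h2, h3⟩ := HasLead.unique (y := rot y θ) c hl.neg ((hL j i h.symm θ).hasLead h1)
    exact ⟨h2, h3.symm⟩
  have hadd : ∀ i j l, i ≠ j → j ≠ l → i ≠ l → ∀ θ : ℝ, ∃ f g : X → ℂ,
      HasLead (rot y θ) f (L i j) (κ i j * Complex.exp (-(Complex.I * (L i j * θ)))) ∧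
      HasLead (rot y θ) g (L j l) (κ j l * Complex.exp (-(Complex.I * (L j l * θ)))) ∧
      HasLead (rot y θ) (f + g) (L i l) (κ i l * Complex.exp (-(Complex.I * (L i l * θ)))) := by
    intro i j l hij hjl hil θ
    obtain ⟨f, hf, hlf⟩ := hL i j hij θ
    obtain ⟨g, hg, hlg⟩ := hL j l hjl θ
    refine ⟨f, g, hlf, hlg, (hL i l hil θ).hasLead ?_⟩
    rw [show germ (rot y θ) (f + g) = germ (rot y θ) f + germ (rot y θ) g from rfl, hf, hg,
      sub_add_sub_cancel]
  -- the order is the sign of the cosine of the leading term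
  have hle : ∀ i j, i ≠ j → ∀ θ, leAt (rot y θ) (A i θ) (A j θ) ↔
      Real.cos (Complex.arg (κ i j) - L i j * θ) < 0 := by
    intro i j hij θ
    constructor
    · intro h
      obtain ⟨f₁, hf₁⟩ := hsec i θ
      obtain ⟨f₂, hf₂⟩ := hsec j θ
      have hf : ∀ᶠ θ' in 𝓝 θ, germ (rot y θ') (f₁ - f₂) = (A i θ').1 - (A j θ').1 := by
        filter_upwards [hf₁, hf₂] with θ' h1 h2
        rw [germ_sub, h1, h2]
      obtain ⟨K, hK⟩ := (leAt_iff (y := rot y θ) c hf.self_of_nhds).1 h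
      have hnonpos : ∀ᶠ θ' in 𝓝 θ, Real.cos (Complex.arg (κ i j) - L i j * θ') ≤ 0 := by
        filter_upwards [hf, eventually_rot_add (eventually_eventually_nearFilter hK)] with θ' h1 h2
        rw [← hcos i j hij]
        exact ((hL i j hij θ').hasLead h1).re_nonpos c h2
      -- the inequality holds near `θ`, and a sinusoid has no local maximum at a zero
      refine lt_of_le_of_ne hnonpos.self_of_nhds fun h0 => ?_
      have hmax : IsLocalMax (fun θ' : ℝ => Real.cos (Complex.arg (κ i j) - L i j * θ')) θ := by
        filter_upwards [hnonpos] with θ' h1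
        rw [h0]; exact h1
      have hder : HasDerivAt (fun θ' : ℝ => Real.cos (Complex.arg (κ i j) - L i j * θ'))
          (-Real.sin (Complex.arg (κ i j) - L i j * θ) * -(L i j)) θ := by
        have h1 : HasDerivAt (fun θ' : ℝ => Complex.arg (κ i j) - L i j * θ') (-(L i j)) θ := by
          simpa using ((hasDerivAt_id θ).const_mul (L i j)).const_sub (Complex.arg (κ i j))
        exact h1.cos
      have h2 := hmax.hasDerivAt_eq_zero hder
      have h3 : Real.sin (Complex.arg (κ i j) - L i j * θ) = 0 := by
        have h4 := (hpos i j hij).ne'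
        simpa [h4] using h2
      have := Real.sin_sq_add_cos_sq (Complex.arg (κ i j) - L i j * θ)
      rw [h0, h3] at this
      norm_num at this
    · intro h
      obtain ⟨f, hf, hl⟩ := hL i j hij θ
      rw [← hcos i j hij] at h
      refine (leAt_iff (y := rot y θ) c hf).2 ⟨0, ?_⟩
      simpa using hl.eventually_re_neg h
  refine ⟨{
    level := fun i j => if i = j then 0 else L i j
    angle := fun i j => Complex.arg (κ i j)
    level_pos := fun i j h => by rw [if_neg h]; exact hpos i j h
    level_symm := fun i j => by
      by_cases h : i = j
      · rw [if_pos h, if_pos h.symm]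
      · rw [if_neg h, if_neg (Ne.symm h), (hsymm i j h 0).1]
    cos_anti := fun i j h θ => by
      rw [if_neg h, if_neg (Ne.symm h), ← hcos i j h, ← hcos j i h.symm, (hsymm i j h θ).2,
        Complex.neg_re]
    ultra := fun i j l hij hjl hil => by
      obtain ⟨f, g, h1, h2, h3⟩ := hadd i j l hij hjl hil 0
      rw [if_neg hij, if_neg hjl, if_neg hil]
      exact HasLead.level_le_max (y := rot y 0) c h1 h2 h3
    cos_eq := fun i j l hij hjl hil hlt θ => by
      obtain ⟨f, g, h1, h2, h3⟩ := hadd i j l hij hjl hil θ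
      rw [if_neg hij, if_neg hjl] at hlt
      rw [if_neg hil, if_neg hjl, ← hcos i l hil, ← hcos j l hjl,
        HasLead.dir_eq_of_lt (y := rot y θ) c h1 h2 h3 hlt]
    trans := fun θ i j l hij hjl h1 h2 => by
      rw [if_neg hij, ← hle i j hij] at h1
      rw [if_neg hjl, ← hle j l hjl] at h2
      have hil : i ≠ l := by
        rintro rfl
        exact hne i j hij θ (leAt_antisymm (y := rot y θ) c h1 h2)
      refine ⟨hil, ?_⟩
      rw [if_neg hil, ← hle i l hil]
      exact leAt_trans (y := rot y θ) c h1 h2 }, fun θ i j => ?_⟩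
  by_cases hij : i = j
  · subst hij
    exact iff_of_true (Or.inl rfl) (leAt_refl (y := rot y θ) c _)
  · rw [hle i j hij]
    simp [ExpData.le, ExpData.lt, hij]

/-- Two sections which agree at a point agree nearby. -/
lemma IsSectionNear.eventually_eq {y : Boundary n D} {φ ψ : ∀ z : Boundary n D, expStalk z}
    (hφ : IsSectionNear y φ) (hψ : IsSectionNear y ψ) (h : φ y = ψ y) :
    ∀ᶠ z in 𝓝 y, φ z = ψ z := by
  obtain ⟨f, hf⟩ := hφ
  obtain ⟨g, hg⟩ := hψ
  have h1 : germ y f = germ y g := by rw [← hf.self_of_nhds, ← hg.self_of_nhds, h]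
  filter_upwards [hf, hg, eventually_germ_eq h1] with z h2 h3 h4
  exact Subtype.ext (by rw [h2, h3, h4])

lemma IsSectionNear.eventually {y : Boundary n D} {φ : ∀ z : Boundary n D, expStalk z}
    (hφ : IsSectionNear y φ) : ∀ᶠ z in 𝓝 y, IsSectionNear z φ := by
  obtain ⟨f, hf⟩ := hφ
  filter_upwards [hf.eventually_nhds] with z hz
  exact ⟨f, hz⟩

/-- The pull-back of a stratified covering along a circle of directions is trivial. -/
lemma IsStratifiedCovering.exists_labels {S : ∀ y : Boundary n D, Set (expStalk y)}
    (hS : IsStratifiedCovering S) (y : Boundary n D) :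
    ∃ (r : ℕ) (A : Fin r → ∀ θ : ℝ, expStalk (rot y θ)),
      (∀ i θ₀, ∃ f, ∀ᶠ θ in 𝓝 θ₀, (A i θ).1 = germ (rot y θ) f) ∧
      (∀ i j, i ≠ j → ∀ θ, A i θ ≠ A j θ) ∧ ∀ θ, range (fun i => A i θ) = S (rot y θ) := by
  set sec : ℝ → Set (∀ θ : ℝ, expStalk (rot y θ)) := fun θ₀ =>
    {s | ∃ f, ∀ᶠ θ in 𝓝 θ₀, (s θ).1 = germ (rot y θ) f ∧ s θ ∈ S (rot y θ)} with hsec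
  have heq : ∀ θ₀, ∀ s ∈ sec θ₀, ∀ s' : ∀ θ : ℝ, expStalk (rot y θ),
      (∃ f, ∀ᶠ θ in 𝓝 θ₀, (s' θ).1 = germ (rot y θ) f) → s θ₀ = s' θ₀ →
      ∀ᶠ θ in 𝓝 θ₀, s θ = s' θ := by
    rintro θ₀ s ⟨f, hf⟩ s' ⟨g, hg⟩ h
    have h1 : germ (rot y θ₀) f = germ (rot y θ₀) g := by
      rw [← hf.self_of_nhds.1, ← hg.self_of_nhds, h]
    filter_upwards [hf, hg, eventually_rot_add (eventually_germ_eq h1)] with θ h2 h3 h4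
    exact Subtype.ext (by rw [h2.1, h3, h4])
  -- the points `rot y θ` lie in one stratum, where the sections of the covering stay distinct
  have hloc : IsLocConst (fun θ => S (rot y θ)) sec := by
    refine ⟨?_, ?_, ?_, ?_⟩
    · rintro z s ⟨f, hf⟩ s' hs
      refine ⟨f, ?_⟩
      filter_upwards [hf, hs] with θ h1 h2
      rwa [← h2]
    · rintro z s ⟨f, hf⟩
      exact hf.self_of_nhds.2
    · rintro z s hs s' hs'
      by_cases h : s z = s' z
      · filter_upwards [heq z s hs s' (by
          obtain ⟨f, hf⟩ := hs'
          exact ⟨f, hf.mono fun _ h => h.1⟩) h] with θ hθ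
        exact iff_of_true hθ h
      · obtain ⟨r, φ, hφ, hev⟩ := hS (rot y z)
        have hmem : ∀ {s}, s ∈ sec z → ∃ i, ∀ᶠ θ in 𝓝 z, s θ = φ i (rot y θ) := by
          intro s hs
          have h1 : s z ∈ S (rot y z) := by
            obtain ⟨f, hf⟩ := hs
            exact hf.self_of_nhds.2
          rw [hev.self_of_nhds.1] at h1
          obtain ⟨i, hi⟩ := h1
          obtain ⟨g, hg⟩ := hφ i
          exact ⟨i, heq z s hs (fun θ => φ i (rot y θ)) ⟨g, eventually_rot_add hg⟩ hi.symm⟩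
        obtain ⟨i, hi⟩ := hmem hs
        obtain ⟨i', hi'⟩ := hmem hs'
        have hii : i ≠ i' := by
          rintro rfl
          exact h (hi.self_of_nhds.trans hi'.self_of_nhds.symm)
        filter_upwards [hi, hi', eventually_rot_add hev] with θ h1 h2 h3
        refine iff_of_false (fun h4 => hii ?_) h
        exact h3.2 (by rw [stratum_rot, stratum_rot]) (by simp only [← h1, ← h2, h4])
    · intro z
      obtain ⟨r, φ, hφ, hev⟩ := hS (rot y z)
      choose f hf using hφ
      obtain ⟨ε, hε, hball⟩ := Metric.eventually_nhds_iff_ball.1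
        ((eventually_rot_add hev).and (eventually_all.2 fun i => eventually_rot_add (hf i)))
      refine ⟨ε, hε, fun z' hz' e he => ?_⟩
      rw [(hball z' hz').1.1] at he
      obtain ⟨i, rfl⟩ := he
      refine ⟨fun θ => φ i (rot y θ), rfl, fun z'' hz'' => ⟨f i, ?_⟩⟩
      filter_upwards [Metric.isOpen_ball.mem_nhds hz''] with θ hθ
      refine ⟨(hball θ hθ).2 i, ?_⟩
      rw [(hball θ hθ).1.1]
      exact ⟨i, rfl⟩
  obtain ⟨r, φ, -, hev⟩ := hS (rot y 0)
  obtain ⟨hrange, hinj⟩ := hev.self_of_nhds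
  choose A hA0 hA using fun i => hloc.exists_section 0 (e := φ i (rot y 0))
    (by rw [hrange]; exact ⟨i, rfl⟩)
  have hmem : ∀ i θ, A i θ ∈ S (rot y θ) := fun i θ => hloc.mem θ _ (hA i θ)
  refine ⟨r, A, fun i θ₀ => ?_, fun i j hij θ h => hij ?_, fun θ => ?_⟩
  · obtain ⟨f, hf⟩ := hA i θ₀
    exact ⟨f, hf.mono fun _ h => h.1⟩
  · have h1 := (hloc.eq_iff_of_isPreconnected isPreconnected_univ (fun z _ => hA i z)
      (fun z _ => hA j z) (mem_univ θ) (mem_univ 0)).1 h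
    rw [hA0, hA0] at h1
    exact hinj rfl h1
  · refine Subset.antisymm (range_subset_iff.2 fun i => hmem i θ) fun e he => ?_
    obtain ⟨s, hs, hs'⟩ := hloc.exists_section θ he
    have h0 := hloc.mem 0 s (hs' 0)
    simp only [hrange] at h0
    obtain ⟨i, hi⟩ := h0
    refine ⟨i, ?_⟩
    rw [← hs]
    refine (hloc.eq_iff_of_isPreconnected isPreconnected_univ (fun z _ => hA i z)
      (fun z _ => hs' z) (mem_univ θ) (mem_univ 0)).2 ?_
    rw [hA0]
    exact hi

end Circle

/-! ### Parallel transport in local systems -/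

namespace LocalSystem

variable {k : Type v} [Field k] {Y : Type u} [TopologicalSpace Y]

section

variable (L : LocalSystem.{u, v, w} k Y) (y : Y)

/-- Every vector of the stalk at `y` is the value at `y` of a section near `y` which depends
linearly on it. -/
lemma exists_transport : ∃ T : L.stalk y →ₗ[k] ∀ z, L.stalk z, (∀ x, T x ∈ L.sec y) ∧
    (∀ x, T x y = x) ∧ ∀ᶠ z in 𝓝 y, Function.Bijective fun x => T x z := by
  obtain ⟨r, b, hb, hev⟩ := L.exists_frame y
  obtain ⟨hli, hsp⟩ := hev.self_of_nhds
  let B := Module.Basis.mk hli hsp.ge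
  refine ⟨B.constr k b, fun x => ?_, fun x => ?_, ?_⟩
  · rw [Module.Basis.constr_apply_fintype]
    exact Submodule.sum_mem _ fun i _ => Submodule.smul_mem _ _ (hb i)
  · rw [Module.Basis.constr_apply_fintype, Finset.sum_apply]
    conv_rhs => rw [← B.sum_equivFun x]
    simp [B]
  · filter_upwards [hev] with z hz
    have h : (fun x => B.constr k b x z) = B.equiv (Module.Basis.mk hz.1 hz.2.ge) (Equiv.refl _) := by
      funext x
      rw [Module.Basis.constr_apply_fintype, Finset.sum_apply]
      conv_rhs => rw [← B.sum_equivFun x, map_sum]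
      exact Finset.sum_congr rfl fun i _ => by
        rw [map_smul, Module.Basis.equiv_apply, Module.Basis.mk_apply]; rfl
    rw [h]
    exact LinearEquiv.bijective _

instance : FiniteDimensional k (L.stalk y) := by
  obtain ⟨r, b, -, hev⟩ := L.exists_frame y
  exact Module.Finite.of_basis (Module.Basis.mk hev.self_of_nhds.1 hev.self_of_nhds.2.ge)

/-- The section near `y` with a given value at `y`. -/
def extend : L.stalk y →ₗ[k] ∀ z, L.stalk z := (L.exists_transport y).choose

lemma extend_mem (x : L.stalk y) : L.extend y x ∈ L.sec y := (L.exists_transport y).choose_spec.1 x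

@[simp] lemma extend_self (x : L.stalk y) : L.extend y x y = x :=
  (L.exists_transport y).choose_spec.2.1 x

/-- The parallel transport from the stalk at `y` to the stalk at a point `z` near `y`. -/
def transport (z : Y) : L.stalk y →ₗ[k] L.stalk z := LinearMap.proj z ∘ₗ L.extend y

@[simp] lemma transport_self : L.transport y y = LinearMap.id := by
  ext x
  exact L.extend_self y x

lemma eventually_bijective : ∀ᶠ z in 𝓝 y, Function.Bijective (L.transport y z) :=
  (L.exists_transport y).choose_spec.2.2

end

variable {L L' : LocalSystem.{u, v, w} k Y} {y : Y}

lemma eventually_eq_of_mem_sec {s t : ∀ z, L.stalk z} (hs : s ∈ L.sec y) (ht : t ∈ L.sec y)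
    (h : s y = t y) : ∀ᶠ z in 𝓝 y, s z = t z := by
  filter_upwards [L.sec_zero y (s - t) (Submodule.sub_mem _ hs ht) (sub_eq_zero.2 h)] with z hz
  exact sub_eq_zero.1 hz

lemma eventually_eq_transport {s : ∀ z, L.stalk z} (hs : s ∈ L.sec y) :
    ∀ᶠ z in 𝓝 y, s z = L.transport y z (s y) :=
  eventually_eq_of_mem_sec hs (L.extend_mem y _) (L.extend_self y _).symm

/-- A property of linear maps holds near a point as soon as it holds for every single vector: this
is the reduction to a basis. -/
lemma eventually_linearMap_eq {V : Type*} [AddCommGroup V] [Module k V] [FiniteDimensional k V]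
    {W : Y → Type*} [∀ z, AddCommGroup (W z)] [∀ z, Module k (W z)] {f g : ∀ z, V →ₗ[k] W z}
    (h : ∀ x, ∀ᶠ z in 𝓝 y, f z x = g z x) : ∀ᶠ z in 𝓝 y, f z = g z := by
  have := eventually_all.2 fun i => h (Module.finBasis k V i)
  filter_upwards [this] with z hz
  exact (Module.finBasis k V).ext hz

lemma eventually_le_comap {V : Type*} [AddCommGroup V] [Module k V] [FiniteDimensional k V]
    {W : Y → Type*} [∀ z, AddCommGroup (W z)] [∀ z, Module k (W z)] {f : ∀ z, V →ₗ[k] W z}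
    {P : Submodule k V} {Q : ∀ z, Submodule k (W z)}
    (h : ∀ x ∈ P, ∀ᶠ z in 𝓝 y, f z x ∈ Q z) : ∀ᶠ z in 𝓝 y, P.map (f z) ≤ Q z := by
  have := eventually_all.2 fun i => h (Module.finBasis k P i) (Module.finBasis k P i).2
  filter_upwards [this] with z hz
  have h1 : (⊤ : Submodule k P) ≤ (Q z).comap (f z ∘ₗ P.subtype) := by
    rw [← (Module.finBasis k P).span_eq, Submodule.span_le]
    rintro _ ⟨i, rfl⟩
    exact hz i
  rw [Submodule.map_le_iff_le_comap]
  intro x hx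
  exact h1 (x := ⟨x, hx⟩) trivial

lemma eventually_extend_mem : ∀ᶠ z in 𝓝 y, ∀ x, L.extend y x ∈ L.sec z := by
  have := eventually_all.2 fun i => L.sec_open y _ (L.extend_mem y (Module.finBasis k (L.stalk y) i))
  filter_upwards [this] with z hz
  have h1 : (⊤ : Submodule k (L.stalk y)) ≤ (L.sec z).comap (L.extend y) := by
    rw [← (Module.finBasis k (L.stalk y)).span_eq, Submodule.span_le]
    rintro _ ⟨i, rfl⟩
    exact hz i
  exact fun x => h1 (x := x) trivial

/-- Morphisms commute with parallel transport. -/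
lemma eventually_map_transport (f : ∀ z, L.stalk z →ₗ[k] L'.stalk z)
    (hf : ∀ s ∈ L.sec y, (fun z => f z (s z)) ∈ L'.sec y) :
    ∀ᶠ z in 𝓝 y, f z ∘ₗ L.transport y z = L'.transport y z ∘ₗ f y := by
  refine eventually_linearMap_eq fun x => ?_
  filter_upwards [eventually_eq_transport (hf _ (L.extend_mem y x))] with z hz
  rwa [extend_self] at hz

/-- A subspace transported along the local system has local frames. -/
lemma exists_frame_map {V : Type*} [AddCommGroup V] [Module k V] [FiniteDimensional k V]
    (T : V →ₗ[k] ∀ z, L.stalk z) (hT : ∀ x, T x ∈ L.sec y) {N : ∀ z, Submodule k (L.stalk z)}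
    (hinj : ∀ᶠ z in 𝓝 y, Function.Injective fun x => T x z)
    (hN : ∀ᶠ z in 𝓝 y, N z = LinearMap.range (LinearMap.proj z ∘ₗ T)) :
    ∃ (q : ℕ) (b : Fin q → ∀ z, L.stalk z), (∀ j, b j ∈ L.sec y) ∧
      ∀ᶠ z in 𝓝 y, LinearIndependent k (fun j => b j z) ∧
        Submodule.span k (range fun j => b j z) = N z := by
  refine ⟨_, fun j => T (Module.finBasis k V j), fun j => hT _, ?_⟩
  filter_upwards [hinj, hN] with z hz hz'
  constructor
  · exact (Module.finBasis k V).linearIndependent.map' (LinearMap.proj z ∘ₗ T)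
      (LinearMap.ker_eq_bot.2 hz)
  · rw [hz', LinearMap.range_eq_map, ← (Module.finBasis k V).span_eq, Submodule.map_span,
      ← range_comp]
    rfl

end LocalSystem

/-! ### Functoriality of decompositions -/

section Decomposition

variable {k : Type*} [Field k] {V V' : Type*} [AddCommGroup V] [Module k V] [AddCommGroup V']
  [Module k V'] {ι : Type*} [Fintype ι] {G : ι → Submodule k V} {G' : ι → Submodule k V'}

namespace IsDecomp

lemma proj_sum (h : IsDecomp G) {x : ι → V} (hx : ∀ i, x i ∈ G i) (i : ι) :
    h.proj i (∑ j, x j) = x i := by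
  classical
  rw [map_sum, Finset.sum_eq_single i, h.proj_self (hx i)]
  · exact fun j _ hj => h.proj_of_ne hj.symm (hx j)
  · simp

open Classical in
lemma finrank_biSup_filter [FiniteDimensional k V] (h : IsDecomp G) (P : ι → Prop) :
    Module.finrank k (⨆ (i) (_ : P i), G i : Submodule k V)
      = ∑ i with P i, Module.finrank k (G i) := by
  have : (⨆ (i) (_ : P i), G i) = ⨆ i ∈ Finset.univ.filter P, G i := by simp
  rw [this, finrank_biSup h.indep]

/-- The image of a decomposition under a surjection with homogeneous kernel. -/
lemma map (h : IsDecomp G) {f : V →ₗ[k] V'} (hf : Function.Surjective f)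
    (hker : ∀ x, f x = 0 → ∀ i, f (h.proj i x) = 0) : IsDecomp fun i => (G i).map f := by
  refine ⟨iSupIndep_of_sum_eq_zero fun y hy hs i => ?_, ?_⟩
  · choose x hx hxy using fun i => Submodule.mem_map.1 (hy i)
    rw [← hxy i, ← h.proj_sum hx i]
    refine hker _ ?_ i
    rw [map_sum, ← hs]
    exact Finset.sum_congr rfl fun j _ => hxy j
  · rw [← Submodule.map_iSup, h.iSup_eq_top, Submodule.map_top, LinearMap.range_eq_top.2 hf]

lemma map_of_bijective (h : IsDecomp G) {f : V →ₗ[k] V'} (hf : Function.Bijective f) :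
    IsDecomp fun i => (G i).map f := by
  refine h.map hf.2 fun x hx i => ?_
  rw [(injective_iff_map_eq_zero f).1 hf.1 x hx, map_zero, map_zero]

/-- The trace of a decomposition on a homogeneous subspace. -/
lemma comap (h : IsDecomp G') {f : V →ₗ[k] V'} (hf : Function.Injective f)
    (hrange : ∀ x i, h.proj i (f x) ∈ LinearMap.range f) : IsDecomp fun i => (G' i).comap f := by
  refine ⟨iSupIndep_of_sum_eq_zero fun x hx hs i => ?_, ?_⟩
  · refine (injective_iff_map_eq_zero f).1 hf _ ?_
    rw [← h.proj_sum (x := fun i => f (x i)) hx i, ← map_sum, hs, map_zero, map_zero]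
  · rw [eq_top_iff]
    intro x _
    choose y hy using fun i => hrange x i
    have : x = ∑ i, y i := by
      apply hf
      rw [map_sum, ← h.sum_proj (f x)]
      exact Finset.sum_congr rfl fun i _ => (hy i).symm
    rw [this]
    refine Submodule.sum_mem _ fun i _ => Submodule.mem_iSup_of_mem i ?_
    rw [Submodule.mem_comap, hy]
    exact h.proj_mem i _

/-- A diagonal map commutes with the projections to the components. -/
lemma map_proj (h : IsDecomp G) (h' : IsDecomp G') {f : V →ₗ[k] V'}
    (hf : ∀ i, G i ≤ (G' i).comap f) (x : V) (i : ι) : f (h.proj i x) = h'.proj i (f x) := by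
  conv_rhs => rw [← h.sum_proj x, map_sum]
  exact (h'.proj_sum (x := fun j => f (h.proj j x)) (fun j => hf j (h.proj_mem j x)) i).symm

lemma prod (h : IsDecomp G) (h' : IsDecomp G') : IsDecomp fun i => (G i).prod (G' i) := by
  refine ⟨iSupIndep_of_sum_eq_zero fun x hx hs i => ?_, ?_⟩
  · refine Prod.ext ?_ ?_
    · rw [← h.proj_sum (x := fun i => (x i).1) (fun i => (hx i).1) i, ← Prod.fst_sum, hs]
      simp
    · rw [← h'.proj_sum (x := fun i => (x i).2) (fun i => (hx i).2) i, ← Prod.snd_sum, hs]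
      simp
  · rw [eq_top_iff]
    rintro ⟨x, x'⟩ -
    have : (x, x') = ∑ i, (h.proj i x, h'.proj i x') := by
      refine Prod.ext ?_ ?_
      · rw [Prod.fst_sum, h.sum_proj]
      · rw [Prod.snd_sum, h'.sum_proj]
    rw [this]
    exact Submodule.sum_mem _ fun i _ => Submodule.mem_iSup_of_mem i
      ⟨h.proj_mem i x, h'.proj_mem i x'⟩

end IsDecomp

end Decomposition

/-! ### Gradations of the stalks of a Stokes filtration -/

section Stalks

variable {n : ℕ} {X : Type u} [TopologicalSpace X] [ChartedSpace (Fin n → ℂ) X] {J : Type t}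
  {D : J → Set X} {k : Type v} [Field k]

namespace PreStokes

variable (L : PreStokes.{u, v, w, t} n k D)

/-- `G` is a gradation of the filtration of the stalk at `z`, its members being placed at the
(not necessarily distinct) germs `a i`. -/
structure IsGradedAt (z : Boundary n D) {r : ℕ} (a : Fin r → expStalk z)
    (G : Fin r → Submodule k (L.stalk z)) : Prop extends IsDecomp G where
  filt : ∀ b, L.filt z b = ⨆ (i) (_ : leAt z (a i) b), G i

namespace IsGradedAt

variable {L} {z : Boundary n D} {r : ℕ} {a : Fin r → expStalk z}
  {G : Fin r → Submodule k (L.stalk z)}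

lemma le_filt (h : L.IsGradedAt z a G) (hD : IsNormalCrossing n D) (i : Fin r) :
    G i ≤ L.filt z (a i) := by
  obtain ⟨c⟩ := hD z.1.pt
  rw [h.filt]
  exact le_iSup₂_of_le i (leAt_refl c _) le_rfl

lemma filtLT_eq (h : L.IsGradedAt z a G) (hD : IsNormalCrossing n D) (b : expStalk z) :
    L.filtLT z b = ⨆ (i) (_ : ltAt z (a i) b), G i := by
  obtain ⟨c⟩ := hD z.1.pt
  refine le_antisymm (iSup₂_le fun e he => ?_) (iSup₂_le fun i hi => ?_)
  · rw [h.filt]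
    refine iSup₂_le fun i hi => le_iSup₂_of_le i ⟨leAt_trans c hi he.1, ?_⟩ le_rfl
    rintro rfl
    exact he.2 (leAt_antisymm c he.1 hi)
  · exact le_iSup₂_of_le (f := fun (e : expStalk z) (_ : ltAt z e b) => L.filt z e)
      (a i) hi (h.le_filt hD i)

open Classical in
/-- The rank of a graded piece is the sum of the ranks of the members placed at the given germ. -/
lemma grRank_eq (h : L.IsGradedAt z a G) (hD : IsNormalCrossing n D) (b : expStalk z) :
    L.grRank z b = ∑ i with a i = b, Module.finrank k (G i) := by
  obtain ⟨c⟩ := hD z.1.pt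
  have hle : L.filtLT z b ≤ L.filt z b := iSup₂_le fun e he => L.filt_mono z e b he.1
  have h1 := Submodule.finrank_quotient_add_finrank ((L.filtLT z b).submoduleOf (L.filt z b))
  rw [(Submodule.submoduleOfEquivOfLe hle).finrank_eq, h.filtLT_eq hD, h.finrank_biSup_filter]
    at h1
  have h2 : Module.finrank k (L.filt z b) = ∑ i with leAt z (a i) b, Module.finrank k (G i) := by
    rw [h.filt, h.finrank_biSup_filter]
  have h3 : (Finset.univ.filter fun i => leAt z (a i) b)
      = (Finset.univ.filter fun i => a i = b) ∪ (Finset.univ.filter fun i => ltAt z (a i) b) := by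
    ext i
    simp only [Finset.mem_filter, Finset.mem_univ, true_and, Finset.mem_union]
    constructor
    · exact fun hi => or_iff_not_imp_left.2 fun hne => ⟨hi, hne⟩
    · rintro (rfl | hi)
      · exact leAt_refl c _
      · exact hi.1
  rw [h3, Finset.sum_union (Finset.disjoint_filter.2 fun i _ h h' => h'.2 h)] at h2
  rw [grRank, h.filtLT_eq hD]
  omega

lemma mem_factors_iff (h : L.IsGradedAt z a G) (hD : IsNormalCrossing n D) (b : expStalk z) :
    b ∈ L.factors z ↔ ∃ i, a i = b ∧ G i ≠ ⊥ := by
  obtain ⟨c⟩ := hD z.1.pt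
  rw [factors, mem_ofPred_eq, h.filt, h.filtLT_eq hD, not_iff_comm]
  push Not
  constructor
  · intro hi
    refine iSup₂_le fun i hib => ?_
    by_cases e : a i = b
    · rw [hi i e]
      exact bot_le
    · exact le_iSup₂_of_le i ⟨hib, e⟩ le_rfl
  · rintro hle i rfl
    have h1 : G i ≤ ⨆ (j) (_ : ltAt z (a j) (a i)), G j :=
      (le_iSup₂_of_le i (leAt_refl c _) le_rfl).trans hle
    have h2 : Disjoint (G i) (⨆ (j) (_ : ltAt z (a j) (a i)), G j) :=
      iSupIndep.disjoint_biSup h.indep (y := {j | ltAt z (a j) (a i)}) fun hi => hi.2 rfl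
    exact h2.eq_bot_of_le h1

open Classical in
lemma finrank_filt (h : L.IsGradedAt z a G) (b : expStalk z) :
    Module.finrank k (L.filt z b) = ∑ i with leAt z (a i) b, Module.finrank k (G i) := by
  rw [h.filt, h.finrank_biSup_filter]

end IsGradedAt

/-- The stalks of a Stokes-filtered local system are graded, the gradation being supported on any
finite set of germs containing the exponential factors. -/
lemma IsStokes.exists_isGradedAt {L : PreStokes.{u, v, w, t} n k D} (hL : L.IsStokes)
    (hD : IsNormalCrossing n D) (z : Boundary n D) {r : ℕ} {a : Fin r → expStalk z}
    (ha : Function.Injective a) (hfac : L.factors z ⊆ range a) : ∃ G, L.IsGradedAt z a G := by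
  obtain ⟨c⟩ := hD z.1.pt
  obtain ⟨G, hG⟩ := hL.graded z
  obtain ⟨-, hind, htop, hfilt⟩ := hG.self_of_nhds rfl
  have hbot : ∀ b, b ∉ range a → G z b = ⊥ := by
    intro b hb
    by_contra hne
    refine hb (hfac fun hle => hne ?_)
    have h1 : G z b ≤ L.filt z b := by
      rw [hfilt]
      exact le_iSup₂_of_le (f := fun (e : expStalk z) (_ : leAt z e b) => G z e)
        b (leAt_refl c b) le_rfl
    have h2 : L.filtLT z b ≤ ⨆ (e) (_ : e ≠ b), G z e := by
      refine iSup₂_le fun e he => ?_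
      rw [hfilt]
      refine iSup₂_le fun e' he' => le_iSup₂_of_le
        (f := fun (e : expStalk z) (_ : e ≠ b) => G z e) e' ?_ le_rfl
      rintro rfl
      exact he.2 (leAt_antisymm c he.1 he')
    exact (hind b).eq_bot_of_le (h1.trans (hle.trans h2))
  have hsup : ∀ P : expStalk z → Prop, (⨆ (b) (_ : P b), G z b) = ⨆ (i) (_ : P (a i)), G z (a i) := by
    intro P
    refine le_antisymm (iSup₂_le fun b hb => ?_) (iSup₂_le fun i hi => ?_)
    · by_cases h : b ∈ range a
      · obtain ⟨i, rfl⟩ := h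
        exact le_iSup₂_of_le (f := fun i (_ : P (a i)) => G z (a i)) i hb le_rfl
      · rw [hbot b h]
        exact bot_le
    · exact le_iSup₂_of_le (f := fun b (_ : P b) => G z b) (a i) hi le_rfl
  refine ⟨fun i => G z (a i), ⟨hind.comp ha, ?_⟩, fun b => ?_⟩
  · have := hsup fun _ => True
    simpa [htop] using this.symm
  · rw [hfilt, hsup]

end PreStokes

end Stalks

/-! ### Local models of Stokes-filtered local systems -/

section Models

variable {n : ℕ} {X : Type u} [TopologicalSpace X] [ChartedSpace (Fin n → ℂ) X] {J : Type t}
  {D : J → Set X} {k : Type v} [Field k]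

namespace PreStokes

/-- Near `y`, the filtration is the one given by the sections `σ i`, whose germs are distinct along
the stratum of `y`, and by the parallel transport of the decomposition `G` of the stalk at `y`. -/
structure IsModel (L : PreStokes.{u, v, w, t} n k D) (y : Boundary n D) {r : ℕ}
    (σ : Fin r → ∀ z : Boundary n D, expStalk z) (G : Fin r → Submodule k (L.stalk y)) : Prop where
  isSectionNear : ∀ i, IsSectionNear y (σ i)
  injective : ∀ᶠ z in 𝓝 y, stratum z = stratum y → Function.Injective fun i => σ i z
  graded : ∀ᶠ z in 𝓝 y, L.IsGradedAt z (fun i => σ i z) fun i => (G i).map (L.transport y z)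

variable {L : PreStokes.{u, v, w, t} n k D} {y : Boundary n D} {r : ℕ}
  {σ : Fin r → ∀ z : Boundary n D, expStalk z} {G : Fin r → Submodule k (L.stalk y)}

namespace IsModel

lemma injective_self (h : L.IsModel y σ G) : Function.Injective fun i => σ i y :=
  h.injective.self_of_nhds rfl

lemma graded_self (h : L.IsModel y σ G) : L.IsGradedAt y (fun i => σ i y) G := by
  simpa using h.graded.self_of_nhds

/-- A local model gives a gradation on a neighbourhood. -/
lemma isGradationNear (h : L.IsModel y σ G) :
    L.IsGradationNear y σ fun i z => (G i).map (L.transport y z) := by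
  refine ⟨h.isSectionNear, h.injective_self, fun i => ?_, ?_⟩
  · refine LocalSystem.exists_frame_map (L.extend y ∘ₗ (G i).subtype)
      (fun x => L.extend_mem y _) ?_ ?_
    · filter_upwards [L.eventually_bijective y] with z hz x x' hx
      exact Subtype.ext (hz.1 hx)
    · refine Eventually.of_forall fun z => ?_
      rw [← LinearMap.comp_assoc, LinearMap.range_comp, Submodule.range_subtype]
      rfl
  · filter_upwards [h.graded] with z hz
    exact ⟨hz.indep, hz.iSup_eq_top, hz.filt⟩

open Classical in
/-- Removing the zero members of a local model. -/
lemma exists_ne_bot (h : L.IsModel y σ G) : ∃ (r' : ℕ) (e : Fin r' → Fin r),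
    L.IsModel y (fun i => σ (e i)) (fun i => G (e i)) ∧ ∀ i, G (e i) ≠ ⊥ := by
  let e := (Fintype.equivFin {i // G i ≠ ⊥}).symm
  have he : Function.Injective fun i => (e i).1 := Subtype.val_injective.comp e.injective
  have hsup : ∀ (P : Fin r → Prop) (z : Boundary n D),
      (⨆ (i) (_ : P i), (G i).map (L.transport y z))
        = ⨆ (i) (_ : P (e i)), (G (e i)).map (L.transport y z) := by
    intro P z
    refine le_antisymm (iSup₂_le fun i hi => ?_) (iSup₂_le fun i hi => ?_)
    · by_cases h0 : G i = ⊥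
      · rw [h0, Submodule.map_bot]
        exact bot_le
      · obtain ⟨j, hj⟩ := e.surjective ⟨i, h0⟩
        have hji : (e j).1 = i := congrArg Subtype.val hj
        refine le_iSup₂_of_le (f := fun i (_ : P (e i)) => (G (e i)).map (L.transport y z))
          j ?_ ?_
        · rwa [hji]
        · rw [hji]
    · exact le_iSup₂_of_le (f := fun i (_ : P i) => (G i).map (L.transport y z)) (e i).1 hi le_rfl
  refine ⟨_, fun i => (e i).1, ⟨fun i => h.isSectionNear _, ?_, ?_⟩, fun i => (e i).2⟩
  · filter_upwards [h.injective] with z hz hs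
    exact (hz hs).comp he
  · filter_upwards [h.graded] with z hz
    refine ⟨⟨hz.indep.comp he, ?_⟩, fun b => ?_⟩
    · have := hsup (fun _ => True) z
      simpa [hz.iSup_eq_top] using this.symm
    · rw [hz.filt, hsup]

lemma mem_factors_iff (h : L.IsModel y σ G) (hD : IsNormalCrossing n D) (b : expStalk y) :
    b ∈ L.factors y ↔ ∃ i, σ i y = b ∧ G i ≠ ⊥ :=
  h.graded_self.mem_factors_iff hD b

end IsModel

open Classical in
/-- The ranks of the graded pieces near a point are determined by a gradation of the stalk at this
point. -/
lemma IsStokes.eventually_grRank_eq (hL : L.IsStokes) (hD : IsNormalCrossing n D)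
    (hσ : ∀ i, IsSectionNear y (σ i)) (hinj : Function.Injective fun i => σ i y)
    (hG : L.IsGradedAt y (fun i => σ i y) G) :
    ∀ᶠ z in 𝓝 y, ∀ a, L.grRank z a = ∑ i, if σ i z = a then Module.finrank k (G i) else 0 := by
  obtain ⟨q, φ, hφ, hφinj, hφr, hev⟩ := hL.rank y
  have h1 : ∀ j, ∃ i, σ i y = φ j y ∧ G i ≠ ⊥ := fun j => by
    rw [← hG.mem_factors_iff hD, ← hφr]
    exact ⟨j, rfl⟩
  choose e he _ using h1
  have heinj : Function.Injective e := fun j j' hj => hφinj (by simp only [← he, hj])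
  have heq := eventually_all.2 fun j => (hσ (e j)).eventually_eq (hφ j) (he j)
  filter_upwards [hev, heq] with z hz hz' a
  rw [hz.2 a, finsum_eq_sum_of_fintype]
  refine Fintype.sum_of_injective e heinj _ _ (fun i hi => ?_) fun j => ?_
  · have h0 : G i = ⊥ := by
      by_contra hne
      have h2 : σ i y ∈ L.factors y := (hG.mem_factors_iff hD _).2 ⟨i, rfl, hne⟩
      rw [← hφr] at h2
      obtain ⟨j, hj⟩ := h2
      exact hi ⟨j, hinj ((he j).trans hj)⟩
    rw [h0, finrank_bot, ite_self]
  · rw [finsum_eq_if, hz' j]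
    refine if_congr Iff.rfl ?_ rfl
    rw [hG.grRank_eq hD, ← he j, Finset.sum_filter, Finset.sum_eq_single (e j)]
    · exact if_pos rfl
    · exact fun i _ hi => if_neg fun h => hi (hinj h)
    · simp

/-- A gradation of the stalk of a Stokes-filtered local system at a point extends to a
neighbourhood: the transported steps are contained in the steps of the filtration, which is an open
condition, and the dimensions agree since the ranks of the graded pieces add up. -/
lemma IsStokes.isModel (hL : L.IsStokes) (hD : IsNormalCrossing n D)
    (hσ : ∀ i, IsSectionNear y (σ i))
    (hinj : ∀ᶠ z in 𝓝 y, stratum z = stratum y → Function.Injective fun i => σ i z)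
    (hG : L.IsGradedAt y (fun i => σ i y) G) : L.IsModel y σ G := by
  classical
  refine ⟨hσ, hinj, ?_⟩
  have hle : ∀ᶠ z in 𝓝 y, ∀ i, (G i).map (L.transport y z) ≤ L.filt z (σ i z) := by
    refine eventually_all.2 fun i => LocalSystem.eventually_le_comap fun x hx => ?_
    obtain ⟨φ, hφ, hφy, s, hs, hsx, hev⟩ := L.filt_open y (σ i y) x (hG.le_filt hD i hx)
    filter_upwards [hev, hφ.eventually_eq (hσ i) hφy, LocalSystem.eventually_eq_transport hs]
      with z h1 h2 h3
    rwa [← h2, ← hsx, ← h3]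
  filter_upwards [hle, L.eventually_bijective y,
    hL.eventually_grRank_eq hD hσ (hinj.self_of_nhds rfl) hG] with z h1 h2 h3
  have hdec := hG.toIsDecomp.map_of_bijective h2
  refine ⟨hdec, fun b => (Submodule.eq_of_le_of_finrank_eq ?_ ?_).symm⟩
  · exact iSup₂_le fun i hi => (h1 i).trans (L.filt_mono z _ _ hi)
  · obtain ⟨q, φ, -, hφinj, hφr, -⟩ := hL.rank z
    obtain ⟨H, hH⟩ := hL.exists_isGradedAt hD z hφinj hφr.ge
    have hdim : ∀ i, Module.finrank k ((G i).map (L.transport y z)) = Module.finrank k (G i) :=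
      fun i => (Submodule.equivMapOfInjective _ h2.1 _).finrank_eq.symm
    rw [hdec.finrank_biSup_filter, hH.finrank_filt]
    have h4 : ∀ j, Module.finrank k (H j)
        = ∑ i, if σ i z = φ j z then Module.finrank k (G i) else 0 := by
      intro j
      rw [← h3, hH.grRank_eq hD, Finset.sum_filter, Finset.sum_eq_single j]
      · exact (if_pos rfl).symm
      · exact fun i _ hi => if_neg fun h => hi (hφinj h)
      · simp
    simp only [hdim, h4]
    rw [Finset.sum_comm, Finset.sum_filter]
    refine Finset.sum_congr rfl fun i _ => ?_
    rw [Finset.sum_filter]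
    by_cases h0 : Module.finrank k (G i) = 0
    · simp [h0]
    · -- the germ of a section carrying a nonzero piece is an exponential factor
      have h5 : σ i z ∈ L.factors z := by
        have h6 := h3 (σ i z)
        rw [hH.grRank_eq hD] at h6
        have h7 : (∑ j, if σ j z = σ i z then Module.finrank k (G j) else 0) ≠ 0 :=
          (Finset.sum_pos' (fun _ _ => Nat.zero_le _)
            ⟨i, Finset.mem_univ _, by simpa using Nat.pos_of_ne_zero h0⟩).ne'
        rw [← h6] at h7
        obtain ⟨j, hj, hj'⟩ := Finset.exists_ne_zero_of_sum_ne_zero h7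
        refine (hH.mem_factors_iff hD _).2 ⟨j, (Finset.mem_filter.1 hj).2, fun h => hj' ?_⟩
        rw [h, finrank_bot]
      rw [← hφr] at h5
      obtain ⟨j, hj⟩ := h5
      rw [Finset.sum_eq_single j]
      · simp only at hj
        simp [hj]
      · intro j' _ hj'
        have : σ i z ≠ φ j' z := fun h => hj' (hφinj (h.symm.trans hj.symm))
        simp [this]
      · simp

/-- A pre-Stokes-filtered local system with local models is Stokes-filtered. -/
lemma isStokes_of_isModel (hD : IsNormalCrossing n D)
    (hL : ∀ y, ∃ (r : ℕ) (σ : Fin r → ∀ z : Boundary n D, expStalk z)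
      (G : Fin r → Submodule k (L.stalk y)), L.IsModel y σ G) : L.IsStokes := by
  classical
  have hL' : ∀ y, ∃ (r : ℕ) (σ : Fin r → ∀ z : Boundary n D, expStalk z)
      (G : Fin r → Submodule k (L.stalk y)), L.IsModel y σ G ∧ ∀ i, G i ≠ ⊥ := fun y => by
    obtain ⟨r, σ, G, h⟩ := hL y
    obtain ⟨r', e, h1, h2⟩ := h.exists_ne_bot
    exact ⟨r', _, _, h1, h2⟩
  have hfac : ∀ {y : Boundary n D} {r : ℕ} {σ : Fin r → ∀ z : Boundary n D, expStalk z}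
      {G : Fin r → Submodule k (L.stalk y)}, L.IsModel y σ G → (∀ i, G i ≠ ⊥) →
      ∀ᶠ z in 𝓝 y, L.factors z = range fun i => σ i z := by
    intro y r σ G h hne
    filter_upwards [h.graded, L.eventually_bijective y] with z hz hz'
    ext b
    rw [hz.mem_factors_iff hD]
    refine ⟨fun ⟨i, hi, _⟩ => ⟨i, hi⟩, fun ⟨i, hi⟩ => ⟨i, hi, fun h0 => hne i ?_⟩⟩
    exact Submodule.map_injective_of_injective hz'.1 (h0.trans (Submodule.map_bot _).symm)
  refine ⟨fun y => ?_, fun y => ?_, fun y => ?_⟩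
  · obtain ⟨r, σ, G, h, -⟩ := hL' y
    refine ⟨fun z a => ⨆ (i) (_ : σ i z = a), (G i).map (L.transport y z), ?_⟩
    filter_upwards [h.graded, h.injective, L.eventually_bijective y,
      eventually_all.2 fun i => (h.isSectionNear i).eventually,
      LocalSystem.eventually_extend_mem (L := L.toLocalSystem) (y := y)]
      with z hz hinj hbij hsec hext hst
    refine ⟨fun a x hx => ?_, ?_, ?_, fun b => ?_⟩
    · by_cases ha : ∃ i, σ i z = a
      · obtain ⟨i, rfl⟩ := ha
        have hle : (⨆ (j) (_ : σ j z = σ i z), (G j).map (L.transport y z))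
            ≤ (G i).map (L.transport y z) := iSup₂_le fun j hj => by
          rw [hinj hst hj]
        have hx' := hle hx
        obtain ⟨x', hx', rfl⟩ := hx'
        refine ⟨σ i, hsec i, rfl, L.extend y x', hext x', rfl, Eventually.of_forall fun t _ => ?_⟩
        exact Submodule.mem_iSup_of_mem i (Submodule.mem_iSup_of_mem rfl ⟨x', hx', rfl⟩)
      · have hx0 : x = 0 := by
          have : (⨆ (i) (_ : σ i z = a), (G i).map (L.transport y z)) = ⊥ :=
            iSup₂_eq_bot.2 fun i hi => (ha ⟨i, hi⟩).elim
          rw [this] at hx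
          exact (Submodule.mem_bot k).1 hx
        obtain ⟨φ, hφ, hφa, -⟩ := L.filt_open z a 0 (Submodule.zero_mem _)
        exact ⟨φ, hφ, hφa, 0, Submodule.zero_mem _, hx0.symm,
          Eventually.of_forall fun t _ => Submodule.zero_mem _⟩
    · intro a
      have h1 : (⨆ (b) (_ : b ≠ a), ⨆ (i) (_ : σ i z = b), (G i).map (L.transport y z))
          ≤ ⨆ (i) (_ : σ i z ≠ a), (G i).map (L.transport y z) := by
        refine iSup₂_le fun b hb => iSup₂_le fun i hi => ?_
        exact le_iSup₂_of_le (f := fun i (_ : σ i z ≠ a) => (G i).map (L.transport y z))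
          i (hi ▸ hb) le_rfl
      exact (hz.disjoint_biSup (A := fun i => σ i z = a) (B := fun i => σ i z ≠ a)
        fun i hi hi' => hi' hi).mono_right h1
    · rw [eq_top_iff, ← hz.iSup_eq_top]
      exact iSup_le fun i => le_iSup_of_le (σ i z) (le_iSup₂_of_le
        (f := fun j (_ : σ j z = σ i z) => (G j).map (L.transport y z)) i rfl le_rfl)
    · rw [hz.filt]
      refine le_antisymm (iSup₂_le fun i hi => ?_) (iSup₂_le fun a ha => iSup₂_le fun i hi => ?_)
      · exact le_iSup₂_of_le (f := fun (a : expStalk z) (_ : leAt z a b) =>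
          ⨆ (i) (_ : σ i z = a), (G i).map (L.transport y z)) (σ i z) hi (le_iSup₂_of_le
            (f := fun j (_ : σ j z = σ i z) => (G j).map (L.transport y z)) i rfl le_rfl)
      · exact le_iSup₂_of_le (f := fun i (_ : leAt z (σ i z) b) => (G i).map (L.transport y z))
          i (hi ▸ ha) le_rfl
  · obtain ⟨r, σ, G, h, hne⟩ := hL' y
    refine ⟨r, σ, h.isSectionNear, ?_⟩
    filter_upwards [hfac h hne, h.injective] with z h1 h2
    exact ⟨h1, h2⟩
  · obtain ⟨r, σ, G, h, hne⟩ := hL' y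
    refine ⟨r, σ, h.isSectionNear, h.injective_self, (hfac h hne).self_of_nhds.symm, ?_⟩
    filter_upwards [hfac h hne, h.graded, L.eventually_bijective y] with z h1 h2 h3
    refine ⟨h1, fun a => ?_⟩
    rw [h2.grRank_eq hD, Finset.sum_filter, finsum_eq_sum_of_fintype]
    refine Finset.sum_congr rfl fun i _ => ?_
    rw [finsum_eq_if, h.graded_self.grRank_eq hD, Finset.sum_filter, Finset.sum_eq_single i,
      if_pos rfl, (Submodule.equivMapOfInjective _ h3.1 _).finrank_eq]
    · exact fun j _ hj => if_neg fun h' => hj (h.injective_self h')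
    · simp

end PreStokes

end Models

/-! ### Sections of a local system along a line -/

namespace LocalSystem

variable {k : Type v} [Field k] {Y : Type u} [TopologicalSpace Y]
  (L : LocalSystem.{u, v, w} k Y) {γ : ℝ → Y}

/-- The global sections of the pull-back of a local system along a path. -/
def lineSections (γ : ℝ → Y) : Submodule k (∀ θ : ℝ, L.stalk (γ θ)) where
  carrier := {s | ∀ θ₀, ∃ t ∈ L.sec (γ θ₀), ∀ᶠ θ in 𝓝 θ₀, s θ = t (γ θ)}
  add_mem' hs hs' θ₀ := by
    obtain ⟨t, ht, h⟩ := hs θ₀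
    obtain ⟨t', ht', h'⟩ := hs' θ₀
    refine ⟨t + t', Submodule.add_mem _ ht ht', ?_⟩
    filter_upwards [h, h'] with θ h1 h2
    rw [Pi.add_apply, Pi.add_apply, h1, h2]
  zero_mem' θ₀ := ⟨0, Submodule.zero_mem _, Eventually.of_forall fun _ => rfl⟩
  smul_mem' a s hs θ₀ := by
    obtain ⟨t, ht, h⟩ := hs θ₀
    refine ⟨a • t, Submodule.smul_mem _ a ht, ?_⟩
    filter_upwards [h] with θ h1
    rw [Pi.smul_apply, Pi.smul_apply, h1]

/-- The value of a section along a path at a point. -/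
def lineEval (γ : ℝ → Y) (θ : ℝ) : L.lineSections γ →ₗ[k] L.stalk (γ θ) :=
  LinearMap.proj θ ∘ₗ (L.lineSections γ).subtype

lemma isLocConst_line (hγ : Continuous γ) : IsLocConst (fun θ => (univ : Set (L.stalk (γ θ))))
    fun θ₀ => {s | ∃ t ∈ L.sec (γ θ₀), ∀ᶠ θ in 𝓝 θ₀, s θ = t (γ θ)} := by
  refine ⟨?_, fun _ _ _ => mem_univ _, ?_, fun θ₀ => ?_⟩
  · rintro θ₀ s ⟨t, ht, h⟩ s' hs'
    refine ⟨t, ht, ?_⟩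
    filter_upwards [h, hs'] with θ h1 h2
    rw [← h2, h1]
  · rintro θ₀ s ⟨t, ht, h⟩ s' ⟨t', ht', h'⟩
    filter_upwards [h, h', hγ.continuousAt.eventually (eventually_eq_transport ht),
      hγ.continuousAt.eventually (eventually_eq_transport ht'),
      hγ.continuousAt.eventually (L.eventually_bijective (γ θ₀))] with θ h1 h2 h3 h4 h5
    rw [h1, h2, h.self_of_nhds, h'.self_of_nhds, h3, h4]
    exact h5.1.eq_iff
  · obtain ⟨ε, hε, hball⟩ := Metric.eventually_nhds_iff_ball.1
      (hγ.continuousAt.eventually ((L.eventually_bijective (γ θ₀)).and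
        (eventually_extend_mem (L := L) (y := γ θ₀))))
    refine ⟨ε, hε, fun θ hθ e _ => ?_⟩
    obtain ⟨x, rfl⟩ := (hball θ hθ).1.2 e
    exact ⟨fun θ => L.extend (γ θ₀) x (γ θ), rfl, fun θ' hθ' =>
      ⟨_, (hball θ' hθ').2 x, Eventually.of_forall fun _ => rfl⟩⟩

lemma lineEval_bijective (hγ : Continuous γ) (θ : ℝ) : Function.Bijective (L.lineEval γ θ) := by
  refine ⟨fun s s' h => Subtype.ext (funext fun θ' => ?_), fun e => ?_⟩
  · exact ((L.isLocConst_line hγ).eq_iff_of_isPreconnected isPreconnected_univ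
      (fun z _ => s.2 z) (fun z _ => s'.2 z) (mem_univ θ) (mem_univ θ')).1 h
  · obtain ⟨s, hs, hs'⟩ := (L.isLocConst_line hγ).exists_section θ (mem_univ e)
    exact ⟨⟨s, hs'⟩, hs⟩

lemma finiteDimensional_lineSections (hγ : Continuous γ) :
    FiniteDimensional k (L.lineSections γ) :=
  Module.Finite.equiv (LinearEquiv.ofBijective _ (L.lineEval_bijective hγ 0)).symm

lemma eventually_lineEval_eq (hγ : Continuous γ) (θ₀ : ℝ) :
    ∀ᶠ θ in 𝓝 θ₀, L.lineEval γ θ = L.transport (γ θ₀) (γ θ) ∘ₗ L.lineEval γ θ₀ := by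
  have := L.finiteDimensional_lineSections hγ
  refine eventually_linearMap_eq fun s => ?_
  obtain ⟨t, ht, h⟩ := s.2 θ₀
  filter_upwards [h, hγ.continuousAt.eventually (eventually_eq_transport ht)] with θ h1 h2
  calc L.lineEval γ θ s = t (γ θ) := h1
    _ = _ := by
      rw [h2, ← h.self_of_nhds]
      rfl

end LocalSystem

/-! ### Diagonalisation of a morphism -/

section Diagonal

variable {n : ℕ} {X : Type u} [TopologicalSpace X] [ChartedSpace (Fin n → ℂ) X] {J : Type t}
  {D : J → Set X} {k : Type v} [Field k] {S : ∀ y : Boundary n D, Set (expStalk y)}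

namespace PreStokes

/-- The filtration of the space of sections along the circle through `y` by the exponential factors
in a given direction. -/
def lineFilt (L : PreStokes.{u, v, w, t} n k D) (y : Boundary n D) {r : ℕ}
    (A : Fin r → ∀ θ : ℝ, expStalk (rot y θ)) (θ : ℝ) (i : Fin r) :
    Submodule k (L.lineSections (rot y)) :=
  (L.filt (rot y θ) (A i θ)).comap (L.lineEval (rot y) θ)

/-- The local models at the points of the circle through `y` make the filtration of the space of
sections locally graded. -/
lemma IsStokes.locGraded_lineFilt {L : PreStokes.{u, v, w, t} n k D} (hL : L.IsStokes)
    (hD : IsNormalCrossing n D) (hS : IsStratifiedCovering S) (hLS : ∀ y, L.factors y ⊆ S y)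
    (y : Boundary n D) {r : ℕ} {A : Fin r → ∀ θ : ℝ, expStalk (rot y θ)}
    (hA : ∀ i θ₀, ∃ f, ∀ᶠ θ in 𝓝 θ₀, (A i θ).1 = germ (rot y θ) f)
    (hinj : ∀ θ, Function.Injective fun i => A i θ)
    (hr : ∀ θ, range (fun i => A i θ) = S (rot y θ)) {E : ExpData (Fin r)}
    (hE : ∀ θ i j, E.le θ i j ↔ leAt (rot y θ) (A i θ) (A j θ)) :
    LocGraded E (L.lineFilt y A) := by
  intro θ₀
  obtain ⟨q, φ, hφ, hev⟩ := hS (rot y θ₀)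
  have h1 : ∀ i, ∃ j, φ j (rot y θ₀) = A i θ₀ := fun i => by
    have h2 : A i θ₀ ∈ S (rot y θ₀) := by
      rw [← hr]
      exact ⟨i, rfl⟩
    rw [hev.self_of_nhds.1] at h2
    exact h2
  choose e he using h1
  have heinj : Function.Injective e := fun i j h => hinj θ₀ (by simp only [← he, h])
  have hAφ : ∀ᶠ θ in 𝓝 θ₀, ∀ i, φ (e i) (rot y θ) = A i θ := by
    refine eventually_all.2 fun i => ?_
    obtain ⟨f, hf⟩ := hA i θ₀
    obtain ⟨g, hg⟩ := hφ (e i)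
    have h2 : germ (rot y θ₀) g = germ (rot y θ₀) f := by
      rw [← hg.self_of_nhds, ← hf.self_of_nhds, he]
    filter_upwards [hf, eventually_rot_add hg, eventually_rot_add (eventually_germ_eq h2)]
      with θ h3 h4 h5
    exact Subtype.ext (by rw [h3, h4, h5])
  have hφA : (fun i => φ (e i) (rot y θ₀)) = fun i => A i θ₀ := funext he
  obtain ⟨H, hH⟩ := hL.exists_isGradedAt hD (rot y θ₀) (a := fun i => φ (e i) (rot y θ₀))
    (hφA ▸ hinj θ₀) (by rw [hφA, hr]; exact hLS _)
  have hmod : L.IsModel (rot y θ₀) (fun i => φ (e i)) H := by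
    refine hL.isModel hD (fun i => hφ _) ?_ hH
    filter_upwards [hev] with z hz hst
    exact (hz.2 hst).comp heinj
  have hbij := fun θ => L.lineEval_bijective (continuous_rot y) θ
  refine ⟨fun i => (H i).comap (L.lineEval (rot y) θ₀), ?_⟩
  filter_upwards [eventually_rot_add hmod.graded, hAφ,
    L.eventually_lineEval_eq (continuous_rot y) θ₀] with θ h2 h3 h4
  refine ⟨hH.toIsDecomp.comap (hbij θ₀).1 fun x i => (hbij θ₀).2 _, fun i => ?_⟩
  apply Submodule.map_injective_of_injective (hbij θ).1
  rw [lineFilt, Submodule.map_comap_eq_of_surjective (hbij θ).2, h2.filt]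
  simp only [Submodule.map_iSup, h3, hE]
  refine iSup_congr fun j => iSup_congr fun _ => ?_
  rw [h4, Submodule.map_comp, Submodule.map_comap_eq_of_surjective (hbij θ₀).2]

/-- A gradation of the sections along the circle through `y` gives one of the stalk. -/
lemma IsStokes.isGradedAt_of_line {L : PreStokes.{u, v, w, t} n k D} (hL : L.IsStokes)
    (hD : IsNormalCrossing n D) (y : Boundary n D) {r : ℕ}
    {A : Fin r → ∀ θ : ℝ, expStalk (rot y θ)} {E : ExpData (Fin r)}
    (hE : ∀ θ i j, E.le θ i j ↔ leAt (rot y θ) (A i θ) (A j θ)) {θ : ℝ}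
    (hinj : Function.Injective fun i => A i θ)
    (hfac : L.factors (rot y θ) ⊆ range fun i => A i θ)
    {G : Fin r → Submodule k (L.lineSections (rot y))}
    (hG : IsGradation (E.le θ) (L.lineFilt y A θ) G) :
    L.IsGradedAt (rot y θ) (fun i => A i θ) fun i => (G i).map (L.lineEval (rot y) θ) := by
  have hbij := L.lineEval_bijective (continuous_rot y) θ
  obtain ⟨H, hH⟩ := hL.exists_isGradedAt hD (rot y θ) hinj hfac
  obtain ⟨c⟩ := hD (rot y θ).1.pt
  have hdec := hG.toIsDecomp.map_of_bijective hbij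
  have h1 : IsGradation (E.le θ) (fun i => L.filt (rot y θ) (A i θ))
      fun i => (G i).map (L.lineEval (rot y) θ) := by
    refine ⟨hdec, fun i => ?_⟩
    have := congrArg (Submodule.map (L.lineEval (rot y) θ)) (hG.filt i)
    rw [lineFilt, Submodule.map_comap_eq_of_surjective hbij.2] at this
    simpa only [Submodule.map_iSup] using this
  have h2 : IsGradation (E.le θ) (fun i => L.filt (rot y θ) (A i θ)) H := by
    refine ⟨hH.toIsDecomp, fun i => ?_⟩
    rw [hH.filt]
    simp only [hE]
  refine ⟨hdec, fun b => ?_⟩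
  have hlow : ∀ i j, E.le θ i j → leAt (rot y θ) (A j θ) b → leAt (rot y θ) (A i θ) b :=
    fun i j hij hj => leAt_trans (y := rot y θ) c ((hE θ i j).1 hij) hj
  rw [hH.filt, ← h2.biSup_filt (E.isPO θ) hlow, h1.biSup_filt (E.isPO θ) hlow]

/-- The stalks of the source and of the target of a morphism of Stokes-filtered local systems have
gradations with respect to which it is diagonal. -/
lemma exists_diagonal_stalk {L L' : PreStokes.{u, v, w, t} n k D} (hL : L.IsStokes)
    (hL' : L'.IsStokes) (hD : IsNormalCrossing n D) (hS : IsStratifiedCovering S)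
    (hgood : IsGoodCovering S) (hLS : ∀ y, L.factors y ⊆ S y) (hLS' : ∀ y, L'.factors y ⊆ S y)
    (f : L ⟶ L') (y : Boundary n D) :
    ∃ (r : ℕ) (a : Fin r → expStalk y) (G : Fin r → Submodule k (L.stalk y))
      (G' : Fin r → Submodule k (L'.stalk y)), Function.Injective a ∧ range a = S y ∧
      L.IsGradedAt y a G ∧ L'.IsGradedAt y a G' ∧ ∀ i, G i ≤ (G' i).comap (app f y) := by
  obtain ⟨c⟩ := hD y.1.pt
  obtain ⟨r, A, hA, hne, hr⟩ := hS.exists_labels y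
  have hinj : ∀ θ, Function.Injective fun i => A i θ := fun θ i j h => by
    by_contra hij
    exact hne i j hij θ h
  obtain ⟨E, hE⟩ := exists_expData y c A hA hne fun i j hij θ =>
    hgood (rot y θ) _ (by rw [← hr]; exact ⟨i, rfl⟩) _ (by rw [← hr]; exact ⟨j, rfl⟩)
      (hne i j hij θ)
  have := L.finiteDimensional_lineSections (continuous_rot y)
  have := L'.finiteDimensional_lineSections (continuous_rot y)
  -- the map induced by the morphism on the sections along the circle
  let F : L.lineSections (rot y) →ₗ[k] L'.lineSections (rot y) :=
    (LinearMap.pi fun θ => app f (rot y θ) ∘ₗ L.lineEval (rot y) θ).codRestrict _ fun s θ₀ => by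
      obtain ⟨t, ht, h⟩ := s.2 θ₀
      refine ⟨_, f.2.1 _ t ht, ?_⟩
      filter_upwards [h] with θ hθ
      exact congrArg _ hθ
  have hF : ∀ θ s, L'.lineEval (rot y) θ (F s) = app f (rot y θ) (L.lineEval (rot y) θ s) :=
    fun θ s => rfl
  obtain ⟨G, G', hG, hG', hGG'⟩ := exists_diagonal_gradation r E (by simp)
    (hL.locGraded_lineFilt hD hS hLS y hA hinj hr hE)
    (hL'.locGraded_lineFilt hD hS hLS' y hA hinj hr hE) F
    (fun θ i s hs => f.2.2 (rot y θ) (A i θ) _ hs) 0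
  have key : ∃ (r : ℕ) (a : Fin r → expStalk (rot y 0)) (G : Fin r → Submodule k (L.stalk (rot y 0)))
      (G' : Fin r → Submodule k (L'.stalk (rot y 0))), Function.Injective a ∧
      range a = S (rot y 0) ∧ L.IsGradedAt (rot y 0) a G ∧ L'.IsGradedAt (rot y 0) a G' ∧
      ∀ i, G i ≤ (G' i).comap (app f (rot y 0)) := by
    refine ⟨r, fun i => A i 0, _, _, hinj 0, hr 0,
      hL.isGradedAt_of_line hD y hE (hinj 0) (by rw [hr]; exact hLS _) hG,
      hL'.isGradedAt_of_line hD y hE (hinj 0) (by rw [hr]; exact hLS' _) hG', fun i => ?_⟩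
    rintro _ ⟨s, hs, rfl⟩
    exact ⟨F s, hGG' i hs, hF 0 s⟩
  rwa [rot_zero] at key

/-- Near every point there are models of the source and of the target of a morphism with respect to
which it is diagonal. -/
lemma exists_diagonal_model {L L' : PreStokes.{u, v, w, t} n k D} (hL : L.IsStokes)
    (hL' : L'.IsStokes) (hD : IsNormalCrossing n D) (hS : IsStratifiedCovering S)
    (hgood : IsGoodCovering S) (hLS : ∀ y, L.factors y ⊆ S y) (hLS' : ∀ y, L'.factors y ⊆ S y)
    (f : L ⟶ L') (y : Boundary n D) :
    ∃ (r : ℕ) (σ : Fin r → ∀ z : Boundary n D, expStalk z) (G : Fin r → Submodule k (L.stalk y))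
      (G' : Fin r → Submodule k (L'.stalk y)), L.IsModel y σ G ∧ L'.IsModel y σ G' ∧
      ∀ i, G i ≤ (G' i).comap (app f y) := by
  obtain ⟨r, a, G, G', ha, hr, hG, hG', h⟩ :=
    exists_diagonal_stalk hL hL' hD hS hgood hLS hLS' f y
  obtain ⟨q, φ, hφ, hev⟩ := hS y
  have h1 : ∀ i, ∃ j, φ j y = a i := fun i => by
    have h2 : a i ∈ S y := by
      rw [← hr]
      exact ⟨i, rfl⟩
    rw [hev.self_of_nhds.1] at h2
    exact h2
  choose e he using h1
  have heinj : Function.Injective e := fun i j h => ha (by rw [← he, ← he, h])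
  have hinj : ∀ᶠ z in 𝓝 y, stratum z = stratum y → Function.Injective fun i => φ (e i) z := by
    filter_upwards [hev] with z hz hst
    exact (hz.2 hst).comp heinj
  have hφa : (fun i => φ (e i) y) = a := funext he
  exact ⟨r, fun i => φ (e i), G, G', hL.isModel hD (fun i => hφ _) hinj (hφa ▸ hG),
    hL'.isModel hD (fun i => hφ _) hinj (hφa ▸ hG'), h⟩

end PreStokes

end Diagonal

/-! ### Subobjects and quotients -/

section SubQuotient

variable {n : ℕ} {X : Type u} [TopologicalSpace X] [ChartedSpace (Fin n → ℂ) X] {J : Type t}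
  {D : J → Set X} {k : Type v} [Field k]

namespace PreStokes

variable {L L' : PreStokes.{u, v, w, t} n k D}

@[ext] lemma hom_ext {f g : L ⟶ L'} (h : ∀ y, app f y = app g y) : f = g := Subtype.ext (funext h)

lemma app_mem_sec (f : L ⟶ L') {y : Boundary n D} {s : ∀ z, L.stalk z} (hs : s ∈ L.sec y) :
    (fun z => app f z (s z)) ∈ L'.sec y := f.2.1 y s hs

lemma app_mem_filt (f : L ⟶ L') {y : Boundary n D} {a : expStalk y} {x : L.stalk y}
    (hx : x ∈ L.filt y a) : app f y x ∈ L'.filt y a := f.2.2 y a x hx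

lemma eventually_app_transport (f : L ⟶ L') (y : Boundary n D) :
    ∀ᶠ z in 𝓝 y, app f z ∘ₗ L.transport y z = L'.transport y z ∘ₗ app f y :=
  LocalSystem.eventually_map_transport (app f) fun _ hs => app_mem_sec f hs

lemma eventually_range_app (f : L ⟶ L') (y : Boundary n D) : ∀ᶠ z in 𝓝 y,
    LinearMap.range (app f z) = (LinearMap.range (app f y)).map (L'.transport y z) := by
  filter_upwards [eventually_app_transport f y, L.eventually_bijective y] with z h1 h2
  rw [← LinearMap.range_comp, ← h1, LinearMap.range_comp, LinearMap.range_eq_top.2 h2.2,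
    Submodule.map_top]

lemma eventually_ker_app (f : L ⟶ L') (y : Boundary n D) : ∀ᶠ z in 𝓝 y,
    LinearMap.ker (app f z) = (LinearMap.ker (app f y)).map (L.transport y z) := by
  filter_upwards [eventually_app_transport f y, L.eventually_bijective y,
    L'.eventually_bijective y] with z h1 h2 h3
  have h4 : LinearMap.ker (app f y) = (LinearMap.ker (app f z)).comap (L.transport y z) := by
    rw [← LinearMap.ker_comp, h1, LinearMap.ker_comp_of_ker_eq_bot _ (LinearMap.ker_eq_bot.2 h3.1)]
  rw [h4, Submodule.map_comap_eq_of_surjective h2.2]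

/-- A family of vectors is a section if its image by a monomorphism is. -/
lemma mem_sec_of_injective (i : L ⟶ L') (hi : ∀ y, Function.Injective (app i y))
    {y : Boundary n D} {s : ∀ z, L.stalk z} (hs : (fun z => app i z (s z)) ∈ L'.sec y) :
    s ∈ L.sec y := by
  refine L.sec_congr y _ (L.extend_mem y (s y)) _ ?_
  filter_upwards [LocalSystem.eventually_eq_of_mem_sec hs
    (app_mem_sec i (L.extend_mem y (s y))) (by simp)] with z hz
  exact (hi z hz).symm

/-- A section of the target of an epimorphism lifts. -/
lemma exists_lift_of_surjective (p : L ⟶ L') (hp : ∀ y, Function.Surjective (app p y))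
    {y : Boundary n D} {s : ∀ z, L'.stalk z} (hs : s ∈ L'.sec y) :
    ∃ s' ∈ L.sec y, ∀ᶠ z in 𝓝 y, s z = app p z (s' z) := by
  obtain ⟨x, hx⟩ := hp y (s y)
  exact ⟨L.extend y x, L.extend_mem y x, LocalSystem.eventually_eq_of_mem_sec hs
    (app_mem_sec p (L.extend_mem y x)) (by simp [hx])⟩

/-- The trace of a local model on a homogeneous subobject. -/
lemma IsModel.comap {y : Boundary n D} {r : ℕ} {σ : Fin r → ∀ z : Boundary n D, expStalk z}
    {G : Fin r → Submodule k (L'.stalk y)} (h : L'.IsModel y σ G) (i : L ⟶ L')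
    (hi : ∀ z, Function.Injective (app i z))
    (hfilt : ∀ z a, L.filt z a = (L'.filt z a).comap (app i z))
    (hrange : ∀ x j, h.graded_self.proj j (app i y x) ∈ LinearMap.range (app i y)) :
    L.IsModel y σ fun j => (G j).comap (app i y) := by
  have hdec := h.graded_self.toIsDecomp.comap (hi y) hrange
  refine ⟨h.isSectionNear, h.injective, ?_⟩
  filter_upwards [h.graded, L.eventually_bijective y, L'.eventually_bijective y,
    eventually_app_transport i y] with z h1 h2 h3 h4
  have hdec' := hdec.map_of_bijective h2
  have hle : ∀ j, ((G j).comap (app i y)).map (L.transport y z)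
      ≤ ((G j).map (L'.transport y z)).comap (app i z) := by
    rintro j _ ⟨x, hx, rfl⟩
    exact ⟨app i y x, hx, (LinearMap.congr_fun h4 x).symm⟩
  refine ⟨hdec', fun b => ?_⟩
  ext x
  rw [hfilt, Submodule.mem_comap, h1.filt, h1.mem_biSup_iff, hdec'.mem_biSup_iff]
  refine forall₂_congr fun j _ => ?_
  rw [← hdec'.map_proj h1.toIsDecomp hle, map_eq_zero_iff _ (hi z)]

/-- The image of a local model in a quotient by a homogeneous subobject. -/
lemma IsModel.map {y : Boundary n D} {r : ℕ} {σ : Fin r → ∀ z : Boundary n D, expStalk z}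
    {G : Fin r → Submodule k (L.stalk y)} (h : L.IsModel y σ G) (p : L ⟶ L')
    (hp : ∀ z, Function.Surjective (app p z))
    (hfilt : ∀ z a, L'.filt z a = (L.filt z a).map (app p z))
    (hker : ∀ x, app p y x = 0 → ∀ j, app p y (h.graded_self.proj j x) = 0) :
    L'.IsModel y σ fun j => (G j).map (app p y) := by
  have hdec := h.graded_self.toIsDecomp.map (hp y) hker
  refine ⟨h.isSectionNear, h.injective, ?_⟩
  filter_upwards [h.graded, L'.eventually_bijective y, eventually_app_transport p y]
    with z h1 h2 h3
  refine ⟨hdec.map_of_bijective h2, fun b => ?_⟩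
  rw [hfilt, h1.filt]
  simp only [Submodule.map_iSup]
  refine iSup_congr fun j => iSup_congr fun _ => ?_
  rw [← Submodule.map_comp, ← Submodule.map_comp, h3]

section Constructions

variable (L) (N : ∀ y, Submodule k (L.stalk y))
  (hN : ∀ y, ∀ᶠ z in 𝓝 y, N z = (N y).map (L.transport y z))

include hN in
lemma eventually_mem_of_mem_sec {y : Boundary n D} {s : ∀ z, L.stalk z} (hs : s ∈ L.sec y)
    (h : s y ∈ N y) : ∀ᶠ z in 𝓝 y, s z ∈ N z := by
  filter_upwards [hN y, LocalSystem.eventually_eq_transport hs] with z h1 h2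
  rw [h1, h2]
  exact ⟨_, h, rfl⟩

open Classical in
include hN in
lemma exists_sec_sub {y : Boundary n D} {s : ∀ z, L.stalk z} (hs : s ∈ L.sec y) (h : s y ∈ N y) :
    ∃ s' : ∀ z, N z, (fun z => (s' z : L.stalk z)) ∈ L.sec y ∧
      ∀ᶠ z in 𝓝 y, s z = s' z := by
  have hev : ∀ᶠ z in 𝓝 y, s z = if s z ∈ N z then s z else 0 := by
    filter_upwards [L.eventually_mem_of_mem_sec N hN hs h] with z hz
    rw [if_pos hz]
  refine ⟨fun z => ⟨if s z ∈ N z then s z else 0, ?_⟩, L.sec_congr y s hs _ hev, hev⟩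
  split_ifs with hz
  · exact hz
  · exact Submodule.zero_mem _

/-- The local subsystem with stalks `N y`, with the induced filtration. -/
def sub : PreStokes.{u, v, w, t} n k D where
  stalk y := N y
  sec y :=
    { carrier := {s | (fun z => (s z : L.stalk z)) ∈ L.sec y}
      add_mem' := fun ha hb => (L.sec y).add_mem ha hb
      zero_mem' := (L.sec y).zero_mem
      smul_mem' := fun c _ ha => (L.sec y).smul_mem c ha }
  sec_open y s hs := L.sec_open y _ hs
  sec_congr y s hs s' h := L.sec_congr y _ hs _ (h.mono fun z hz => congrArg Subtype.val hz)
  sec_zero y s hs h := (L.sec_zero y _ hs (congrArg Subtype.val h)).mono fun z hz => Subtype.ext hz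
  exists_frame y := by
    obtain ⟨q, b, hb, hev⟩ := LocalSystem.exists_frame_map (L := L.toLocalSystem) (y := y)
      (N := N) (L.extend y ∘ₗ (N y).subtype) (fun x => L.extend_mem y _)
      ((L.eventually_bijective y).mono fun z hz x x' hx => Subtype.ext (hz.1 hx))
      ((hN y).mono fun z hz => by
        rw [hz, ← LinearMap.comp_assoc, LinearMap.range_comp, Submodule.range_subtype]
        rfl)
    choose b' hb' hbb' using fun j => L.exists_sec_sub N hN (hb j) (by
      rw [← hev.self_of_nhds.2]
      exact Submodule.subset_span ⟨j, rfl⟩)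
    refine ⟨q, b', hb', ?_⟩
    filter_upwards [hev, eventually_all.2 hbb'] with z h1 h2
    have h3 : (fun j => b j z) = (N z).subtype ∘ fun j => b' j z := funext h2
    rw [h3] at h1
    refine ⟨h1.1.of_comp _, ?_⟩
    apply Submodule.map_injective_of_injective (N z).injective_subtype
    rw [Submodule.map_top, Submodule.range_subtype, Submodule.map_span, ← range_comp]
    exact h1.2
  filt y a := (L.filt y a).comap (N y).subtype
  filt_mono y a b h := Submodule.comap_mono (L.filt_mono y a b h)
  filt_open y a x hx := by
    obtain ⟨φ, hφ, hφa, s, hs, hsx, hev⟩ := L.filt_open y a x hx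
    obtain ⟨s', hs', hss'⟩ := L.exists_sec_sub N hN hs (by rw [hsx]; exact x.2)
    refine ⟨φ, hφ, hφa, s', hs', Subtype.ext ?_, ?_⟩
    · rw [← hsx, hss'.self_of_nhds]
    · filter_upwards [hev, hss'] with z h1 h2
      rw [h2] at h1
      exact h1

/-- The inclusion of a local subsystem. -/
def subι : L.sub N hN ⟶ L :=
  ⟨fun y => (N y).subtype, fun _ _ hs => hs, fun _ _ _ hx => hx⟩

/-- The quotient by the local subsystem with stalks `N y`, with the induced filtration. -/
def quot : PreStokes.{u, v, w, t} n k D where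
  stalk y := L.stalk y ⧸ N y
  sec y :=
    { carrier := {s | ∃ s' ∈ L.sec y, ∀ᶠ z in 𝓝 y, s z = (N z).mkQ (s' z)}
      add_mem' := by
        rintro s t ⟨s', hs', hs⟩ ⟨t', ht', ht⟩
        refine ⟨s' + t', (L.sec y).add_mem hs' ht', ?_⟩
        filter_upwards [hs, ht] with z h1 h2
        rw [Pi.add_apply, Pi.add_apply, h1, h2, map_add]
      zero_mem' := ⟨0, (L.sec y).zero_mem, Eventually.of_forall fun _ => rfl⟩
      smul_mem' := by
        rintro c s ⟨s', hs', hs⟩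
        refine ⟨c • s', (L.sec y).smul_mem c hs', ?_⟩
        filter_upwards [hs] with z h1
        rw [Pi.smul_apply, Pi.smul_apply, h1, map_smul] }
  sec_open y s hs := by
    obtain ⟨s', hs', hs⟩ := hs
    filter_upwards [L.sec_open y s' hs', hs.eventually_nhds] with z h1 h2
    exact ⟨s', h1, h2⟩
  sec_congr y s hs t h := by
    obtain ⟨s', hs', hs⟩ := hs
    refine ⟨s', hs', ?_⟩
    filter_upwards [hs, h] with z h1 h2
    rw [← h2, h1]
  sec_zero y s hs h := by
    obtain ⟨s', hs', hs⟩ := hs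
    rw [hs.self_of_nhds, Submodule.mkQ_apply, Submodule.Quotient.mk_eq_zero] at h
    filter_upwards [hs, L.eventually_mem_of_mem_sec N hN hs' h] with z h1 h2
    rw [h1, Submodule.mkQ_apply, (Submodule.Quotient.mk_eq_zero _).2 h2]
  exists_frame y := by
    let b := Module.finBasis k (L.stalk y ⧸ N y)
    choose x hx using fun j => (N y).mkQ_surjective (b j)
    refine ⟨_, fun j z => (N z).mkQ (L.extend y (x j) z),
      fun j => ⟨_, L.extend_mem y (x j), Eventually.of_forall fun _ => rfl⟩, ?_⟩
    filter_upwards [hN y, L.eventually_bijective y] with z h1 h2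
    let e := Submodule.Quotient.equiv (N y) (N z) (LinearEquiv.ofBijective _ h2) h1.symm
    have h3 : (fun j => (N z).mkQ (L.extend y (x j) z)) = b.map e := by
      funext j
      rw [Module.Basis.map_apply, ← hx j]
      rfl
    rw [h3]
    exact ⟨(b.map e).linearIndependent, (b.map e).span_eq⟩
  filt y a := (L.filt y a).map (N y).mkQ
  filt_mono y a b h := Submodule.map_mono (L.filt_mono y a b h)
  filt_open y a x hx := by
    obtain ⟨x', hx', rfl⟩ := hx
    obtain ⟨φ, hφ, hφa, s, hs, hsx, hev⟩ := L.filt_open y a x' hx'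
    refine ⟨φ, hφ, hφa, fun z => (N z).mkQ (s z), ⟨s, hs, Eventually.of_forall fun _ => rfl⟩,
      congrArg (N y).mkQ hsx, ?_⟩
    filter_upwards [hev] with z h1
    exact ⟨_, h1, rfl⟩

/-- The projection to a quotient. -/
def quotπ : L ⟶ L.quot N hN :=
  ⟨fun y => (N y).mkQ, fun _ s hs => ⟨s, hs, Eventually.of_forall fun _ => rfl⟩,
    fun _ _ x hx => ⟨x, hx, rfl⟩⟩

end Constructions

/-- The kernel of the underlying morphism of local systems, with the induced filtration. -/
lemma exists_isKernelOf (f : L ⟶ L') :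
    ∃ (K : PreStokes.{u, v, w, t} n k D) (i : K ⟶ L), IsKernelOf i f :=
  ⟨_, L.subι _ (eventually_ker_app f), fun y =>
    ⟨(LinearMap.ker (app f y)).injective_subtype, Submodule.range_subtype _, fun _ => rfl⟩⟩

/-- The cokernel of the underlying morphism of local systems, with the induced filtration. -/
lemma exists_isCokernelOf (f : L ⟶ L') :
    ∃ (C : PreStokes.{u, v, w, t} n k D) (p : L' ⟶ C), IsCokernelOf p f :=
  ⟨_, L'.quotπ _ (eventually_range_app f), fun _ =>
    ⟨Submodule.mkQ_surjective _, Submodule.ker_mkQ _, fun _ => rfl⟩⟩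

/-- The image of the underlying morphism of local systems of a strict morphism. -/
lemma IsStrict.exists_isImageOf {f : L ⟶ L'} (hf : IsStrict f) :
    ∃ (M : PreStokes.{u, v, w, t} n k D) (p : L ⟶ M) (i : M ⟶ L'), IsImageOf p i f := by
  refine ⟨L'.sub _ (eventually_range_app f), ⟨fun y => (app f y).rangeRestrict,
    fun y s hs => app_mem_sec f hs, fun y a x hx => app_mem_filt f hx⟩,
    L'.subι _ _, rfl, fun y => ⟨(app f y).surjective_rangeRestrict,
    (LinearMap.range (app f y)).injective_subtype, fun a => ⟨rfl, ?_⟩⟩⟩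
  ext x
  obtain ⟨v, hv⟩ : ∃ v, app f y v = x.1 := x.2
  have h : x.1 ∈ (L.filt y a).map (app f y) ↔ x.1 ∈ L'.filt y a := by
    rw [hf y a]
    exact and_iff_left ⟨v, hv⟩
  exact h.symm.trans ⟨fun ⟨w, hw, e⟩ => ⟨w, hw, Subtype.ext e⟩,
    fun ⟨w, hw, e⟩ => ⟨w, hw, congrArg Subtype.val e⟩⟩

end PreStokes

end SubQuotient

/-! ### Strictness -/

section Strict

variable {n : ℕ} {X : Type u} [TopologicalSpace X] [ChartedSpace (Fin n → ℂ) X] {J : Type t}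
  {D : J → Set X} {k : Type v} [Field k]

namespace PreStokes

variable {L L' : PreStokes.{u, v, w, t} n k D}

/-- Near every point, there are models of the source and of the target with respect to which the
morphism is diagonal. -/
def HasDiagonalModels (f : L ⟶ L') : Prop :=
  ∀ y, ∃ (r : ℕ) (σ : Fin r → ∀ z : Boundary n D, expStalk z) (G : Fin r → Submodule k (L.stalk y))
    (G' : Fin r → Submodule k (L'.stalk y)), L.IsModel y σ G ∧ L'.IsModel y σ G' ∧
    ∀ i, G i ≤ (G' i).comap (app f y)

namespace HasDiagonalModels

variable {f : L ⟶ L'} (hf : HasDiagonalModels f)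
include hf

lemma isLocallyDiagonal : IsLocallyDiagonal f := by
  intro y
  obtain ⟨r, σ, G, G', h, h', hd⟩ := hf y
  refine ⟨r, σ, _, _, h.isGradationNear, h'.isGradationNear, ?_⟩
  filter_upwards [eventually_app_transport f y] with z hz i
  rw [← Submodule.map_comp, hz, Submodule.map_comp]
  exact Submodule.map_mono (Submodule.map_le_iff_le_comap.2 (hd i))

open Classical in
/-- The components of a vector at the indices which are not at most `a` have zero image if its image
lies in the step `a`, so that they may be dropped. -/
lemma isStrict : IsStrict f := by
  intro y a
  obtain ⟨r, σ, G, G', h, h', hd⟩ := hf y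
  have hG := h.graded_self
  have hG' := h'.graded_self
  refine le_antisymm ?_ ?_
  · rintro _ ⟨x, hx, rfl⟩
    exact ⟨app_mem_filt f hx, ⟨x, rfl⟩⟩
  · rintro _ ⟨hx, ⟨x, rfl⟩⟩
    -- keep the components of the antecedent whose indices are at most `a`
    refine ⟨∑ i, if leAt y (σ i y) a then hG.proj i x else 0, ?_, ?_⟩
    · refine Submodule.sum_mem _ fun i _ => ?_
      split_ifs with hi
      · rw [hG.filt]
        exact Submodule.mem_iSup_of_mem i (Submodule.mem_iSup_of_mem hi (hG.proj_mem i x))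
      · exact Submodule.zero_mem _
    · rw [map_sum]
      conv_rhs => rw [← hG'.sum_proj (app f y x)]
      refine Finset.sum_congr rfl fun i _ => ?_
      rw [← hG.toIsDecomp.map_proj hG'.toIsDecomp hd]
      split_ifs with hi
      · rfl
      · have hx' : app f y x ∈ L'.filt y a := hx
        rw [hG'.filt, hG'.mem_biSup_iff] at hx'
        rw [map_zero, hG.toIsDecomp.map_proj hG'.toIsDecomp hd, hx' i hi]

lemma kernel_isStokes (hD : IsNormalCrossing n D) {K : PreStokes.{u, v, w, t} n k D} {i : K ⟶ L}
    (hi : IsKernelOf i f) : K.IsStokes ∧ ∀ y, K.factors y ⊆ L.factors y := by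
  have key : ∀ y, ∃ (r : ℕ) (σ : Fin r → ∀ z : Boundary n D, expStalk z)
      (G : Fin r → Submodule k (L.stalk y)), L.IsModel y σ G ∧
      K.IsModel y σ fun j => (G j).comap (app i y) := fun y => by
    obtain ⟨r, σ, G, G', h, h', hd⟩ := hf y
    refine ⟨r, σ, G, h, h.comap i (fun z => (hi z).1) (fun z => (hi z).2.2) fun x j => ?_⟩
    rw [(hi y).2.1, LinearMap.mem_ker,
      h.graded_self.toIsDecomp.map_proj h'.graded_self.toIsDecomp hd]
    have hx : app f y (app i y x) = 0 := by
      rw [← LinearMap.mem_ker, ← (hi y).2.1]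
      exact ⟨x, rfl⟩
    rw [hx, map_zero]
  refine ⟨isStokes_of_isModel hD fun y => ?_, fun y a ha => ?_⟩
  · obtain ⟨r, σ, G, -, h⟩ := key y
    exact ⟨r, σ, _, h⟩
  · obtain ⟨r, σ, G, h, hK⟩ := key y
    obtain ⟨j, hj, hne⟩ := (hK.mem_factors_iff hD a).1 ha
    refine (h.mem_factors_iff hD a).2 ⟨j, hj, fun h0 => hne ?_⟩
    rw [h0, Submodule.comap_bot, LinearMap.ker_eq_bot.2 (hi y).1]

lemma cokernel_isStokes (hD : IsNormalCrossing n D) {C : PreStokes.{u, v, w, t} n k D} {p : L' ⟶ C}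
    (hp : IsCokernelOf p f) : C.IsStokes ∧ ∀ y, C.factors y ⊆ L'.factors y := by
  have key : ∀ y, ∃ (r : ℕ) (σ : Fin r → ∀ z : Boundary n D, expStalk z)
      (G : Fin r → Submodule k (L'.stalk y)), L'.IsModel y σ G ∧
      C.IsModel y σ fun j => (G j).map (app p y) := fun y => by
    obtain ⟨r, σ, G, G', h, h', hd⟩ := hf y
    refine ⟨r, σ, G', h', h'.map p (fun z => (hp z).1) (fun z => (hp z).2.2) fun x hx j => ?_⟩
    rw [← LinearMap.mem_ker, (hp y).2.1] at hx ⊢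
    obtain ⟨x, rfl⟩ := hx
    exact ⟨_, h.graded_self.toIsDecomp.map_proj h'.graded_self.toIsDecomp hd x j⟩
  refine ⟨isStokes_of_isModel hD fun y => ?_, fun y a ha => ?_⟩
  · obtain ⟨r, σ, G, -, h⟩ := key y
    exact ⟨r, σ, _, h⟩
  · obtain ⟨r, σ, G, h, hC⟩ := key y
    obtain ⟨j, hj, hne⟩ := (hC.mem_factors_iff hD a).1 ha
    refine (h.mem_factors_iff hD a).2 ⟨j, hj, fun h0 => hne ?_⟩
    rw [h0, Submodule.map_bot]

/-- The image is both a subobject of the target and a quotient of the source: its exponential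
factors are among those of both. -/
lemma image_isStokes (hD : IsNormalCrossing n D) {M : PreStokes.{u, v, w, t} n k D} {p : L ⟶ M}
    {i : M ⟶ L'} (hM : IsImageOf p i f) :
    M.IsStokes ∧ ∀ y, M.factors y ⊆ L.factors y ∩ L'.factors y := by
  obtain ⟨hpi, hM⟩ := hM
  have hpi' : ∀ y x, app i y (app p y x) = app f y x := fun y x => by rw [← hpi]; rfl
  have key : ∀ y, ∃ (r : ℕ) (σ : Fin r → ∀ z : Boundary n D, expStalk z)
      (G : Fin r → Submodule k (L.stalk y)) (G' : Fin r → Submodule k (L'.stalk y)),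
      L.IsModel y σ G ∧ L'.IsModel y σ G' ∧ (M.IsModel y σ fun j => (G j).map (app p y)) ∧
      M.IsModel y σ fun j => (G' j).comap (app i y) := fun y => by
    obtain ⟨r, σ, G, G', h, h', hd⟩ := hf y
    refine ⟨r, σ, G, G', h, h', h.map p (fun z => (hM z).1) (fun z a => ((hM z).2.2 a).2)
      fun x hx j => ?_, h'.comap i (fun z => (hM z).2.1) (fun z a => ((hM z).2.2 a).1)
      fun x j => ?_⟩
    · apply (hM y).2.1
      rw [hpi', h.graded_self.toIsDecomp.map_proj h'.graded_self.toIsDecomp hd, ← hpi', hx,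
        map_zero, map_zero]
    · obtain ⟨x, rfl⟩ := (hM y).1 x
      rw [hpi', ← h.graded_self.toIsDecomp.map_proj h'.graded_self.toIsDecomp hd, ← hpi']
      exact ⟨_, rfl⟩
  refine ⟨isStokes_of_isModel hD fun y => ?_, fun y a ha => ?_⟩
  · obtain ⟨r, σ, G, G', -, -, h, -⟩ := key y
    exact ⟨r, σ, _, h⟩
  · obtain ⟨r, σ, G, G', h, h', h1, h2⟩ := key y
    constructor
    · obtain ⟨j, hj, hne⟩ := (h1.mem_factors_iff hD a).1 ha
      refine (h.mem_factors_iff hD a).2 ⟨j, hj, fun h0 => hne ?_⟩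
      rw [h0, Submodule.map_bot]
    · obtain ⟨j, hj, hne⟩ := (h2.mem_factors_iff hD a).1 ha
      refine (h'.mem_factors_iff hD a).2 ⟨j, hj, fun h0 => hne ?_⟩
      rw [h0, Submodule.comap_bot, LinearMap.ker_eq_bot.2 (hM y).2.1]

end HasDiagonalModels

/-! ### Universal properties -/

lemma IsKernelOf.comp_eq_zero {K : PreStokes.{u, v, w, t} n k D} {i : K ⟶ L} {f : L ⟶ L'}
    (hi : IsKernelOf i f) : i ≫ f = 0 := by
  ext y x
  exact ((hi y).2.1.le ⟨x, rfl⟩ : app i y x ∈ LinearMap.ker (app f y))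

lemma IsCokernelOf.comp_eq_zero {C : PreStokes.{u, v, w, t} n k D} {p : L' ⟶ C} {f : L ⟶ L'}
    (hp : IsCokernelOf p f) : f ≫ p = 0 := by
  ext y x
  exact ((hp y).2.1.ge ⟨x, rfl⟩ : app f y x ∈ LinearMap.ker (app p y))

lemma IsKernelOf.exists_lift {K : PreStokes.{u, v, w, t} n k D} {i : K ⟶ L} {f : L ⟶ L'}
    (hi : IsKernelOf i f) {W : PreStokes.{u, v, w, t} n k D} (g : W ⟶ L) (hg : g ≫ f = 0) :
    ∃ l : W ⟶ K, l ≫ i = g := by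
  have hr : ∀ y x, app g y x ∈ LinearMap.range (app i y) := fun y x => by
    rw [(hi y).2.1, LinearMap.mem_ker]
    exact LinearMap.congr_fun (congrArg (fun h => app h y) hg) x
  let l : ∀ y, W.stalk y →ₗ[k] K.stalk y := fun y =>
    (LinearEquiv.ofInjective (app i y) (hi y).1).symm.toLinearMap ∘ₗ
      (app g y).codRestrict _ (hr y)
  have hl : ∀ y x, app i y (l y x) = app g y x := fun y x =>
    congrArg Subtype.val ((LinearEquiv.ofInjective (app i y) (hi y).1).apply_symm_apply
      ⟨app g y x, hr y x⟩)
  refine ⟨⟨l, fun y s hs => mem_sec_of_injective i (fun z => (hi z).1) ?_, fun y a x hx => ?_⟩, ?_⟩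
  · simp only [hl]
    exact app_mem_sec g hs
  · rw [(hi y).2.2, Submodule.mem_comap, hl]
    exact app_mem_filt g hx
  · ext y x
    exact hl y x

lemma IsCokernelOf.exists_desc {C : PreStokes.{u, v, w, t} n k D} {p : L' ⟶ C} {f : L ⟶ L'}
    (hp : IsCokernelOf p f) {W : PreStokes.{u, v, w, t} n k D} (g : L' ⟶ W) (hg : f ≫ g = 0) :
    ∃ d : C ⟶ W, p ≫ d = g := by
  have hr : ∀ y, LinearMap.ker (app p y) ≤ LinearMap.ker (app g y) := fun y => by
    rw [(hp y).2.1]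
    rintro _ ⟨x, rfl⟩
    exact LinearMap.congr_fun (congrArg (fun h => app h y) hg) x
  let d : ∀ y, C.stalk y →ₗ[k] W.stalk y := fun y =>
    (LinearMap.ker (app p y)).liftQ (app g y) (hr y) ∘ₗ
      ((app p y).quotKerEquivOfSurjective (hp y).1).symm.toLinearMap
  have hd : ∀ y x, d y (app p y x) = app g y x := fun y x => by
    have : ((app p y).quotKerEquivOfSurjective (hp y).1).symm
        (app p y x) = Submodule.Quotient.mk x := by
      rw [LinearEquiv.symm_apply_eq]
      rfl
    simp only [d, LinearMap.comp_apply, LinearEquiv.coe_coe, this]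
    rfl
  refine ⟨⟨d, fun y s hs => ?_, fun y a x hx => ?_⟩, ?_⟩
  · obtain ⟨s', hs', h⟩ := exists_lift_of_surjective p (fun z => (hp z).1) hs
    refine W.sec_congr y _ (app_mem_sec g hs') _ ?_
    filter_upwards [h] with z hz
    rw [hz, hd]
  · rw [(hp y).2.2] at hx
    obtain ⟨x, hx, rfl⟩ := hx
    rw [hd]
    exact app_mem_filt g hx
  · ext y x
    exact hd y x

/-- A strict injective morphism is a kernel of its cokernel. -/
lemma IsCokernelOf.isKernelOf {C : PreStokes.{u, v, w, t} n k D} {p : L' ⟶ C} {f : L ⟶ L'}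
    (hp : IsCokernelOf p f) (hf : IsStrict f) (hinj : ∀ y, Function.Injective (app f y)) :
    IsKernelOf f p := fun y => ⟨hinj y, (hp y).2.1.symm, fun a => by
  apply Submodule.map_injective_of_injective (hinj y)
  rw [hf, Submodule.map_comap_eq, inf_comm]⟩

/-- A strict surjective morphism is a cokernel of its kernel. -/
lemma IsKernelOf.isCokernelOf {K : PreStokes.{u, v, w, t} n k D} {i : K ⟶ L} {f : L ⟶ L'}
    (hi : IsKernelOf i f) (hf : IsStrict f) (hsurj : ∀ y, Function.Surjective (app f y)) :
    IsCokernelOf f i := fun y => ⟨hsurj y, (hi y).2.1.symm, fun a => by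
  rw [hf, LinearMap.range_eq_top.2 (hsurj y), inf_top_eq]⟩

end PreStokes

end Strict

/-! ### The zero object and products -/

section Additive

variable {n : ℕ} {X : Type u} [TopologicalSpace X] [ChartedSpace (Fin n → ℂ) X] {J : Type t}
  {D : J → Set X} {k : Type v} [Field k]

lemma biSup_prod {V V' : Type*} [AddCommGroup V] [Module k V] [AddCommGroup V'] [Module k V']
    {ι : Type*} (P : ι → Prop) (p : ι → Submodule k V) (q : ι → Submodule k V') :
    (⨆ (i) (_ : P i), p i).prod (⨆ (i) (_ : P i), q i) = ⨆ (i) (_ : P i), (p i).prod (q i) := by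
  simp only [LinearMap.prod_eq_sup_map, Submodule.map_iSup, iSup_sup_eq]

lemma isMultivaluedMero_zero (hD : IsNormalCrossing n D) (y : Boundary n D) :
    IsMultivaluedMero y 0 := by
  obtain ⟨c⟩ := hD y.1.pt
  refine ⟨0, 0, c, 1, c.chart, le_rfl, ⟨c.chart.source, ?_, c.chart.continuousOn, fun z _ i => ?_⟩,
    fun _ _ => rfl, analyticAt_const, Eventually.of_forall fun z => ?_⟩
  · exact tendsto_nearFilter y (c.chart.open_source.mem_nhds c.mem_source)
  · exact ⟨fun _ => pow_one _, fun _ => rfl⟩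
  · simp

open Classical in
/-- There is a section of the sheaf of exponential factors through every germ. -/
lemma exists_isSectionNear [IsManifold 𝓘(ℂ, Fin n → ℂ) ω X] (hD : IsNormalCrossing n D)
    (y : Boundary n D) (a : expStalk y) :
    ∃ φ : ∀ z : Boundary n D, expStalk z, IsSectionNear y φ ∧ φ y = a := by
  obtain ⟨_, f, hf, rfl⟩ := a
  have hval : ∀ z : Boundary n D, IsMultivaluedMero z f →
      ((if h : IsMultivaluedMero z f then ⟨germ z f, f, h, rfl⟩
        else ⟨germ z 0, 0, isMultivaluedMero_zero hD z, rfl⟩ : expStalk z) : GermModBounded z)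
      = germ z f := fun z hz => by rw [dif_pos hz]
  exact ⟨_, ⟨f, hf.eventually.mono hval⟩, Subtype.ext (hval y hf)⟩

namespace PreStokes

/-- The zero local system. -/
def zeroObj [IsManifold 𝓘(ℂ, Fin n → ℂ) ω X] (k : Type v) [Field k] (hD : IsNormalCrossing n D) :
    PreStokes.{u, v, w, t} n k D where
  stalk _ := PUnit
  sec _ := ⊤
  sec_open _ _ _ := Eventually.of_forall fun _ => trivial
  sec_congr _ _ _ _ _ := trivial
  sec_zero _ _ _ _ := Eventually.of_forall fun _ => rfl
  exists_frame y := ⟨0, Fin.elim0, fun i => i.elim0, Eventually.of_forall fun z =>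
    ⟨linearIndependent_empty_type, Subsingleton.elim _ _⟩⟩
  filt _ _ := ⊤
  filt_mono _ _ _ _ := le_rfl
  filt_open y a x _ := by
    obtain ⟨φ, hφ, hφa⟩ := exists_isSectionNear hD y a
    exact ⟨φ, hφ, hφa, 0, trivial, rfl, Eventually.of_forall fun _ => trivial⟩

/-- The direct sum of two pre-Stokes-filtered local systems. -/
def prod (L L' : PreStokes.{u, v, w, t} n k D) : PreStokes.{u, v, w, t} n k D where
  stalk y := L.stalk y × L'.stalk y
  sec y :=
    { carrier := {s | (fun z => (s z).1) ∈ L.sec y ∧ (fun z => (s z).2) ∈ L'.sec y}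
      add_mem' := fun ha hb => ⟨(L.sec y).add_mem ha.1 hb.1, (L'.sec y).add_mem ha.2 hb.2⟩
      zero_mem' := ⟨(L.sec y).zero_mem, (L'.sec y).zero_mem⟩
      smul_mem' := fun c _ ha => ⟨(L.sec y).smul_mem c ha.1, (L'.sec y).smul_mem c ha.2⟩ }
  sec_open y s hs := (L.sec_open y _ hs.1).and (L'.sec_open y _ hs.2)
  sec_congr y s hs t h := ⟨L.sec_congr y _ hs.1 _ (h.mono fun z hz => congrArg Prod.fst hz),
    L'.sec_congr y _ hs.2 _ (h.mono fun z hz => congrArg Prod.snd hz)⟩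
  sec_zero y s hs h := by
    filter_upwards [L.sec_zero y _ hs.1 (congrArg Prod.fst h),
      L'.sec_zero y _ hs.2 (congrArg Prod.snd h)] with z h1 h2
    exact Prod.ext h1 h2
  exists_frame y := by
    let b := Module.finBasis k (L.stalk y × L'.stalk y)
    refine ⟨_, fun j z => (L.extend y (b j).1 z, L'.extend y (b j).2 z),
      fun j => ⟨L.extend_mem y _, L'.extend_mem y _⟩, ?_⟩
    filter_upwards [L.eventually_bijective y, L'.eventually_bijective y] with z h1 h2
    let e := (LinearEquiv.ofBijective _ h1).prodCongr (LinearEquiv.ofBijective _ h2)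
    have h3 : (fun j => (L.extend y (b j).1 z, L'.extend y (b j).2 z)) = b.map e := by
      funext j
      rw [Module.Basis.map_apply]
      rfl
    rw [h3]
    exact ⟨(b.map e).linearIndependent, (b.map e).span_eq⟩
  filt y a := (L.filt y a).prod (L'.filt y a)
  filt_mono y a b h := Submodule.prod_mono (L.filt_mono y a b h) (L'.filt_mono y a b h)
  filt_open y a x hx := by
    obtain ⟨φ, hφ, hφa, s, hs, hsx, hev⟩ := L.filt_open y a x.1 hx.1
    obtain ⟨φ', hφ', hφa', s', hs', hsx', hev'⟩ := L'.filt_open y a x.2 hx.2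
    refine ⟨φ, hφ, hφa, fun z => (s z, s' z), ⟨hs, hs'⟩, Prod.ext hsx hsx', ?_⟩
    filter_upwards [hev, hev', hφ.eventually_eq hφ' (hφa.trans hφa'.symm)] with z h1 h2 h3
    exact ⟨h1, h3 ▸ h2⟩

section Prod

variable (L L' : PreStokes.{u, v, w, t} n k D)

/-- The first projection. -/
def prodFst : L.prod L' ⟶ L :=
  ⟨fun _ => LinearMap.fst k _ _, fun _ _ hs => hs.1, fun _ _ _ hx => hx.1⟩

/-- The second projection. -/
def prodSnd : L.prod L' ⟶ L' :=
  ⟨fun _ => LinearMap.snd k _ _, fun _ _ hs => hs.2, fun _ _ _ hx => hx.2⟩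

/-- The first injection. -/
def prodInl : L ⟶ L.prod L' :=
  ⟨fun _ => LinearMap.inl k _ _, fun y _ hs => ⟨hs, (L'.sec y).zero_mem⟩,
    fun y a _ hx => ⟨hx, (L'.filt y a).zero_mem⟩⟩

/-- The second injection. -/
def prodInr : L' ⟶ L.prod L' :=
  ⟨fun _ => LinearMap.inr k _ _, fun y _ hs => ⟨(L.sec y).zero_mem, hs⟩,
    fun y a _ hx => ⟨(L.filt y a).zero_mem, hx⟩⟩

variable {L L'}

lemma IsModel.prod {y : Boundary n D} {r : ℕ} {σ : Fin r → ∀ z : Boundary n D, expStalk z}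
    {G : Fin r → Submodule k (L.stalk y)} {G' : Fin r → Submodule k (L'.stalk y)}
    (h : L.IsModel y σ G) (h' : L'.IsModel y σ G') :
    (L.prod L').IsModel y σ fun i => (G i).prod (G' i) := by
  refine ⟨h.isSectionNear, h.injective, ?_⟩
  filter_upwards [h.graded, h'.graded, eventually_app_transport (prodFst L L') y,
    eventually_app_transport (prodSnd L L') y] with z h1 h2 h3 h4
  have ht : (L.prod L').transport y z = (L.transport y z).prodMap (L'.transport y z) :=
    LinearMap.ext fun x => Prod.ext (LinearMap.congr_fun h3 x) (LinearMap.congr_fun h4 x)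
  have hm : (fun i => ((G i).prod (G' i)).map ((L.prod L').transport y z))
      = fun i => ((G i).map (L.transport y z)).prod ((G' i).map (L'.transport y z)) := by
    funext i
    rw [ht]
    exact LinearMap.prodMap_map_prod _ _ _ _
  rw [hm]
  refine ⟨h1.toIsDecomp.prod h2.toIsDecomp, fun b => ?_⟩
  have h5 : (L.prod L').filt z b = (L.filt z b).prod (L'.filt z b) := rfl
  rw [h5, h1.filt, h2.filt]
  exact biSup_prod _ _ _

lemma prod_stokesIn {S : ∀ y : Boundary n D, Set (expStalk y)} (hD : IsNormalCrossing n D)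
    (hS : IsStratifiedCovering S) (hL : stokesIn k S L) (hL' : stokesIn k S L') :
    stokesIn k S (L.prod L') := by
  have key : ∀ y, ∃ (r : ℕ) (σ : Fin r → ∀ z : Boundary n D, expStalk z)
      (G : Fin r → Submodule k ((L.prod L').stalk y)), (L.prod L').IsModel y σ G ∧
      ∀ i, σ i y ∈ S y := fun y => by
    obtain ⟨r, φ, hφ, hev⟩ := hS y
    obtain ⟨hr, hinj⟩ := hev.self_of_nhds
    have hinj' := hev.mono fun z hz => hz.2
    obtain ⟨G, hG⟩ := hL.1.exists_isGradedAt hD y (hinj rfl) (hr ▸ hL.2 y)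
    obtain ⟨G', hG'⟩ := hL'.1.exists_isGradedAt hD y (hinj rfl) (hr ▸ hL'.2 y)
    exact ⟨r, φ, _, (hL.1.isModel hD hφ hinj' hG).prod (hL'.1.isModel hD hφ hinj' hG'),
      fun i => hr ▸ ⟨i, rfl⟩⟩
  refine ⟨isStokes_of_isModel hD fun y => ?_, fun y a ha => ?_⟩
  · obtain ⟨r, σ, G, h, -⟩ := key y
    exact ⟨r, σ, G, h⟩
  · obtain ⟨r, σ, G, h, hσ⟩ := key y
    obtain ⟨i, rfl, -⟩ := (h.mem_factors_iff hD a).1 ha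
    exact hσ i

lemma zeroObj_stokesIn [IsManifold 𝓘(ℂ, Fin n → ℂ) ω X] {S : ∀ y : Boundary n D, Set (expStalk y)}
    (hD : IsNormalCrossing n D) : stokesIn k S (zeroObj.{u, v, w, t} k hD) := by
  refine ⟨isStokes_of_isModel hD fun y => ⟨0, Fin.elim0, Fin.elim0, fun i => i.elim0,
    Eventually.of_forall fun z _ i => i.elim0, Eventually.of_forall fun z => ⟨⟨?_, ?_⟩, fun b => ?_⟩⟩,
    fun y a ha => (ha ?_).elim⟩
  · exact fun i => i.elim0
  · exact Subsingleton.elim (α := Submodule k PUnit.{w + 1}) _ _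
  · exact Subsingleton.elim (α := Submodule k PUnit.{w + 1}) _ _
  · exact (Subsingleton.elim (α := Submodule k PUnit.{w + 1}) _ _).le

end Prod

end PreStokes

end Additive

/-! ### The abelian category -/

section Abelian

open Limits PreStokes

variable {n : ℕ} {X : Type u} [TopologicalSpace X] [ChartedSpace (Fin n → ℂ) X] {J : Type t}
  {D : J → Set X} {k : Type v} [Field k] {S : ∀ y : Boundary n D, Set (expStalk y)}

/-- The category of the Stokes-filtered local systems with exponential factors in `S`. -/
abbrev StokesCat (k : Type v) [Field k] (S : ∀ y : Boundary n D, Set (expStalk y)) :=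
  (stokesIn.{u, v, w, t} k S).FullSubcategory

lemma hasDiagonalModels_hom (hD : IsNormalCrossing n D) (hS : IsStratifiedCovering S)
    (hgood : IsGoodCovering S) {A B : StokesCat.{u, v, w, t} k S} (f : A ⟶ B) :
    HasDiagonalModels f.hom :=
  exists_diagonal_model A.property.1 B.property.1 hD hS hgood A.property.2 B.property.2 f.hom

lemma exists_kernel (hD : IsNormalCrossing n D) (hS : IsStratifiedCovering S)
    (hgood : IsGoodCovering S) {A B : StokesCat.{u, v, w, t} k S} (f : A ⟶ B) :
    ∃ (K : StokesCat.{u, v, w, t} k S) (i : K ⟶ A), IsKernelOf i.hom f.hom := by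
  obtain ⟨K, i, hi⟩ := exists_isKernelOf f.hom
  obtain ⟨h1, h2⟩ := (hasDiagonalModels_hom hD hS hgood f).kernel_isStokes hD hi
  exact ⟨⟨K, h1, fun y => (h2 y).trans (A.property.2 y)⟩, ObjectProperty.homMk i, hi⟩

lemma exists_cokernel (hD : IsNormalCrossing n D) (hS : IsStratifiedCovering S)
    (hgood : IsGoodCovering S) {A B : StokesCat.{u, v, w, t} k S} (f : A ⟶ B) :
    ∃ (C : StokesCat.{u, v, w, t} k S) (p : B ⟶ C), IsCokernelOf p.hom f.hom := by
  obtain ⟨C, p, hp⟩ := exists_isCokernelOf f.hom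
  obtain ⟨h1, h2⟩ := (hasDiagonalModels_hom hD hS hgood f).cokernel_isStokes hD hp
  exact ⟨⟨C, h1, fun y => (h2 y).trans (B.property.2 y)⟩, ObjectProperty.homMk p, hp⟩

lemma isKernelOf_comp_eq_zero {K A B : StokesCat.{u, v, w, t} k S} {i : K ⟶ A} {f : A ⟶ B}
    (h : IsKernelOf i.hom f.hom) : i ≫ f = 0 := ObjectProperty.hom_ext _ h.comp_eq_zero

lemma isCokernelOf_comp_eq_zero {A B C : StokesCat.{u, v, w, t} k S} {f : A ⟶ B} {p : B ⟶ C}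
    (h : IsCokernelOf p.hom f.hom) : f ≫ p = 0 := ObjectProperty.hom_ext _ h.comp_eq_zero

/-- A kernel of local systems with the induced filtration is a kernel in the category. -/
lemma nonempty_isLimit_kernelFork {K A B : StokesCat.{u, v, w, t} k S} {i : K ⟶ A} {f : A ⟶ B}
    (h : IsKernelOf i.hom f.hom) :
    Nonempty (IsLimit (KernelFork.ofι i (isKernelOf_comp_eq_zero h))) := by
  have hlift : ∀ {W : StokesCat.{u, v, w, t} k S} (g : W ⟶ A), g ≫ f = 0 →
      ∃ l : W ⟶ K, l ≫ i = g := fun g hg => by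
    obtain ⟨l, hl⟩ := h.exists_lift g.hom (congrArg (fun φ => φ.hom) hg)
    exact ⟨ObjectProperty.homMk l, ObjectProperty.hom_ext _ hl⟩
  choose l hl using @hlift
  refine ⟨KernelFork.IsLimit.ofι i _ (fun g hg => l g hg) (fun g hg => hl g hg) ?_⟩
  intro W g hg m hm
  ext y x
  apply (h y).1
  have h1 := congrArg (fun φ => app φ.hom y x) (hm.trans (hl g hg).symm)
  exact h1

/-- A cokernel of local systems with the induced filtration is a cokernel in the category. -/
lemma nonempty_isColimit_cokernelCofork {A B C : StokesCat.{u, v, w, t} k S} {f : A ⟶ B} {p : B ⟶ C}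
    (h : IsCokernelOf p.hom f.hom) :
    Nonempty (IsColimit (CokernelCofork.ofπ p (isCokernelOf_comp_eq_zero h))) := by
  have hdesc : ∀ {W : StokesCat.{u, v, w, t} k S} (g : B ⟶ W), f ≫ g = 0 →
      ∃ l : C ⟶ W, p ≫ l = g := fun g hg => by
    obtain ⟨l, hl⟩ := h.exists_desc g.hom (congrArg (fun φ => φ.hom) hg)
    exact ⟨ObjectProperty.homMk l, ObjectProperty.hom_ext _ hl⟩
  choose l hl using @hdesc
  refine ⟨CokernelCofork.IsColimit.ofπ p _ (fun g hg => l g hg) (fun g hg => hl g hg) ?_⟩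
  intro W g hg m hm
  ext y x
  obtain ⟨x, rfl⟩ := (h y).1 x
  have h1 := congrArg (fun φ => app φ.hom y x) (hm.trans (hl g hg).symm)
  exact h1

lemma injective_app_of_mono (hD : IsNormalCrossing n D) (hS : IsStratifiedCovering S)
    (hgood : IsGoodCovering S) {A B : StokesCat.{u, v, w, t} k S} (f : A ⟶ B) [Mono f]
    (y : Boundary n D) :
    Function.Injective (app f.hom y) := by
  obtain ⟨K, i, hi⟩ := exists_kernel hD hS hgood f
  have h0 : i = 0 := Preadditive.mono_iff_cancel_zero f |>.1 inferInstance _ i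
    (isKernelOf_comp_eq_zero hi)
  rw [← LinearMap.ker_eq_bot, ← (hi y).2.1, h0]
  exact LinearMap.range_zero

lemma surjective_app_of_epi (hD : IsNormalCrossing n D) (hS : IsStratifiedCovering S)
    (hgood : IsGoodCovering S) {A B : StokesCat.{u, v, w, t} k S} (f : A ⟶ B) [Epi f]
    (y : Boundary n D) :
    Function.Surjective (app f.hom y) := by
  obtain ⟨C, p, hp⟩ := exists_cokernel hD hS hgood f
  have h0 : p = 0 := Preadditive.epi_iff_cancel_zero f |>.1 inferInstance _ p
    (isCokernelOf_comp_eq_zero hp)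
  rw [← LinearMap.range_eq_top, ← (hp y).2.1, h0]
  exact LinearMap.ker_zero

lemma hasFiniteProducts_fullSubcategory [IsManifold 𝓘(ℂ, Fin n → ℂ) ω X]
    (hD : IsNormalCrossing n D) (hS : IsStratifiedCovering S) :
    HasFiniteProducts (StokesCat.{u, v, w, t} k S) := by
  have h0 : HasTerminal (StokesCat.{u, v, w, t} k S) := by
    let Z : StokesCat.{u, v, w, t} k S := ⟨zeroObj k hD, zeroObj_stokesIn hD⟩
    have : ∀ Y : StokesCat.{u, v, w, t} k S, Nonempty (Y ⟶ Z) := fun Y => ⟨0⟩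
    have : ∀ Y : StokesCat.{u, v, w, t} k S, Subsingleton (Y ⟶ Z) := fun Y => ⟨fun f g => by
      ext y x
      exact Subsingleton.elim (α := PUnit) _ _⟩
    exact hasTerminal_of_unique Z
  have h1 : HasBinaryBiproducts (StokesCat.{u, v, w, t} k S) := ⟨fun A B => by
    let b : BinaryBicone A B :=
      { pt := ⟨A.obj.prod B.obj, prod_stokesIn hD hS A.property B.property⟩
        fst := ObjectProperty.homMk (prodFst _ _)
        snd := ObjectProperty.homMk (prodSnd _ _)
        inl := ObjectProperty.homMk (prodInl _ _)
        inr := ObjectProperty.homMk (prodInr _ _)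
        inl_fst := rfl
        inl_snd := rfl
        inr_fst := rfl
        inr_snd := rfl }
    refine hasBinaryBiproduct_of_total b ?_
    ext y x
    exact Prod.ext (add_zero x.1) (zero_add x.2)⟩
  exact hasFiniteProducts_of_has_binary_and_terminal

/-- The category of the Stokes-filtered local systems with exponential factors in a good stratified
covering is abelian: a morphism which is stalkwise injective (resp. surjective) is a kernel (resp. a
cokernel) since it is strict. -/
@[reducible] def abelianStokesIn [IsManifold 𝓘(ℂ, Fin n → ℂ) ω X] (hD : IsNormalCrossing n D)
    (hS : IsStratifiedCovering S) (hgood : IsGoodCovering S) :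
    Abelian (StokesCat.{u, v, w, t} k S) where
  toPreadditive := Preadditive.fullSubcategory _
  has_finite_products := hasFiniteProducts_fullSubcategory hD hS
  has_kernels := ⟨fun f => by
    obtain ⟨K, i, hi⟩ := exists_kernel hD hS hgood f
    exact ⟨⟨⟨_, (nonempty_isLimit_kernelFork hi).some⟩⟩⟩⟩
  has_cokernels := ⟨fun f => by
    obtain ⟨C, p, hp⟩ := exists_cokernel hD hS hgood f
    exact ⟨⟨⟨_, (nonempty_isColimit_cokernelCofork hp).some⟩⟩⟩⟩
  normalMonoOfMono f _ := by
    obtain ⟨C, p, hp⟩ := exists_cokernel hD hS hgood f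
    have h := hp.isKernelOf (hasDiagonalModels_hom hD hS hgood f).isStrict
      (injective_app_of_mono hD hS hgood f)
    exact ⟨⟨C, p, _, (nonempty_isLimit_kernelFork h).some⟩⟩
  normalEpiOfEpi f _ := by
    obtain ⟨K, i, hi⟩ := exists_kernel hD hS hgood f
    have h := hi.isCokernelOf (hasDiagonalModels_hom hD hS hgood f).isStrict
      (surjective_app_of_epi hD hS hgood f)
    exact ⟨⟨K, i, _, (nonempty_isColimit_cokernelCofork h).some⟩⟩

end Abelian

end Stokes

end

theorem mainTheorem6 (n : ℕ) {X : Type u} [TopologicalSpace X] [T2Space X]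
    [ChartedSpace (Fin n → ℂ) X] [IsManifold 𝓘(ℂ, Fin n → ℂ) ω X] {J : Type t}
    (D : J → Set X) (hD : Stokes.IsNormalCrossing n D) (k : Type v) [Field k]
    (S : ∀ y : Stokes.Boundary n D, Set (Stokes.expStalk y))
    (hS : Stokes.IsStratifiedCovering S) (hgood : Stokes.IsGoodCovering S) :
    (∀ (L L' : Stokes.PreStokes.{u, v, w, t} n k D), L.IsStokes → L'.IsStokes →
      (∀ y, L.factors y ⊆ S y) → (∀ y, L'.factors y ⊆ S y) → ∀ f : L ⟶ L',
        Stokes.PreStokes.IsLocallyDiagonal f ∧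
        Stokes.PreStokes.IsStrict f ∧
        (∃ (K : Stokes.PreStokes.{u, v, w, t} n k D) (i : K ⟶ L),
          Stokes.PreStokes.IsKernelOf i f ∧ K.IsGoodStokes ∧
          ∀ y, K.factors y ⊆ L.factors y) ∧
        (∃ (M : Stokes.PreStokes.{u, v, w, t} n k D) (p : L ⟶ M) (i : M ⟶ L'),
          Stokes.PreStokes.IsImageOf p i f ∧ M.IsGoodStokes ∧
          ∀ y, M.factors y ⊆ L.factors y ∩ L'.factors y) ∧
        (∃ (C : Stokes.PreStokes.{u, v, w, t} n k D) (p : L' ⟶ C),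
          Stokes.PreStokes.IsCokernelOf p f ∧ C.IsGoodStokes ∧
          ∀ y, C.factors y ⊆ L'.factors y)) ∧
    ∃ A : Abelian (Stokes.stokesIn.{u, v, w, t} k S).FullSubcategory,
      A.toPreadditive =
        Preadditive.fullSubcategory (Stokes.stokesIn.{u, v, w, t} k S) := by
  refine ⟨fun L L' hL hL' hLS hLS' f => ?_,
    Stokes.abelianStokesIn hD hS hgood, rfl⟩
  have hf : Stokes.PreStokes.HasDiagonalModels f :=
    Stokes.PreStokes.exists_diagonal_model hL hL' hD hS hgood hLS hLS' f
  have good : ∀ M : Stokes.PreStokes.{u, v, w, t} n k D, (∀ y, M.factors y ⊆ S y) →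
      Stokes.IsGoodCovering M.factors :=
    fun M hM y a ha b hb => hgood y a (hM y ha) b (hM y hb)
  refine ⟨hf.isLocallyDiagonal, hf.isStrict, ?_, ?_, ?_⟩
  · obtain ⟨K, i, hi⟩ := Stokes.PreStokes.exists_isKernelOf f
    obtain ⟨h1, h2⟩ := hf.kernel_isStokes hD hi
    exact ⟨K, i, hi, ⟨h1, good K fun y => (h2 y).trans (hLS y)⟩, h2⟩
  · obtain ⟨M, p, i, hM⟩ := hf.isStrict.exists_isImageOf
    obtain ⟨h1, h2⟩ := hf.image_isStokes hD hM
    exact ⟨M, p, i, hM, ⟨h1, good M fun y => (h2 y).trans (inter_subset_left.trans (hLS y))⟩, h2⟩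
  · obtain ⟨C, p, hp⟩ := Stokes.PreStokes.exists_isCokernelOf f
    obtain ⟨h1, h2⟩ := hf.cokernel_isStokes hD hp
    exact ⟨C, p, hp, ⟨h1, good C fun y => (h2 y).trans (hLS' y)⟩, h2⟩
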